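/- Let $H$ be a separable infinite-dimensional real Hilbert space (for instance $L^2[0,1]$), write $x\otimes y=\langle x,\cdot\rangle y$, and let $\|\cdot\|_{\mathcal L}$ be the operator norm. Let $X_j=\sum_{\ell\ge 0}\psi_\ell\varepsilon_{j-\ell}$, $j\in\mathbb Z$, be a mean-zero functional linear process in $H$ with bounded operators $\psi_\ell$ satisfying $\sum_{m\ge1}\sum_{\ell\ge m}\|\psi_\ell\|_{\mathcal L}<\infty$ and i.i.d. innovations with $\mathrm E\|\varepsilon_0\|^4<\infty$. Let it be invertible: $X_j=\sum_{\ell\ge1}\pi_\ell X_{j-\ell}+\varepsilon_j$ with bounded operators $\pi_\ell$, $\sum_{\ell\ge1}\|\pi_\ell\|_{\mathcal L}<\infty$. Let $C_{X;h}=\mathrm E[X_0\otimes X_h]$, and let $C_X=C_{X;0}$ have eigenvalues $\lambda_1>\lambda_2>\dots>0$ with an orthonormal basis $(\nu_i)$ of eigenfunctions. Put $\delta_1=\lambda_1-\lambda_2$ and $\delta_j=\min\{\lambda_{j-1}-\lambda_j,\lambda_j-\lambda_{j+1}\}$ for $j\ge2$. Let $d_1\le d_2\le\cdots$ be positive integers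 with $d_k\to\infty$. Let $\alpha_d$ be the infimum, over all frequencies $t\in[-\pi,\pi]$, of the eigenvalues of the spectral density operator $\frac1{2\pi}\sum_{h\in\mathbb Z}e^{-iht}C_{X;h}$ compressed to (the complexification of) $\mathrm{span}\{\nu_1,\dots,\nu_d\}$; assume $\alpha_{d_k}>0$ for all $k$. *Estimators from $X_1,\dots,X_n$.* Let $\hat C_{X;h}=\frac1n\sum_{j=1}^{n-h}X_j\otimes X_{j+h}$ for $h\ge0$, let $(\hat\nu_i)$ be any orthonormal basis of $H$ of eigenfunctions of $\hat C_{X;0}$ ordered by decreasing eigenvalue, and let $\hat P_i$ be the orthogonal projection onto $\mathrm{span}\{\hat\nu_1,\dots,\hat\nu_{d_i}\}$. With $X_j(k)=(X_j,\dots,X_{j-k+1})\in H^k$ and $\hat P_{(k)}=\mathrm{diag}(\hat P_k,\dots,\hat P_1)$, put $$\hat\Gamma_k=\frac1{n-k}\sum_{j=k}^{n-1}X_j(k)\otimes X_j(k),\qquad \hat\Gamma_{1,k}=\frac1{n-k}\sum_{j=k}^{n-1}X_j(k)\otimes X_{j+1},$$ $$(\hat{\hat\beta}_{k,1},\dots,\hat{\hat\beta}_{k,k})=\hat\Gamma_{1,k}\hat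 P_{(k)}\,\big(\hat P_{(k)}\hat\Gamma_k\hat P_{(k)}\big)^{-1}.$$ Let $\hat{\hat\theta}_{k,i}$, $1\le i\le k$, be given by the Innovations Algorithm $$\hat{\hat\theta}_{k,k-i}=\Big(\hat P_{k+1}\hat C_{X;k-i}\hat P_{i+1}-\sum_{j=0}^{i-1}\hat{\hat\theta}_{k,k-j}\hat V_j\hat{\hat\theta}{}_{i,i-j}^{*}\Big)\hat V_i^{-1}\quad(0\le i<k),$$ $$\hat V_k=\hat P_{k+1}\hat C_{X;0}\hat P_{k+1}-\sum_{i=0}^{k-1}\hat{\hat\theta}_{k,k-i}\hat V_i\hat{\hat\theta}{}_{k,k-i}^{*}\quad(k\ge 0).$$ Here the inverses of $\hat P_{(k)}\hat\Gamma_k\hat P_{(k)}$ and of $\hat V_i$ are taken on the ranges of $\hat P_{(k)}$ and of $\hat P_{i+1}$ and extended by $0$ to the orthogonal complement (and set to $0$ if the operator is not invertible on that range). *Assumptions.* Let $k=k_n<n$ with $k_n\to\infty$ be such that, as $n\to\infty$, the following hold. - (ii) $k^{1/2}(n-k)^{-1/2}\alpha_{d_k}^{-2}\to0$. - (iii) $R(k)\to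 0$, where $R(k)=k^{1/2}\alpha_{d_k}^{-1}\big(\sum_{\ell>k}\|\pi_\ell\|_{\mathcal L}+\sum_{\ell=1}^k\|\pi_\ell\|_{\mathcal L}\sum_{i>d_{k+1-\ell}}\lambda_i\big)$. - (iv) $k^{3/2}\alpha_{d_k}^{-2}n^{-1}\big(\sum_{\ell=1}^{d_k}\delta_\ell^{-2}\big)^{1/2}\to0$. *Conclusions.* 1. For all $x\in H$ and $i\ge1$, $\|(\hat{\hat\beta}_{k,i}-\pi_i)(x)\|\to0$ in probability as $n\to\infty$. 2. If moreover $R(k_n-s)\to0$ as $n\to\infty$ for every fixed $s\in\mathbb N$ (for instance if $R(k)\to0$ as $k\to\infty$ through all integers, which follows from (iii) when $k_n$ takes every large integer value), then for all $x\in H$ and $i\ge1$, $\|(\hat{\hat\theta}_{k,i}-\psi_i)(x)\|\to0$ in probability as $n\to\infty$. 3. If all the operators $\psi_\ell$ and $\pi_\ell$, $\ell\ge1$, are Hilbert–Schmidt, then the convergence in 1 and (under the condition in 2) in 2 is uniform: $\|\hat{\hat\beta}_{k,i}-\pi_i\|_{\mathcal L}\to0$ and $\|\hat{\hat\theta}_{k,i}-\psi_i\|_{\mathcal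 L}\to0$ in probability for every $i\ge 1$. -/

import Mathlib

open MeasureTheory ProbabilityTheory Filter Topology

namespace FTS

noncomputable section

/-! ### Operators on a real Hilbert space -/

/-- The operator `x ⊗ y = ⟨x, ·⟩ y`. -/
def tensor {E F : Type*} [NormedAddCommGroup E] [InnerProductSpace ℝ E]
    [NormedAddCommGroup F] [InnerProductSpace ℝ F] (x : E) (y : F) : E →L[ℝ] F :=
  InnerProductSpace.rankOne ℝ y x

/-- Hilbert–Schmidt operators on a separable infinite-dimensional Hilbert space. -/
def IsHilbertSchmidt {H : Type*} [NormedAddCommGroup H] [InnerProductSpace ℝ H]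
    (T : H →L[ℝ] H) : Prop :=
  ∃ b : HilbertBasis ℕ ℝ H, Summable fun i => ‖T (b i)‖ ^ 2

/-- The inverse of `P T P` as an operator on the range of the projection `P`, extended by zero
to the orthogonal complement of that range (and `0` if `P T P` is not invertible on the range
of `P`): the operator `P T P + (1 - P)` is block diagonal, equal to `P T P` on the range of `P`
and to the identity on its complement. -/
def compInv {E : Type*} [NormedAddCommGroup E] [InnerProductSpace ℝ E]
    (P T : E →L[ℝ] E) : E →L[ℝ] E :=
  Ring.inverse (P * T * P + (1 - P)) * P

/-- The orthogonal projection onto the span of the first `d` elements of the sequence `e`. -/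
def projSpan {H : Type*} [NormedAddCommGroup H] [InnerProductSpace ℝ H]
    (e : ℕ → H) (d : ℕ) : H →L[ℝ] H :=
  haveI : FiniteDimensional ℝ (Submodule.span ℝ (Set.range fun i : Fin d => e i)) :=
    FiniteDimensional.span_of_finite ℝ (Set.finite_range _)
  (Submodule.span ℝ (Set.range fun i : Fin d => e i)).starProjection

/-- `(l i, e i)` are the eigenvalues, in decreasing order, of `C`, with an orthonormal basis
of eigenvectors (indices start at `0`). -/
def IsEigenbasis {H : Type*} [NormedAddCommGroup H] [InnerProductSpace ℝ H]
    (C : H →L[ℝ] H) (l : ℕ → ℝ) (e : HilbertBasis ℕ ℝ H) : Prop :=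
  Antitone l ∧ ∀ i, C (e i) = l i • e i

/-! ### Functional linear processes and their second-order structure -/

section Population

variable {Ω H : Type*} [MeasurableSpace Ω] [NormedAddCommGroup H] [InnerProductSpace ℝ H]

/-- The functional linear process `X_j = ∑_{ℓ ≥ 0} ψ_ℓ ε_{j-ℓ}` with independent, identically
distributed innovations having a finite fourth moment, mean zero, and
`∑_{m ≥ 1} ∑_{ℓ ≥ m} ‖ψ_ℓ‖ < ∞`. -/
structure IsLinearProcess [MeasurableSpace H] (μ : Measure Ω)
    (X ε : ℤ → Ω → H) (ψ : ℕ → H →L[ℝ] H) : Prop where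
  indep : iIndepFun ε μ
  ident : ∀ j, IdentDistrib (ε j) (ε 0) μ μ
  moment : MemLp (ε 0) 4 μ
  summable : Summable fun ℓ => ‖ψ ℓ‖
  summable_tail : Summable fun m : ℕ => ∑' ℓ : ℕ, ‖ψ (m + 1 + ℓ)‖
  series : ∀ j, ∀ᵐ ω ∂μ, HasSum (fun ℓ : ℕ => ψ ℓ (ε (j - ℓ) ω)) (X j ω)
  mean : ∀ j, ∫ ω, X j ω ∂μ = 0

/-- Invertibility: `X_j = ∑_{ℓ ≥ 1} π_ℓ X_{j-ℓ} + ε_j` with `∑_{ℓ ≥ 1} ‖π_ℓ‖ < ∞`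
(`π 0` plays no role). -/
structure IsInvertible (μ : Measure Ω) (X ε : ℤ → Ω → H) (π : ℕ → H →L[ℝ] H) : Prop where
  summable : Summable fun ℓ => ‖π (ℓ + 1)‖
  series : ∀ j, ∀ᵐ ω ∂μ,
    HasSum (fun ℓ : ℕ => π (ℓ + 1) (X (j - (ℓ + 1 : ℕ)) ω)) (X j ω - ε j ω)

/-- The lag-`h` covariance operator `C_{X;h} = E[X_0 ⊗ X_h]`; `C_X` is the case `h = 0`. -/
def lagCov (μ : Measure Ω) (X : ℤ → Ω → H) (h : ℤ) : H →L[ℝ] H :=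
  ∫ ω, tensor (X 0 ω) (X h ω) ∂μ

/-- The spectral density operator `(2π)⁻¹ ∑_h e^{-iht} C_{X;h}` at frequency `t` of the process
projected to the span of `e 0, …, e (d-1)`, as an operator on the complexification of that
span, written as a matrix in the basis `e 0, …, e (d-1)`. -/
def specDensity (μ : Measure Ω) (X : ℤ → Ω → H) (e : ℕ → H) (d : ℕ) (t : ℝ) :
    Matrix (Fin d) (Fin d) ℂ :=
  Matrix.of fun r s => (1 / (2 * Real.pi) : ℂ) *
    ∑' h : ℤ, Complex.exp (-Complex.I * h * t) * ((inner ℝ (e r) (lagCov μ X h (e s)) : ℝ) : ℂ)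

/-- The infimum of the eigenvalues of all spectral density operators of the process projected
to the span of `e 0, …, e (d-1)`. -/
def alpha (μ : Measure Ω) (X : ℤ → Ω → H) (e : ℕ → H) (d : ℕ) : ℝ :=
  sInf {a : ℝ | ∃ t ∈ Set.Icc (-Real.pi) Real.pi,
    Module.End.HasEigenvalue (Matrix.toLin' (specDensity μ X e d t)) (a : ℂ)}

end Population

/-- The spectral gaps `δ`, with index starting at `0`. -/
def gap (l : ℕ → ℝ) (j : ℕ) : ℝ :=
  if j = 0 then l 0 - l 1 else min (l (j - 1) - l j) (l j - l (j + 1))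

/-- `k^{1/2} a⁻¹ (∑_{ℓ>k} ‖π_ℓ‖ + ∑_{ℓ=1}^k ‖π_ℓ‖ ∑_{i>d_{k+1-ℓ}} λ_i)` with `a = a_{d_k}`;
since `l` is indexed from `0`, `λ_i` is `l (i - 1)`. -/
def truncRate {H : Type*} [NormedAddCommGroup H] [InnerProductSpace ℝ H]
    (a : ℕ → ℝ) (π : ℕ → H →L[ℝ] H) (l : ℕ → ℝ) (d : ℕ → ℕ) (k : ℕ) : ℝ :=
  Real.sqrt k * (a (d k))⁻¹ *
    ((∑' ℓ : ℕ, ‖π (k + 1 + ℓ)‖) +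
      ∑ ℓ ∈ Finset.Icc 1 k, ‖π ℓ‖ * ∑' i : ℕ, l (d (k + 1 - ℓ) + i))

/-! ### Estimators

`x : ℤ → H` is a path of the process; only the observations `x 1, …, x n` are used. The sequence
`e` is a sequence of sample eigenfunctions, and `d 1, d 2, …` are the projection dimensions. -/

section Sample

variable {H : Type*} [NormedAddCommGroup H] [InnerProductSpace ℝ H]

/-- The sample lag-`h` covariance operator `n⁻¹ ∑_{j=1}^{n-h} x_j ⊗ x_{j+h}`. -/
def sampleCov (x : ℤ → H) (n h : ℕ) : H →L[ℝ] H :=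
  (n : ℝ)⁻¹ • ∑ j ∈ Finset.Icc 1 (n - h), tensor (x j) (x (j + h : ℕ))

/-- `H^k` with the norm `‖v‖ = (∑ ‖v_i‖²)^{1/2}`. -/
abbrev HilbertPow (H : Type*) (k : ℕ) : Type _ := PiLp 2 fun _ : Fin k => H

/-- `x_j(k) = (x_j, x_{j-1}, …, x_{j-k+1})`. -/
def window (x : ℤ → H) (k : ℕ) (j : ℤ) : HilbertPow H k :=
  WithLp.toLp 2 fun i : Fin k => x (j - (i : ℕ))

/-- `(n-k)⁻¹ ∑_{j=k}^{n-1} x_j(k) ⊗ x_j(k)`. -/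
def gammaHat (x : ℤ → H) (n k : ℕ) : HilbertPow H k →L[ℝ] HilbertPow H k :=
  ((n : ℝ) - k)⁻¹ • ∑ j ∈ Finset.Ico k n, tensor (window x k j) (window x k j)

/-- `(n-k)⁻¹ ∑_{j=k}^{n-1} x_j(k) ⊗ x_{j+1}`, an operator from `H^k` to `H`. -/
def gammaHatOne (x : ℤ → H) (n k : ℕ) : HilbertPow H k →L[ℝ] H :=
  ((n : ℝ) - k)⁻¹ • ∑ j ∈ Finset.Ico k n, tensor (window x k j) (x (j + 1))

/-- `P_(k) = diag(P_{d_k}, …, P_{d_1})` on `H^k`. -/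
def diagProj (e : ℕ → H) (d : ℕ → ℕ) (k : ℕ) : HilbertPow H k →L[ℝ] HilbertPow H k :=
  (PiLp.continuousLinearEquiv 2 ℝ fun _ : Fin k => H).symm.toContinuousLinearMap ∘L
    ContinuousLinearMap.piMap (fun i : Fin k => projSpan e (d (k - i))) ∘L
    (PiLp.continuousLinearEquiv 2 ℝ fun _ : Fin k => H).toContinuousLinearMap

/-- The embedding of `H` as the `i`-th coordinate of `H^k`, `1 ≤ i ≤ k`. -/
def coordEmb (H : Type*) [NormedAddCommGroup H] [InnerProductSpace ℝ H] (k i : ℕ) :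
    H →L[ℝ] HilbertPow H k :=
  (PiLp.continuousLinearEquiv 2 ℝ fun _ : Fin k => H).symm.toContinuousLinearMap ∘L
    ContinuousLinearMap.pi fun r : Fin k =>
      if (r : ℕ) + 1 = i then ContinuousLinearMap.id ℝ H else 0

/-- The solution `B(k)` of the estimated Yule–Walker equations: `Γ_{1,k} P_(k)` composed with
the inverse of `P_(k) Γ_k P_(k)` on the range of `P_(k)`. -/
def yuleWalker (x : ℤ → H) (e : ℕ → H) (d : ℕ → ℕ) (n k : ℕ) : HilbertPow H k →L[ℝ] H :=
  (gammaHatOne x n k ∘L diagProj e d k) ∘L compInv (diagProj e d k) (gammaHat x n k)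

/-- The regression operator estimate `β_{k,i}`, the `i`-th entry of `B(k)`, `1 ≤ i ≤ k`. -/
def betaHat (x : ℤ → H) (e : ℕ → H) (d : ℕ → ℕ) (n k i : ℕ) : H →L[ℝ] H :=
  yuleWalker x e d n k ∘L coordEmb H k i

end Sample

/-! ### The functional Innovations Algorithm

`C h` is the lag-`h` covariance operator and `P i` the projection onto the `i`-th projection
subspace, `i ≥ 1`. -/

section Innovations

variable {H : Type*} [NormedAddCommGroup H] [InnerProductSpace ℝ H] [CompleteSpace H]

mutual

/-- `innovRev C P k i` is `θ_{k,k-i}` for `0 ≤ i < k`: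
`θ_{k,k-i} = (P_{k+1} C_{k-i} P_{i+1} - ∑_{j<i} θ_{k,k-j} V_j θ_{i,i-j}^*) V_i⁻¹`. -/
def innovRev (C : ℕ → H →L[ℝ] H) (P : ℕ → H →L[ℝ] H) (k i : ℕ) : H →L[ℝ] H :=
  if _h : i < k then
    (P (k + 1) * C (k - i) * P (i + 1) -
      ∑ j : Fin i, innovRev C P k j * innovVar C P j *
        ContinuousLinearMap.adjoint (innovRev C P i j)) * compInv (P (i + 1)) (innovVar C P i)
  else 0
termination_by (k, i)
decreasing_by
  · exact Prod.Lex.right _ j.2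
  · exact Prod.Lex.left _ _ (by have := j.2; omega)
  · exact Prod.Lex.left _ _ _h
  · exact Prod.Lex.left _ _ _h

/-- `V_k = P_{k+1} C_0 P_{k+1} - ∑_{i<k} θ_{k,k-i} V_i θ_{k,k-i}^*`. -/
def innovVar (C : ℕ → H →L[ℝ] H) (P : ℕ → H →L[ℝ] H) (k : ℕ) : H →L[ℝ] H :=
  P (k + 1) * C 0 * P (k + 1) -
    ∑ i : Fin k, innovRev C P k i * innovVar C P i *
      ContinuousLinearMap.adjoint (innovRev C P k i)
termination_by (k, k)
decreasing_by
  · exact Prod.Lex.right _ i.2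
  · exact Prod.Lex.left _ _ i.2

end

/-- The innovations coefficient estimate `θ_{k,i}`, `1 ≤ i ≤ k`: the Innovations Algorithm run
with the sample covariance operators and the projections onto the span of the first `d_i`
sample eigenfunctions. -/
def thetaHat (x : ℤ → H) (e : ℕ → H) (d : ℕ → ℕ) (n k i : ℕ) : H →L[ℝ] H :=
  innovRev (sampleCov x n) (fun r => projSpan e (d r)) k (k - i)

end Innovations

end

end FTS

namespace FTS

open scoped InnerProductSpace TensorProduct ENNReal

set_option linter.unusedSectionVars false

/-! ### Coercive operators and orthogonal projections -/

section Operators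

variable {E F : Type*} [NormedAddCommGroup E] [InnerProductSpace ℝ E]
  [NormedAddCommGroup F] [InnerProductSpace ℝ F]

-- Regression. The estimated Yule–Walker operator is a least squares fit of X_{j+1} on projected
-- windows w_j of length k. Write X_{j+1} = A P w_j + r_j + ε_{j+1}, where A collects π_1, …, π_k, P
-- is the block diagonal of sample projections, and r_j contains the autoregressive tail beyond k
-- together with the components that P removes. If the empirical second moment of the windows is at
-- least c on the range of P, then `norm_leastSquares_sub_le` bounds the distance of the fit from A
-- P by c^{-1/2} times the weak root mean square of r plus c^{-1} times the norm of the empirical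
-- cross-covariance of windows and noise. The comparison is with π_i P, not with π_i, so no rate for
-- sample eigenvectors is ever needed. It is enough that the sample projections tend strongly to the
-- identity, which follows from the eigenvalue equation alone (`IsEigenbasis.close`). This gives the
-- pointwise statements, and the norm statements for Hilbert–Schmidt operators, since these are norm
-- limits of finite rank operators.
--
-- Lower bound. The constant c has the order of α, the spectral infimum at dimension d_k.
-- Integrating the Rayleigh bound for the spectral density over a period gives 2πα for the
-- covariance form on population eigenspaces (`two_pi_mul_alpha_le_covForm`). A Davis–Kahan argument
-- moves this to sample eigenspaces, and its gap comes for free: the last retained population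
-- eigenvalue is at least 2πα, whereas R(k) → 0 forces the next one below α as soon as some π_ℓ is
-- nonzero. If every π_ℓ vanishes, the process is white noise and the covariance form is diagonal.
-- Both cases are in `IsProc.le_covForm`.
--
-- Deviations. The empirical form on H^k has to be close to its mean uniformly over an
-- infinite-dimensional ball. A discrete Fourier transform with 2k frequencies (`toeplitzForm_eq`)
-- reduces it to 2k band-limited quadratic forms on H. The off-diagonal part of each is a pairing
-- with one random element of H ⊗ H, a sum of martingale differences with fourth moment O(n²k²).
-- Adding fourth powers over the frequencies and taking the fourth root gives O(√n k^{3/4}), which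
-- is negligible against nα exactly when k^{3/2} α^{-2} n^{-1} → 0. The factor made of spectral gaps
-- only strengthens that condition (`rates_power`). The cross terms cost √(k(n-k)), the tail is
-- controlled through R(k), and boundary windows number at most 2k. All these bounds concern
-- quantities that do not involve the sample eigenvectors, so no measurable choice of the latter
-- matters.
--
-- Innovations. The algorithm is a block factorization L V L* of the projected block Toeplitz matrix
-- of sample covariances. That matrix is the Gram matrix of the windows of the zero-extended path,
-- so its normal equations are again a least squares problem of the kind above, with at most 2k
-- extra boundary windows. Triangularity turns them into θ_{k,m} = Σ_{i≤m} P β_{k,i} θ_{k-i,m-i}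
-- (`innovL_eq_sum_regCoef`), with a projection in place of θ_{k-m,0}. The causal coefficients
-- satisfy ψ_m = Σ_{i≤m} π_i ψ_{m-i}, and induction on m finishes the proof.
--
-- Identification. That last recursion is first obtained after multiplication by the noise
-- covariance, so the latter must be shown to be injective. A direction v not charged by the noise
-- gives a linear relation between X_0 and its past. Truncated and projected, this relation
-- contradicts the lower bound α unless the projections of v tend to zero
-- (`Setting.norm_projSpan_le`), whence v = 0.

theorem tensor_apply (x : E) (y : F) (z : E) : tensor x y z = ⟪x, z⟫_ℝ • y := rfl

/-- Lax–Milgram for the bilinear form (v, w) ↦ ⟨T v, w⟩. -/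
theorem isUnit_of_coercive [CompleteSpace E] (T : E →L[ℝ] E) {c : ℝ} (hc : 0 < c)
    (h : ∀ v, c * ‖v‖ ^ 2 ≤ ⟪T v, v⟫_ℝ) : IsUnit T := by
  have hB : IsCoercive ((innerSL ℝ : E →L[ℝ] E →L[ℝ] ℝ).comp T) :=
    ⟨c, hc, fun v => by have := h v; simpa [pow_two, mul_assoc] using this⟩
  have hT : T = (hB.continuousLinearEquivOfBilin : E →L[ℝ] E) := by
    ext v
    exact hB.unique_continuousLinearEquivOfBilin fun w => by simp
  rw [hT]
  exact (ContinuousLinearEquiv.toUnit hB.continuousLinearEquivOfBilin).isUnit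

/-- Orthogonal projections, as symmetric idempotents. -/
structure IsOrthProj (P : E →L[ℝ] E) : Prop where
  idem : ∀ x, P (P x) = P x
  symm : ∀ x y, ⟪P x, y⟫_ℝ = ⟪x, P y⟫_ℝ

namespace IsOrthProj

variable {P : E →L[ℝ] E}

theorem mul_self (hP : IsOrthProj P) : P * P = P := by ext x; exact hP.idem x

theorem norm_sq (hP : IsOrthProj P) (x : E) : ‖x‖ ^ 2 = ‖P x‖ ^ 2 + ‖x - P x‖ ^ 2 := by
  have h : ⟪P x, x - P x⟫_ℝ = 0 := by
    rw [hP.symm, map_sub, hP.idem, sub_self, inner_zero_right]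
  have h2 := norm_add_sq_real (P x) (x - P x)
  rw [h] at h2
  simpa using h2

theorem norm_apply_le (hP : IsOrthProj P) (x : E) : ‖P x‖ ≤ ‖x‖ := by
  have := hP.norm_sq x
  exact abs_le_of_sq_le_sq' (by nlinarith [sq_nonneg ‖x - P x‖]) (norm_nonneg _) |>.2

theorem norm_sub_apply_le (hP : IsOrthProj P) (x : E) : ‖x - P x‖ ≤ ‖x‖ := by
  have := hP.norm_sq x
  exact abs_le_of_sq_le_sq' (by nlinarith [sq_nonneg ‖P x‖]) (norm_nonneg _) |>.2

theorem norm_le (hP : IsOrthProj P) : ‖P‖ ≤ 1 :=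
  ContinuousLinearMap.opNorm_le_bound _ zero_le_one fun x => by simpa using hP.norm_apply_le x

theorem norm_one_sub_le (hP : IsOrthProj P) : ‖1 - P‖ ≤ 1 :=
  ContinuousLinearMap.opNorm_le_bound _ zero_le_one fun x => by
    simpa using hP.norm_sub_apply_le x

end IsOrthProj

section CompInv

variable [CompleteSpace E] {P T : E →L[ℝ] E} {c : ℝ}

/-- The operator is block diagonal for the splitting by P: the compression of T on one block, the
identity on the other. It is therefore coercive with constant min c 1. -/
theorem isUnit_comp_add (hP : IsOrthProj P) (hc : 0 < c)
    (h : ∀ v, P v = v → c * ‖v‖ ^ 2 ≤ ⟪T v, v⟫_ℝ) : IsUnit (P * T * P + (1 - P)) := by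
  refine isUnit_of_coercive _ (lt_min hc one_pos) fun v => ?_
  have h1 := h (P v) (hP.idem v)
  have h2 : ⟪(P * T * P + (1 - P)) v, v⟫_ℝ = ⟪T (P v), P v⟫_ℝ + ‖v - P v‖ ^ 2 := by
    have h3 : ⟪v - P v, P v⟫_ℝ = 0 := by
      rw [← hP.symm, map_sub, hP.idem, sub_self, inner_zero_left]
    have h4 : ⟪v - P v, v⟫_ℝ = ‖v - P v‖ ^ 2 := by
      rw [← real_inner_self_eq_norm_sq, inner_sub_right (v - P v), h3, sub_zero]
    simp only [_root_.add_apply, mul_apply_eq_comp,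
      _root_.sub_apply, one_apply_eq_self, inner_add_left, h4, hP.symm]
  rw [h2, hP.norm_sq v, mul_add]
  have := mul_le_mul_of_nonneg_right (min_le_left c 1) (sq_nonneg ‖P v‖)
  have := mul_le_mul_of_nonneg_right (min_le_right c 1) (sq_nonneg ‖v - P v‖)
  linarith

/-- With W = P T P + (1 - P) one has P W = W P = P T P, so P commutes with W⁻¹. The four identities
say that `compInv P T` = W⁻¹ P is a two-sided inverse on the range of P and lives there. -/
theorem comp_mul_compInv (hP : IsOrthProj P) (hc : 0 < c)
    (h : ∀ v, P v = v → c * ‖v‖ ^ 2 ≤ ⟪T v, v⟫_ℝ) :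
    P * compInv P T = compInv P T ∧ P * T * P * compInv P T = P ∧
      compInv P T * (P * T * P) = P ∧ compInv P T * P = compInv P T := by
  obtain ⟨u, hu⟩ := isUnit_comp_add hP hc h
  have hPP := hP.mul_self
  have e1 : P * (u : E →L[ℝ] E) = P * T * P := by
    rw [hu]; simp only [mul_add, mul_sub, ← mul_assoc, hPP, mul_one, sub_self, add_zero]
  have e2 : (u : E →L[ℝ] E) * P = P * T * P := by
    rw [hu]; simp only [add_mul, sub_mul, mul_assoc, hPP, one_mul, sub_self, add_zero]
  have hC : compInv P T = (↑u⁻¹ : E →L[ℝ] E) * P := by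
    rw [compInv, ← hu, Ring.inverse_unit]
  have e3 : P * (↑u⁻¹ : E →L[ℝ] E) = (↑u⁻¹ : E →L[ℝ] E) * P := by
    have : (↑u⁻¹ : E →L[ℝ] E) * (u * P) * ↑u⁻¹ = ↑u⁻¹ * (P * u) * ↑u⁻¹ := by rw [e1, e2]
    simpa [mul_assoc] using this
  have f1 : P * compInv P T = compInv P T := by rw [hC, ← mul_assoc, e3, mul_assoc, hPP]
  refine ⟨f1, ?_, ?_, by rw [hC, mul_assoc, hPP]⟩
  · rw [← e2, mul_assoc, f1, hC, ← mul_assoc]; simp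
  · rw [hC, mul_assoc, ← mul_assoc P, ← mul_assoc P, hPP, ← e2, ← mul_assoc]; simp

/-- Test the equation P T P y = P u with y itself. The energy bound matters as much as the norm
bound: it lets residuals that are small only in mean square pay c^{-1/2} instead of c^{-1}. -/
theorem norm_compInv_apply_le (hP : IsOrthProj P) (hc : 0 < c)
    (h : ∀ v, P v = v → c * ‖v‖ ^ 2 ≤ ⟪T v, v⟫_ℝ) (u : E) :
    ‖compInv P T u‖ ≤ c⁻¹ * ‖u‖ ∧ ⟪T (compInv P T u), compInv P T u⟫_ℝ ≤ c⁻¹ * ‖u‖ ^ 2 := by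
  obtain ⟨h1, h2, -, -⟩ := comp_mul_compInv hP hc h
  set y := compInv P T u with hy
  have hPy : P y = y := DFunLike.congr_fun h1 u
  have hTy : P (T (P y)) = P u := DFunLike.congr_fun h2 u
  have h3 : ⟪T y, y⟫_ℝ = ⟪P u, y⟫_ℝ := by
    rw [← hTy, hP.symm, hPy]
  have h4 := h y hPy
  have h5 : ⟪P u, y⟫_ℝ ≤ ‖u‖ * ‖y‖ :=
    (real_inner_le_norm _ _).trans (by gcongr; exact hP.norm_apply_le u)
  have h6 : ‖y‖ ≤ c⁻¹ * ‖u‖ := by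
    rw [inv_mul_eq_div, le_div_iff₀ hc]
    by_contra hh
    push Not at hh
    have hyp : 0 < ‖y‖ := by
      by_contra h0
      have : ‖y‖ = 0 := le_antisymm (not_lt.mp h0) (norm_nonneg _)
      rw [this, zero_mul] at hh
      exact absurd hh (not_lt.mpr (norm_nonneg _))
    nlinarith
  refine ⟨h6, ?_⟩
  rw [h3]
  refine h5.trans ?_
  nlinarith [norm_nonneg u]

end CompInv

/-- Error decomposition and bound for a projected least squares regression of `z j` on `w j`
with coefficient operator `A` and errors `z j - A (w j) = r j + s j`. -/
theorem norm_leastSquares_sub_le [CompleteSpace E] {ι : Type*} (J : Finset ι) (w : ι → E)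
    (z r s : ι → F) (A : E →L[ℝ] F) {P : E →L[ℝ] E} (hP : IsOrthProj P) {b c ρ σ : ℝ}
    (hb : 0 < b) (hc : 0 < c) (hρ : 0 ≤ ρ) (hσ : 0 ≤ σ)
    (hz : ∀ j ∈ J, z j = A (P (w j)) + r j + s j)
    (hlow : ∀ v, P v = v → c * ‖v‖ ^ 2 ≤ b * ∑ j ∈ J, ⟪w j, v⟫_ℝ ^ 2)
    (hr : ∀ u : F, b * ∑ j ∈ J, ⟪r j, u⟫_ℝ ^ 2 ≤ ρ ^ 2 * ‖u‖ ^ 2)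
    (hs : ∀ v : E, ∀ u : F, |b * ∑ j ∈ J, ⟪w j, v⟫_ℝ * ⟪s j, u⟫_ℝ| ≤ σ * ‖v‖ * ‖u‖) :
    ‖((b • ∑ j ∈ J, tensor (w j) (z j)) ∘L P) ∘L compInv P (b • ∑ j ∈ J, tensor (w j) (w j)) -
      A ∘L P‖ ≤ ρ * (Real.sqrt c)⁻¹ + σ * c⁻¹ := by
  set G : E →L[ℝ] E := b • ∑ j ∈ J, tensor (w j) (w j) with hG
  have hGv : ∀ v v', ⟪G v, v'⟫_ℝ = b * ∑ j ∈ J, ⟪w j, v⟫_ℝ * ⟪w j, v'⟫_ℝ := fun v v' => by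
    simp [hG, sum_inner, tensor_apply, real_inner_smul_left, Finset.mul_sum]
  have hGlow : ∀ v, P v = v → c * ‖v‖ ^ 2 ≤ ⟪G v, v⟫_ℝ := fun v hv => by
    rw [hGv]; simpa [pow_two] using hlow v hv
  obtain ⟨h1, h2, -, -⟩ := comp_mul_compInv hP hc hGlow
  refine ContinuousLinearMap.opNorm_le_bound _ (by positivity) fun x => ?_
  set y := compInv P G x with hy
  have hPy : P y = y := DFunLike.congr_fun h1 x
  have hTy : P (G (P y)) = P x := DFunLike.congr_fun h2 x
  obtain ⟨hy1, hy2⟩ := norm_compInv_apply_le hP hc hGlow x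
  rw [← hy] at hy1 hy2
  have key : ∀ u : F, ⟪(((b • ∑ j ∈ J, tensor (w j) (z j)) ∘L P) ∘L compInv P G - A ∘L P) x, u⟫_ℝ
      = b * ∑ j ∈ J, ⟪w j, y⟫_ℝ * ⟪r j, u⟫_ℝ + b * ∑ j ∈ J, ⟪w j, y⟫_ℝ * ⟪s j, u⟫_ℝ := fun u => by
    -- Normal equations: since P G y = P x, the target A P x can be written with the same weights
    -- ⟨w_j, y⟩ as the estimator, so only the errors r and s survive in the difference.
    have e1 : A (P x) = b • ∑ j ∈ J, ⟪w j, y⟫_ℝ • A (P (w j)) := by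
      rw [← hTy, hPy]
      simp [hG, tensor_apply]
    have e2 : (((b • ∑ j ∈ J, tensor (w j) (z j)) ∘L P) ∘L compInv P G - A ∘L P) x
        = b • ∑ j ∈ J, (⟪w j, y⟫_ℝ • r j + ⟪w j, y⟫_ℝ • s j) := by
      simp only [_root_.sub_apply, ContinuousLinearMap.comp_apply, ← hy, hPy]
      rw [e1]
      simp only [_root_.smul_apply, _root_.sum_apply, tensor_apply]
      rw [← smul_sub, ← Finset.sum_sub_distrib]
      congr 1
      refine Finset.sum_congr rfl fun j hj => ?_
      rw [hz j hj, smul_add, smul_add]; abel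
    rw [e2, real_inner_smul_left, sum_inner, ← mul_add, ← Finset.sum_add_distrib]
    simp [inner_add_left, real_inner_smul_left]
  set D := (((b • ∑ j ∈ J, tensor (w j) (z j)) ∘L P) ∘L compInv P G - A ∘L P) x with hD
  -- Cauchy–Schwarz over j, with the energy bound for the weights ⟨w_j, y⟩.
  have kr : ∀ u : F, b * ∑ j ∈ J, ⟪w j, y⟫_ℝ * ⟪r j, u⟫_ℝ ≤ ρ * (Real.sqrt c)⁻¹ * ‖x‖ * ‖u‖ := by
    intro u
    have cs := Finset.sum_mul_sq_le_sq_mul_sq J (fun j => ⟪w j, y⟫_ℝ) (fun j => ⟪r j, u⟫_ℝ)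
    have hy3 : b * ∑ j ∈ J, ⟪w j, y⟫_ℝ ^ 2 ≤ c⁻¹ * ‖x‖ ^ 2 := by
      have := hGv y y
      simp only [← pow_two] at this
      rw [← this]; exact hy2
    have : (b * ∑ j ∈ J, ⟪w j, y⟫_ℝ * ⟪r j, u⟫_ℝ) ^ 2 ≤
        (ρ * (Real.sqrt c)⁻¹ * ‖x‖ * ‖u‖) ^ 2 := by
      calc (b * ∑ j ∈ J, ⟪w j, y⟫_ℝ * ⟪r j, u⟫_ℝ) ^ 2
          = b ^ 2 * (∑ j ∈ J, ⟪w j, y⟫_ℝ * ⟪r j, u⟫_ℝ) ^ 2 := by ring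
        _ ≤ b ^ 2 * ((∑ j ∈ J, ⟪w j, y⟫_ℝ ^ 2) * ∑ j ∈ J, ⟪r j, u⟫_ℝ ^ 2) := by gcongr
        _ = (b * ∑ j ∈ J, ⟪w j, y⟫_ℝ ^ 2) * (b * ∑ j ∈ J, ⟪r j, u⟫_ℝ ^ 2) := by ring
        _ ≤ (c⁻¹ * ‖x‖ ^ 2) * (ρ ^ 2 * ‖u‖ ^ 2) :=
            mul_le_mul hy3 (hr u)
              (mul_nonneg hb.le (Finset.sum_nonneg fun _ _ => sq_nonneg _)) (by positivity)
        _ = _ := by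
            have : (Real.sqrt c)⁻¹ ^ 2 = c⁻¹ := by rw [inv_pow, Real.sq_sqrt hc.le]
            rw [← this]; ring
    exact (abs_le_of_sq_le_sq' this (by positivity)).2
  -- The noise is not small in mean square, only its correlation with the regressors is; the
  -- bilinear bound loses the full c^{-1}.
  have ks : ∀ u : F, b * ∑ j ∈ J, ⟪w j, y⟫_ℝ * ⟪s j, u⟫_ℝ ≤ σ * c⁻¹ * ‖x‖ * ‖u‖ := fun u => by
    calc _ ≤ σ * ‖y‖ * ‖u‖ := (le_abs_self _).trans (hs y u)
      _ ≤ σ * (c⁻¹ * ‖x‖) * ‖u‖ := by gcongr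
      _ = _ := by ring
  have hDD : ‖D‖ * ‖D‖ ≤ ((ρ * (Real.sqrt c)⁻¹ + σ * c⁻¹) * ‖x‖) * ‖D‖ := by
    rw [← real_inner_self_eq_norm_mul_norm, key D]
    have := kr D
    have := ks D
    nlinarith
  rcases eq_or_ne ‖D‖ 0 with h0 | h0
  · rw [h0]; positivity
  · exact le_of_mul_le_mul_right hDD (lt_of_le_of_ne (norm_nonneg _) (Ne.symm h0))

end Operators

/-! ### Eigenbases and spectral projections -/

section Eigen

variable {H : Type*} [NormedAddCommGroup H] [InnerProductSpace ℝ H]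

theorem projSpan_apply {e : ℕ → H} (he : Orthonormal ℝ e) (d : ℕ) (v : H) :
    projSpan e d v = ∑ i ∈ Finset.range d, ⟪e i, v⟫_ℝ • e i := by
  have : FiniteDimensional ℝ (Submodule.span ℝ (Set.range fun i : Fin d => e i)) :=
    FiniteDimensional.span_of_finite ℝ (Set.finite_range _)
  have hmem : ∀ i < d, e i ∈ Submodule.span ℝ (Set.range fun i : Fin d => e i) := fun i hi =>
    Submodule.subset_span ⟨⟨i, hi⟩, rfl⟩
  rw [projSpan]
  refine Submodule.eq_starProjection_of_mem_orthogonal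
    (Submodule.sum_mem _ fun i hi => Submodule.smul_mem _ _ (hmem i (Finset.mem_range.mp hi))) ?_
  rw [Submodule.mem_orthogonal]
  intro u hu
  induction hu using Submodule.span_induction with
  | mem x hx =>
    obtain ⟨i, rfl⟩ := hx
    rw [inner_sub_right, inner_sum]
    simp only [real_inner_smul_right, orthonormal_iff_ite.mp he]
    rw [Finset.sum_eq_single (i : ℕ)]
    · simp
    · intro b _ hb; simp [hb.symm]
    · intro h; exact absurd (Finset.mem_range.mpr i.2) h
  | zero => simp
  | add x y _ _ hx hy => rw [inner_add_left, hx, hy, add_zero]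
  | smul a x _ hx => rw [real_inner_smul_left, hx, mul_zero]

theorem isOrthProj_projSpan (e : ℕ → H) (d : ℕ) : IsOrthProj (projSpan e d) := by
  have : FiniteDimensional ℝ (Submodule.span ℝ (Set.range fun i : Fin d => e i)) :=
    FiniteDimensional.span_of_finite ℝ (Set.finite_range _)
  refine ⟨fun x => ?_, fun x y => ?_⟩
  · rw [projSpan]
    exact Submodule.starProjection_eq_self_iff.mpr (Submodule.starProjection_apply_mem _ _)
  · rw [projSpan]
    exact Submodule.inner_starProjection_left_eq_right _ x y

theorem inner_projSpan {e : ℕ → H} (he : Orthonormal ℝ e) (d : ℕ) (j : ℕ) (v : H) :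
    ⟪e j, projSpan e d v⟫_ℝ = if j < d then ⟪e j, v⟫_ℝ else 0 := by
  rw [projSpan_apply he, inner_sum]
  simp only [real_inner_smul_right, orthonormal_iff_ite.mp he]
  simp [Finset.sum_ite_eq]

theorem projSpan_comp_projSpan {e : ℕ → H} (he : Orthonormal ℝ e) {d d' : ℕ} (h : d ≤ d') (v : H) :
    projSpan e d' (projSpan e d v) = projSpan e d v := by
  rw [projSpan_apply he d', projSpan_apply he d]
  simp only [← projSpan_apply he d v, inner_projSpan he]
  rw [projSpan_apply he d, ← Finset.sum_subset (Finset.range_mono h)]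
  · exact Finset.sum_congr rfl fun i hi => by simp [Finset.mem_range.mp hi]
  · intro i _ hi
    simp [Finset.mem_range.not.mp hi]

theorem hasSum_of_forall_eq {ι M : Type*} [AddCommMonoid M] [TopologicalSpace M] {f g : ι → M}
    {a : M} (h : ∀ j, f j = g j) (hf : HasSum f a) : HasSum g a :=
  (funext h : f = g) ▸ hf

variable {C : H →L[ℝ] H} {l : ℕ → ℝ} {e : HilbertBasis ℕ ℝ H}

theorem hasSum_inner_sq (e : HilbertBasis ℕ ℝ H) (v : H) :
    HasSum (fun j => ⟪e j, v⟫_ℝ ^ 2) (‖v‖ ^ 2) := by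
  have := e.hasSum_inner_mul_inner v v
  rw [real_inner_self_eq_norm_sq] at this
  refine hasSum_of_forall_eq (fun j => ?_) this
  rw [real_inner_comm, pow_two]

/-- Symmetry of C is not part of `IsEigenbasis`; it comes from expanding v in the eigenbasis and
using continuity. -/
theorem IsEigenbasis.inner_apply (hC : IsEigenbasis C l e) (j : ℕ) (v : H) :
    ⟪e j, C v⟫_ℝ = l j * ⟪e j, v⟫_ℝ := by
  have h1 := ((e.hasSum_repr v).mapL C).mapL (innerSL ℝ (e j))
  have h2 : HasSum (fun i => (innerSL ℝ (e j)) (C (e.repr v i • e i))) (l j * ⟪e j, v⟫_ℝ) := by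
    have : (fun i => (innerSL ℝ (e j)) (C (e.repr v i • e i)))
        = fun i => if i = j then l j * ⟪e j, v⟫_ℝ else 0 := by
      funext i
      simp only [map_smul, hC.2, innerSL_apply_apply, orthonormal_iff_ite.mp e.orthonormal,
        e.repr_apply_apply, smul_eq_mul]
      by_cases h : i = j
      · subst h; simp; ring
      · simp [h, Ne.symm h]
    rw [this]
    exact hasSum_ite_eq j _
  exact h1.unique h2

theorem IsEigenbasis.hasSum_inner (hC : IsEigenbasis C l e) (v : H) :
    HasSum (fun j => l j * ⟪e j, v⟫_ℝ ^ 2) ⟪C v, v⟫_ℝ := by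
  refine hasSum_of_forall_eq (fun j => ?_) (e.hasSum_inner_mul_inner (C v) v)
  rw [real_inner_comm, hC.inner_apply]; ring

theorem IsEigenbasis.commute (hC : IsEigenbasis C l e) (d : ℕ) (v : H) :
    C (projSpan e d v) = projSpan e d (C v) := by
  rw [projSpan_apply e.orthonormal, projSpan_apply e.orthonormal, map_sum]
  refine Finset.sum_congr rfl fun i _ => ?_
  rw [map_smul, hC.2, hC.inner_apply, smul_smul, mul_comm]

theorem IsEigenbasis.inner_le_of_inner_eq_zero (hC : IsEigenbasis C l e) {d : ℕ} {v : H}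
    (hv : ∀ j < d, ⟪e j, v⟫_ℝ = 0) : ⟪C v, v⟫_ℝ ≤ l d * ‖v‖ ^ 2 := by
  refine hasSum_le (fun j => ?_) (hC.hasSum_inner v) ((hasSum_inner_sq e v).mul_left _)
  rcases lt_or_ge j d with h | h
  · simp [hv j h]
  · exact mul_le_mul_of_nonneg_right (hC.1 h) (sq_nonneg _)

theorem IsEigenbasis.le_inner_of_inner_eq_zero (hC : IsEigenbasis C l e) {d : ℕ} {v : H}
    (hv : ∀ j, d < j → ⟪e j, v⟫_ℝ = 0) : l d * ‖v‖ ^ 2 ≤ ⟪C v, v⟫_ℝ := by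
  refine hasSum_le (fun j => ?_) ((hasSum_inner_sq e v).mul_left _) (hC.hasSum_inner v)
  rcases lt_or_ge d j with h | h
  · simp [hv j h]
  · exact mul_le_mul_of_nonneg_right (hC.1 h) (sq_nonneg _)

theorem IsEigenbasis.norm_apply_le_of_inner_eq_zero (hC : IsEigenbasis C l e) (hl : ∀ i, 0 ≤ l i)
    {d : ℕ} {v : H} (hv : ∀ j < d, ⟪e j, v⟫_ℝ = 0) : ‖C v‖ ≤ l d * ‖v‖ := by
  have : ‖C v‖ ^ 2 ≤ (l d * ‖v‖) ^ 2 := by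
    rw [mul_pow]
    refine hasSum_le (fun j => ?_) (hasSum_inner_sq e (C v)) ((hasSum_inner_sq e v).mul_left _)
    rw [hC.inner_apply, mul_pow]
    rcases lt_or_ge j d with h | h
    · simp [hv j h]
    · exact mul_le_mul_of_nonneg_right (pow_le_pow_left₀ (hl j) (hC.1 h) 2) (sq_nonneg _)
  exact (abs_le_of_sq_le_sq' this (mul_nonneg (hl d) (norm_nonneg _))).2

theorem inner_sub_projSpan (e : HilbertBasis ℕ ℝ H) {d j : ℕ} (h : j < d) (v : H) :
    ⟪e j, v - projSpan e d v⟫_ℝ = 0 := by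
  rw [inner_sub_right, inner_projSpan e.orthonormal]; simp [h]

theorem inner_eq_zero_of_projSpan_eq (e : HilbertBasis ℕ ℝ H) {d j : ℕ} (h : d ≤ j) {v : H}
    (hv : projSpan e d v = v) : ⟪e j, v⟫_ℝ = 0 := by
  rw [← hv, inner_projSpan e.orthonormal]; simp [h]

theorem IsEigenbasis.nonneg (hC : IsEigenbasis C l e) (h : ∀ v, 0 ≤ ⟪C v, v⟫_ℝ) (i : ℕ) :
    0 ≤ l i := by
  have := h (e i)
  rw [hC.2, real_inner_smul_left, real_inner_self_eq_norm_sq, e.orthonormal.1 i] at this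
  simpa using this

variable {A : H →L[ℝ] H} {m : ℕ → ℝ} {f : HilbertBasis ℕ ℝ H}

/-- One half of Weyl's inequality. -/
theorem IsEigenbasis.le_add_norm_sub (hC : IsEigenbasis C l e) (hA : IsEigenbasis A m f) (i : ℕ) :
    m i ≤ l i + ‖A - C‖ := by
  -- Dimension count: the i + 1 leading eigenvectors of A span a space with a nonzero vector
  -- orthogonal to the i leading eigenvectors of C. On it the two Rayleigh quotients are compared.
  let L : (Fin (i + 1) → ℝ) →ₗ[ℝ] (Fin i → ℝ) :=
    { toFun := fun a j => ⟪e j, ∑ r, a r • f r⟫_ℝ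
      map_add' := fun a b => by
        funext j; simp [add_smul, Finset.sum_add_distrib, inner_add_right]
      map_smul' := fun a b => by
        funext j; simp [mul_smul, ← Finset.smul_sum, real_inner_smul_right] }
  obtain ⟨a, ha, ha0⟩ := (LinearMap.ker L).ne_bot_iff.mp
    (LinearMap.ker_ne_bot_of_finrank_lt (f := L) (by simp))
  set v : H := ∑ r, a r • f r with hv
  have hfv : ∀ j : ℕ, ⟪f j, v⟫_ℝ = if h : j < i + 1 then a ⟨j, h⟩ else 0 := fun j => by
    rw [hv, inner_sum]
    simp only [real_inner_smul_right, orthonormal_iff_ite.mp f.orthonormal]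
    split_ifs with h
    · rw [Finset.sum_eq_single ⟨j, h⟩]
      · simp
      · intro b _ hb
        rw [if_neg (fun h' => hb (Fin.ext h'.symm)), mul_zero]
      · simp
    · refine Finset.sum_eq_zero fun b _ => ?_
      rw [if_neg (fun h' : j = b => h (h' ▸ b.2)), mul_zero]
  have hv0 : 0 < ‖v‖ ^ 2 := by
    have : v ≠ 0 := fun h0 => ha0 <| funext fun r => by
      have := hfv r
      rw [h0, inner_zero_right, dif_pos r.2] at this
      exact this.symm
    have := norm_pos_iff.mpr this
    positivity
  have h1 : ⟪C v, v⟫_ℝ ≤ l i * ‖v‖ ^ 2 := hC.inner_le_of_inner_eq_zero fun j hj =>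
    congr_fun (LinearMap.mem_ker.mp ha) ⟨j, hj⟩
  have h2 : m i * ‖v‖ ^ 2 ≤ ⟪A v, v⟫_ℝ := hA.le_inner_of_inner_eq_zero fun j hj => by
    rw [hfv, dif_neg (by omega)]
  have h3 : ⟪(A - C) v, v⟫_ℝ ≤ ‖A - C‖ * ‖v‖ ^ 2 := by
    refine (real_inner_le_norm _ _).trans ?_
    rw [pow_two, ← mul_assoc]
    gcongr
    exact ContinuousLinearMap.le_opNorm _ _
  rw [_root_.sub_apply, inner_sub_left] at h3
  by_contra hh
  push Not at hh
  nlinarith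

/-- A Davis–Kahan bound for the leading spectral projections. -/
theorem IsEigenbasis.norm_sub_projSpan_le (hC : IsEigenbasis C l e) (hA : IsEigenbasis A m f)
    (hl : ∀ i, 0 ≤ l i) {d : ℕ} (hd : l (d + 1) < m d) {v : H}
    (hv : projSpan f (d + 1) v = v) :
    (m d - l (d + 1)) * ‖v - projSpan e (d + 1) v‖ ≤ ‖A - C‖ * ‖v‖ := by
  set P := projSpan e (d + 1) with hP
  set Q := projSpan f (d + 1) with hQ
  have hPp := isOrthProj_projSpan (e : ℕ → H) (d + 1)
  have hm : 0 < m d := (hl _).trans_lt hd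
  set B : H →L[ℝ] H := (1 - P) * Q with hB
  have hBv : ∀ v, Q v = v → ‖v - P v‖ ≤ ‖B‖ * ‖v‖ := fun v hv => by
    have := B.le_opNorm v
    simpa [hB, hv] using this
  -- Every v in the range of Q is A u with u in that range and ‖u‖ ≤ ‖v‖ / m_d. Then (1 - P) v = (1
  -- - P)(A - C) u + C (1 - P) u, and C is at most l_{d+1} on the range of 1 - P.
  have hkey : ∀ v, Q v = v → m d * ‖v - P v‖ ≤ (‖A - C‖ + l (d + 1) * ‖B‖) * ‖v‖ := fun v hv => by
    set u : H := ∑ i ∈ Finset.range (d + 1), ((m i)⁻¹ * ⟪f i, v⟫_ℝ) • f i with hu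
    have hmi : ∀ i < d + 1, m i ≠ 0 := fun i hi => (hm.trans_le (hA.1 (by omega))).ne'
    have hAu : A u = v := by
      rw [hu, map_sum, ← hv, hQ, projSpan_apply f.orthonormal]
      refine Finset.sum_congr rfl fun i hi => ?_
      rw [← projSpan_apply f.orthonormal, ← hQ, hv, map_smul, hA.2, smul_smul]
      congr 1
      field_simp [hmi i (Finset.mem_range.mp hi)]
    have hfu : ∀ j, ⟪f j, v⟫_ℝ = m j * ⟪f j, u⟫_ℝ := fun j => by rw [← hA.inner_apply, hAu]
    have hfu0 : ∀ j, d + 1 ≤ j → ⟪f j, u⟫_ℝ = 0 := fun j hj => by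
      rw [hu, inner_sum]
      refine Finset.sum_eq_zero fun i hi => ?_
      have : i ≠ j := by have := Finset.mem_range.mp hi; omega
      simp [real_inner_smul_right, orthonormal_iff_ite.mp f.orthonormal, this.symm]
    have hQu : Q u = u := by
      refine f.repr.injective (lp.ext (funext fun j => ?_))
      rw [f.repr_apply_apply, f.repr_apply_apply, hQ, inner_projSpan f.orthonormal]
      split_ifs with h
      · rfl
      · exact (hfu0 j (by omega)).symm
    have hun : m d * ‖u‖ ≤ ‖v‖ := by
      have : (m d * ‖u‖) ^ 2 ≤ ‖v‖ ^ 2 := by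
        rw [mul_pow]
        refine hasSum_le (fun j => ?_) ((hasSum_inner_sq f u).mul_left _) (hasSum_inner_sq f v)
        rw [hfu, mul_pow]
        rcases lt_or_ge j (d + 1) with h | h
        · exact mul_le_mul_of_nonneg_right (pow_le_pow_left₀ hm.le (hA.1 (by omega)) 2)
            (sq_nonneg _)
        · simp [hfu0 j h]
      exact (abs_le_of_sq_le_sq' this (norm_nonneg _)).2
    have hdec : v - P v = ((A - C) u - P ((A - C) u)) + C (u - P u) := by
      rw [map_sub C, hC.commute, ← hAu]
      simp only [_root_.sub_apply, map_sub]
      rw [hP]; abel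
    have h1 : ‖(A - C) u - P ((A - C) u)‖ ≤ ‖A - C‖ * ‖u‖ :=
      (hPp.norm_sub_apply_le _).trans (ContinuousLinearMap.le_opNorm _ _)
    have h2 : ‖C (u - P u)‖ ≤ l (d + 1) * (‖B‖ * ‖u‖) :=
      (hC.norm_apply_le_of_inner_eq_zero hl fun j hj => inner_sub_projSpan e hj u).trans
        (mul_le_mul_of_nonneg_left (hBv u hQu) (hl _))
    calc m d * ‖v - P v‖ ≤ m d * (‖A - C‖ * ‖u‖ + l (d + 1) * (‖B‖ * ‖u‖)) := by
          rw [hdec]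
          exact mul_le_mul_of_nonneg_left ((norm_add_le _ _).trans (add_le_add h1 h2)) hm.le
      _ = (‖A - C‖ + l (d + 1) * ‖B‖) * (m d * ‖u‖) := by ring
      _ ≤ _ := mul_le_mul_of_nonneg_left hun
        (add_nonneg (norm_nonneg _) (mul_nonneg (hl _) (norm_nonneg _)))
  -- The supremum over v makes the estimate self-referential in ‖B‖ = ‖(1 - P) Q‖. It can be solved
  -- because l_{d+1} < m_d, so only a gap between the two different spectra is needed.
  have hBle : m d * ‖B‖ ≤ ‖A - C‖ + l (d + 1) * ‖B‖ := by
    rw [mul_comm, ← le_div_iff₀ hm]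
    refine ContinuousLinearMap.opNorm_le_bound _
      (div_nonneg (add_nonneg (norm_nonneg _) (mul_nonneg (hl _) (norm_nonneg _))) hm.le)
      fun x => ?_
    have h1 := hkey (Q x) ((isOrthProj_projSpan (f : ℕ → H) (d + 1)).idem x)
    have h2 := (isOrthProj_projSpan (f : ℕ → H) (d + 1)).norm_apply_le x
    have h3 : B x = Q x - P (Q x) := by simp [hB]
    rw [h3, div_mul_eq_mul_div, le_div_iff₀ hm, mul_comm]
    exact h1.trans (mul_le_mul_of_nonneg_left h2
        (add_nonneg (norm_nonneg _) (mul_nonneg (hl _) (norm_nonneg _))))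
  calc (m d - l (d + 1)) * ‖v - P v‖ ≤ (m d - l (d + 1)) * (‖B‖ * ‖v‖) :=
        mul_le_mul_of_nonneg_left (hBv v hv) (sub_pos.mpr hd).le
    _ = ((m d - l (d + 1)) * ‖B‖) * ‖v‖ := by ring
    _ ≤ ‖A - C‖ * ‖v‖ := by gcongr; linarith

end Eigen

/-! ### Fourth moments of sums of martingale differences -/

section FourthMoment

variable {Ω K : Type*} [MeasurableSpace Ω] {μ : Measure Ω}
  [NormedAddCommGroup K] [InnerProductSpace ℝ K]

/-- The term ‖x‖²⟨x, y⟩ is kept because it integrates to zero when y is a martingale difference; the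
remaining terms are absorbed with a free weight t. -/
theorem norm_add_pow_four_le (x y : K) {t : ℝ} (ht : 0 < t) :
    ‖x + y‖ ^ 4 ≤ (1 + 4 * t) * ‖x‖ ^ 4 + 4 * (‖x‖ ^ 2 * ⟪x, y⟫_ℝ) + (4 / t + 3) * ‖y‖ ^ 4 := by
  have h1 : ‖x + y‖ ^ 4 = (‖x‖ ^ 2 + 2 * ⟪x, y⟫_ℝ + ‖y‖ ^ 2) ^ 2 := by
    rw [← norm_add_sq_real]; ring
  have h2 : |⟪x, y⟫_ℝ| ≤ ‖x‖ * ‖y‖ := abs_real_inner_le_norm x y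
  have h3 : ⟪x, y⟫_ℝ ^ 2 ≤ ‖x‖ ^ 2 * ‖y‖ ^ 2 := by
    rw [← mul_pow, ← sq_abs]; exact pow_le_pow_left₀ (abs_nonneg _) h2 2
  have h4 : ⟪x, y⟫_ℝ * ‖y‖ ^ 2 ≤ (‖x‖ ^ 2 * ‖y‖ ^ 2 + ‖y‖ ^ 4) / 2 := by
    have := mul_le_mul_of_nonneg_right ((le_abs_self _).trans h2) (sq_nonneg ‖y‖)
    nlinarith [mul_nonneg (sq_nonneg (‖x‖ - ‖y‖)) (sq_nonneg ‖y‖)]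
  have h5 : 8 * (‖x‖ ^ 2 * ‖y‖ ^ 2) ≤ 4 * t * ‖x‖ ^ 4 + 4 / t * ‖y‖ ^ 4 := by
    have : 0 ≤ 4 / t * (t * ‖x‖ ^ 2 - ‖y‖ ^ 2) ^ 2 := by positivity
    have e : 4 / t * (t * ‖x‖ ^ 2 - ‖y‖ ^ 2) ^ 2 =
        4 * t * ‖x‖ ^ 4 + 4 / t * ‖y‖ ^ 4 - 8 * (‖x‖ ^ 2 * ‖y‖ ^ 2) := by
      field_simp; ring
    linarith
  rw [h1]
  nlinarith

theorem integrable_norm_sq_mul_inner {S D : Ω → K} (hS : AEStronglyMeasurable S μ)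
    (hD : AEStronglyMeasurable D μ) (iS : Integrable (fun ω => ‖S ω‖ ^ 4) μ)
    (iD : Integrable (fun ω => ‖D ω‖ ^ 4) μ) :
    Integrable (fun ω => ‖S ω‖ ^ 2 * ⟪S ω, D ω⟫_ℝ) μ := by
  refine (iS.add iD).mono ((hS.norm.pow 2).mul (hS.inner hD)) (ae_of_all _ fun ω => ?_)
  rw [Real.norm_eq_abs, abs_mul, abs_of_nonneg (sq_nonneg _)]
  have h2 : |⟪S ω, D ω⟫_ℝ| ≤ ‖S ω‖ * ‖D ω‖ := abs_real_inner_le_norm _ _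
  refine (mul_le_mul_of_nonneg_left h2 (sq_nonneg _)).trans ?_
  rw [Pi.add_apply, Real.norm_of_nonneg (by positivity)]
  nlinarith [sq_nonneg (‖S ω‖ ^ 2 - ‖S ω‖ * ‖D ω‖), sq_nonneg (‖S ω‖ ^ 2 - ‖D ω‖ ^ 2),
    sq_nonneg (‖S ω‖ ^ 2), sq_nonneg (‖D ω‖ ^ 2)]

/-- Induction on the latest index. The martingale property enters only through the vanishing of E
‖S‖²⟨S, D_q⟩, which keeps conditional expectations in K out of the argument. -/
theorem integral_norm_sum_pow_four_le (J : Finset ℤ) (D : ℤ → Ω → K) {B : ℝ} (hB : 0 ≤ B)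
    (hD : ∀ q ∈ J, AEStronglyMeasurable (D q) μ)
    (iD : ∀ q ∈ J, Integrable (fun ω => ‖D q ω‖ ^ 4) μ)
    (bD : ∀ q ∈ J, ∫ ω, ‖D q ω‖ ^ 4 ∂μ ≤ B)
    (hz : ∀ q ∈ J, ∀ s ⊆ J, (∀ p ∈ s, p < q) → Integrable (fun ω => ‖∑ p ∈ s, D p ω‖ ^ 4) μ →
      ∫ ω, ‖∑ p ∈ s, D p ω‖ ^ 2 * ⟪∑ p ∈ s, D p ω, D q ω⟫_ℝ ∂μ = 0) :
    Integrable (fun ω => ‖∑ q ∈ J, D q ω‖ ^ 4) μ ∧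
      ∫ ω, ‖∑ q ∈ J, D q ω‖ ^ 4 ∂μ ≤ 16 * (J.card : ℝ) ^ 2 * B := by
  induction J using Finset.induction_on_max with
  | empty => simp
  | insert q s hq ih =>
    have hqs : q ∉ s := fun h => lt_irrefl _ (hq q h)
    obtain ⟨i1, b1⟩ := ih (fun p hp => hD p (Finset.mem_insert_of_mem hp))
      (fun p hp => iD p (Finset.mem_insert_of_mem hp))
      (fun p hp => bD p (Finset.mem_insert_of_mem hp))
      (fun p hp r hr => hz p (Finset.mem_insert_of_mem hp) r
        (hr.trans (Finset.subset_insert _ _)))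
    have hS : AEStronglyMeasurable (fun ω => ∑ p ∈ s, D p ω) μ :=
      Finset.aestronglyMeasurable_fun_sum s fun p hp => hD p (Finset.mem_insert_of_mem hp)
    have hDq := hD q (Finset.mem_insert_self _ _)
    have iDq := iD q (Finset.mem_insert_self _ _)
    have bDq := bD q (Finset.mem_insert_self _ _)
    have h0 := hz q (Finset.mem_insert_self _ _) s (Finset.subset_insert _ _) hq i1
    have ic := integrable_norm_sq_mul_inner hS hDq i1 iDq
    simp only [Finset.sum_insert hqs, Finset.card_insert_of_notMem hqs]
    have hbd : ∀ t : ℝ, 0 < t → Integrable (fun ω => (1 + 4 * t) * ‖∑ p ∈ s, D p ω‖ ^ 4 +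
        4 * (‖∑ p ∈ s, D p ω‖ ^ 2 * ⟪∑ p ∈ s, D p ω, D q ω⟫_ℝ) + (4 / t + 3) * ‖D q ω‖ ^ 4) μ :=
      fun t _ => ((i1.const_mul _).add (ic.const_mul _)).add (iDq.const_mul _)
    have i2 : Integrable (fun ω => ‖D q ω + ∑ p ∈ s, D p ω‖ ^ 4) μ := by
      refine (hbd 1 one_pos).mono ((hDq.add hS).norm.pow 4) (ae_of_all _ fun ω => ?_)
      rw [Real.norm_of_nonneg (by positivity)]
      refine le_trans ?_ (le_abs_self _)
      rw [add_comm (D q ω)]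
      exact norm_add_pow_four_le _ _ one_pos
    refine ⟨i2, ?_⟩
    have hle : ∀ t : ℝ, 0 < t → ∫ ω, ‖D q ω + ∑ p ∈ s, D p ω‖ ^ 4 ∂μ ≤
        (1 + 4 * t) * (16 * (s.card : ℝ) ^ 2 * B) + (4 / t + 3) * B := fun t ht => by
      calc ∫ ω, ‖D q ω + ∑ p ∈ s, D p ω‖ ^ 4 ∂μ
          ≤ ∫ ω, ((1 + 4 * t) * ‖∑ p ∈ s, D p ω‖ ^ 4 +
        4 * (‖∑ p ∈ s, D p ω‖ ^ 2 * ⟪∑ p ∈ s, D p ω, D q ω⟫_ℝ) +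
          (4 / t + 3) * ‖D q ω‖ ^ 4) ∂μ := by
            refine integral_mono i2 (hbd t ht) fun ω => ?_
            simp only
            rw [add_comm (D q ω)]
            exact norm_add_pow_four_le _ _ ht
        _ = (1 + 4 * t) * ∫ ω, ‖∑ p ∈ s, D p ω‖ ^ 4 ∂μ + (4 / t + 3) * ∫ ω, ‖D q ω‖ ^ 4 ∂μ := by
            have i3 : Integrable (fun ω => (1 + 4 * t) * ‖∑ p ∈ s, D p ω‖ ^ 4 +
                4 * (‖∑ p ∈ s, D p ω‖ ^ 2 * ⟪∑ p ∈ s, D p ω, D q ω⟫_ℝ)) μ :=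
              (i1.const_mul _).add (ic.const_mul _)
            rw [integral_add i3 (iDq.const_mul _), integral_add (i1.const_mul _) (ic.const_mul _), integral_const_mul,
              integral_const_mul, integral_const_mul, h0]
            ring
        _ ≤ _ := by gcongr
    rcases Nat.eq_zero_or_pos s.card with hs | hs
    · rw [Finset.card_eq_zero.mp hs]
      simp only [Finset.sum_empty, add_zero, Finset.card_empty]
      push_cast
      linarith
    · have hm : (0 : ℝ) < s.card := by exact_mod_cast hs
      -- With N terms, t = 1/(4N) gives 16N² + 32N + 3 ≤ 16(N + 1)², which closes the induction with
      -- quadratic growth.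
      have := hle (1 / (4 * s.card)) (by positivity)
      refine this.trans ?_
      push_cast
      have e : (1 + 4 * (1 / (4 * (s.card : ℝ)))) * (16 * (s.card : ℝ) ^ 2 * B) +
          (4 / (1 / (4 * (s.card : ℝ))) + 3) * B = (16 * (s.card : ℝ) ^ 2 + 32 * s.card + 3) * B := by
        field_simp; ring
      rw [e]
      nlinarith

end FourthMoment

/-! ### Independent noise -/

section Noise

variable {Ω H : Type*} [MeasurableSpace Ω] {μ : Measure Ω} [IsProbabilityMeasure μ]
  [NormedAddCommGroup H] [InnerProductSpace ℝ H] [CompleteSpace H]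
  [MeasurableSpace H] [BorelSpace H] [SecondCountableTopology H]

/-- Independent, identically distributed, centred noise with a finite fourth moment. -/
structure IsNoise (μ : Measure Ω) (ε : ℤ → Ω → H) : Prop where
  meas : ∀ j, Measurable (ε j)
  indep : iIndepFun ε μ
  ident : ∀ j, IdentDistrib (ε j) (ε 0) μ μ
  memLp : MemLp (ε 0) 4 μ
  mean : ∫ ω, ε 0 ω ∂μ = 0

/-- The σ-algebra generated by the noise before time `q`. -/
@[reducible]
def past (ε : ℤ → Ω → H) (q : ℤ) : MeasurableSpace Ω :=
  ⨆ p ∈ Set.Iio q, MeasurableSpace.comap (ε p) inferInstance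

theorem measurable_past (ε : ℤ → Ω → H) {p q : ℤ} (h : p < q) : Measurable[past ε q] (ε p) := by
  have : MeasurableSpace.comap (ε p) inferInstance ≤ past ε q :=
    le_biSup (fun p => MeasurableSpace.comap (ε p) inferInstance) (Set.mem_Iio.mpr h)
  exact (comap_measurable (ε p)).mono this le_rfl

namespace IsNoise

variable {ε : ℤ → Ω → H}

theorem past_le (hε : IsNoise μ ε) (q : ℤ) : past ε q ≤ ‹MeasurableSpace Ω› :=
  iSup₂_le fun p _ => (hε.meas p).comap_le

theorem indepFun_past (hε : IsNoise μ ε) {q : ℤ} {G : Type*} [MeasurableSpace G] {W : Ω → G}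
    (hW : Measurable[past ε q] W) : IndepFun W (ε q) μ := by
  have h := indep_iSup_of_disjoint (m := fun p => MeasurableSpace.comap (ε p) inferInstance)
    (fun p => (hε.meas p).comap_le) hε.indep (S := Set.Iio q) (T := {q}) (by simp)
  rw [IndepFun_iff_Indep]
  refine indep_of_indep_of_le_left (indep_of_indep_of_le_right h ?_) hW.comap_le
  simp

theorem memLp' (hε : IsNoise μ ε) (j : ℤ) : MemLp (ε j) 4 μ :=
  (hε.ident j).memLp_iff.mpr hε.memLp

theorem integrable (hε : IsNoise μ ε) (j : ℤ) : Integrable (ε j) μ :=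
  (hε.memLp' j).integrable (by norm_num)

theorem mean' (hε : IsNoise μ ε) (j : ℤ) : ∫ ω, ε j ω ∂μ = 0 :=
  (hε.ident j).integral_eq.trans hε.mean

theorem integrable_norm_pow (hε : IsNoise μ ε) (j : ℤ) : Integrable (fun ω => ‖ε j ω‖ ^ 4) μ := by
  simpa using (hε.memLp' j).integrable_norm_pow (by norm_num : (4 : ℕ) ≠ 0)

theorem integral_norm_pow (hε : IsNoise μ ε) (j : ℤ) (r : ℕ) :
    ∫ ω, ‖ε j ω‖ ^ r ∂μ = ∫ ω, ‖ε 0 ω‖ ^ r ∂μ :=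
  ((hε.ident j).comp (measurable_norm.pow_const r)).integral_eq

theorem integral_inner_eq_zero (hε : IsNoise μ ε) {q : ℤ} {W : Ω → H}
    (hW : Measurable[past ε q] W) (hi : Integrable W μ) :
    ∫ ω, ⟪W ω, ε q ω⟫_ℝ ∂μ = 0 := by
  have := (hε.indepFun_past hW).integral_bilin hi (hε.integrable q) (innerSL ℝ)
  rw [hε.mean', map_zero] at this
  exact this

/-- Fourth moments of linear combinations of the noise. -/
theorem integral_norm_sum_smul_pow_four_le (hε : IsNoise μ ε) (F : Finset ℤ) (c : ℤ → ℝ)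
    (hc : ∀ p ∈ F, |c p| ≤ 1) :
    Integrable (fun ω => ‖∑ p ∈ F, c p • ε p ω‖ ^ 4) μ ∧
      ∫ ω, ‖∑ p ∈ F, c p • ε p ω‖ ^ 4 ∂μ ≤ 16 * (F.card : ℝ) ^ 2 * ∫ ω, ‖ε 0 ω‖ ^ 4 ∂μ := by
  have hm : ∀ q, AEStronglyMeasurable (fun ω => c q • ε q ω) μ := fun q =>
    ((hε.meas q).const_smul (c q)).aestronglyMeasurable
  have hi : ∀ q, Integrable (fun ω => ‖c q • ε q ω‖ ^ 4) μ := fun q => by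
    simp only [norm_smul, mul_pow]; exact (hε.integrable_norm_pow q).const_mul _
  refine integral_norm_sum_pow_four_le F _ (integral_nonneg fun ω => by positivity)
    (fun q _ => hm q) (fun q _ => hi q) (fun q hq => ?_) (fun q hq s hs hsq is => ?_)
  · rw [← hε.integral_norm_pow q]
    refine integral_mono (hi q) (hε.integrable_norm_pow q) fun ω => ?_
    simp only [norm_smul]
    gcongr
    exact mul_le_of_le_one_left (norm_nonneg _) (hc q hq)
  · have hS : Measurable[past ε q] (fun ω => ∑ p ∈ s, c p • ε p ω) :=
      Finset.measurable_fun_sum s fun p hp => (measurable_past ε (hsq p hp)).const_smul (c p)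
    have hSm : Measurable (fun ω => ∑ p ∈ s, c p • ε p ω) := hS.mono (hε.past_le q) le_rfl
    have hW : Measurable[past ε q] (fun ω => (‖∑ p ∈ s, c p • ε p ω‖ ^ 2 * c q) •
        ∑ p ∈ s, c p • ε p ω) := (((measurable_norm.comp hS).pow_const 2).mul_const _).smul hS
    have hWi : Integrable (fun ω => (‖∑ p ∈ s, c p • ε p ω‖ ^ 2 * c q) •
        ∑ p ∈ s, c p • ε p ω) μ := by
      refine ((is.add (integrable_const 1)).const_mul (|c q|)).mono
        (hW.mono (hε.past_le q) le_rfl).aestronglyMeasurable (ae_of_all _ fun ω => ?_)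
      rw [norm_smul, norm_mul, Real.norm_eq_abs, Real.norm_eq_abs, Real.norm_eq_abs,
        abs_of_nonneg (sq_nonneg _)]
      set a := ‖∑ p ∈ s, c p • ε p ω‖
      have ha : 0 ≤ a := norm_nonneg _
      refine le_trans ?_ (le_abs_self _)
      have : a ^ 3 ≤ a ^ 4 + 1 := by
        nlinarith [sq_nonneg (a ^ 2 - a), sq_nonneg (a - 1), sq_nonneg (a ^ 2 - 1)]
      calc a ^ 2 * |c q| * a = |c q| * a ^ 3 := by ring
        _ ≤ |c q| * (a ^ 4 + 1) := by gcongr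
    rw [← hε.integral_inner_eq_zero hW hWi]
    refine integral_congr_ae (ae_of_all _ fun ω => ?_)
    simp only [real_inner_smul_left, real_inner_smul_right]
    ring

/-- Fourth moments of off-diagonal quadratic forms in the noise. -/
theorem integral_norm_sum_tmul_pow_four_le (hε : IsNoise μ ε) (J : Finset ℤ) (F : ℤ → Finset ℤ)
    (hF : ∀ q ∈ J, ∀ p ∈ F q, p < q) (c : ℤ → ℤ → ℝ) (hc : ∀ q p, |c q p| ≤ 1) {b : ℕ}
    (hb : ∀ q ∈ J, (F q).card ≤ b) :
    Integrable (fun ω => ‖∑ q ∈ J, (∑ p ∈ F q, c q p • ε p ω) ⊗ₜ[ℝ] ε q ω‖ ^ 4) μ ∧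
      ∫ ω, ‖∑ q ∈ J, (∑ p ∈ F q, c q p • ε p ω) ⊗ₜ[ℝ] ε q ω‖ ^ 4 ∂μ ≤
        16 * (J.card : ℝ) ^ 2 * (16 * (b : ℝ) ^ 2 * (∫ ω, ‖ε 0 ω‖ ^ 4 ∂μ) ^ 2) := by
  set Y : ℤ → Ω → H := fun q ω => ∑ p ∈ F q, c q p • ε p ω with hY
  set M := ∫ ω, ‖ε 0 ω‖ ^ 4 ∂μ with hM
  have hM0 : 0 ≤ M := integral_nonneg fun ω => by positivity
  have hYp : ∀ q ∈ J, ∀ r, q ≤ r → Measurable[past ε r] (Y q) := fun q hq r hr =>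
    Finset.measurable_fun_sum _ fun p hp =>
      (measurable_past ε ((hF q hq p hp).trans_le hr)).const_smul (c q p)
  have hYm : ∀ q, Measurable (Y q) := fun q =>
    Finset.measurable_fun_sum _ fun p _ => (hε.meas p).const_smul (c q p)
  have hm : ∀ q, AEStronglyMeasurable (fun ω => Y q ω ⊗ₜ[ℝ] ε q ω) μ := fun q =>
    Continuous.comp_aestronglyMeasurable₂ (g := fun x y => x ⊗ₜ[ℝ] y)
      TensorProduct.continuous_tmul (hYm q).aestronglyMeasurable (hε.meas q).aestronglyMeasurable
  have hYi := fun q => hε.integral_norm_sum_smul_pow_four_le (F q) (c q) (fun p _ => hc q p)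
  have hind : ∀ q ∈ J, IndepFun (fun ω => ‖Y q ω‖ ^ 4) (fun ω => ‖ε q ω‖ ^ 4) μ := fun q hq =>
    (hε.indepFun_past (hYp q hq q le_rfl)).comp (measurable_norm.pow_const 4)
      (measurable_norm.pow_const 4)
  have hi : ∀ q ∈ J, Integrable (fun ω => ‖Y q ω ⊗ₜ[ℝ] ε q ω‖ ^ 4) μ := fun q hq => by
    simp only [TensorProduct.norm_tmul, mul_pow]
    exact (hind q hq).integrable_mul (hYi q).1 (hε.integrable_norm_pow q)
  refine integral_norm_sum_pow_four_le J (fun q ω => Y q ω ⊗ₜ[ℝ] ε q ω) (by positivity)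
    (fun q _ => hm q) hi (fun q hq => ?_) (fun q hq s hs hsq is => ?_)
  · simp only [TensorProduct.norm_tmul, mul_pow]
    rw [(hind q hq).integral_fun_mul_eq_mul_integral (hYi q).1.1 (hε.integrable_norm_pow q).1,
      hε.integral_norm_pow q 4]
    have := (hYi q).2
    have hb' : ((F q).card : ℝ) ≤ b := by exact_mod_cast hb q hq
    calc _ ≤ (16 * ((F q).card : ℝ) ^ 2 * M) * M := by gcongr
      _ ≤ (16 * (b : ℝ) ^ 2 * M) * M := by gcongr
      _ = _ := by ring
  · set S : Ω → H ⊗[ℝ] H := fun ω => ∑ p ∈ s, Y p ω ⊗ₜ[ℝ] ε p ω with hS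
    -- Expanding in scalar products reduces measurability with respect to the past to H-valued
    -- variables, so no σ-algebra on H ⊗ H is used.
    have hSn : ∀ ω, ‖S ω‖ ^ 2 = ∑ p ∈ s, ∑ r ∈ s, ⟪Y p ω, Y r ω⟫_ℝ * ⟪ε p ω, ε r ω⟫_ℝ := by
      intro ω
      rw [← real_inner_self_eq_norm_sq, hS]
      simp only [sum_inner, inner_sum, TensorProduct.inner_tmul]
      rw [Finset.sum_comm]
    have hSm : Measurable[past ε q] (fun ω => ‖S ω‖ ^ 2) := by
      simp only [hSn]
      refine Finset.measurable_fun_sum _ fun p hp => Finset.measurable_fun_sum _ fun r hr => ?_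
      exact ((hYp p (hs hp) q (hsq p hp).le).inner (hYp r (hs hr) q (hsq r hr).le)).mul
        ((measurable_past ε (hsq p hp)).inner (measurable_past ε (hsq r hr)))
    -- The cross term ‖S‖²⟨S, Y_q ⊗ ε_q⟩ is linear in ε_q. Its Riesz representative W depends on the
    -- past only, so independence and centring of ε_q make the term vanish.
    set W : Ω → H := fun ω => ∑ p ∈ s, (‖S ω‖ ^ 2 * ⟪Y p ω, Y q ω⟫_ℝ) • ε p ω with hWd
    have hW : Measurable[past ε q] W :=
      Finset.measurable_fun_sum _ fun p hp => (hSm.mul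
        ((hYp p (hs hp) q (hsq p hp).le).inner (hYp q hq q le_rfl))).smul
          (measurable_past ε (hsq p hp))
    have hWS : ∀ ω, ∀ u : H, ⟪W ω, u⟫_ℝ = ‖S ω‖ ^ 2 * ⟪S ω, Y q ω ⊗ₜ[ℝ] u⟫_ℝ := fun ω u => by
      simp only [hWd, hS, sum_inner, real_inner_smul_left, TensorProduct.inner_tmul,
        Finset.mul_sum, mul_assoc]
    have hWn : ∀ ω, ‖W ω‖ ≤ ‖S ω‖ ^ 3 * ‖Y q ω‖ := fun ω => by
      by_cases h0 : ‖W ω‖ = 0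
      · rw [h0]; positivity
      have h1 : ‖W ω‖ * ‖W ω‖ ≤ (‖S ω‖ ^ 3 * ‖Y q ω‖) * ‖W ω‖ := by
        rw [← real_inner_self_eq_norm_mul_norm, hWS]
        have := real_inner_le_norm (S ω) (Y q ω ⊗ₜ[ℝ] W ω)
        rw [TensorProduct.norm_tmul] at this
        calc _ ≤ ‖S ω‖ ^ 2 * (‖S ω‖ * (‖Y q ω‖ * ‖W ω‖)) := by gcongr
          _ = _ := by ring
      exact le_of_mul_le_mul_right h1 (lt_of_le_of_ne (norm_nonneg _) (Ne.symm h0))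
    have hWi : Integrable W μ := by
      refine (is.add (hYi q).1).mono (hW.mono (hε.past_le q) le_rfl).aestronglyMeasurable
        (ae_of_all _ fun ω => (hWn ω).trans ?_)
      refine le_trans ?_ (le_abs_self _)
      change ‖S ω‖ ^ 3 * ‖Y q ω‖ ≤ ‖S ω‖ ^ 4 + ‖Y q ω‖ ^ 4
      set a := ‖S ω‖
      set b := ‖Y q ω‖
      nlinarith [sq_nonneg (a ^ 2 - a * b), sq_nonneg (a ^ 2 - b ^ 2), sq_nonneg (a ^ 2),
        sq_nonneg (b ^ 2)]
    rw [← hε.integral_inner_eq_zero hW hWi]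
    exact integral_congr_ae (ae_of_all _ fun ω => (hWS ω _).symm)

end IsNoise

end Noise

/-! ### Toeplitz forms and the discrete Fourier transform -/

section Toeplitz

/-- Real part of a geometric sum of an N-th root of unity; |h| < N and h ≠ 0 keep that root away
from 1. -/
theorem sum_cos_eq_zero {N : ℕ} (hN : 0 < N) {h : ℤ} (hh : h ≠ 0) (hlt : |h| < N) :
    ∑ j ∈ Finset.range N, Real.cos (2 * Real.pi * j / N * h) = 0 := by
  have hN' : (N : ℂ) ≠ 0 := by exact_mod_cast hN.ne'
  set z : ℂ := Complex.exp (2 * Real.pi * Complex.I * h / N) with hz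
  have hz1 : z ≠ 1 := by
    intro h1
    obtain ⟨n, hn⟩ := Complex.exp_eq_one_iff.mp h1
    have h2 : (h : ℂ) = n * N := by
      have h3 : (2 * Real.pi * Complex.I : ℂ) ≠ 0 := Complex.two_pi_I_ne_zero
      field_simp at hn
      have : (2 * Real.pi * Complex.I : ℂ) * h = (2 * Real.pi * Complex.I) * (n * N) := by
        linear_combination (2 * Real.pi * Complex.I : ℂ) * hn
      exact mul_left_cancel₀ h3 this
    have h4 : h = n * N := by exact_mod_cast h2
    have hn0 : n ≠ 0 := fun h0 => hh (by rw [h4, h0, zero_mul])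
    rw [h4, abs_mul, Nat.abs_cast] at hlt
    have : (1 : ℤ) ≤ |n| := Int.one_le_abs hn0
    nlinarith [Int.natCast_nonneg N]
  have hzN : z ^ N = 1 := by
    rw [hz, ← Complex.exp_nat_mul]
    refine Complex.exp_eq_one_iff.mpr ⟨h, ?_⟩
    field_simp
  have hsum : ∑ j ∈ Finset.range N, z ^ j = 0 := by
    have := geom_sum_eq hz1 N
    rw [this, hzN, sub_self, zero_div]
  have hre := congrArg Complex.re hsum
  rw [Complex.re_sum, Complex.zero_re] at hre
  rw [← hre]
  refine Finset.sum_congr rfl fun j _ => ?_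
  rw [hz, ← Complex.exp_nat_mul]
  have : (j : ℂ) * (2 * Real.pi * Complex.I * h / N) =
      ((2 * Real.pi * j / N * h : ℝ) : ℂ) * Complex.I := by
    push_cast; ring
  rw [this, Complex.exp_ofReal_mul_I_re]

theorem sum_cos_eq_ite {N : ℕ} (hN : 0 < N) {h : ℤ} (hlt : |h| < N) :
    ∑ j ∈ Finset.range N, Real.cos (2 * Real.pi * j / N * h) = if h = 0 then (N : ℝ) else 0 := by
  split_ifs with h0
  · simp [h0]
  · exact sum_cos_eq_zero hN h0 hlt

variable {H : Type*} [NormedAddCommGroup H] [InnerProductSpace ℝ H]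

/-- The frequency band-limited form of a kernel `b`. -/
noncomputable def bandForm (I : Finset ℤ) (k : ℕ) (b : ℤ → ℤ → H →ₗ[ℝ] H →ₗ[ℝ] ℝ) (g : ℤ → ℝ) :
    H →ₗ[ℝ] H →ₗ[ℝ] ℝ :=
  ∑ s ∈ I, ∑ t ∈ I, (if |s - t| < k then g (s - t) else 0) • b s t

/-- The bilinear form of an operator. -/
noncomputable def opForm (T : H →L[ℝ] H) : H →ₗ[ℝ] H →ₗ[ℝ] ℝ := (innerₗ H).comp T.toLinearMap

theorem opForm_apply (T : H →L[ℝ] H) (u v : H) : opForm T u v = ⟪T u, v⟫_ℝ := rfl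

/-- The Toeplitz form on `H^k` of a kernel `b`. -/
noncomputable def toeplitzForm (I : Finset ℤ) (k : ℕ) (b : ℤ → ℤ → H →ₗ[ℝ] H →ₗ[ℝ] ℝ)
    (v : ℕ → H) : ℝ :=
  ∑ i ∈ Finset.range k, ∑ i' ∈ Finset.range k, ∑ s ∈ I, ∑ s' ∈ I,
    if s + i = s' + i' then b s s' (v i) (v i') else 0

/-- The constraint s + i = s' + i' is the average over 2k frequencies of cos(ω(s - s' + i - i')),
and the addition formulas separate the times from the coordinates. Pairs with |s - s'| ≥ k never
meet the constraint, so the band truncation costs nothing. -/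
theorem toeplitzForm_eq (I : Finset ℤ) {k : ℕ} (hk : 0 < k) (b : ℤ → ℤ → H →ₗ[ℝ] H →ₗ[ℝ] ℝ)
    (v : ℕ → H) (vc vs : ℕ → H)
    (hvc : ∀ j, vc j = ∑ i ∈ Finset.range k,
      Real.cos (2 * Real.pi * j / (2 * k : ℕ) * (i : ℤ)) • v i)
    (hvs : ∀ j, vs j = ∑ i ∈ Finset.range k,
      Real.sin (2 * Real.pi * j / (2 * k : ℕ) * (i : ℤ)) • v i) :
    (2 * k : ℕ) * toeplitzForm I k b v = ∑ j ∈ Finset.range (2 * k),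
      (bandForm I k b (fun h => Real.cos (2 * Real.pi * j / (2 * k : ℕ) * h)) (vc j) (vc j) +
        bandForm I k b (fun h => Real.cos (2 * Real.pi * j / (2 * k : ℕ) * h)) (vs j) (vs j) -
        bandForm I k b (fun h => Real.sin (2 * Real.pi * j / (2 * k : ℕ) * h)) (vs j) (vc j) +
        bandForm I k b (fun h => Real.sin (2 * Real.pi * j / (2 * k : ℕ) * h)) (vc j) (vs j)) := by
  have hN : 0 < 2 * k := by omega
  set N := 2 * k with hNdef
  have hband : ∀ (g : ℤ → ℝ) (a a' : ℕ → ℝ), bandForm I k b g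
      (∑ i ∈ Finset.range k, a i • v i) (∑ i ∈ Finset.range k, a' i • v i) =
      ∑ i ∈ Finset.range k, ∑ i' ∈ Finset.range k, ∑ s ∈ I, ∑ s' ∈ I,
        (a i * a' i' * (if |s - s'| < k then g (s - s') else 0)) * b s s' (v i) (v i') := by
    intro g a a'
    simp only [map_sum, LinearMap.sum_apply, map_smul, LinearMap.smul_apply, bandForm, smul_eq_mul]
    rw [Finset.sum_comm]
    refine Finset.sum_congr rfl fun i _ => ?_
    simp only [Finset.mul_sum]
    refine Finset.sum_congr rfl fun i' _ => Finset.sum_congr rfl fun s _ =>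
      Finset.sum_congr rfl fun s' _ => by ring
  simp only [hvc, hvs, hband, ← Finset.sum_add_distrib, ← Finset.sum_sub_distrib]
  rw [toeplitzForm, Finset.mul_sum, Finset.sum_comm]
  refine Finset.sum_congr rfl fun i hi => ?_
  rw [Finset.mul_sum, Finset.sum_comm]
  refine Finset.sum_congr rfl fun i' hi' => ?_
  rw [Finset.mul_sum, Finset.sum_comm]
  refine Finset.sum_congr rfl fun s _ => ?_
  rw [Finset.mul_sum, Finset.sum_comm]
  refine Finset.sum_congr rfl fun s' _ => ?_
  simp only [← add_mul, ← sub_mul]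
  rw [← Finset.sum_mul]
  have hi1 := Finset.mem_range.mp hi
  have hi2 := Finset.mem_range.mp hi'
  by_cases hs : |s - s'| < (k : ℤ)
  · simp only [if_pos hs]
    -- No aliasing: both differences are below k in absolute value. This is why 2k frequencies are
    -- used instead of k.
    have hlt : |s - s' + (i - i' : ℤ)| < (N : ℤ) := by
      rw [abs_lt] at hs ⊢; constructor <;> push_cast [hNdef] <;> omega
    have key := sum_cos_eq_ite hN hlt
    have : ∀ j : ℕ, (Real.cos (2 * Real.pi * j / N * (i : ℤ)) *
        Real.cos (2 * Real.pi * j / N * (i' : ℤ)) +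
        Real.sin (2 * Real.pi * j / N * (i : ℤ)) * Real.sin (2 * Real.pi * j / N * (i' : ℤ))) *
          Real.cos (2 * Real.pi * j / N * (s - s' : ℤ)) -
        Real.sin (2 * Real.pi * j / N * (i : ℤ)) * Real.cos (2 * Real.pi * j / N * (i' : ℤ)) *
          Real.sin (2 * Real.pi * j / N * (s - s' : ℤ)) +
        Real.cos (2 * Real.pi * j / N * (i : ℤ)) * Real.sin (2 * Real.pi * j / N * (i' : ℤ)) *
          Real.sin (2 * Real.pi * j / N * (s - s' : ℤ)) =
        Real.cos (2 * Real.pi * j / N * (s - s' + (i - i') : ℤ)) := by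
      intro j
      have e : (2 * Real.pi * j / N * ((s - s' + (i - i') : ℤ) : ℝ)) =
          2 * Real.pi * j / N * (s - s' : ℤ) +
            (2 * Real.pi * j / N * (i : ℤ) - 2 * Real.pi * j / N * (i' : ℤ)) := by
        push_cast; ring
      rw [e, Real.cos_add, Real.cos_sub, Real.sin_sub]
      ring
    rw [Finset.sum_congr rfl fun j _ => this j, key]
    by_cases h0 : s + i = s' + i'
    · rw [if_pos h0, if_pos (by omega)]
    · rw [if_neg h0, if_neg (by omega)]; simp
  · simp only [if_neg hs]
    rw [if_neg (by rw [abs_lt] at hs; omega)]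
    simp

/-- Parseval for the transform of length 2k of the sequence padded with zeros. -/
theorem sum_norm_dft_sq {k : ℕ} (hk : 0 < k) (v : ℕ → H) :
    ∑ j ∈ Finset.range (2 * k),
      (‖∑ i ∈ Finset.range k, Real.cos (2 * Real.pi * j / (2 * k : ℕ) * (i : ℤ)) • v i‖ ^ 2 +
        ‖∑ i ∈ Finset.range k, Real.sin (2 * Real.pi * j / (2 * k : ℕ) * (i : ℤ)) • v i‖ ^ 2) =
      (2 * k : ℕ) * ∑ i ∈ Finset.range k, ‖v i‖ ^ 2 := by
  have hN : 0 < 2 * k := by omega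
  set N := 2 * k with hNdef
  simp only [← real_inner_self_eq_norm_sq, sum_inner, inner_sum, real_inner_smul_left,
    real_inner_smul_right, ← Finset.sum_add_distrib]
  rw [Finset.sum_comm, Finset.mul_sum]
  refine Finset.sum_congr rfl fun i hi => ?_
  rw [Finset.sum_comm]
  have hi1 := Finset.mem_range.mp hi
  have : ∀ i' ∈ Finset.range k, ∑ j ∈ Finset.range N,
      (Real.cos (2 * Real.pi * j / N * (i : ℤ)) * (Real.cos (2 * Real.pi * j / N * (i' : ℤ)) *
        ⟪v i, v i'⟫_ℝ) + Real.sin (2 * Real.pi * j / N * (i : ℤ)) *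
        (Real.sin (2 * Real.pi * j / N * (i' : ℤ)) * ⟪v i, v i'⟫_ℝ)) =
      if i' = i then (N : ℝ) * ⟪v i, v i⟫_ℝ else 0 := by
    intro i' hi'
    have hi2 := Finset.mem_range.mp hi'
    have hlt : |(i' - i : ℤ)| < (N : ℤ) := by
      rw [abs_lt]; constructor <;> push_cast [hNdef] <;> omega
    have key := sum_cos_eq_ite hN hlt
    have e : ∀ j : ℕ, Real.cos (2 * Real.pi * j / N * (i : ℤ)) *
        (Real.cos (2 * Real.pi * j / N * (i' : ℤ)) *
        ⟪v i, v i'⟫_ℝ) + Real.sin (2 * Real.pi * j / N * (i : ℤ)) *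
        (Real.sin (2 * Real.pi * j / N * (i' : ℤ)) * ⟪v i, v i'⟫_ℝ) =
        Real.cos (2 * Real.pi * j / N * (i' - i : ℤ)) * ⟪v i, v i'⟫_ℝ := by
      intro j
      have e : (2 * Real.pi * j / N * ((i' - i : ℤ) : ℝ)) =
          2 * Real.pi * j / N * (i' : ℤ) - 2 * Real.pi * j / N * (i : ℤ) := by
        push_cast; ring
      rw [e, Real.cos_sub]; ring
    rw [Finset.sum_congr rfl fun j _ => e j, ← Finset.sum_mul, key]
    by_cases h0 : i' = i
    · subst h0; simp
    · rw [if_neg h0, if_neg (by omega), zero_mul]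
  simp only [real_inner_comm (v i)]
  rw [Finset.sum_congr rfl this]
  simp [hi1]

/-- A bound uniform over H^k from bounds for 2k forms on H. The two sine forms mix the cosine and
sine transforms of v, and 2‖v_c‖‖v_s‖ ≤ ‖v_c‖² + ‖v_s‖² brings them back to the Parseval sum. -/
theorem abs_toeplitzForm_le (I : Finset ℤ) {k : ℕ} (b : ℤ → ℤ → H →ₗ[ℝ] H →ₗ[ℝ] ℝ)
    {Z Z' : ℝ}
    (hc : ∀ j < 2 * k, ∀ u u', |bandForm I k b
      (fun h => Real.cos (2 * Real.pi * j / (2 * k : ℕ) * h)) u u'| ≤ Z * (‖u‖ * ‖u'‖))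
    (hs : ∀ j < 2 * k, ∀ u u', |bandForm I k b
      (fun h => Real.sin (2 * Real.pi * j / (2 * k : ℕ) * h)) u u'| ≤ Z' * (‖u‖ * ‖u'‖))
    (hZ' : 0 ≤ Z') (v : ℕ → H) :
    |toeplitzForm I k b v| ≤ (Z + Z') * ∑ i ∈ Finset.range k, ‖v i‖ ^ 2 := by
  rcases Nat.eq_zero_or_pos k with rfl | hk
  · simp [toeplitzForm]
  have hN : (0 : ℝ) < (2 * k : ℕ) := by exact_mod_cast (by omega : 0 < 2 * k)
  have h1 := toeplitzForm_eq I hk b v _ _ (fun j => rfl) (fun j => rfl)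
  have h2 := sum_norm_dft_sq hk v
  refine le_of_mul_le_mul_left ?_ hN
  rw [← abs_of_pos hN, ← abs_mul, abs_of_pos hN, h1, mul_left_comm, ← h2, Finset.mul_sum]
  refine (Finset.abs_sum_le_sum_abs _ _).trans (Finset.sum_le_sum fun j hj => ?_)
  have hj' := Finset.mem_range.mp hj
  set vc := ∑ i ∈ Finset.range k, Real.cos (2 * Real.pi * j / (2 * k : ℕ) * (i : ℤ)) • v i
  set vs := ∑ i ∈ Finset.range k, Real.sin (2 * Real.pi * j / (2 * k : ℕ) * (i : ℤ)) • v i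
  have a1 := abs_le.mp (hc j hj' vc vc)
  have a2 := abs_le.mp (hc j hj' vs vs)
  have a3 := abs_le.mp (hs j hj' vs vc)
  have a4 := abs_le.mp (hs j hj' vc vs)
  have a5 : Z' * (2 * (‖vc‖ * ‖vs‖)) ≤ Z' * (‖vc‖ ^ 2 + ‖vs‖ ^ 2) :=
    mul_le_mul_of_nonneg_left (by nlinarith [sq_nonneg (‖vc‖ - ‖vs‖)]) hZ'
  rw [abs_le]
  constructor <;> nlinarith

end Toeplitz

/-! ### Deviation of sample covariances of the noise -/

/-- Hölder against the constant 1 on a probability space. -/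
theorem lintegral_rpow_inv_le {Ω : Type*} [MeasurableSpace Ω] {μ : Measure Ω}
    [IsProbabilityMeasure μ] {f : Ω → ℝ≥0∞} (hf : AEMeasurable f μ) {p : ℝ} (hp : 1 < p) :
    ∫⁻ ω, f ω ^ (1 / p) ∂μ ≤ (∫⁻ ω, f ω ∂μ) ^ (1 / p) := by
  have hpq : p.HolderConjugate (Real.conjExponent p) := Real.HolderConjugate.conjExponent hp
  have h := ENNReal.lintegral_mul_le_Lp_mul_Lq μ hpq (hf.pow_const (1 / p))
    (aemeasurable_const (b := (1 : ℝ≥0∞)))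
  have h0 : p ≠ 0 := by linarith
  simpa [← ENNReal.rpow_mul, inv_mul_cancel₀ h0] using h

-- Operator norm and Hilbert–Schmidt norm

section HilbertSchmidt

variable {H : Type*} [NormedAddCommGroup H] [InnerProductSpace ℝ H] [CompleteSpace H]

/-- By Parseval ‖A* w‖² = Σ ⟨A e_i, w⟩² ≤ R‖w‖², where R is the sum of squares, and A inherits the
bound from A*. Extended norms allow an infinite sum, as is convenient for a random operator. -/
theorem enorm_apply_le_hilbertSchmidt (A : H →L[ℝ] H) (e : HilbertBasis ℕ ℝ H) (u : H) :
    ‖A u‖ₑ ≤ (∑' i, ‖A (e i)‖ₑ ^ 2) ^ (1 / 2 : ℝ) * ‖u‖ₑ := by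
  by_cases htop : ∑' i, ‖A (e i)‖ₑ ^ 2 = ∞
  · by_cases hu : u = 0
    · simp [hu]
    · rw [htop, ENNReal.top_rpow_of_pos (by norm_num), ENNReal.top_mul (by simpa using hu)]
      exact le_top
  have hsum : Summable fun i => ‖A (e i)‖ ^ 2 := by
    have := ENNReal.summable_toReal htop
    simpa using this
  have htot : ∑' i, ‖A (e i)‖ₑ ^ 2 = ENNReal.ofReal (∑' i, ‖A (e i)‖ ^ 2) := by
    rw [ENNReal.ofReal_tsum_of_nonneg (fun i => by positivity) hsum]
    refine tsum_congr fun i => ?_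
    rw [ENNReal.ofReal_pow (norm_nonneg _), ofReal_norm]
  set R := ∑' i, ‖A (e i)‖ ^ 2 with hR
  have hR0 : 0 ≤ R := tsum_nonneg fun i => by positivity
  have hadj : ∀ w : H, ‖ContinuousLinearMap.adjoint A w‖ ^ 2 ≤ R * ‖w‖ ^ 2 := fun w => by
    refine hasSum_le (fun i => ?_) (hasSum_inner_sq e _) (hsum.hasSum.mul_right _)
    rw [ContinuousLinearMap.adjoint_inner_right, ← mul_pow, ← sq_abs]
    exact pow_le_pow_left₀ (abs_nonneg _) (abs_real_inner_le_norm _ _) 2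
  have hreal : ‖A u‖ ≤ Real.sqrt R * ‖u‖ := by
    have h1 := hadj (A u)
    have h2 : ‖A u‖ ^ 2 ≤ ‖ContinuousLinearMap.adjoint A (A u)‖ * ‖u‖ := by
      rw [← real_inner_self_eq_norm_sq, ← ContinuousLinearMap.adjoint_inner_left]
      exact real_inner_le_norm _ _
    have h3 : ‖ContinuousLinearMap.adjoint A (A u)‖ ≤ Real.sqrt R * ‖A u‖ := by
      refine (abs_le_of_sq_le_sq' ?_ (by positivity)).2
      rw [mul_pow, Real.sq_sqrt hR0]; exact h1
    rcases eq_or_ne ‖A u‖ 0 with h0 | h0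
    · rw [h0]; positivity
    · have hp : 0 < ‖A u‖ := lt_of_le_of_ne (norm_nonneg _) (Ne.symm h0)
      refine le_of_mul_le_mul_left ?_ hp
      nlinarith [mul_le_mul_of_nonneg_right h3 (norm_nonneg u)]
  rw [htot, ← ofReal_norm, ← ofReal_norm, ENNReal.ofReal_rpow_of_nonneg hR0 (by norm_num),
    ← ENNReal.ofReal_mul (by positivity), ← Real.sqrt_eq_rpow]
  exact ENNReal.ofReal_le_ofReal hreal

end HilbertSchmidt

-- Sample covariance of independent noise

section Diagonal

variable {Ω H : Type*} [MeasurableSpace Ω] {μ : Measure Ω} [IsProbabilityMeasure μ]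
  [NormedAddCommGroup H] [InnerProductSpace ℝ H] [CompleteSpace H]
  [MeasurableSpace H] [BorelSpace H] [SecondCountableTopology H]

theorem integrable_inner_of_memLp {K : Type*} [NormedAddCommGroup K] [InnerProductSpace ℝ K]
    {f g : Ω → K} (hf : MemLp f 2 μ) (hg : MemLp g 2 μ) :
    Integrable (fun ω => ⟪f ω, g ω⟫_ℝ) μ := by
  refine ((hf.integrable_norm_pow (by norm_num)).add (hg.integrable_norm_pow (by norm_num))).mono
    (hf.1.inner hg.1) (ae_of_all _ fun ω => ?_)
  refine (abs_real_inner_le_norm _ _).trans (le_trans ?_ (le_abs_self _))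
  change ‖f ω‖ * ‖g ω‖ ≤ ‖f ω‖ ^ 2 + ‖g ω‖ ^ 2
  nlinarith [sq_nonneg (‖f ω‖ - ‖g ω‖), sq_nonneg ‖f ω‖, sq_nonneg ‖g ω‖]

theorem integral_norm_sum_sq_of_orthogonal (I : Finset ℤ) (ξ : ℤ → Ω → H)
    (hξ : ∀ s ∈ I, MemLp (ξ s) 2 μ)
    (h0 : ∀ s ∈ I, ∀ t ∈ I, s ≠ t → ∫ ω, ⟪ξ s ω, ξ t ω⟫_ℝ ∂μ = 0) :
    ∫ ω, ‖∑ s ∈ I, ξ s ω‖ ^ 2 ∂μ = ∑ s ∈ I, ∫ ω, ‖ξ s ω‖ ^ 2 ∂μ := by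
  have hi : ∀ s ∈ I, ∀ t ∈ I, Integrable (fun ω => ⟪ξ s ω, ξ t ω⟫_ℝ) μ := fun s hs t ht =>
    integrable_inner_of_memLp (hξ s hs) (hξ t ht)
  have : ∀ ω, ‖∑ s ∈ I, ξ s ω‖ ^ 2 = ∑ s ∈ I, ∑ t ∈ I, ⟪ξ s ω, ξ t ω⟫_ℝ := fun ω => by
    rw [← real_inner_self_eq_norm_sq, sum_inner]
    exact Finset.sum_congr rfl fun s _ => inner_sum _ _ _
  simp only [this]
  rw [integral_finsetSum _ fun s hs => integrable_finsetSum _ fun t ht => hi s hs t ht]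
  refine Finset.sum_congr rfl fun s hs => ?_
  rw [integral_finsetSum _ fun t ht => hi s hs t ht, Finset.sum_eq_single s]
  · simp only [real_inner_self_eq_norm_sq]
  · exact fun t ht hts => h0 s hs t ht hts.symm
  · exact fun h => absurd hs h

/-- The covariance operator of the noise. -/
noncomputable def noiseCov (μ : Measure Ω) (ε : ℤ → Ω → H) : H →L[ℝ] H :=
  ∫ ω, tensor (ε 0 ω) (ε 0 ω) ∂μ

/-- The deviation, in Hilbert–Schmidt norm, of the sum of `ε s ⊗ ε s` from its mean. -/
noncomputable def diagDev (μ : Measure Ω) (ε : ℤ → Ω → H) (e : HilbertBasis ℕ ℝ H) (I : Finset ℤ)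
    (ω : Ω) : ℝ≥0∞ :=
  (∑' i, ‖∑ s ∈ I, (⟪ε s ω, e i⟫_ℝ • ε s ω - noiseCov μ ε (e i))‖ₑ ^ 2) ^ (1 / 2 : ℝ)

theorem continuous_tensor {E F : Type*} [NormedAddCommGroup E] [InnerProductSpace ℝ E]
    [NormedAddCommGroup F] [InnerProductSpace ℝ F] :
    Continuous fun p : E × F => tensor p.1 p.2 := by
  have : Continuous fun p : E × F =>
      ContinuousLinearMap.smulRightL ℝ E F (innerSL ℝ p.1) p.2 := by fun_prop
  exact this

theorem norm_tensor {E F : Type*} [NormedAddCommGroup E] [InnerProductSpace ℝ E]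
    [NormedAddCommGroup F] [InnerProductSpace ℝ F] (x : E) (y : F) :
    ‖tensor x y‖ = ‖x‖ * ‖y‖ := by
  rw [tensor, InnerProductSpace.norm_rankOne, mul_comm]

namespace IsNoise

variable {ε : ℤ → Ω → H}

theorem memLp_two (hε : IsNoise μ ε) (j : ℤ) : MemLp (ε j) 2 μ :=
  (hε.memLp' j).mono_exponent (by norm_num)

theorem noiseCov_apply (hε : IsNoise μ ε) (u : H) :
    noiseCov μ ε u = ∫ ω, ⟪ε 0 ω, u⟫_ℝ • ε 0 ω ∂μ := by
  have hi : Integrable (fun ω => tensor (ε 0 ω) (ε 0 ω)) μ := by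
    refine ((hε.memLp_two 0).integrable_norm_pow (by norm_num)).mono
      ((continuous_tensor.comp_aestronglyMeasurable₂ (hε.meas 0).aestronglyMeasurable
        (hε.meas 0).aestronglyMeasurable)) (ae_of_all _ fun ω => ?_)
    rw [norm_tensor, Real.norm_of_nonneg (by positivity), pow_two]
  rw [noiseCov, ContinuousLinearMap.integral_apply hi]
  rfl

theorem memLp_smul (hε : IsNoise μ ε) (j : ℤ) (u : H) :
    MemLp (fun ω => ⟪ε j ω, u⟫_ℝ • ε j ω) 2 μ := by
  have hm : AEStronglyMeasurable (fun ω => ⟪ε j ω, u⟫_ℝ • ε j ω) μ :=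
    (((hε.meas j).inner_const).smul (hε.meas j)).aestronglyMeasurable
  rw [memLp_two_iff_integrable_sq_norm hm]
  refine ((hε.integrable_norm_pow j).const_mul (‖u‖ ^ 2)).mono (hm.norm.pow 2)
    (ae_of_all _ fun ω => ?_)
  rw [Real.norm_of_nonneg (by positivity), Real.norm_of_nonneg (by positivity), norm_smul, mul_pow]
  have h1 := abs_real_inner_le_norm (ε j ω) u
  have : ‖⟪ε j ω, u⟫_ℝ‖ ^ 2 ≤ (‖ε j ω‖ * ‖u‖) ^ 2 := pow_le_pow_left₀ (norm_nonneg _) h1 2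
  nlinarith [sq_nonneg (‖ε j ω‖), mul_le_mul_of_nonneg_right this (sq_nonneg ‖ε j ω‖)]

theorem integral_smul (hε : IsNoise μ ε) (j : ℤ) (u : H) :
    ∫ ω, ⟪ε j ω, u⟫_ℝ • ε j ω ∂μ = noiseCov μ ε u := by
  rw [hε.noiseCov_apply]
  exact ((hε.ident j).comp (u := fun x : H => ⟪x, u⟫_ℝ • x)
    ((measurable_id.inner_const).smul measurable_id)).integral_eq

/-- Independent centred summands are orthogonal in L², and centring does not increase the second
moment. -/
theorem integral_norm_sum_sub_sq_le (hε : IsNoise μ ε) (I : Finset ℤ) (u : H) :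
    ∫⁻ ω, ‖∑ s ∈ I, (⟪ε s ω, u⟫_ℝ • ε s ω - noiseCov μ ε u)‖ₑ ^ 2 ∂μ ≤
      I.card * ∫⁻ ω, ‖⟪ε 0 ω, u⟫_ℝ‖ₑ ^ 2 * ‖ε 0 ω‖ₑ ^ 2 ∂μ := by
  set ξ : ℤ → Ω → H := fun s ω => ⟪ε s ω, u⟫_ℝ • ε s ω - noiseCov μ ε u with hξ
  have hL : ∀ s, MemLp (ξ s) 2 μ := fun s => (hε.memLp_smul s u).sub (memLp_const _)
  have hφ : Measurable (fun x : H => ⟪x, u⟫_ℝ • x - noiseCov μ ε u) :=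
    ((measurable_id.inner_const).smul measurable_id).sub_const _
  have hmean : ∀ s, ∫ ω, ξ s ω ∂μ = 0 := fun s => by
    rw [hξ]
    simp only
    rw [integral_sub ((hε.memLp_smul s u).integrable (by norm_num)) (integrable_const _),
      hε.integral_smul]
    simp
  have h0 : ∀ s ∈ I, ∀ t ∈ I, s ≠ t → ∫ ω, ⟪ξ s ω, ξ t ω⟫_ℝ ∂μ = 0 := fun s _ t _ hst => by
    have hind : IndepFun (ξ s) (ξ t) μ := (hε.indep.indepFun hst).comp hφ hφ
    have := hind.integral_bilin ((hL s).integrable (by norm_num))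
      ((hL t).integrable (by norm_num)) (innerSL ℝ)
    rw [hmean, map_zero] at this
    exact this
  have hsum := integral_norm_sum_sq_of_orthogonal I ξ (fun s _ => hL s) h0
  have hSL : MemLp (fun ω => ∑ s ∈ I, ξ s ω) 2 μ := memLp_finsetSum _ fun s _ => hL s
  have e1 : ∀ f : Ω → H, MemLp f 2 μ → ∫⁻ ω, ‖f ω‖ₑ ^ 2 ∂μ = ENNReal.ofReal (∫ ω, ‖f ω‖ ^ 2 ∂μ) := by
    intro f hf
    rw [ofReal_integral_eq_lintegral_ofReal (hf.integrable_norm_pow (by norm_num))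
      (ae_of_all _ fun ω => by positivity)]
    refine lintegral_congr fun ω => ?_
    rw [ENNReal.ofReal_pow (norm_nonneg _), ofReal_norm]
  have hle : ∀ s, ∫ ω, ‖ξ s ω‖ ^ 2 ∂μ ≤ ∫ ω, ‖⟪ε 0 ω, u⟫_ℝ • ε 0 ω‖ ^ 2 ∂μ := fun s => by
    have e2 : ∀ ω, ‖ξ s ω‖ ^ 2 = ‖⟪ε s ω, u⟫_ℝ • ε s ω‖ ^ 2 -
        2 * ⟪⟪ε s ω, u⟫_ℝ • ε s ω, noiseCov μ ε u⟫_ℝ + ‖noiseCov μ ε u‖ ^ 2 := fun ω =>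
      norm_sub_sq_real _ _
    have i1 := (hε.memLp_smul s u).integrable_norm_pow (by norm_num)
    have i2 : Integrable (fun ω => ⟪⟪ε s ω, u⟫_ℝ • ε s ω, noiseCov μ ε u⟫_ℝ) μ :=
      ((hε.memLp_smul s u).integrable (by norm_num)).inner_const _
    have i3 : ∫ ω, ⟪⟪ε s ω, u⟫_ℝ • ε s ω, noiseCov μ ε u⟫_ℝ ∂μ = ‖noiseCov μ ε u‖ ^ 2 := by
      have h1 : ∀ ω, ⟪⟪ε s ω, u⟫_ℝ • ε s ω, noiseCov μ ε u⟫_ℝ =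
        ⟪noiseCov μ ε u, ⟪ε s ω, u⟫_ℝ • ε s ω⟫_ℝ := fun ω => real_inner_comm _ _
      simp only [h1]
      rw [integral_inner ((hε.memLp_smul s u).integrable (by norm_num)), hε.integral_smul,
        real_inner_self_eq_norm_sq]
    have i4 : ∫ ω, ‖⟪ε s ω, u⟫_ℝ • ε s ω‖ ^ 2 ∂μ = ∫ ω, ‖⟪ε 0 ω, u⟫_ℝ • ε 0 ω‖ ^ 2 ∂μ :=
      ((hε.ident s).comp (u := fun x : H => ‖⟪x, u⟫_ℝ • x‖ ^ 2)
        (((measurable_id.inner_const).smul measurable_id).norm.pow_const 2)).integral_eq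
    have i5 : Integrable (fun ω => ‖⟪ε s ω, u⟫_ℝ • ε s ω‖ ^ 2 -
        2 * ⟪⟪ε s ω, u⟫_ℝ • ε s ω, noiseCov μ ε u⟫_ℝ) μ := i1.sub (i2.const_mul 2)
    simp only [e2]
    rw [integral_add i5 (integrable_const _), integral_sub i1 (i2.const_mul 2),
      integral_const_mul, i3, i4]
    simp
    nlinarith [sq_nonneg ‖noiseCov μ ε u‖]
  have e3 : ∫⁻ ω, ‖⟪ε 0 ω, u⟫_ℝ‖ₑ ^ 2 * ‖ε 0 ω‖ₑ ^ 2 ∂μ =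
      ENNReal.ofReal (∫ ω, ‖⟪ε 0 ω, u⟫_ℝ • ε 0 ω‖ ^ 2 ∂μ) := by
    rw [← e1 _ (hε.memLp_smul 0 u)]
    simp only [enorm_smul, mul_pow]
  rw [e1 _ hSL, hsum, e3, ← ENNReal.ofReal_natCast, ← ENNReal.ofReal_mul (by positivity)]
  refine ENNReal.ofReal_le_ofReal ?_
  rw [← nsmul_eq_mul]
  exact Finset.sum_le_card_nsmul _ _ _ fun s _ => hle s

theorem measurable_diagDev (hε : IsNoise μ ε) (e : HilbertBasis ℕ ℝ H) (I : Finset ℤ) :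
    Measurable (diagDev μ ε e I) := by
  refine Measurable.pow_const (Measurable.tsum fun i => ?_) _
  refine Measurable.pow_const (Measurable.enorm (Finset.measurable_fun_sum _ fun s _ => ?_)) _
  exact (((hε.meas s).inner_const).smul (hε.meas s)).sub_const _

/-- After Jensen for the square root, the second moments are summed over the basis; Parseval turns
Σ_i ⟨ε, e_i⟩²‖ε‖² into ‖ε‖⁴. -/
theorem lintegral_diagDev_le (hε : IsNoise μ ε) (e : HilbertBasis ℕ ℝ H) (I : Finset ℤ) :
    ∫⁻ ω, diagDev μ ε e I ω ∂μ ≤ (I.card * ∫⁻ ω, ‖ε 0 ω‖ₑ ^ 4 ∂μ) ^ (1 / 2 : ℝ) := by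
  have hm : ∀ i, Measurable fun ω =>
      ‖∑ s ∈ I, (⟪ε s ω, e i⟫_ℝ • ε s ω - noiseCov μ ε (e i))‖ₑ ^ 2 := fun i =>
    Measurable.pow_const (Measurable.enorm (Finset.measurable_fun_sum _ fun s _ =>
      (((hε.meas s).inner_const).smul (hε.meas s)).sub_const _)) _
  refine (lintegral_rpow_inv_le (Measurable.tsum hm).aemeasurable (by norm_num)).trans ?_
  gcongr
  rw [lintegral_tsum fun i => (hm i).aemeasurable]
  refine (ENNReal.tsum_le_tsum fun i => hε.integral_norm_sum_sub_sq_le I (e i)).trans ?_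
  rw [ENNReal.tsum_mul_left]
  gcongr
  have hm2 : ∀ i, Measurable fun ω => ‖⟪ε 0 ω, e i⟫_ℝ‖ₑ ^ 2 * ‖ε 0 ω‖ₑ ^ 2 := fun i =>
    (((hε.meas 0).inner_const).enorm.pow_const 2).mul ((hε.meas 0).enorm.pow_const 2)
  rw [← lintegral_tsum fun i => (hm2 i).aemeasurable]
  refine lintegral_mono fun ω => ?_
  rw [ENNReal.tsum_mul_right]
  have h := hasSum_inner_sq e (ε 0 ω)
  have : ∑' i, ‖⟪ε 0 ω, e i⟫_ℝ‖ₑ ^ 2 = ‖ε 0 ω‖ₑ ^ 2 := by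
    rw [← ofReal_norm, ← ENNReal.ofReal_pow (norm_nonneg _), ← h.tsum_eq,
      ENNReal.ofReal_tsum_of_nonneg (fun i => sq_nonneg _) h.summable]
    refine tsum_congr fun i => ?_
    rw [← sq_abs, ENNReal.ofReal_pow (abs_nonneg _), ← Real.norm_eq_abs, ofReal_norm,
      real_inner_comm]
  rw [this, ← pow_add]

theorem abs_sum_inner_sub_le (e : HilbertBasis ℕ ℝ H) (I : Finset ℤ) (ω : Ω)
    (h : diagDev μ ε e I ω ≠ ∞) (u v : H) :
    |∑ s ∈ I, ⟪ε s ω, u⟫_ℝ * ⟪ε s ω, v⟫_ℝ - I.card * ⟪noiseCov μ ε u, v⟫_ℝ| ≤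
      (diagDev μ ε e I ω).toReal * (‖u‖ * ‖v‖) := by
  set A : H →L[ℝ] H := ∑ s ∈ I, (tensor (ε s ω) (ε s ω) - noiseCov μ ε) with hA
  have hAe : ∀ u, A u = ∑ s ∈ I, (⟪ε s ω, u⟫_ℝ • ε s ω - noiseCov μ ε u) := fun u => by
    simp [hA, tensor_apply]
  have h1 := enorm_apply_le_hilbertSchmidt A e u
  simp only [hAe (e _)] at h1
  change ‖A u‖ₑ ≤ diagDev μ ε e I ω * ‖u‖ₑ at h1
  have h2 : ‖A u‖ ≤ (diagDev μ ε e I ω).toReal * ‖u‖ := by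
    have := ENNReal.toReal_mono (ENNReal.mul_ne_top h (by simp)) h1
    simpa using this
  have h3 : ∑ s ∈ I, ⟪ε s ω, u⟫_ℝ * ⟪ε s ω, v⟫_ℝ - I.card * ⟪noiseCov μ ε u, v⟫_ℝ = ⟪A u, v⟫_ℝ := by
    rw [hAe, sum_inner]
    simp [inner_sub_left, real_inner_smul_left]
  rw [h3, ← mul_assoc]
  exact (abs_real_inner_le_norm _ _).trans (by gcongr)

end IsNoise

end Diagonal

/-! ### Deviation of Toeplitz forms of a linear process -/

section OffDiagonal

variable {Ω H : Type*} [MeasurableSpace Ω] {μ : Measure Ω} [IsProbabilityMeasure μ]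
  [NormedAddCommGroup H] [InnerProductSpace ℝ H] [CompleteSpace H]
  [MeasurableSpace H] [BorelSpace H] [SecondCountableTopology H]

/-- The index set `I` shifted to the left by `m`. -/
def shift (I : Finset ℤ) (m : ℕ) : Finset ℤ := I.map (Equiv.subRight (m : ℤ)).toEmbedding

theorem card_shift (I : Finset ℤ) (m : ℕ) : (shift I m).card = I.card := Finset.card_map _

theorem sum_shift {M : Type*} [AddCommMonoid M] (I : Finset ℤ) (m : ℕ) (f : ℤ → M) :
    ∑ p ∈ shift I m, f p = ∑ s ∈ I, f (s - m) := by
  simp [shift, Finset.sum_map]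

/-- The indices before `q` that interact with `q`. -/
def bandIndex (I : Finset ℤ) (k m m' : ℕ) (q : ℤ) : Finset ℤ :=
  (shift I m).filter fun p => p < q ∧ |p + m - (q + m')| < k

theorem card_bandIndex_le (I : Finset ℤ) (k m m' : ℕ) (q : ℤ) :
    (bandIndex I k m m' q).card ≤ 2 * k := by
  have : bandIndex I k m m' q ⊆ Finset.Ioo (q + m' - m - k) (q + m' - m + k) := fun p hp => by
    have := (Finset.mem_filter.mp hp).2.2
    rw [abs_lt] at this
    rw [Finset.mem_Ioo]; omega
  refine (Finset.card_le_card this).trans ?_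
  rw [Int.card_Ioo]
  omega

/-- The part above the diagonal of a band quadratic form in the noise. -/
noncomputable def offForm (ε : ℤ → Ω → H) (I : Finset ℤ) (k : ℕ) (g : ℤ → ℝ) (m m' : ℕ) (ω : Ω) :
    H ⊗[ℝ] H :=
  ∑ q ∈ shift I m', (∑ p ∈ bandIndex I k m m' q, g (p + m - (q + m')) • ε p ω) ⊗ₜ[ℝ] ε q ω

/-- The double sum is split by the order of the two noise indices. The parts above and below the
diagonal are pairings with elements of H ⊗ H that do not depend on a and b, so Cauchy–Schwarz gives
bounds uniform in a and b. -/
theorem bandSum_eq (ε : ℤ → Ω → H) (I : Finset ℤ) (k : ℕ) (g : ℤ → ℝ) (m m' : ℕ) (ω : Ω)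
    (a b : H) :
    ∑ s ∈ I, ∑ s' ∈ I, (if |s - s'| < k then g (s - s') else 0) *
      (⟪ε (s - m) ω, a⟫_ℝ * ⟪ε (s' - m') ω, b⟫_ℝ) =
    ⟪offForm ε I k g m m' ω, a ⊗ₜ[ℝ] b⟫_ℝ + ⟪offForm ε I k (fun h => g (-h)) m' m ω, b ⊗ₜ[ℝ] a⟫_ℝ +
      (if |(m - m' : ℤ)| < k then g (m - m') else 0) *
        ∑ p ∈ shift I m ∩ shift I m', ⟪ε p ω, a⟫_ℝ * ⟪ε p ω, b⟫_ℝ := by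
  set G : ℤ → ℤ → ℝ := fun p q => (if |p + m - (q + m')| < k then g (p + m - (q + m')) else 0) *
    (⟪ε p ω, a⟫_ℝ * ⟪ε q ω, b⟫_ℝ) with hG
  have h1 : ∑ s ∈ I, ∑ s' ∈ I, (if |s - s'| < k then g (s - s') else 0) *
      (⟪ε (s - m) ω, a⟫_ℝ * ⟪ε (s' - m') ω, b⟫_ℝ) =
      ∑ p ∈ shift I m, ∑ q ∈ shift I m', G p q := by
    rw [sum_shift]
    refine Finset.sum_congr rfl fun s _ => ?_
    rw [sum_shift]
    refine Finset.sum_congr rfl fun s' _ => ?_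
    simp [hG]
  have h2 : ⟪offForm ε I k g m m' ω, a ⊗ₜ[ℝ] b⟫_ℝ =
      ∑ p ∈ shift I m, ∑ q ∈ shift I m', if p < q then G p q else 0 := by
    rw [offForm, sum_inner, Finset.sum_comm]
    refine Finset.sum_congr rfl fun q _ => ?_
    rw [TensorProduct.inner_tmul, sum_inner, Finset.sum_mul, bandIndex, Finset.sum_filter]
    refine Finset.sum_congr rfl fun p _ => ?_
    rw [real_inner_smul_left, hG]
    by_cases c1 : p < q <;> by_cases c2 : |p + m - (q + m')| < (k : ℤ) <;> simp [c1, c2]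
    ring
  have h3 : ⟪offForm ε I k (fun h => g (-h)) m' m ω, b ⊗ₜ[ℝ] a⟫_ℝ =
      ∑ p ∈ shift I m, ∑ q ∈ shift I m', if q < p then G p q else 0 := by
    rw [offForm, sum_inner]
    refine Finset.sum_congr rfl fun p _ => ?_
    rw [TensorProduct.inner_tmul, sum_inner, Finset.sum_mul, bandIndex, Finset.sum_filter]
    refine Finset.sum_congr rfl fun q _ => ?_
    rw [real_inner_smul_left, hG]
    have e : |q + m' - (p + m)| = |p + m - (q + m')| := abs_sub_comm _ _
    rw [e, neg_sub]
    by_cases c1 : q < p <;> by_cases c2 : |p + m - (q + m')| < (k : ℤ) <;> simp [c1, c2]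
    ring
  have h4 : (if |(m - m' : ℤ)| < k then g (m - m') else 0) *
        ∑ p ∈ shift I m ∩ shift I m', ⟪ε p ω, a⟫_ℝ * ⟪ε p ω, b⟫_ℝ =
      ∑ p ∈ shift I m, ∑ q ∈ shift I m', if p = q then G p q else 0 := by
    rw [Finset.mul_sum, ← Finset.filter_mem_eq_inter, Finset.sum_filter]
    refine Finset.sum_congr rfl fun p _ => ?_
    rw [Finset.sum_ite_eq]
    refine if_congr Iff.rfl ?_ rfl
    simp [hG]
  rw [h1, h2, h3, h4, ← Finset.sum_add_distrib, ← Finset.sum_add_distrib]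
  refine Finset.sum_congr rfl fun p _ => ?_
  rw [← Finset.sum_add_distrib, ← Finset.sum_add_distrib]
  refine Finset.sum_congr rfl fun q _ => ?_
  rcases lt_trichotomy p q with h | h | h
  · simp [h, h.ne, not_lt.mpr h.le]
  · simp [h]
  · simp [h, h.ne', not_lt.mpr h.le]

/-- The counterpart of `bandSum_eq` for expectations: different noise variables are uncorrelated, so
only coinciding indices contribute. -/
theorem bandCount_eq (I : Finset ℤ) (k : ℕ) (g : ℤ → ℝ) (m m' : ℕ) (c : ℝ) :
    ∑ s ∈ I, ∑ s' ∈ I, (if |s - s'| < k then g (s - s') else 0) *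
      (if s - m = s' - m' then c else 0) =
      (if |(m - m' : ℤ)| < k then g (m - m') else 0) * ((shift I m ∩ shift I m').card * c) := by
  have h1 : ∑ s ∈ I, ∑ s' ∈ I, (if |s - s'| < k then g (s - s') else 0) *
      (if s - m = s' - m' then c else 0) =
      ∑ p ∈ shift I m, ∑ q ∈ shift I m', if p = q then
        (if |(m - m' : ℤ)| < k then g (m - m') else 0) * c else 0 := by
    rw [sum_shift]
    refine Finset.sum_congr rfl fun s _ => ?_
    rw [sum_shift]
    refine Finset.sum_congr rfl fun s' _ => ?_
    by_cases h : s - m = s' - (m' : ℤ)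
    · have e : s - s' = m - m' := by omega
      simp [h, e]
    · simp [h]
  rw [h1, ← nsmul_eq_mul, mul_smul_comm, ← Finset.sum_const, ← Finset.filter_mem_eq_inter,
    Finset.sum_filter]
  refine Finset.sum_congr rfl fun p _ => ?_
  rw [Finset.sum_ite_eq]

variable {ε : ℤ → Ω → H}

theorem IsNoise.aestronglyMeasurable_offForm (hε : IsNoise μ ε) (I : Finset ℤ) (k : ℕ)
    (g : ℤ → ℝ) (m m' : ℕ) : AEStronglyMeasurable (offForm ε I k g m m') μ := by
  refine Finset.aestronglyMeasurable_fun_sum _ fun q _ => ?_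
  refine Continuous.comp_aestronglyMeasurable₂ (g := fun x y => x ⊗ₜ[ℝ] y)
      TensorProduct.continuous_tmul (Measurable.aestronglyMeasurable ?_)
        (hε.meas q).aestronglyMeasurable
  exact Finset.measurable_fun_sum _ fun p _ => (hε.meas p).const_smul _

theorem IsNoise.lintegral_offForm_le (hε : IsNoise μ ε) (I : Finset ℤ) (k : ℕ)
    {g : ℤ → ℝ} (hg : ∀ h, |g h| ≤ 1) (m m' : ℕ) :
    ∫⁻ ω, ‖offForm ε I k g m m' ω‖ₑ ^ 4 ∂μ ≤
      ENNReal.ofReal (16 * (I.card : ℝ) ^ 2 * (16 * ((2 * k : ℕ) : ℝ) ^ 2 *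
        (∫ ω, ‖ε 0 ω‖ ^ 4 ∂μ) ^ 2)) := by
  obtain ⟨h1, h2⟩ := hε.integral_norm_sum_tmul_pow_four_le (shift I m') (bandIndex I k m m')
    (fun q _ p hp => (Finset.mem_filter.mp hp).2.1) (fun q p => g (p + m - (q + m')))
    (fun q p => hg _) (fun q _ => card_bandIndex_le I k m m' q)
  rw [card_shift] at h2
  refine le_trans (le_of_eq ?_) (ENNReal.ofReal_le_ofReal h2)
  rw [ofReal_integral_eq_lintegral_ofReal h1 (ae_of_all _ fun ω => by positivity)]
  refine lintegral_congr fun ω => ?_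
  rw [ENNReal.ofReal_pow (norm_nonneg _), ofReal_norm, offForm]

/-- The frequencies `2 π j / (2 k)`. -/
noncomputable def cosFreq (k j : ℕ) (h : ℤ) : ℝ := Real.cos (2 * Real.pi * j / (2 * k : ℕ) * h)

/-- The frequencies `2 π j / (2 k)`. -/
noncomputable def sinFreq (k j : ℕ) (h : ℤ) : ℝ := Real.sin (2 * Real.pi * j / (2 * k : ℕ) * h)

/-- A bound for all band forms over the grid of frequencies. -/
noncomputable def offDev (ε : ℤ → Ω → H) (I : Finset ℤ) (k m m' : ℕ) (ω : Ω) : ℝ≥0∞ :=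
  (∑ j ∈ Finset.range (2 * k), (‖offForm ε I k (cosFreq k j) m m' ω‖ₑ ^ 4 +
    ‖offForm ε I k (fun h => cosFreq k j (-h)) m' m ω‖ₑ ^ 4 +
    ‖offForm ε I k (sinFreq k j) m m' ω‖ₑ ^ 4 +
    ‖offForm ε I k (fun h => sinFreq k j (-h)) m' m ω‖ₑ ^ 4)) ^ (1 / 4 : ℝ)

theorem IsNoise.aemeasurable_offDev (hε : IsNoise μ ε) (I : Finset ℤ) (k m m' : ℕ) :
    AEMeasurable (offDev ε I k m m') μ := by
  have h := fun g m m' => (hε.aestronglyMeasurable_offForm I k g m m').enorm.pow_const 4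
  exact (Finset.aemeasurable_fun_sum _ fun j _ =>
    (((h _ _ _).add (h _ _ _)).add (h _ _ _)).add (h _ _ _)).pow_const _

/-- Each form has fourth moment of order N²k², because an index interacts with at most 2k earlier
ones. The sum over 2k frequencies replaces a maximum and raises this to N²k³, and the fourth root
gives √N k^{3/4}. -/
theorem IsNoise.lintegral_offDev_le (hε : IsNoise μ ε) (I : Finset ℤ) (k m m' : ℕ) :
    ∫⁻ ω, offDev ε I k m m' ω ∂μ ≤ ENNReal.ofReal (10 * Real.sqrt (∫ ω, ‖ε 0 ω‖ ^ 4 ∂μ) *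
      Real.sqrt I.card * (k : ℝ) ^ (3 / 4 : ℝ)) := by
  have h := fun g m m' => (hε.aestronglyMeasurable_offForm I k g m m').enorm.pow_const 4
  set M := ∫ ω, ‖ε 0 ω‖ ^ 4 ∂μ with hM
  have hM0 : 0 ≤ M := integral_nonneg fun ω => by positivity
  set Q := ENNReal.ofReal (16 * (I.card : ℝ) ^ 2 * (16 * ((2 * k : ℕ) : ℝ) ^ 2 * M ^ 2)) with hQ
  refine (lintegral_rpow_inv_le (Finset.aemeasurable_fun_sum _ fun j _ =>
    (((h _ _ _).add (h _ _ _)).add (h _ _ _)).add (h _ _ _)) (by norm_num)).trans ?_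
  -- 8192 = 2 · 4 · 16 · 16 · 4: the 2k frequencies, four forms for each, the two fourth moment
  -- constants, and the square of 2k. The final constant 10 works because 10⁴ exceeds it.
  have hb : ∫⁻ ω, ∑ j ∈ Finset.range (2 * k), (‖offForm ε I k (cosFreq k j) m m' ω‖ₑ ^ 4 +
    ‖offForm ε I k (fun h => cosFreq k j (-h)) m' m ω‖ₑ ^ 4 +
    ‖offForm ε I k (sinFreq k j) m m' ω‖ₑ ^ 4 +
    ‖offForm ε I k (fun h => sinFreq k j (-h)) m' m ω‖ₑ ^ 4) ∂μ ≤
      ENNReal.ofReal (8192 * (k : ℝ) ^ 3 * (I.card : ℝ) ^ 2 * M ^ 2) := by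
    have hj : ∀ j, AEMeasurable (fun ω => ‖offForm ε I k (cosFreq k j) m m' ω‖ₑ ^ 4 +
        ‖offForm ε I k (fun h => cosFreq k j (-h)) m' m ω‖ₑ ^ 4 +
        ‖offForm ε I k (sinFreq k j) m m' ω‖ₑ ^ 4 +
        ‖offForm ε I k (fun h => sinFreq k j (-h)) m' m ω‖ₑ ^ 4) μ := fun j =>
      (((h _ _ _).add (h _ _ _)).add (h _ _ _)).add (h _ _ _)
    rw [lintegral_finsetSum' _ fun j _ => hj j]
    have : ∀ j ∈ Finset.range (2 * k), ∫⁻ ω, (‖offForm ε I k (cosFreq k j) m m' ω‖ₑ ^ 4 +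
        ‖offForm ε I k (fun h => cosFreq k j (-h)) m' m ω‖ₑ ^ 4 +
        ‖offForm ε I k (sinFreq k j) m m' ω‖ₑ ^ 4 +
        ‖offForm ε I k (fun h => sinFreq k j (-h)) m' m ω‖ₑ ^ 4) ∂μ ≤ Q + Q + Q + Q := by
      intro j _
      rw [lintegral_add_right' _ (h _ _ _), lintegral_add_right' _ (h _ _ _),
        lintegral_add_right' _ (h _ _ _)]
      gcongr
      · exact hε.lintegral_offForm_le I k (fun _ => Real.abs_cos_le_one _) m m'
      · exact hε.lintegral_offForm_le I k (fun _ => Real.abs_cos_le_one _) m' m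
      · exact hε.lintegral_offForm_le I k (fun _ => Real.abs_sin_le_one _) m m'
      · exact hε.lintegral_offForm_le I k (fun _ => Real.abs_sin_le_one _) m' m
    refine (Finset.sum_le_card_nsmul _ _ _ this).trans (le_of_eq ?_)
    rw [Finset.card_range, nsmul_eq_mul, hQ, ← ENNReal.ofReal_add (by positivity) (by positivity),
      ← ENNReal.ofReal_add (by positivity) (by positivity),
      ← ENNReal.ofReal_add (by positivity) (by positivity), ← ENNReal.ofReal_natCast,
      ← ENNReal.ofReal_mul (by positivity)]
    congr 1
    push_cast; ring
  refine (ENNReal.rpow_le_rpow hb (by norm_num)).trans ?_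
  rw [ENNReal.ofReal_rpow_of_nonneg (by positivity) (by norm_num)]
  refine ENNReal.ofReal_le_ofReal ?_
  have e : (10 * Real.sqrt M * Real.sqrt I.card * (k : ℝ) ^ (3 / 4 : ℝ)) =
      ((10 * Real.sqrt M * Real.sqrt I.card * (k : ℝ) ^ (3 / 4 : ℝ)) ^ 4) ^ (1 / 4 : ℝ) := by
    rw [← Real.rpow_natCast, ← Real.rpow_mul (by positivity)]; norm_num
  rw [e]
  refine Real.rpow_le_rpow (by positivity) ?_ (by norm_num)
  have e1 : Real.sqrt M ^ 4 = M ^ 2 := by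
    rw [show (4 : ℕ) = 2 * 2 by norm_num, pow_mul, Real.sq_sqrt hM0]
  have e2 : Real.sqrt I.card ^ 4 = (I.card : ℝ) ^ 2 := by
    rw [show (4 : ℕ) = 2 * 2 by norm_num, pow_mul, Real.sq_sqrt (by positivity)]
  have e3 : ((k : ℝ) ^ (3 / 4 : ℝ)) ^ 4 = (k : ℝ) ^ 3 := by
    rw [← Real.rpow_natCast, ← Real.rpow_mul (by positivity), ← Real.rpow_natCast]; norm_num
  rw [mul_pow, mul_pow, mul_pow, e1, e2, e3]
  have : 0 ≤ (k : ℝ) ^ 3 * (I.card : ℝ) ^ 2 * M ^ 2 := by positivity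
  nlinarith

/-- A bound for the deviation of Toeplitz forms of a linear process from their mean. -/
noncomputable def toepDev (μ : Measure Ω) (ε : ℤ → Ω → H) (ψ : ℕ → H →L[ℝ] H)
    (e : HilbertBasis ℕ ℝ H) (I : Finset ℤ) (k : ℕ) (ω : Ω) : ℝ≥0∞ :=
  ∑' m, ∑' m', ‖ψ m‖ₑ * ‖ψ m'‖ₑ *
    (2 * offDev ε I k m m' ω + diagDev μ ε e (shift I m ∩ shift I m') ω)

theorem IsNoise.aemeasurable_toepDev (hε : IsNoise μ ε) (ψ : ℕ → H →L[ℝ] H)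
    (e : HilbertBasis ℕ ℝ H) (I : Finset ℤ) (k : ℕ) :
    AEMeasurable (toepDev μ ε ψ e I k) μ :=
  AEMeasurable.tsum fun m => AEMeasurable.tsum fun m' => AEMeasurable.const_mul
    (((hε.aemeasurable_offDev I k m m').const_mul 2).add
      (hε.measurable_diagDev e _).aemeasurable) _

theorem tsum_enorm_eq {ψ : ℕ → H →L[ℝ] H} (hψ : Summable fun m => ‖ψ m‖) :
    ∑' m, ‖ψ m‖ₑ = ENNReal.ofReal (∑' m, ‖ψ m‖) := by
  rw [ENNReal.ofReal_tsum_of_nonneg (fun _ => norm_nonneg _) hψ]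
  exact tsum_congr fun m => (ofReal_norm _).symm

/-- The weights ‖ψ_m‖‖ψ_{m'}‖ sum to (Σ‖ψ_m‖)² and the expected deviation is bounded uniformly in m,
m'. The constant is 21 = 2 · 10 + 1, the diagonal part √N being absorbed since k ≥ 1. -/
theorem IsNoise.lintegral_toepDev_le (hε : IsNoise μ ε) {ψ : ℕ → H →L[ℝ] H}
    (hψ : Summable fun m => ‖ψ m‖) (e : HilbertBasis ℕ ℝ H) (I : Finset ℤ) {k : ℕ} (hk : 1 ≤ k) :
    ∫⁻ ω, toepDev μ ε ψ e I k ω ∂μ ≤ ENNReal.ofReal (21 * (∑' m, ‖ψ m‖) ^ 2 *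
      Real.sqrt (∫ ω, ‖ε 0 ω‖ ^ 4 ∂μ) * Real.sqrt I.card * (k : ℝ) ^ (3 / 4 : ℝ)) := by
  set M := ∫ ω, ‖ε 0 ω‖ ^ 4 ∂μ with hM
  have hM0 : 0 ≤ M := integral_nonneg fun ω => by positivity
  have hm : ∀ m m', AEMeasurable (fun ω => 2 * offDev ε I k m m' ω +
      diagDev μ ε e (shift I m ∩ shift I m') ω) μ := fun m m' =>
    ((hε.aemeasurable_offDev I k m m').const_mul 2).add (hε.measurable_diagDev e _).aemeasurable
  set K := ENNReal.ofReal (21 * Real.sqrt M * Real.sqrt I.card * (k : ℝ) ^ (3 / 4 : ℝ)) with hK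
  have hk1 : (1 : ℝ) ≤ (k : ℝ) ^ (3 / 4 : ℝ) :=
    Real.one_le_rpow (by exact_mod_cast hk) (by norm_num)
  have hb : ∀ m m', ∫⁻ ω, (2 * offDev ε I k m m' ω +
      diagDev μ ε e (shift I m ∩ shift I m') ω) ∂μ ≤ K := fun m m' => by
    have hd := hε.lintegral_diagDev_le e (shift I m ∩ shift I m')
    have hM4 : ∫⁻ ω, ‖ε 0 ω‖ₑ ^ 4 ∂μ = ENNReal.ofReal M := by
      rw [hM, ofReal_integral_eq_lintegral_ofReal (hε.integrable_norm_pow 0)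
        (ae_of_all _ fun ω => by positivity)]
      refine lintegral_congr fun ω => ?_
      rw [ENNReal.ofReal_pow (norm_nonneg _), ofReal_norm]
    have hcard : ((shift I m ∩ shift I m').card : ℝ≥0∞) ≤ ENNReal.ofReal I.card := by
      rw [ENNReal.ofReal_natCast]
      exact_mod_cast (Finset.card_le_card Finset.inter_subset_left).trans (card_shift I m).le
    have hd2 : ∫⁻ ω, diagDev μ ε e (shift I m ∩ shift I m') ω ∂μ ≤
        ENNReal.ofReal (Real.sqrt M * Real.sqrt I.card) := by
      refine hd.trans ?_
      rw [hM4]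
      refine (ENNReal.rpow_le_rpow (mul_le_mul_left hcard _) (by norm_num)).trans (le_of_eq ?_)
      rw [← ENNReal.ofReal_mul (by positivity), ENNReal.ofReal_rpow_of_nonneg (by positivity)
        (by norm_num), ← Real.sqrt_eq_rpow, Real.sqrt_mul (by positivity), mul_comm]
    rw [lintegral_add_right' _ (hε.measurable_diagDev e _).aemeasurable,
      lintegral_const_mul'' _ (hε.aemeasurable_offDev I k m m')]
    refine (add_le_add (mul_le_mul_right (hε.lintegral_offDev_le I k m m') 2) hd2).trans ?_
    rw [show (2 : ℝ≥0∞) = ENNReal.ofReal 2 by simp, ← ENNReal.ofReal_mul (by norm_num),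
      ← ENNReal.ofReal_add (by positivity) (by positivity), hK]
    refine ENNReal.ofReal_le_ofReal ?_
    have : 0 ≤ Real.sqrt M * Real.sqrt I.card := by positivity
    nlinarith
  unfold toepDev
  rw [lintegral_tsum fun m => AEMeasurable.tsum fun m' => (hm m m').const_mul _]
  calc ∑' m, ∫⁻ ω, ∑' m', ‖ψ m‖ₑ * ‖ψ m'‖ₑ *
        (2 * offDev ε I k m m' ω + diagDev μ ε e (shift I m ∩ shift I m') ω) ∂μ
      ≤ ∑' m, ∑' m', ‖ψ m‖ₑ * ‖ψ m'‖ₑ * K := by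
        refine ENNReal.tsum_le_tsum fun m => ?_
        rw [lintegral_tsum fun m' => (hm m m').const_mul _]
        refine ENNReal.tsum_le_tsum fun m' => ?_
        rw [lintegral_const_mul'' _ (hm m m')]
        gcongr
        exact hb m m'
    _ = (∑' m, ‖ψ m‖ₑ) * (∑' m, ‖ψ m‖ₑ) * K := by
        simp only [ENNReal.tsum_mul_right, ENNReal.tsum_mul_left]
    _ = _ := by
        rw [tsum_enorm_eq hψ, hK, ← ENNReal.ofReal_mul (tsum_nonneg fun _ => norm_nonneg _),
          ← ENNReal.ofReal_mul (mul_self_nonneg _)]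
        congr 1; ring

/-- The truncated linear process. -/
def truncProc (ε : ℤ → Ω → H) (ψ : ℕ → H →L[ℝ] H) (L : ℕ) (s : ℤ) (ω : Ω) : H :=
  ∑ m ∈ Finset.range L, ψ m (ε (s - m) ω)

/-- The covariance operators of the truncated linear process. -/
noncomputable def truncCov (μ : Measure Ω) (ε : ℤ → Ω → H) (ψ : ℕ → H →L[ℝ] H) (L : ℕ)
    (s s' : ℤ) : H →L[ℝ] H :=
  ∑ m ∈ Finset.range L, ∑ m' ∈ Finset.range L,
    if s - m = s' - m' then ψ m' * noiseCov μ ε * ContinuousLinearMap.adjoint (ψ m) else 0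

theorem inner_truncCov (μ : Measure Ω) (ε : ℤ → Ω → H) (ψ : ℕ → H →L[ℝ] H) (L : ℕ) (s s' : ℤ)
    (u v : H) : ⟪truncCov μ ε ψ L s s' u, v⟫_ℝ =
      ∑ m ∈ Finset.range L, ∑ m' ∈ Finset.range L,
        if s - m = s' - m' then ⟪noiseCov μ ε (ContinuousLinearMap.adjoint (ψ m) u),
          ContinuousLinearMap.adjoint (ψ m') v⟫_ℝ else 0 := by
  rw [truncCov, _root_.sum_apply, sum_inner]
  refine Finset.sum_congr rfl fun m _ => ?_
  rw [_root_.sum_apply, sum_inner]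
  refine Finset.sum_congr rfl fun m' _ => ?_
  split_ifs
  · rw [mul_apply_eq_comp, mul_apply_eq_comp, ContinuousLinearMap.adjoint_inner_right]
  · simp

/-- The operators ψ_m are moved onto the test vectors by adjoints, leaving forms in the pure noise.
The bound does not depend on the truncation level L, so it survives the passage to the full process.
-/
theorem abs_bandForm_le (e : HilbertBasis ℕ ℝ H) (ψ : ℕ → H →L[ℝ] H) (I : Finset ℤ) (k L : ℕ)
    {g : ℤ → ℝ} (hg : ∀ h, |g h| ≤ 1) (ω : Ω) (hZ : toepDev μ ε ψ e I k ω ≠ ∞)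
    (h1 : ∀ m m', ‖offForm ε I k g m m' ω‖ₑ ≤ offDev ε I k m m' ω)
    (h2 : ∀ m m', ‖offForm ε I k (fun h => g (-h)) m' m ω‖ₑ ≤ offDev ε I k m m' ω) (u v : H) :
    |bandForm I k (fun s s' => opForm (tensor (truncProc ε ψ L s ω) (truncProc ε ψ L s' ω) -
      truncCov μ ε ψ L s s')) g u v| ≤ (toepDev μ ε ψ e I k ω).toReal * (‖u‖ * ‖v‖) := by
  set a : ℕ → H := fun m => ContinuousLinearMap.adjoint (ψ m) u with ha
  set b : ℕ → H := fun m => ContinuousLinearMap.adjoint (ψ m) v with hb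
  set cf : ℕ → ℕ → ℝ := fun m m' => if |(m - m' : ℤ)| < k then g (m - m') else 0 with hcf
  have hcf1 : ∀ m m', |cf m m'| ≤ 1 := fun m m' => by
    simp only [hcf]; split_ifs
    · exact hg _
    · simp
  have hexp : bandForm I k (fun s s' => opForm (tensor (truncProc ε ψ L s ω)
      (truncProc ε ψ L s' ω) - truncCov μ ε ψ L s s')) g u v =
      ∑ m ∈ Finset.range L, ∑ m' ∈ Finset.range L,
        (⟪offForm ε I k g m m' ω, a m ⊗ₜ[ℝ] b m'⟫_ℝ +
          ⟪offForm ε I k (fun h => g (-h)) m' m ω, b m' ⊗ₜ[ℝ] a m⟫_ℝ +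
          cf m m' * (∑ p ∈ shift I m ∩ shift I m', ⟪ε p ω, a m⟫_ℝ * ⟪ε p ω, b m'⟫_ℝ -
            (shift I m ∩ shift I m').card * ⟪noiseCov μ ε (a m), b m'⟫_ℝ)) := by
    have hT : ∀ s s', ⟪(tensor (truncProc ε ψ L s ω) (truncProc ε ψ L s' ω) -
        truncCov μ ε ψ L s s') u, v⟫_ℝ = ∑ m ∈ Finset.range L, ∑ m' ∈ Finset.range L,
          (⟪ε (s - m) ω, a m⟫_ℝ * ⟪ε (s' - m') ω, b m'⟫_ℝ -
            if s - m = s' - m' then ⟪noiseCov μ ε (a m), b m'⟫_ℝ else 0) := by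
      intro s s'
      rw [_root_.sub_apply, inner_sub_left, inner_truncCov, tensor_apply, real_inner_smul_left,
        truncProc, truncProc, sum_inner, sum_inner, Finset.sum_mul_sum]
      simp only [Finset.sum_sub_distrib]
      congr 1
      refine Finset.sum_congr rfl fun m _ => Finset.sum_congr rfl fun m' _ => ?_
      rw [ha, hb, ContinuousLinearMap.adjoint_inner_right, ContinuousLinearMap.adjoint_inner_right]
    simp only [bandForm, LinearMap.sum_apply, LinearMap.smul_apply, opForm_apply, hT, smul_eq_mul,
      Finset.mul_sum]
    have swap : ∀ f : ℤ → ℤ → ℕ → ℕ → ℝ, ∑ s ∈ I, ∑ s' ∈ I, ∑ m ∈ Finset.range L,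
        ∑ m' ∈ Finset.range L, f s s' m m' = ∑ m ∈ Finset.range L, ∑ m' ∈ Finset.range L,
        ∑ s ∈ I, ∑ s' ∈ I, f s s' m m' := by
      intro f
      rw [Finset.sum_congr rfl fun s _ => Finset.sum_comm, Finset.sum_comm]
      refine Finset.sum_congr rfl fun m _ => ?_
      rw [Finset.sum_congr rfl fun s _ => Finset.sum_comm, Finset.sum_comm]
    rw [swap]
    refine Finset.sum_congr rfl fun m _ => Finset.sum_congr rfl fun m' _ => ?_
    simp only [mul_sub, Finset.sum_sub_distrib]
    rw [bandSum_eq, bandCount_eq]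
    ring
  rw [hexp]
  refine (Finset.abs_sum_le_sum_abs _ _).trans ((Finset.sum_le_sum fun m _ =>
    Finset.abs_sum_le_sum_abs _ _).trans ?_)
  have hterm : ∀ m m', ‖ψ m‖ₑ * ‖ψ m'‖ₑ * (2 * offDev ε I k m m' ω +
      diagDev μ ε e (shift I m ∩ shift I m') ω) ≤ toepDev μ ε ψ e I k ω := fun m m' =>
    (ENNReal.le_tsum (f := fun m' => ‖ψ m‖ₑ * ‖ψ m'‖ₑ * (2 * offDev ε I k m m' ω +
      diagDev μ ε e (shift I m ∩ shift I m') ω)) m').trans (ENNReal.le_tsum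
        (f := fun m => ∑' m', ‖ψ m‖ₑ * ‖ψ m'‖ₑ * (2 * offDev ε I k m m' ω +
      diagDev μ ε e (shift I m ∩ shift I m') ω)) m)
  have hne : ∀ m m', ‖ψ m‖ₑ * ‖ψ m'‖ₑ * (2 * offDev ε I k m m' ω +
      diagDev μ ε e (shift I m ∩ shift I m') ω) ≠ ∞ := fun m m' =>
    ne_top_of_le_ne_top hZ (hterm m m')
  have hbd : ∀ m m', |⟪offForm ε I k g m m' ω, a m ⊗ₜ[ℝ] b m'⟫_ℝ +
          ⟪offForm ε I k (fun h => g (-h)) m' m ω, b m' ⊗ₜ[ℝ] a m⟫_ℝ +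
          cf m m' * (∑ p ∈ shift I m ∩ shift I m', ⟪ε p ω, a m⟫_ℝ * ⟪ε p ω, b m'⟫_ℝ -
            (shift I m ∩ shift I m').card * ⟪noiseCov μ ε (a m), b m'⟫_ℝ)| ≤
      (‖ψ m‖ₑ * ‖ψ m'‖ₑ * (2 * offDev ε I k m m' ω +
        diagDev μ ε e (shift I m ∩ shift I m') ω)).toReal * (‖u‖ * ‖v‖) := by
    intro m m'
    have hA : ‖a m‖ ≤ ‖ψ m‖ * ‖u‖ := by
      simpa [ha] using (ContinuousLinearMap.adjoint (ψ m)).le_opNorm u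
    have hB : ‖b m'‖ ≤ ‖ψ m'‖ * ‖v‖ := by
      simpa [hb] using (ContinuousLinearMap.adjoint (ψ m')).le_opNorm v
    -- A zero coefficient needs its own treatment: 0 · ∞ = 0 in the extended reals, so finiteness of
    -- the total says nothing about the deviation it multiplies.
    by_cases h0 : ‖ψ m‖ₑ * ‖ψ m'‖ₑ = 0
    · rcases mul_eq_zero.mp h0 with h | h
      · have : a m = 0 := by
          have : ψ m = 0 := by rwa [← ofReal_norm, ENNReal.ofReal_eq_zero, norm_le_zero_iff] at h
          simp [ha, this]
        simp [this]
        positivity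
      · have : b m' = 0 := by
          have : ψ m' = 0 := by rwa [← ofReal_norm, ENNReal.ofReal_eq_zero, norm_le_zero_iff] at h
          simp [hb, this]
        simp [this]
        positivity
    have hsum : 2 * offDev ε I k m m' ω + diagDev μ ε e (shift I m ∩ shift I m') ω ≠ ∞ := by
      intro htop
      exact hne m m' (by rw [htop, ENNReal.mul_top h0])
    obtain ⟨ho2, hd⟩ := ENNReal.add_ne_top.mp hsum
    have ho : offDev ε I k m m' ω ≠ ∞ := by
      intro h; rw [h] at ho2; simp at ho2
    have n1 : ‖offForm ε I k g m m' ω‖ ≤ (offDev ε I k m m' ω).toReal := by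
      simpa using ENNReal.toReal_mono ho (h1 m m')
    have n2 : ‖offForm ε I k (fun h => g (-h)) m' m ω‖ ≤ (offDev ε I k m m' ω).toReal := by
      simpa using ENNReal.toReal_mono ho (h2 m m')
    have d1 := IsNoise.abs_sum_inner_sub_le (μ := μ) e (shift I m ∩ shift I m') ω hd (a m) (b m')
    rw [ENNReal.toReal_mul, ENNReal.toReal_mul, ENNReal.toReal_add ho2 hd, ENNReal.toReal_mul,
      toReal_enorm, toReal_enorm]
    set R := (offDev ε I k m m' ω).toReal
    set D := (diagDev μ ε e (shift I m ∩ shift I m') ω).toReal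
    have hR : 0 ≤ R := ENNReal.toReal_nonneg
    have hD : 0 ≤ D := ENNReal.toReal_nonneg
    have i1 := abs_real_inner_le_norm (offForm ε I k g m m' ω) (a m ⊗ₜ[ℝ] b m')
    have i2 := abs_real_inner_le_norm (offForm ε I k (fun h => g (-h)) m' m ω) (b m' ⊗ₜ[ℝ] a m)
    rw [TensorProduct.norm_tmul] at i1 i2
    refine (abs_add_le _ _).trans ((add_le_add (abs_add_le _ _) le_rfl).trans ?_)
    rw [abs_mul]
    have j1 : ‖offForm ε I k g m m' ω‖ * (‖a m‖ * ‖b m'‖) ≤ R * (‖a m‖ * ‖b m'‖) := by gcongr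
    have j2 : ‖offForm ε I k (fun h => g (-h)) m' m ω‖ * (‖b m'‖ * ‖a m‖) ≤
      R * (‖b m'‖ * ‖a m‖) := by gcongr
    have j3 := mul_le_mul (hcf1 m m') d1 (abs_nonneg _) zero_le_one
    have j4 : ‖a m‖ * ‖b m'‖ ≤ (‖ψ m‖ * ‖u‖) * (‖ψ m'‖ * ‖v‖) := by gcongr
    calc _ ≤ (2 * R + D) * (‖a m‖ * ‖b m'‖) := by linarith
      _ ≤ (2 * R + D) * ((‖ψ m‖ * ‖u‖) * (‖ψ m'‖ * ‖v‖)) := by gcongr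
      _ = _ := by simp; ring
  refine (Finset.sum_le_sum fun m _ => Finset.sum_le_sum fun m' _ => hbd m m').trans ?_
  simp only [← Finset.sum_mul]
  gcongr
  rw [← Finset.sum_congr rfl fun m _ => ENNReal.toReal_sum fun m' _ => hne m m',
    ← ENNReal.toReal_sum fun m _ => ENNReal.sum_ne_top.mpr fun m' _ => hne m m']
  refine ENNReal.toReal_mono hZ ?_
  exact (Finset.sum_le_sum fun m _ => ENNReal.sum_le_tsum _).trans (ENNReal.sum_le_tsum _)

theorem enorm_offForm_le_offDev {I : Finset ℤ} {k j : ℕ} (hj : j < 2 * k) (m m' : ℕ) (ω : Ω) :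
    ‖offForm ε I k (cosFreq k j) m m' ω‖ₑ ≤ offDev ε I k m m' ω ∧
    ‖offForm ε I k (fun h => cosFreq k j (-h)) m' m ω‖ₑ ≤ offDev ε I k m m' ω ∧
    ‖offForm ε I k (sinFreq k j) m m' ω‖ₑ ≤ offDev ε I k m m' ω ∧
    ‖offForm ε I k (fun h => sinFreq k j (-h)) m' m ω‖ₑ ≤ offDev ε I k m m' ω := by
  have key : ∀ x : ℝ≥0∞, x ^ 4 ≤ ∑ j ∈ Finset.range (2 * k),
      (‖offForm ε I k (cosFreq k j) m m' ω‖ₑ ^ 4 +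
    ‖offForm ε I k (fun h => cosFreq k j (-h)) m' m ω‖ₑ ^ 4 +
    ‖offForm ε I k (sinFreq k j) m m' ω‖ₑ ^ 4 +
    ‖offForm ε I k (fun h => sinFreq k j (-h)) m' m ω‖ₑ ^ 4) → x ≤ offDev ε I k m m' ω := by
    intro x hx
    have : x = (x ^ 4) ^ (1 / 4 : ℝ) := by
      rw [← ENNReal.rpow_natCast, ← ENNReal.rpow_mul]; norm_num
    rw [this]
    exact ENNReal.rpow_le_rpow hx (by norm_num)
  have hs := fun f : ℕ → ℝ≥0∞ => Finset.single_le_sum (f := f) (s := Finset.range (2 * k))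
    (fun _ _ => bot_le) (Finset.mem_range.mpr hj)
  have hj := hs fun j => ‖offForm ε I k (cosFreq k j) m m' ω‖ₑ ^ 4 +
    ‖offForm ε I k (fun h => cosFreq k j (-h)) m' m ω‖ₑ ^ 4 +
    ‖offForm ε I k (sinFreq k j) m m' ω‖ₑ ^ 4 +
    ‖offForm ε I k (fun h => sinFreq k j (-h)) m' m ω‖ₑ ^ 4
  refine ⟨key _ (le_trans ?_ hj), key _ (le_trans ?_ hj), key _ (le_trans ?_ hj),
    key _ (le_trans ?_ hj)⟩
  · exact le_self_add.trans (le_self_add.trans le_self_add)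
  · exact le_add_self.trans (le_self_add.trans le_self_add)
  · exact le_add_self.trans le_self_add
  · exact le_add_self

/-- Deviation of the Toeplitz form of the truncated process from its mean. -/
theorem abs_toeplitzForm_trunc_le (e : HilbertBasis ℕ ℝ H) (ψ : ℕ → H →L[ℝ] H) (I : Finset ℤ)
    (k L : ℕ) (ω : Ω) (hZ : toepDev μ ε ψ e I k ω ≠ ∞) (v : ℕ → H) :
    |toeplitzForm I k (fun s s' => opForm (tensor (truncProc ε ψ L s ω) (truncProc ε ψ L s' ω) -
      truncCov μ ε ψ L s s')) v| ≤
      2 * (toepDev μ ε ψ e I k ω).toReal * ∑ i ∈ Finset.range k, ‖v i‖ ^ 2 := by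
  rw [two_mul (ENNReal.toReal _)]
  refine abs_toeplitzForm_le I _ (fun j hj u u' => ?_) (fun j hj u u' => ?_)
    ENNReal.toReal_nonneg v
  · exact abs_bandForm_le e ψ I k L (fun _ => Real.abs_cos_le_one _) ω hZ
      (fun m m' => (enorm_offForm_le_offDev hj m m' ω).1)
      (fun m m' => (enorm_offForm_le_offDev hj m m' ω).2.1) u u'
  · exact abs_bandForm_le e ψ I k L (fun _ => Real.abs_sin_le_one _) ω hZ
      (fun m m' => (enorm_offForm_le_offDev hj m m' ω).2.2.1)
      (fun m m' => (enorm_offForm_le_offDev hj m m' ω).2.2.2) u u'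

end OffDiagonal

/-! ### Second-order structure of linear processes -/

section SecondOrder

variable {Ω H : Type*} [MeasurableSpace Ω] {μ : Measure Ω} [IsProbabilityMeasure μ]
  [NormedAddCommGroup H] [InnerProductSpace ℝ H] [CompleteSpace H]
  [MeasurableSpace H] [BorelSpace H] [SecondCountableTopology H]

/-- A linear process driven by measurable noise. -/
structure IsProc (μ : Measure Ω) (X ε : ℤ → Ω → H) (ψ : ℕ → H →L[ℝ] H) : Prop where
  noise : IsNoise μ ε
  summable : Summable fun ℓ => ‖ψ ℓ‖
  series : ∀ j, ∀ᵐ ω ∂μ, HasSum (fun ℓ : ℕ => ψ ℓ (ε (j - ℓ) ω)) (X j ω)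

/-- A dominating function for the linear process. -/
noncomputable def procBound (ε : ℤ → Ω → H) (ψ : ℕ → H →L[ℝ] H) (s : ℤ) (ω : Ω) : ℝ≥0∞ :=
  ∑' m : ℕ, ‖ψ m‖ₑ * ‖ε (s - m) ω‖ₑ

theorem enorm_truncProc_le (ε : ℤ → Ω → H) (ψ : ℕ → H →L[ℝ] H) (L : ℕ) (s : ℤ) (ω : Ω) :
    ‖truncProc ε ψ L s ω‖ₑ ≤ procBound ε ψ s ω := by
  rw [truncProc, procBound]
  refine (enorm_sum_le _ _).trans ((Finset.sum_le_sum fun m _ => ?_).trans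
    (ENNReal.sum_le_tsum _))
  exact (ψ m).le_opENorm _

namespace IsNoise

variable {ε : ℤ → Ω → H} {ψ : ℕ → H →L[ℝ] H}

theorem lintegral_enorm_sq (hε : IsNoise μ ε) (j : ℤ) :
    ∫⁻ ω, ‖ε j ω‖ₑ ^ 2 ∂μ = ENNReal.ofReal (∫ ω, ‖ε 0 ω‖ ^ 2 ∂μ) := by
  rw [← hε.integral_norm_pow j, ofReal_integral_eq_lintegral_ofReal
    ((hε.memLp_two j).integrable_norm_pow (by norm_num)) (ae_of_all _ fun ω => by positivity)]
  refine lintegral_congr fun ω => ?_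
  rw [ENNReal.ofReal_pow (norm_nonneg _), ofReal_norm]

theorem measurable_procBound (hε : IsNoise μ ε) (s : ℤ) : Measurable (procBound ε ψ s) :=
  Measurable.tsum fun _ => (hε.meas _).enorm.const_mul _

/-- Expand the product of the two series; each E ‖ε_p‖‖ε_q‖ is at most E ‖ε_0‖² by 2ab ≤ a² + b² and
identical distribution. -/
theorem lintegral_procBound_le (hε : IsNoise μ ε) (hψ : Summable fun m => ‖ψ m‖) (s t : ℤ) :
    ∫⁻ ω, procBound ε ψ s ω * procBound ε ψ t ω ∂μ ≤
      ENNReal.ofReal ((∑' m, ‖ψ m‖) ^ 2 * ∫ ω, ‖ε 0 ω‖ ^ 2 ∂μ) := by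
  have hpair : ∀ p q, ∫⁻ ω, ‖ε p ω‖ₑ * ‖ε q ω‖ₑ ∂μ ≤ ENNReal.ofReal (∫ ω, ‖ε 0 ω‖ ^ 2 ∂μ) := by
    intro p q
    have h2 : ∀ a b : ℝ≥0∞, 2 * (a * b) ≤ a ^ 2 + b ^ 2 := fun a b => by
      rcases eq_or_ne a ∞ with rfl | ha
      · simp
      rcases eq_or_ne b ∞ with rfl | hb
      · simp
      lift a to NNReal using ha
      lift b to NNReal using hb
      have := two_mul_le_add_sq (a : ℝ) b
      rw [mul_assoc] at this
      exact_mod_cast this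
    have hmm : Measurable fun ω => ‖ε p ω‖ₑ * ‖ε q ω‖ₑ :=
      (hε.meas p).enorm.mul (hε.meas q).enorm
    have : 2 * ∫⁻ ω, ‖ε p ω‖ₑ * ‖ε q ω‖ₑ ∂μ ≤ 2 * ENNReal.ofReal (∫ ω, ‖ε 0 ω‖ ^ 2 ∂μ) := by
      rw [← lintegral_const_mul _ hmm]
      refine (lintegral_mono fun ω => h2 _ _).trans ?_
      rw [lintegral_add_left ((hε.meas p).enorm.pow_const 2), hε.lintegral_enorm_sq,
        hε.lintegral_enorm_sq, two_mul]
    exact (ENNReal.mul_le_mul_iff_right (by norm_num) (by norm_num)).mp this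
  have e : ∀ ω, procBound ε ψ s ω * procBound ε ψ t ω =
      ∑' m : ℕ, ∑' m' : ℕ, ‖ψ m‖ₑ * ‖ψ m'‖ₑ * (‖ε (s - m) ω‖ₑ * ‖ε (t - m') ω‖ₑ) := fun ω => by
    rw [procBound, procBound, ← ENNReal.tsum_mul_right]
    refine tsum_congr fun m => ?_
    rw [← ENNReal.tsum_mul_left]
    exact tsum_congr fun m' => by ring
  have hm : ∀ m m' : ℕ, Measurable fun ω => ‖ψ m‖ₑ * ‖ψ m'‖ₑ *
      (‖ε (s - m) ω‖ₑ * ‖ε (t - m') ω‖ₑ) := fun m m' =>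
    ((hε.meas _).enorm.mul (hε.meas _).enorm).const_mul _
  simp only [e]
  rw [lintegral_tsum fun m => (Measurable.tsum fun m' => hm m m').aemeasurable]
  calc _ ≤ ∑' m, ∑' m', ‖ψ m‖ₑ * ‖ψ m'‖ₑ * ENNReal.ofReal (∫ ω, ‖ε 0 ω‖ ^ 2 ∂μ) := by
        refine ENNReal.tsum_le_tsum fun m => ?_
        rw [lintegral_tsum fun m' => (hm m m').aemeasurable]
        refine ENNReal.tsum_le_tsum fun m' => ?_
        have hmm : Measurable fun ω => ‖ε (s - m) ω‖ₑ * ‖ε (t - m') ω‖ₑ :=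
          (hε.meas _).enorm.mul (hε.meas _).enorm
        rw [lintegral_const_mul _ hmm]
        gcongr
        exact hpair _ _
    _ = (∑' m, ‖ψ m‖ₑ) * (∑' m, ‖ψ m‖ₑ) * ENNReal.ofReal (∫ ω, ‖ε 0 ω‖ ^ 2 ∂μ) := by
        simp only [ENNReal.tsum_mul_right, ENNReal.tsum_mul_left]
    _ = _ := by
        rw [tsum_enorm_eq hψ, ← ENNReal.ofReal_mul (tsum_nonneg fun _ => norm_nonneg _),
          ← ENNReal.ofReal_mul (mul_self_nonneg _), pow_two]

theorem integral_inner_mul_inner (hε : IsNoise μ ε) (p q : ℤ) (u v : H) :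
    ∫ ω, ⟪ε p ω, u⟫_ℝ * ⟪ε q ω, v⟫_ℝ ∂μ = if p = q then ⟪noiseCov μ ε u, v⟫_ℝ else 0 := by
  split_ifs with h
  · subst h
    rw [← hε.integral_smul p u, real_inner_comm,
      ← integral_inner ((hε.memLp_smul p u).integrable (by norm_num))]
    refine integral_congr_ae (ae_of_all _ fun ω => ?_)
    simp only [real_inner_smul_right]
    rw [real_inner_comm v]
  · have hind : IndepFun (fun ω => ⟪ε p ω, u⟫_ℝ) (fun ω => ⟪ε q ω, v⟫_ℝ) μ :=
      (hε.indep.indepFun h).comp (φ := fun x : H => ⟪x, u⟫_ℝ) (ψ := fun x : H => ⟪x, v⟫_ℝ)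
        measurable_id.inner_const measurable_id.inner_const
    rw [hind.integral_fun_mul_eq_mul_integral ((hε.meas p).inner_const).aestronglyMeasurable
      ((hε.meas q).inner_const).aestronglyMeasurable]
    have : ∫ ω, ⟪ε p ω, u⟫_ℝ ∂μ = 0 := by
      have := integral_inner (𝕜 := ℝ) (hε.integrable p) u
      rw [hε.mean', inner_zero_right] at this
      rw [← this]
      exact integral_congr_ae (ae_of_all _ fun ω => real_inner_comm _ _)
    rw [this, zero_mul]

theorem norm_noiseCov_le (_ : IsNoise μ ε) : ‖noiseCov μ ε‖ ≤ ∫ ω, ‖ε 0 ω‖ ^ 2 ∂μ := by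
  refine (norm_integral_le_integral_norm _).trans (le_of_eq ?_)
  simp only [norm_tensor, pow_two]

theorem measurable_truncProc (hε : IsNoise μ ε) (L : ℕ) (s : ℤ) :
    Measurable (truncProc ε ψ L s) :=
  Finset.measurable_fun_sum _ fun m _ => (ψ m).continuous.measurable.comp (hε.meas _)

theorem integral_truncProc (hε : IsNoise μ ε) (L : ℕ) (s t : ℤ) (u v : H) :
    ∫ ω, ⟪truncProc ε ψ L s ω, u⟫_ℝ * ⟪truncProc ε ψ L t ω, v⟫_ℝ ∂μ =
      ⟪truncCov μ ε ψ L s t u, v⟫_ℝ := by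
  have hi : ∀ p q (a b : H), Integrable (fun ω => ⟪ε p ω, a⟫_ℝ * ⟪ε q ω, b⟫_ℝ) μ :=
    fun p q a b => by
      have ha : MemLp (fun ω => ⟪ε p ω, a⟫_ℝ) 2 μ := (hε.memLp_two p).inner_const a
      have hb : MemLp (fun ω => ⟪ε q ω, b⟫_ℝ) 2 μ := (hε.memLp_two q).inner_const b
      exact ha.integrable_mul hb
  rw [inner_truncCov]
  simp only [truncProc, sum_inner, Finset.sum_mul_sum]
  have e : ∀ (m : ℕ) (p : ℤ) (w : H) (ω : Ω), ⟪ψ m (ε p ω), w⟫_ℝ =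
      ⟪ε p ω, ContinuousLinearMap.adjoint (ψ m) w⟫_ℝ := fun m p w ω =>
    (ContinuousLinearMap.adjoint_inner_right _ _ _).symm
  simp only [e]
  rw [integral_finsetSum _ fun m _ => integrable_finsetSum _ fun m' _ => hi _ _ _ _]
  refine Finset.sum_congr rfl fun m _ => ?_
  rw [integral_finsetSum _ fun m' _ => hi _ _ _ _]
  exact Finset.sum_congr rfl fun m' _ => hε.integral_inner_mul_inner _ _ _ _

end IsNoise

theorem truncCov_eq (μ : Measure Ω) (ε : ℤ → Ω → H) (ψ : ℕ → H →L[ℝ] H) (L : ℕ) (s t : ℤ) :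
    truncCov μ ε ψ L s t = truncCov μ ε ψ L 0 (t - s) := by
  rw [truncCov, truncCov]
  refine Finset.sum_congr rfl fun m _ => Finset.sum_congr rfl fun m' _ => ?_
  exact if_congr (by omega) rfl rfl

/-- A summable bound for the norms of the autocovariance operators. -/
noncomputable def lagBound (ψ : ℕ → H →L[ℝ] H) (h : ℤ) : ℝ≥0∞ :=
  ∑' m : ℕ, ∑' m' : ℕ, if (m' : ℤ) - m = h then ‖ψ m‖ₑ * ‖ψ m'‖ₑ else 0

/-- Each pair (m, m') contributes to exactly one lag. This is where summability of the
autocovariances comes from. -/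
theorem tsum_lagBound (ψ : ℕ → H →L[ℝ] H) :
    ∑' h, lagBound ψ h = (∑' m, ‖ψ m‖ₑ) * ∑' m, ‖ψ m‖ₑ := by
  unfold lagBound
  rw [ENNReal.tsum_comm, ← ENNReal.tsum_mul_right]
  refine tsum_congr fun m => ?_
  rw [ENNReal.tsum_comm, ← ENNReal.tsum_mul_left]
  refine tsum_congr fun m' => ?_
  rw [tsum_eq_single ((m' : ℤ) - m) fun h hh => if_neg hh.symm, if_pos rfl]

theorem tsum_lagBound_ne_top {ψ : ℕ → H →L[ℝ] H} (hψ : Summable fun m => ‖ψ m‖) :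
    ∑' h, lagBound ψ h ≠ ∞ := by
  rw [tsum_lagBound, tsum_enorm_eq hψ]
  exact ENNReal.mul_ne_top ENNReal.ofReal_ne_top ENNReal.ofReal_ne_top

theorem abs_inner_truncCov_le {ε : ℤ → Ω → H} (hε : IsNoise μ ε) {ψ : ℕ → H →L[ℝ] H}
    (hψ : Summable fun m => ‖ψ m‖) (L : ℕ) (h : ℤ) (u v : H) :
    |⟪truncCov μ ε ψ L 0 h u, v⟫_ℝ| ≤
      (∫ ω, ‖ε 0 ω‖ ^ 2 ∂μ) * (lagBound ψ h).toReal * (‖u‖ * ‖v‖) := by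
  have hne : lagBound ψ h ≠ ∞ := ne_top_of_le_ne_top (tsum_lagBound_ne_top hψ) (ENNReal.le_tsum h)
  set σ := ∫ ω, ‖ε 0 ω‖ ^ 2 ∂μ with hσ
  have hσ0 : 0 ≤ σ := integral_nonneg fun ω => by positivity
  rw [inner_truncCov]
  refine (Finset.abs_sum_le_sum_abs _ _).trans ((Finset.sum_le_sum fun m _ =>
    Finset.abs_sum_le_sum_abs _ _).trans ?_)
  have hb : ∀ m m' : ℕ, |if (0 : ℤ) - m = h - m' then
      ⟪noiseCov μ ε (ContinuousLinearMap.adjoint (ψ m) u),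
        ContinuousLinearMap.adjoint (ψ m') v⟫_ℝ else 0| ≤
      (if (m' : ℤ) - m = h then ‖ψ m‖ₑ * ‖ψ m'‖ₑ else 0).toReal * (σ * (‖u‖ * ‖v‖)) := by
    intro m m'
    by_cases hc : (m' : ℤ) - m = h
    · rw [if_pos hc, if_pos (by omega), ENNReal.toReal_mul, toReal_enorm, toReal_enorm]
      have hA : ‖ContinuousLinearMap.adjoint (ψ m) u‖ ≤ ‖ψ m‖ * ‖u‖ := by
        simpa using (ContinuousLinearMap.adjoint (ψ m)).le_opNorm u
      have hB : ‖ContinuousLinearMap.adjoint (ψ m') v‖ ≤ ‖ψ m'‖ * ‖v‖ := by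
        simpa using (ContinuousLinearMap.adjoint (ψ m')).le_opNorm v
      have hC := (noiseCov μ ε).le_opNorm (ContinuousLinearMap.adjoint (ψ m) u)
      have hD := hε.norm_noiseCov_le
      refine (abs_real_inner_le_norm _ _).trans ?_
      calc _ ≤ (σ * (‖ψ m‖ * ‖u‖)) * (‖ψ m'‖ * ‖v‖) := by
            refine mul_le_mul (hC.trans ?_) hB (norm_nonneg _) (by positivity)
            exact mul_le_mul hD hA (norm_nonneg _) hσ0
        _ = _ := by ring
    · rw [if_neg hc, if_neg (by omega)]; simp
  refine (Finset.sum_le_sum fun m _ => Finset.sum_le_sum fun m' _ => hb m m').trans ?_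
  have hf : ∀ m m' : ℕ, (if (m' : ℤ) - m = h then ‖ψ m‖ₑ * ‖ψ m'‖ₑ else 0) ≠ ∞ := fun m m' => by
    split_ifs
    · exact ENNReal.mul_ne_top (by simp) (by simp)
    · simp
  simp only [← Finset.sum_mul]
  rw [← Finset.sum_congr rfl fun m _ => ENNReal.toReal_sum fun m' _ => hf m m',
    ← ENNReal.toReal_sum fun m _ => ENNReal.sum_ne_top.mpr fun m' _ => hf m m']
  have : (∑ m ∈ Finset.range L, ∑ m' ∈ Finset.range L,
      if (m' : ℤ) - m = h then ‖ψ m‖ₑ * ‖ψ m'‖ₑ else 0).toReal ≤ (lagBound ψ h).toReal := by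
    refine ENNReal.toReal_mono hne ?_
    exact (Finset.sum_le_sum fun m _ => ENNReal.sum_le_tsum _).trans (ENNReal.sum_le_tsum _)
  calc _ ≤ (lagBound ψ h).toReal * (σ * (‖u‖ * ‖v‖)) := by gcongr
    _ = _ := by ring

namespace IsProc

variable {X ε : ℤ → Ω → H} {ψ : ℕ → H →L[ℝ] H}

theorem tendsto_truncProc (hX : IsProc μ X ε ψ) (s : ℤ) :
    ∀ᵐ ω ∂μ, Tendsto (fun L => truncProc ε ψ L s ω) atTop (𝓝 (X s ω)) := by
  filter_upwards [hX.series s] with ω h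
  exact h.tendsto_sum_nat

theorem aestronglyMeasurable (hX : IsProc μ X ε ψ) (s : ℤ) : AEStronglyMeasurable (X s) μ :=
  aestronglyMeasurable_of_tendsto_ae atTop
    (fun L => (hX.noise.measurable_truncProc (ψ := ψ) L s).aestronglyMeasurable)
    (hX.tendsto_truncProc s)

theorem enorm_le_procBound (hX : IsProc μ X ε ψ) (s : ℤ) :
    ∀ᵐ ω ∂μ, ‖X s ω‖ₑ ≤ procBound ε ψ s ω := by
  filter_upwards [hX.tendsto_truncProc s] with ω h
  exact le_of_tendsto h.enorm (Eventually.of_forall fun L => enorm_truncProc_le ε ψ L s ω)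

theorem lintegral_enorm_sq_le (hX : IsProc μ X ε ψ) (s : ℤ) :
    ∫⁻ ω, ‖X s ω‖ₑ ^ 2 ∂μ ≤ ENNReal.ofReal ((∑' m, ‖ψ m‖) ^ 2 * ∫ ω, ‖ε 0 ω‖ ^ 2 ∂μ) := by
  refine (lintegral_mono_ae ?_).trans (hX.noise.lintegral_procBound_le hX.summable s s)
  filter_upwards [hX.enorm_le_procBound s] with ω h
  rw [pow_two]
  exact mul_le_mul' h h

theorem memLp_two (hX : IsProc μ X ε ψ) (s : ℤ) : MemLp (X s) 2 μ := by
  refine ⟨hX.aestronglyMeasurable s, ?_⟩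
  rw [eLpNorm_lt_top_iff_lintegral_rpow_enorm_lt_top (by norm_num) (by norm_num)]
  simpa using (hX.lintegral_enorm_sq_le s).trans_lt ENNReal.ofReal_lt_top

theorem integrable_inner_mul (hX : IsProc μ X ε ψ) (s t : ℤ) (u v : H) :
    Integrable (fun ω => ⟪X s ω, u⟫_ℝ * ⟪X t ω, v⟫_ℝ) μ :=
  MemLp.integrable_mul ((hX.memLp_two s).inner_const u) ((hX.memLp_two t).inner_const v)

/-- Dominated convergence, with the product of the two `procBound`s as integrable majorant. -/
theorem tendsto_truncCov (hX : IsProc μ X ε ψ) (s t : ℤ) (u v : H) :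
    Tendsto (fun L => ⟪truncCov μ ε ψ L s t u, v⟫_ℝ) atTop
      (𝓝 (∫ ω, ⟪X s ω, u⟫_ℝ * ⟪X t ω, v⟫_ℝ ∂μ)) := by
  simp only [← hX.noise.integral_truncProc]
  have hfin : ∀ᵐ ω ∂μ, procBound ε ψ s ω * procBound ε ψ t ω < ∞ :=
    ae_lt_top ((hX.noise.measurable_procBound s).mul (hX.noise.measurable_procBound t))
      ((hX.noise.lintegral_procBound_le hX.summable s t).trans_lt ENNReal.ofReal_lt_top).ne
  refine tendsto_integral_of_dominated_convergence
    (fun ω => (procBound ε ψ s ω * procBound ε ψ t ω).toReal * (‖u‖ * ‖v‖)) (fun L => ?_) ?_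
    (fun L => ?_) ?_
  · exact (((hX.noise.measurable_truncProc L s).inner_const).mul
      ((hX.noise.measurable_truncProc L t).inner_const)).aestronglyMeasurable
  · refine Integrable.mul_const ?_ _
    exact integrable_toReal_of_lintegral_ne_top
      ((hX.noise.measurable_procBound s).mul (hX.noise.measurable_procBound t)).aemeasurable
      ((hX.noise.lintegral_procBound_le hX.summable s t).trans_lt ENNReal.ofReal_lt_top).ne
  · filter_upwards [hfin] with ω hω
    rw [norm_mul]
    have h1 := mul_le_mul' (enorm_truncProc_le ε ψ L s ω) (enorm_truncProc_le ε ψ L t ω)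
    have h2 := ENNReal.toReal_mono hω.ne h1
    rw [ENNReal.toReal_mul, toReal_enorm, toReal_enorm] at h2
    have i1 := norm_inner_le_norm (𝕜 := ℝ) (truncProc ε ψ L s ω) u
    have i2 := norm_inner_le_norm (𝕜 := ℝ) (truncProc ε ψ L t ω) v
    calc _ ≤ (‖truncProc ε ψ L s ω‖ * ‖u‖) * (‖truncProc ε ψ L t ω‖ * ‖v‖) := by gcongr
      _ = (‖truncProc ε ψ L s ω‖ * ‖truncProc ε ψ L t ω‖) * (‖u‖ * ‖v‖) := by ring
      _ ≤ _ := by gcongr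
  · filter_upwards [hX.tendsto_truncProc s, hX.tendsto_truncProc t] with ω h1 h2
    exact (h1.inner tendsto_const_nhds).mul (h2.inner tendsto_const_nhds)

theorem inner_lagCov_zero (hX : IsProc μ X ε ψ) (h : ℤ) (u v : H) :
    ⟪lagCov μ X h u, v⟫_ℝ = ∫ ω, ⟪X 0 ω, u⟫_ℝ * ⟪X h ω, v⟫_ℝ ∂μ := by
  have hi : Integrable (fun ω => tensor (X 0 ω) (X h ω)) μ := by
    refine (((hX.memLp_two 0).integrable_norm_pow (by norm_num)).add
      ((hX.memLp_two h).integrable_norm_pow (by norm_num))).mono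
      ((continuous_tensor.comp_aestronglyMeasurable₂ (hX.aestronglyMeasurable 0)
        (hX.aestronglyMeasurable h))) (ae_of_all _ fun ω => ?_)
    rw [norm_tensor]
    refine le_trans ?_ (le_abs_self _)
    change ‖X 0 ω‖ * ‖X h ω‖ ≤ ‖X 0 ω‖ ^ 2 + ‖X h ω‖ ^ 2
    nlinarith [sq_nonneg (‖X 0 ω‖ - ‖X h ω‖), sq_nonneg ‖X 0 ω‖, sq_nonneg ‖X h ω‖]
  rw [lagCov, ContinuousLinearMap.integral_apply hi, real_inner_comm,
    ← integral_inner (hi.apply_continuousLinearMap u)]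
  refine integral_congr_ae (ae_of_all _ fun ω => ?_)
  simp only [tensor_apply, real_inner_smul_right]
  rw [real_inner_comm v]

/-- Second-order stationarity, inherited from the truncated processes, whose covariances visibly
depend on t - s only. -/
theorem inner_lagCov (hX : IsProc μ X ε ψ) (s t : ℤ) (u v : H) :
    ⟪lagCov μ X (t - s) u, v⟫_ℝ = ∫ ω, ⟪X s ω, u⟫_ℝ * ⟪X t ω, v⟫_ℝ ∂μ := by
  rw [hX.inner_lagCov_zero]
  have h1 := hX.tendsto_truncCov s t u v
  simp only [truncCov_eq μ ε ψ _ s t] at h1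
  exact tendsto_nhds_unique (hX.tendsto_truncCov 0 (t - s) u v) h1

theorem norm_lagCov_le (hX : IsProc μ X ε ψ) (h : ℤ) :
    ‖lagCov μ X h‖ ≤ (∫ ω, ‖ε 0 ω‖ ^ 2 ∂μ) * (lagBound ψ h).toReal := by
  have hσ0 : 0 ≤ ∫ ω, ‖ε 0 ω‖ ^ 2 ∂μ := integral_nonneg fun ω => by positivity
  have key : ∀ u v, |⟪lagCov μ X h u, v⟫_ℝ| ≤
      (∫ ω, ‖ε 0 ω‖ ^ 2 ∂μ) * (lagBound ψ h).toReal * (‖u‖ * ‖v‖) := fun u v => by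
    rw [hX.inner_lagCov_zero]
    exact le_of_tendsto (hX.tendsto_truncCov 0 h u v).abs
      (Eventually.of_forall fun L => abs_inner_truncCov_le hX.noise hX.summable L h u v)
  refine ContinuousLinearMap.opNorm_le_bound _ (by positivity) fun u => ?_
  have h1 := key u (lagCov μ X h u)
  rw [real_inner_self_eq_norm_sq, abs_of_nonneg (sq_nonneg _)] at h1
  rcases eq_or_ne ‖lagCov μ X h u‖ 0 with h0 | h0
  · rw [h0]; positivity
  · have hp : 0 < ‖lagCov μ X h u‖ := lt_of_le_of_ne (norm_nonneg _) (Ne.symm h0)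
    refine le_of_mul_le_mul_right ?_ hp
    nlinarith

theorem summable_norm_lagCov (hX : IsProc μ X ε ψ) : Summable fun h : ℤ => ‖lagCov μ X h‖ :=
  Summable.of_nonneg_of_le (fun _ => norm_nonneg _) hX.norm_lagCov_le
    ((ENNReal.summable_toReal (tsum_lagBound_ne_top hX.summable)).mul_left _)

/-- Deviation of the Toeplitz form of the process from its mean. -/
theorem abs_toeplitzForm_sub_le (hX : IsProc μ X ε ψ) (e : HilbertBasis ℕ ℝ H) (I : Finset ℤ)
    (k : ℕ) : ∀ᵐ ω ∂μ, toepDev μ ε ψ e I k ω ≠ ∞ → ∀ v : ℕ → H,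
    |toeplitzForm I k (fun s s' => opForm (tensor (X s ω) (X s' ω))) v -
      toeplitzForm I k (fun s s' => opForm (lagCov μ X (s' - s))) v| ≤
      2 * (toepDev μ ε ψ e I k ω).toReal * ∑ i ∈ Finset.range k, ‖v i‖ ^ 2 := by
  have hall : ∀ᵐ ω ∂μ, ∀ s, Tendsto (fun L => truncProc ε ψ L s ω) atTop (𝓝 (X s ω)) :=
    ae_all_iff.mpr hX.tendsto_truncProc
  filter_upwards [hall] with ω hω hZ v
  refine le_of_tendsto (x := atTop) (Tendsto.abs ?_) (Eventually.of_forall fun L =>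
    abs_toeplitzForm_trunc_le e ψ I k L ω hZ v)
  simp only [toeplitzForm, ← Finset.sum_sub_distrib]
  refine tendsto_finsetSum _ fun i _ => tendsto_finsetSum _ fun i' _ =>
    tendsto_finsetSum _ fun s _ => tendsto_finsetSum _ fun s' _ => ?_
  split_ifs
  · simp only [opForm_apply, _root_.sub_apply, inner_sub_left, tensor_apply, real_inner_smul_left]
    refine Tendsto.sub (((hω s).inner tendsto_const_nhds).mul ((hω s').inner tendsto_const_nhds)) ?_
    rw [hX.inner_lagCov s s']
    exact hX.tendsto_truncCov s s' _ _
  · simp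

end IsProc

end SecondOrder

/-! ### Toeplitz forms over intervals -/

section Toeplitz

variable {H : Type*} [NormedAddCommGroup H] [InnerProductSpace ℝ H]

/-- Reindexing by the common value j = s + i = s' + i', the time at which a window ends; J only has
to contain all such values. -/
theorem toeplitzForm_eq_sum (I J : Finset ℤ) (k : ℕ) (hJ : ∀ s ∈ I, ∀ i < k, s + (i : ℕ) ∈ J)
    (b : ℤ → ℤ → H →ₗ[ℝ] H →ₗ[ℝ] ℝ) (v : ℕ → H) :
    toeplitzForm I k b v = ∑ i ∈ Finset.range k, ∑ i' ∈ Finset.range k, ∑ j ∈ J,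
      if j - i ∈ I ∧ j - i' ∈ I then b (j - i) (j - i') (v i) (v i') else 0 := by
  refine Finset.sum_congr rfl fun i hi => Finset.sum_congr rfl fun i' hi' => ?_
  have e1 : ∀ s ∈ I, (∑ s' ∈ I, if s + i = s' + i' then b s s' (v i) (v i') else 0) =
      if s + i - i' ∈ I then b s (s + i - i') (v i) (v i') else 0 := by
    intro s _
    rw [← Finset.sum_ite_eq I (s + i - i') fun s' => b s s' (v i) (v i')]
    exact Finset.sum_congr rfl fun s' _ => if_congr (by omega) rfl rfl
  rw [Finset.sum_congr rfl e1]
  have e2 : ∑ j ∈ J, (if j - (i : ℤ) ∈ I ∧ j - (i' : ℤ) ∈ I then b (j - i) (j - i') (v i) (v i')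
      else 0) =
      ∑ j ∈ J with j - (i : ℤ) ∈ I,
        if j - (i' : ℤ) ∈ I then b (j - i) (j - i') (v i) (v i') else 0 := by
    rw [Finset.sum_filter]
    exact Finset.sum_congr rfl fun j _ => ite_and _ _ _ _
  rw [e2]
  refine Finset.sum_bij (fun s _ => s + i) (fun s hs => ?_) (fun s _ t _ h => add_right_cancel h)
    (fun j hj => ?_) fun s _ => ?_
  · rw [Finset.mem_filter]
    exact ⟨hJ s hs i (Finset.mem_range.mp hi), by simpa using hs⟩
  · rw [Finset.mem_filter] at hj
    exact ⟨j - i, hj.2, by ring⟩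
  · rw [add_sub_cancel_right]

/-- The part of `∑_i ⟨x_{j-i}, v_i⟩` with time indices in `I`. -/
noncomputable def bandSum (x : ℤ → H) (I : Finset ℤ) (k : ℕ) (v : ℕ → H) (j : ℤ) : ℝ :=
  ∑ i ∈ Finset.range k, if j - i ∈ I then ⟪x (j - i), v i⟫_ℝ else 0

theorem toeplitzForm_tensor (x : ℤ → H) (I J : Finset ℤ) (k : ℕ)
    (hJ : ∀ s ∈ I, ∀ i < k, s + (i : ℕ) ∈ J) (v : ℕ → H) :
    toeplitzForm I k (fun s s' => opForm (tensor (x s) (x s'))) v =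
      ∑ j ∈ J, bandSum x I k v j ^ 2 := by
  rw [toeplitzForm_eq_sum I J k hJ]
  simp only [bandSum, pow_two, Finset.sum_mul_sum]
  rw [Finset.sum_comm (s := J)]
  refine Finset.sum_congr rfl fun i _ => ?_
  rw [Finset.sum_comm (s := J)]
  refine Finset.sum_congr rfl fun i' _ => Finset.sum_congr rfl fun j _ => ?_
  rw [ite_and, ite_mul, zero_mul, mul_ite, mul_zero, opForm_apply, tensor_apply,
    real_inner_smul_left]

/-- The quadratic form `∑_{i,i'} ⟨C_{i-i'} v_i, v_{i'}⟩`. -/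
noncomputable def covForm (C : ℤ → H →L[ℝ] H) (k : ℕ) (v : ℕ → H) : ℝ :=
  ∑ i ∈ Finset.range k, ∑ i' ∈ Finset.range k, ⟪C ((i : ℤ) - i') (v i), v i'⟫_ℝ

/-- Schur's test: every row and every column of the kernel sums to at most Σ_h ‖C_h‖. -/
theorem sum_norm_kernel_le {C : ℤ → H →L[ℝ] H} (hC : Summable fun h => ‖C h‖) (k : ℕ)
    (v : ℕ → H) : ∑ i ∈ Finset.range k, ∑ i' ∈ Finset.range k,
      ‖C ((i : ℤ) - i')‖ * (‖v i‖ * ‖v i'‖) ≤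
      (∑' h, ‖C h‖) * ∑ i ∈ Finset.range k, ‖v i‖ ^ 2 := by
  have hrow : ∀ f : ℕ → ℤ, Function.Injective f →
      ∑ i ∈ Finset.range k, ‖C (f i)‖ ≤ ∑' h, ‖C h‖ := fun f hf => by
    rw [← Finset.sum_image (f := fun h => ‖C h‖) (s := Finset.range k) (g := f)
      fun _ _ _ _ h => hf h]
    exact hC.sum_le_tsum _ fun _ _ => norm_nonneg _
  calc _ ≤ ∑ i ∈ Finset.range k, ∑ i' ∈ Finset.range k,
        (‖C ((i : ℤ) - i')‖ * (‖v i‖ ^ 2 / 2) + ‖C ((i : ℤ) - i')‖ * (‖v i'‖ ^ 2 / 2)) := by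
        refine Finset.sum_le_sum fun i _ => Finset.sum_le_sum fun i' _ => ?_
        rw [← mul_add]
        refine mul_le_mul_of_nonneg_left ?_ (norm_nonneg _)
        nlinarith [sq_nonneg (‖v i‖ - ‖v i'‖)]
    _ = ∑ i ∈ Finset.range k, (∑ i' ∈ Finset.range k, ‖C ((i : ℤ) - i')‖) * (‖v i‖ ^ 2 / 2) +
        ∑ i' ∈ Finset.range k, (∑ i ∈ Finset.range k, ‖C ((i : ℤ) - i')‖) *
          (‖v i'‖ ^ 2 / 2) := by
        simp only [Finset.sum_add_distrib, Finset.sum_mul]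
        congr 1
        exact Finset.sum_comm
    _ ≤ ∑ i ∈ Finset.range k, (∑' h, ‖C h‖) * (‖v i‖ ^ 2 / 2) +
        ∑ i' ∈ Finset.range k, (∑' h, ‖C h‖) * (‖v i'‖ ^ 2 / 2) := by
        gcongr with i _ i' _
        · exact hrow (fun i' => (i : ℤ) - i') fun a b h => by simpa using h
        · exact hrow (fun i => (i : ℤ) - i') fun a b h => by simpa using h
    _ = _ := by
        rw [← Finset.mul_sum, ← Finset.sum_div]
        ring

theorem abs_covForm_le {C : ℤ → H →L[ℝ] H} (hC : Summable fun h => ‖C h‖) (k : ℕ) (v : ℕ → H) :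
    |covForm C k v| ≤ (∑' h, ‖C h‖) * ∑ i ∈ Finset.range k, ‖v i‖ ^ 2 := by
  refine le_trans ?_ (sum_norm_kernel_le hC k v)
  refine (Finset.abs_sum_le_sum_abs _ _).trans (Finset.sum_le_sum fun i _ =>
    (Finset.abs_sum_le_sum_abs _ _).trans (Finset.sum_le_sum fun i' _ => ?_))
  refine (abs_real_inner_le_norm _ _).trans ?_
  rw [← mul_assoc]
  exact mul_le_mul_of_nonneg_right ((C _).le_opNorm _) (norm_nonneg _)

/-- For given coordinates i, i' the admissible times form an interval whose length differs from N by
at most k, and the summand depends on i - i' only. -/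
theorem abs_toeplitzForm_sub_covForm_le {C : ℤ → H →L[ℝ] H} (hC : Summable fun h => ‖C h‖)
    (a : ℤ) (N k : ℕ) (v : ℕ → H) :
    |toeplitzForm (Finset.Ico a (a + N)) k (fun s s' => opForm (C (s' - s))) v -
      N * covForm C k v| ≤ k * ((∑' h, ‖C h‖) * ∑ i ∈ Finset.range k, ‖v i‖ ^ 2) := by
  rw [toeplitzForm_eq_sum (Finset.Ico a (a + N)) (Finset.Ico a (a + N + k)) k
    (fun s hs i hi => by rw [Finset.mem_Ico] at hs ⊢; omega)]
  refine le_trans ?_ (mul_le_mul_of_nonneg_left (sum_norm_kernel_le hC k v) (Nat.cast_nonneg k))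
  simp only [covForm, Finset.mul_sum, ← Finset.sum_sub_distrib]
  refine (Finset.abs_sum_le_sum_abs _ _).trans (Finset.sum_le_sum fun i hi =>
    (Finset.abs_sum_le_sum_abs _ _).trans (Finset.sum_le_sum fun i' hi' => ?_))
  rw [Finset.mem_range] at hi hi'
  have e : ∀ j : ℤ, j - i' - (j - i) = (i : ℤ) - i' := fun j => by ring
  simp only [e]
  rw [← Finset.sum_filter, Finset.sum_const, nsmul_eq_mul, opForm_apply, ← sub_mul, abs_mul]
  have hcard : ((Finset.Ico a (a + N + k)).filter fun j =>
      j - (i : ℤ) ∈ Finset.Ico a (a + N) ∧ j - (i' : ℤ) ∈ Finset.Ico a (a + N)) =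
      Finset.Ico (a + max i i') (a + N + min i i') := by
    ext j
    simp only [Finset.mem_filter, Finset.mem_Ico]
    omega
  rw [hcard, Int.card_Ico]
  refine mul_le_mul ?_ ?_ (abs_nonneg _) (Nat.cast_nonneg _)
  · have : |(((a + N + min (i : ℤ) i' - (a + max (i : ℤ) i')).toNat : ℤ) - N)| ≤ k := by
      rw [abs_le]
      omega
    exact_mod_cast this
  · refine (abs_real_inner_le_norm _ _).trans ?_
    rw [← mul_assoc]
    exact mul_le_mul_of_nonneg_right ((C _).le_opNorm _) (norm_nonneg _)

/-- The quadratic form `∑_i ⟨x_{j-i}, v_i⟩²` over full windows, compared with Toeplitz forms. -/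
theorem toeplitzForm_le_sum (x : ℤ → H) {n k : ℕ} (hk : 1 ≤ k) (hn : k < n) (v : ℕ → H) :
    toeplitzForm (Finset.Ico 1 (1 + (n - 1 : ℕ))) k (fun s s' => opForm (tensor (x s) (x s'))) v ≤
      ∑ j ∈ Finset.Ico (k : ℤ) n, (∑ i ∈ Finset.range k, ⟪x (j - i), v i⟫_ℝ) ^ 2 +
      toeplitzForm (Finset.Ico 1 (1 + (k - 1 : ℕ))) k (fun s s' => opForm (tensor (x s) (x s'))) v +
      toeplitzForm (Finset.Ico ((n - k + 1 : ℕ) : ℤ) ((n - k + 1 : ℕ) + (k - 1 : ℕ))) k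
        (fun s s' => opForm (tensor (x s) (x s'))) v := by
  have hJ : ∀ a b : ℤ, 1 ≤ a → b ≤ n → ∀ s ∈ Finset.Ico a b, ∀ i < k,
      s + (i : ℕ) ∈ Finset.Ico (1 : ℤ) (n + k) := fun a b ha hb s hs i hi => by
    rw [Finset.mem_Ico] at hs ⊢; omega
  rw [toeplitzForm_tensor x _ _ k (hJ _ _ le_rfl (by omega)),
    toeplitzForm_tensor x _ _ k (hJ _ _ le_rfl (by omega)),
    toeplitzForm_tensor x _ _ k (hJ _ _ (by omega) (by omega))]
  have hsub : Finset.Ico (k : ℤ) n ⊆ Finset.Ico (1 : ℤ) (n + k) :=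
    Finset.Ico_subset_Ico (by omega) (by omega)
  rw [Finset.sum_subset_zero_on_sdiff (g := fun j => if j ∈ Finset.Ico (k : ℤ) n then
    (∑ i ∈ Finset.range k, ⟪x (j - i), v i⟫_ℝ) ^ 2 else 0) hsub
    (fun j hj => if_neg (Finset.mem_sdiff.mp hj).2) (fun j hj => (if_pos hj).symm),
    ← Finset.sum_add_distrib, ← Finset.sum_add_distrib]
  refine Finset.sum_le_sum fun j hj => ?_
  rw [Finset.mem_Ico] at hj
  -- An incomplete window at the start (j < k) meets only the first k - 1 times, one at the end (j ≥
  -- n) only the last k - 1. Each kind is therefore a term of one of the two short Toeplitz forms.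
  rcases lt_or_ge j k with h1 | h1
  · have : bandSum x (Finset.Ico 1 (1 + (n - 1 : ℕ))) k v j =
        bandSum x (Finset.Ico 1 (1 + (k - 1 : ℕ))) k v j := by
      refine Finset.sum_congr rfl fun i hi => if_congr ?_ rfl rfl
      simp only [Finset.mem_Ico]
      omega
    rw [this]
    have : (0 : ℝ) ≤ if j ∈ Finset.Ico (k : ℤ) n then
        (∑ i ∈ Finset.range k, ⟪x (j - i), v i⟫_ℝ) ^ 2 else 0 := by split_ifs <;> positivity
    nlinarith [sq_nonneg (bandSum x (Finset.Ico ((n - k + 1 : ℕ) : ℤ)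
      ((n - k + 1 : ℕ) + (k - 1 : ℕ))) k v j)]
  · rcases lt_or_ge j n with h2 | h2
    · rw [if_pos (Finset.mem_Ico.mpr ⟨h1, h2⟩)]
      have : bandSum x (Finset.Ico 1 (1 + (n - 1 : ℕ))) k v j =
          ∑ i ∈ Finset.range k, ⟪x (j - i), v i⟫_ℝ := by
        refine Finset.sum_congr rfl fun i hi => if_pos ?_
        rw [Finset.mem_range] at hi
        rw [Finset.mem_Ico]
        omega
      rw [this, add_assoc]
      exact le_add_of_nonneg_right (by positivity)
    · have : bandSum x (Finset.Ico 1 (1 + (n - 1 : ℕ))) k v j =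
          bandSum x (Finset.Ico ((n - k + 1 : ℕ) : ℤ) ((n - k + 1 : ℕ) + (k - 1 : ℕ))) k v j := by
        refine Finset.sum_congr rfl fun i hi => if_congr ?_ rfl rfl
        rw [Finset.mem_range] at hi
        simp only [Finset.mem_Ico]
        omega
      rw [this]
      refine le_add_of_nonneg_left (add_nonneg ?_ (sq_nonneg _))
      split_ifs <;> positivity

end Toeplitz

/-! ### The spectral density and the covariance form -/

section Spectral

open scoped ComplexOrder

variable {Ω H : Type*} [MeasurableSpace Ω] {μ : Measure Ω} [IsProbabilityMeasure μ]
  [NormedAddCommGroup H] [InnerProductSpace ℝ H] [CompleteSpace H]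
  [MeasurableSpace H] [BorelSpace H] [SecondCountableTopology H]
  {X ε : ℤ → Ω → H} {ψ : ℕ → H →L[ℝ] H}

namespace IsProc

theorem memLp_sum_inner (hX : IsProc μ X ε ψ) (k : ℕ) (v : ℕ → H) :
    MemLp (fun ω => ∑ i ∈ Finset.range k, ⟪X (-i) ω, v i⟫_ℝ) 2 μ :=
  memLp_finsetSum _ fun i _ => (hX.memLp_two (-i)).inner_const (v i)

theorem covForm_eq (hX : IsProc μ X ε ψ) (k : ℕ) (v : ℕ → H) :
    covForm (lagCov μ X) k v = ∫ ω, (∑ i ∈ Finset.range k, ⟪X (-i) ω, v i⟫_ℝ) ^ 2 ∂μ := by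
  simp only [pow_two, Finset.sum_mul_sum]
  rw [integral_finsetSum _ fun m _ => integrable_finsetSum _ fun m' _ =>
    hX.integrable_inner_mul _ _ _ _]
  refine Finset.sum_congr rfl fun i _ => ?_
  rw [integral_finsetSum _ fun m' _ => hX.integrable_inner_mul _ _ _ _]
  refine Finset.sum_congr rfl fun i' _ => ?_
  rw [← hX.inner_lagCov]
  congr 3
  ring

/-- Pointwise (a + b)² ≥ a²/2 - b², integrated. -/
theorem covForm_add_ge (hX : IsProc μ X ε ψ) (k : ℕ) (u v : ℕ → H) :
    covForm (lagCov μ X) k u / 2 - covForm (lagCov μ X) k v ≤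
      covForm (lagCov μ X) k (fun i => u i + v i) := by
  have hi := fun w => (hX.memLp_sum_inner k w).integrable_sq
  rw [hX.covForm_eq, hX.covForm_eq, hX.covForm_eq, ← integral_div,
    ← integral_sub ((hi u).div_const 2) (hi v)]
  refine integral_mono (((hi u).div_const 2).sub (hi v)) (hi _) fun ω => ?_
  simp only [inner_add_right, Finset.sum_add_distrib]
  generalize ∑ i ∈ Finset.range k, ⟪X (-i) ω, u i⟫_ℝ = a
  generalize ∑ i ∈ Finset.range k, ⟪X (-i) ω, v i⟫_ℝ = b
  nlinarith [sq_nonneg (a + 2 * b)]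

theorem inner_lagCov_neg (hX : IsProc μ X ε ψ) (h : ℤ) (u v : H) :
    ⟪lagCov μ X (-h) u, v⟫_ℝ = ⟪u, lagCov μ X h v⟫_ℝ := by
  have h1 := hX.inner_lagCov h 0 u v
  rw [zero_sub] at h1
  rw [h1, ← real_inner_comm, hX.inner_lagCov_zero]
  simp only [mul_comm]

end IsProc

/-- The matrix entries of the spectral density. -/
noncomputable def specEntry (μ : Measure Ω) (X : ℤ → Ω → H) (e : ℕ → H) (t : ℝ) (r s : ℕ) : ℂ :=
  (1 / (2 * Real.pi) : ℂ) *
    ∑' h : ℤ, Complex.exp (-Complex.I * h * t) * ((inner ℝ (e r) (lagCov μ X h (e s)) : ℝ) : ℂ)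

/-- The sesquilinear form of the spectral density. -/
noncomputable def specForm (μ : Measure Ω) (X : ℤ → Ω → H) (e : ℕ → H) (t : ℝ) (d : ℕ)
    (z : ℕ → ℂ) : ℂ :=
  ∑ r ∈ Finset.range d, ∑ s ∈ Finset.range d, star (z r) * (specEntry μ X e t r s * z s)

theorem star_dotProduct_specDensity (e : ℕ → H) (d : ℕ) (t : ℝ) (z : ℕ → ℂ) :
    star (fun i : Fin d => z i) ⬝ᵥ (specDensity μ X e d t).mulVec (fun i : Fin d => z i) =
      specForm μ X e t d z := by
  simp only [dotProduct, Matrix.mulVec, specForm, Finset.mul_sum, Finset.sum_range]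
  rfl

namespace IsProc

theorem summable_specEntry (hX : IsProc μ X ε ψ) (t : ℝ) (u v : H) :
    Summable fun h : ℤ => Complex.exp (-Complex.I * h * t) *
      ((inner ℝ u (lagCov μ X h v) : ℝ) : ℂ) := by
  refine Summable.of_norm_bounded (hX.summable_norm_lagCov.mul_right (‖u‖ * ‖v‖)) fun h => ?_
  have : -Complex.I * h * t = ((-(h * t) : ℝ) : ℂ) * Complex.I := by push_cast; ring
  rw [norm_mul, this, Complex.norm_exp_ofReal_mul_I, one_mul, Complex.norm_real]
  refine (norm_inner_le_norm u _).trans ?_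
  have := (lagCov μ X h).le_opNorm v
  nlinarith [norm_nonneg u]

theorem isHermitian_specDensity (hX : IsProc μ X ε ψ) (e : ℕ → H) (d : ℕ) (t : ℝ) :
    (specDensity μ X e d t).IsHermitian := by
  ext r s
  rw [Matrix.conjTranspose_apply]
  change star (specEntry μ X e t s r) = specEntry μ X e t r s
  rw [specEntry, specEntry, star_mul', tsum_star]
  congr 1
  · simp
  rw [← (Equiv.neg ℤ).tsum_eq]
  refine tsum_congr fun h => ?_
  rw [star_mul', Equiv.neg_apply]
  congr 1
  · rw [Complex.star_def, ← Complex.exp_conj]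
    congr 1
    simp
  · rw [real_inner_comm, hX.inner_lagCov_neg]
    exact Complex.conj_ofReal _

/-- The spectral density minus α is Hermitian with nonnegative eigenvalues, since an eigenvalue of
the difference shifted by α belongs to the set whose infimum is α. -/
theorem alpha_le_re_specForm (hX : IsProc μ X ε ψ) (e : ℕ → H) (d : ℕ)
    (hα : 0 < alpha μ X e d) {t : ℝ} (ht : t ∈ Set.Icc (-Real.pi) Real.pi) (z : ℕ → ℂ) :
    alpha μ X e d * ∑ s ∈ Finset.range d, ‖z s‖ ^ 2 ≤ (specForm μ X e t d z).re := by
  set F := specDensity μ X e d t with hF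
  have hH : F.IsHermitian := hX.isHermitian_specDensity e d t
  set a := alpha μ X e d with ha
  -- The infimum of a set that is unbounded below is 0 by convention, so positivity of α yields
  -- boundedness.
  have hbdd : BddBelow {a : ℝ | ∃ t ∈ Set.Icc (-Real.pi) Real.pi,
      Module.End.HasEigenvalue (Matrix.toLin' (specDensity μ X e d t)) (a : ℂ)} := by
    by_contra h
    rw [ha, alpha, Real.sInf_of_not_bddBelow h] at hα
    exact lt_irrefl _ hα
  have hH' : (F - (a : ℂ) • (1 : Matrix (Fin d) (Fin d) ℂ)).IsHermitian := by
    refine hH.sub ?_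
    rw [Matrix.IsHermitian, Matrix.conjTranspose_smul, Matrix.conjTranspose_one]
    simp
  have hpos : (F - (a : ℂ) • (1 : Matrix (Fin d) (Fin d) ℂ)).PosSemidef := by
    rw [hH'.posSemidef_iff_eigenvalues_nonneg]
    intro j
    have h1 := hH'.mulVec_eigenvectorBasis j
    rw [Matrix.sub_mulVec, Matrix.smul_mulVec, Matrix.one_mulVec, sub_eq_iff_eq_add] at h1
    have h2 : Module.End.HasEigenvalue (Matrix.toLin' F) ((hH'.eigenvalues j + a : ℝ) : ℂ) := by
      refine Module.End.hasEigenvalue_of_hasEigenvector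
        (x := (hH'.eigenvectorBasis j).ofLp) ⟨?_, ?_⟩
      · rw [Module.End.mem_eigenspace_iff, Matrix.toLin'_apply, h1]
        push_cast
        rw [add_smul]
        rfl
      · intro h0
        have := hH'.eigenvectorBasis.orthonormal.ne_zero j
        exact this (by ext i; exact congrFun h0 i)
    have h3 : a ≤ hH'.eigenvalues j + a := csInf_le hbdd ⟨t, ht, h2⟩
    change 0 ≤ _
    linarith
  have h4 := hpos.re_dotProduct_nonneg (fun i : Fin d => z i)
  rw [Matrix.sub_mulVec, Matrix.smul_mulVec, Matrix.one_mulVec, dotProduct_sub, dotProduct_smul,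
    hF, star_dotProduct_specDensity] at h4
  have h5 : star (fun i : Fin d => z i) ⬝ᵥ (fun i : Fin d => z i) =
      ((∑ s ∈ Finset.range d, ‖z s‖ ^ 2 : ℝ) : ℂ) := by
    rw [Finset.sum_range, dotProduct]
    push_cast
    refine Finset.sum_congr rfl fun i _ => ?_
    rw [Pi.star_apply, Complex.star_def, mul_comm, Complex.mul_conj, Complex.normSq_eq_norm_sq]
    push_cast
    rfl
  rw [h5, smul_eq_mul, ← Complex.ofReal_mul] at h4
  change 0 ≤ (_ - _ : ℂ).re at h4
  rw [Complex.sub_re, Complex.ofReal_re] at h4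
  linarith

/-- An eigenvector for dimension d, extended by zero, has the same Rayleigh quotient in dimension
d'. -/
theorem alpha_antitone (hX : IsProc μ X ε ψ) (e : ℕ → H) {d d' : ℕ} (hd : d ≤ d')
    (hα : 0 < alpha μ X e d) (hα' : 0 < alpha μ X e d') : alpha μ X e d' ≤ alpha μ X e d := by
  -- The infimum of the empty set is 0 by convention, so positivity of α yields nonemptiness.
  have hne : {a : ℝ | ∃ t ∈ Set.Icc (-Real.pi) Real.pi,
      Module.End.HasEigenvalue (Matrix.toLin' (specDensity μ X e d t)) (a : ℂ)}.Nonempty := by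
    by_contra h
    rw [Set.not_nonempty_iff_eq_empty] at h
    rw [alpha, h, Real.sInf_empty] at hα
    exact lt_irrefl _ hα
  refine le_csInf hne ?_
  rintro a ⟨t, ht, hev⟩
  obtain ⟨w, hw⟩ := hev.exists_hasEigenvector
  set z : ℕ → ℂ := fun i => if h : i < d then w ⟨i, h⟩ else 0 with hz
  have hzw : (fun i : Fin d => z i) = w := by
    ext i
    simp [hz]
  have h1 := hX.alpha_le_re_specForm e d' hα' ht z
  have hz0 : ∀ i ∈ Finset.range d', i ∉ Finset.range d → z i = 0 := fun i _ hi => by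
    rw [Finset.mem_range] at hi
    simp [hz, hi]
  have hsub : Finset.range d ⊆ Finset.range d' := Finset.range_subset_range.mpr hd
  have h2 : specForm μ X e t d' z = specForm μ X e t d z := by
    symm
    refine Finset.sum_subset_zero_on_sdiff hsub (fun r hr => ?_) fun r _ => ?_
    · rw [Finset.mem_sdiff] at hr
      simp [hz0 r hr.1 hr.2]
    · refine Finset.sum_subset hsub fun s hs hs' => ?_
      simp [hz0 s hs hs']
  have h3 : ∑ s ∈ Finset.range d', ‖z s‖ ^ 2 = ∑ s ∈ Finset.range d, ‖z s‖ ^ 2 := by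
    symm
    refine Finset.sum_subset hsub fun s hs hs' => ?_
    simp [hz0 s hs hs']
  have h5 : star (fun i : Fin d => z i) ⬝ᵥ (fun i : Fin d => z i) =
      ((∑ s ∈ Finset.range d, ‖z s‖ ^ 2 : ℝ) : ℂ) := by
    rw [Finset.sum_range, dotProduct]
    push_cast
    refine Finset.sum_congr rfl fun i _ => ?_
    rw [Pi.star_apply, Complex.star_def, mul_comm, Complex.mul_conj, Complex.normSq_eq_norm_sq]
    push_cast
    rfl
  have h4 : specForm μ X e t d z = ((a * ∑ s ∈ Finset.range d, ‖z s‖ ^ 2 : ℝ) : ℂ) := by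
    have hw1 := hw.apply_eq_smul
    rw [Matrix.toLin'_apply] at hw1
    rw [← star_dotProduct_specDensity, hzw, hw1, dotProduct_smul, ← hzw, h5, smul_eq_mul]
    push_cast
    rfl
  rw [h2, h3, h4, Complex.ofReal_re] at h1
  refine le_of_mul_le_mul_right h1 ?_
  obtain ⟨i, hi⟩ := Function.ne_iff.mp hw.2
  refine Finset.sum_pos' (fun _ _ => by positivity) ⟨i, Finset.mem_range.mpr i.2, ?_⟩
  have : z i = w i := congrFun hzw i
  rw [this]
  have := norm_pos_iff.mpr hi
  positivity

end IsProc

theorem integral_cos_int (m : ℤ) :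
    ∫ t in (-Real.pi)..Real.pi, Real.cos (m * t) = if m = 0 then 2 * Real.pi else 0 := by
  split_ifs with h
  · simp [h]; ring
  · have hm : (m : ℝ) ≠ 0 := by exact_mod_cast h
    rw [intervalIntegral.integral_comp_mul_left (fun x => Real.cos x) hm, integral_cos, mul_neg,
      Real.sin_neg, Real.sin_int_mul_pi]
    simp

/-- With z = a + ib the transform of v at frequency t, the left side is Re(e^{-iht} ⟨z, T z⟩). It is
used for T = C_h, and for T = id with h = 0, which gives the norm of z. -/
theorem inner_cos_sin_eq (T : H →L[ℝ] H) (h : ℤ) (k : ℕ) (v : ℕ → H) (t : ℝ) (a b : H)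
    (ha : a = ∑ i ∈ Finset.range k, Real.cos (i * t) • v i)
    (hb : b = ∑ i ∈ Finset.range k, Real.sin (i * t) • v i) :
    Real.cos (h * t) * (⟪a, T a⟫_ℝ + ⟪b, T b⟫_ℝ) + Real.sin (h * t) * (⟪a, T b⟫_ℝ - ⟪b, T a⟫_ℝ) =
      ∑ i ∈ Finset.range k, ∑ i' ∈ Finset.range k,
        Real.cos (((i : ℤ) - i' - h : ℤ) * t) * ⟪T (v i), v i'⟫_ℝ := by
  have key : ∀ f g : ℕ → ℝ, ⟪∑ i ∈ Finset.range k, f i • v i,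
      T (∑ i ∈ Finset.range k, g i • v i)⟫_ℝ =
      ∑ i ∈ Finset.range k, ∑ i' ∈ Finset.range k, g i * f i' * ⟪T (v i), v i'⟫_ℝ := by
    intro f g
    rw [map_sum, real_inner_comm, sum_inner]
    refine Finset.sum_congr rfl fun i _ => ?_
    rw [map_smul, inner_sum]
    refine Finset.sum_congr rfl fun i' _ => ?_
    rw [real_inner_smul_left, real_inner_smul_right]
    ring
  rw [ha, hb, key, key, key, key]
  simp only [← Finset.sum_add_distrib, ← Finset.sum_sub_distrib, Finset.mul_sum]
  refine Finset.sum_congr rfl fun i _ => Finset.sum_congr rfl fun i' _ => ?_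
  have : ((((i : ℤ) - i' - h : ℤ) : ℝ)) * t = (i * t - i' * t) - h * t := by push_cast; ring
  rw [this, Real.cos_sub, Real.cos_sub, Real.sin_sub]
  ring

namespace IsProc

theorem hasSum_re_specForm (hX : IsProc μ X ε ψ) (e : HilbertBasis ℕ ℝ H) (d : ℕ) (t : ℝ)
    {a b : H} (ha : projSpan e d a = a) (hb : projSpan e d b = b) :
    HasSum (fun h : ℤ => (2 * Real.pi)⁻¹ * (Real.cos (h * t) *
      (⟪a, lagCov μ X h a⟫_ℝ + ⟪b, lagCov μ X h b⟫_ℝ) +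
      Real.sin (h * t) * (⟪a, lagCov μ X h b⟫_ℝ - ⟪b, lagCov μ X h a⟫_ℝ)))
      (specForm μ X e t d fun s => (⟪e s, a⟫_ℝ : ℂ) + (⟪e s, b⟫_ℝ : ℂ) * Complex.I).re := by
  set z : ℕ → ℂ := fun s => (⟪e s, a⟫_ℝ : ℂ) + (⟪e s, b⟫_ℝ : ℂ) * Complex.I with hz
  have h1 : HasSum (fun h : ℤ => ∑ r ∈ Finset.range d, ∑ s ∈ Finset.range d,
      star (z r) * ((1 / (2 * Real.pi) : ℂ) * (Complex.exp (-Complex.I * h * t) *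
        ((inner ℝ (e r) (lagCov μ X h (e s)) : ℝ) : ℂ)) * z s)) (specForm μ X e t d z) := by
    refine hasSum_sum fun r _ => hasSum_sum fun s _ => ?_
    exact (((hX.summable_specEntry t (e r) (e s)).hasSum.mul_left _).mul_right _).mul_left _
  have h2 := Complex.hasSum_re h1
  convert h2 using 2 with h
  have hC : ∀ {u w : H}, projSpan e d u = u → projSpan e d w = w → ⟪u, lagCov μ X h w⟫_ℝ =
      ∑ r ∈ Finset.range d, ∑ s ∈ Finset.range d,
        ⟪e r, u⟫_ℝ * ⟪e s, w⟫_ℝ * ⟪e r, lagCov μ X h (e s)⟫_ℝ := by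
    intro u w hu hw
    conv_lhs => rw [← hu, ← hw, projSpan_apply e.orthonormal, projSpan_apply e.orthonormal, map_sum,
      sum_inner]
    refine Finset.sum_congr rfl fun r _ => ?_
    rw [inner_sum]
    refine Finset.sum_congr rfl fun s _ => ?_
    rw [map_smul, real_inner_smul_left, real_inner_smul_right]
    ring
  rw [hC ha ha, hC ha hb, hC hb ha, hC hb hb]
  have he : Complex.exp (-Complex.I * h * t) =
      (Real.cos (h * t) : ℂ) - (Real.sin (h * t) : ℂ) * Complex.I := by
    have : -Complex.I * h * t = ((-(h * t) : ℝ) : ℂ) * Complex.I := by push_cast; ring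
    rw [this, Complex.exp_mul_I, ← Complex.ofReal_cos, ← Complex.ofReal_sin, Real.cos_neg,
      Real.sin_neg]
    push_cast
    ring
  simp only [← Finset.sum_add_distrib, ← Finset.sum_sub_distrib, Finset.mul_sum, Complex.re_sum]
  refine Finset.sum_congr rfl fun r _ => Finset.sum_congr rfl fun s _ => ?_
  have h3 : (1 / (2 * Real.pi) : ℂ) = (((2 * Real.pi)⁻¹ : ℝ) : ℂ) := by push_cast; ring
  rw [he, h3]
  simp only [hz, Complex.star_def, map_add, map_mul, Complex.conj_ofReal, Complex.conj_I,
    Complex.mul_re, Complex.mul_im, Complex.add_re, Complex.add_im, Complex.sub_re, Complex.sub_im,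
    Complex.ofReal_re, Complex.ofReal_im, Complex.I_re, Complex.I_im, Complex.neg_re,
    Complex.neg_im]
  ring

/-- The Rayleigh bound at the transform z(t) of v is integrated over [-π, π]. On the left,
orthogonality of the exponentials leaves 2π Σ‖v_i‖². On the right it selects the lag h = i - i', and
the normalization (2π)⁻¹ of the density cancels the length of the period. -/
theorem two_pi_mul_alpha_le_covForm (hX : IsProc μ X ε ψ) (e : HilbertBasis ℕ ℝ H) (d : ℕ)
    (hα : 0 < alpha μ X e d) (k : ℕ) (v : ℕ → H) (hv : ∀ i, projSpan e d (v i) = v i) :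
    2 * Real.pi * alpha μ X e d * ∑ i ∈ Finset.range k, ‖v i‖ ^ 2 ≤
      covForm (lagCov μ X) k v := by
  set a : ℝ → H := fun t => ∑ i ∈ Finset.range k, Real.cos (i * t) • v i with ha
  set b : ℝ → H := fun t => ∑ i ∈ Finset.range k, Real.sin (i * t) • v i with hb
  have hpa : ∀ t, projSpan e d (a t) = a t := fun t => by simp only [ha, map_sum, map_smul, hv]
  have hpb : ∀ t, projSpan e d (b t) = b t := fun t => by simp only [hb, map_sum, map_smul, hv]
  set g : ℤ → ℝ → ℝ := fun h t => (2 * Real.pi)⁻¹ * ∑ i ∈ Finset.range k, ∑ i' ∈ Finset.range k,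
        Real.cos (((i : ℤ) - i' - h : ℤ) * t) * ⟪lagCov μ X h (v i), v i'⟫_ℝ with hg
  set f : ℝ → ℝ := fun t => ∑ i ∈ Finset.range k, ∑ i' ∈ Finset.range k,
        Real.cos (((i : ℤ) - i' : ℤ) * t) * ⟪v i, v i'⟫_ℝ with hf
  set G : ℝ → ℝ := fun t => ∑' h, g h t with hG
  have hpi := Real.pi_pos
  have hgb : ∀ h t, ‖g h t‖ ≤ ‖lagCov μ X h‖ * ((2 * Real.pi)⁻¹ *
      ∑ i ∈ Finset.range k, ∑ i' ∈ Finset.range k, ‖v i‖ * ‖v i'‖) := by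
    intro h t
    rw [hg, norm_mul, mul_left_comm, Real.norm_of_nonneg (by positivity)]
    refine mul_le_mul_of_nonneg_left ?_ (by positivity)
    simp only [Finset.mul_sum]
    refine (norm_sum_le _ _).trans (Finset.sum_le_sum fun i _ =>
      (norm_sum_le _ _).trans (Finset.sum_le_sum fun i' _ => ?_))
    rw [norm_mul, ← mul_assoc, ← one_mul (‖lagCov μ X h‖ * ‖v i‖ * ‖v i'‖)]
    refine mul_le_mul (Real.abs_cos_le_one _) ?_ (norm_nonneg _) zero_le_one
    exact (norm_inner_le_norm _ _).trans
      (mul_le_mul_of_nonneg_right ((lagCov μ X h).le_opNorm _) (norm_nonneg _))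
  have hsum := hX.summable_norm_lagCov.mul_right ((2 * Real.pi)⁻¹ *
      ∑ i ∈ Finset.range k, ∑ i' ∈ Finset.range k, ‖v i‖ * ‖v i'‖)
  have hgc : ∀ h, Continuous (g h) := fun h => by fun_prop
  have hGc : Continuous G := continuous_tsum hgc hsum hgb
  have hfc : Continuous f := by fun_prop
  have hle : ∀ t ∈ Set.Icc (-Real.pi) Real.pi, alpha μ X e d * f t ≤ G t := by
    intro t ht
    have h1 := hX.alpha_le_re_specForm e d hα ht
      fun s => (⟪e s, a t⟫_ℝ : ℂ) + (⟪e s, b t⟫_ℝ : ℂ) * Complex.I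
    have h2 := hX.hasSum_re_specForm e d t (hpa t) (hpb t)
    simp only [inner_cos_sin_eq _ _ k v t (a t) (b t) rfl rfl] at h2
    have h2' : HasSum (fun h => g h t) _ := h2
    rw [← h2'.tsum_eq] at h1
    refine le_trans (le_of_eq ?_) h1
    congr 1
    have h3 := inner_cos_sin_eq (ContinuousLinearMap.id ℝ H) 0 k v t (a t) (b t) rfl rfl
    simp only [Int.cast_zero, zero_mul, Real.cos_zero, one_mul, Real.sin_zero, add_zero, sub_zero,
      ContinuousLinearMap.id_apply] at h3
    rw [hf]
    simp only
    rw [← h3, ← hpa t, ← hpb t]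
    have hn : ∀ u : H, ⟪projSpan e d u, projSpan e d u⟫_ℝ =
        ∑ s ∈ Finset.range d, ⟪e s, u⟫_ℝ ^ 2 := fun u => by
      rw [projSpan_apply e.orthonormal, e.orthonormal.inner_sum]
      simp [pow_two]
    rw [hn, hn, ← Finset.sum_add_distrib, hpa, hpb]
    refine Finset.sum_congr rfl fun s _ => ?_
    rw [← Complex.normSq_eq_norm_sq, Complex.normSq_add_mul_I]
  have hint : ∫ t in (-Real.pi)..Real.pi, alpha μ X e d * f t ≤
      ∫ t in (-Real.pi)..Real.pi, G t :=
    intervalIntegral.integral_mono_on (by linarith) ((hfc.const_mul _).intervalIntegrable _ _)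
      (hGc.intervalIntegrable _ _) hle
  have hF : ∫ t in (-Real.pi)..Real.pi, f t = 2 * Real.pi * ∑ i ∈ Finset.range k, ‖v i‖ ^ 2 := by
    rw [hf, intervalIntegral.integral_finsetSum fun i _ =>
      (Continuous.intervalIntegrable (by fun_prop) _ _), Finset.mul_sum]
    refine Finset.sum_congr rfl fun i hi => ?_
    rw [intervalIntegral.integral_finsetSum fun i _ =>
      (Continuous.intervalIntegrable (by fun_prop) _ _)]
    simp only [intervalIntegral.integral_mul_const, integral_cos_int]
    rw [Finset.sum_eq_single_of_mem i hi fun i' _ hne => by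
      rw [if_neg (by omega), zero_mul]]
    simp
  have hGi : HasSum (fun h => ∫ t in (-Real.pi)..Real.pi, g h t)
      (∫ t in (-Real.pi)..Real.pi, G t) := by
    refine intervalIntegral.hasSum_integral_of_dominated_convergence
      (fun h _ => ‖lagCov μ X h‖ * ((2 * Real.pi)⁻¹ *
        ∑ i ∈ Finset.range k, ∑ i' ∈ Finset.range k, ‖v i‖ * ‖v i'‖))
      (fun h => (hgc h).aestronglyMeasurable) (fun h => ae_of_all _ fun t _ => hgb h t)
      (ae_of_all _ fun t _ => hsum) ?_ (ae_of_all _ fun t _ => ?_)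
    · exact intervalIntegrable_const
    · exact (Summable.of_norm_bounded hsum (hgb · t)).hasSum
  have hgi : ∀ h : ℤ, ∫ t in (-Real.pi)..Real.pi, g h t =
      ∑ i ∈ Finset.range k, ∑ i' ∈ Finset.range k,
        if h = (i : ℤ) - i' then ⟪lagCov μ X ((i : ℤ) - i') (v i), v i'⟫_ℝ else 0 := by
    intro h
    rw [hg]
    simp only
    rw [intervalIntegral.integral_const_mul, intervalIntegral.integral_finsetSum fun i _ =>
      (Continuous.intervalIntegrable (by fun_prop) _ _), Finset.mul_sum]
    refine Finset.sum_congr rfl fun i _ => ?_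
    rw [intervalIntegral.integral_finsetSum fun i _ =>
      (Continuous.intervalIntegrable (by fun_prop) _ _), Finset.mul_sum]
    refine Finset.sum_congr rfl fun i' _ => ?_
    rw [intervalIntegral.integral_mul_const, integral_cos_int]
    by_cases hh : h = (i : ℤ) - i'
    · rw [if_pos hh, if_pos (by omega), ← hh]
      field_simp
    · rw [if_neg hh, if_neg (by omega)]
      ring
  have hGval : ∫ t in (-Real.pi)..Real.pi, G t = covForm (lagCov μ X) k v := by
    refine hGi.unique ?_
    simp only [hgi]
    exact hasSum_sum fun i _ => hasSum_sum fun i' _ => hasSum_ite_eq _ _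
  rw [intervalIntegral.integral_const_mul, hF, hGval] at hint
  linarith

/-- The case of a window of length one, evaluated at the last retained eigenvector. -/
theorem two_pi_mul_alpha_le (hX : IsProc μ X ε ψ) {l : ℕ → ℝ} {e : HilbertBasis ℕ ℝ H}
    (he : IsEigenbasis (lagCov μ X 0) l e) (d : ℕ) (hα : 0 < alpha μ X e (d + 1)) :
    2 * Real.pi * alpha μ X e (d + 1) ≤ l d := by
  have h := hX.two_pi_mul_alpha_le_covForm e (d + 1) hα 1 (fun _ => e d) fun _ => by
    rw [projSpan_apply e.orthonormal, Finset.sum_eq_single_of_mem d (by simp) fun i _ hi => by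
      rw [orthonormal_iff_ite.mp e.orthonormal, if_neg hi, zero_smul]]
    simp [e.orthonormal.1 d]
  simpa [covForm, he.2 d, real_inner_smul_left, e.orthonormal.1 d] using h

end IsProc

end Spectral

/-! ### Cross terms between the process and the noise, and truncation residuals -/

section Cross

variable {Ω H : Type*} [MeasurableSpace Ω] {μ : Measure Ω} [IsProbabilityMeasure μ]
  [NormedAddCommGroup H] [InnerProductSpace ℝ H] [CompleteSpace H]
  [MeasurableSpace H] [BorelSpace H] [SecondCountableTopology H]
  {X ε : ℤ → Ω → H} {ψ : ℕ → H →L[ℝ] H}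

/-- The sum of `ε_{q-1-p} ⊗ ε_q` over `q ∈ J`. -/
noncomputable def crossForm (ε : ℤ → Ω → H) (J : Finset ℤ) (p : ℕ) (ω : Ω) : H ⊗[ℝ] H :=
  ∑ q ∈ J, ε (q - 1 - p) ω ⊗ₜ[ℝ] ε q ω

/-- A bound for the cross terms between windows of the process and the noise. -/
noncomputable def crossDev (ε : ℤ → Ω → H) (ψ : ℕ → H →L[ℝ] H) (J : Finset ℤ) (k : ℕ) (ω : Ω) :
    ℝ≥0∞ :=
  ∑' m, ‖ψ m‖ₑ * (∑ i ∈ Finset.range k, ‖crossForm ε J (i + m) ω‖ₑ ^ 2) ^ (1 / 2 : ℝ)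

namespace IsNoise

theorem aestronglyMeasurable_crossForm (hε : IsNoise μ ε) (J : Finset ℤ) (p : ℕ) :
    AEStronglyMeasurable (crossForm ε J p) μ := by
  refine Finset.aestronglyMeasurable_fun_sum _ fun q _ => ?_
  exact Continuous.comp_aestronglyMeasurable₂ (g := fun x y => x ⊗ₜ[ℝ] y)
    TensorProduct.continuous_tmul (hε.meas _).aestronglyMeasurable
    (hε.meas q).aestronglyMeasurable

theorem aemeasurable_crossDev (hε : IsNoise μ ε) (J : Finset ℤ) (k : ℕ) :
    AEMeasurable (crossDev ε ψ J k) μ :=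
  AEMeasurable.tsum fun m => ((Finset.aemeasurable_fun_sum _ fun i _ =>
    ((hε.aestronglyMeasurable_crossForm J (i + m)).enorm.pow_const 2)).pow_const _).const_mul _

/-- The martingale fourth moment bound with a single earlier index for each q, followed by Jensen to
come down to second moments. -/
theorem lintegral_crossForm_le (hε : IsNoise μ ε) (J : Finset ℤ) (p : ℕ) :
    ∫⁻ ω, ‖crossForm ε J p ω‖ₑ ^ 2 ∂μ ≤
      ENNReal.ofReal (16 * J.card * ∫ ω, ‖ε 0 ω‖ ^ 4 ∂μ) := by
  set M := ∫ ω, ‖ε 0 ω‖ ^ 4 ∂μ with hM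
  have hM0 : 0 ≤ M := integral_nonneg fun ω => by positivity
  obtain ⟨h1, h2⟩ := hε.integral_norm_sum_tmul_pow_four_le J (fun q => {q - 1 - p})
    (fun q _ p' hp => by rw [Finset.mem_singleton] at hp; omega) (fun _ _ => 1)
    (fun _ _ => by simp) (b := 1) (fun q _ => by simp)
  simp only [Finset.sum_singleton, one_smul] at h1 h2
  have h3 : ∫⁻ ω, ‖crossForm ε J p ω‖ₑ ^ 4 ∂μ ≤
      ENNReal.ofReal (16 * (J.card : ℝ) ^ 2 * (16 * ((1 : ℕ) : ℝ) ^ 2 * M ^ 2)) := by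
    refine le_trans (le_of_eq ?_) (ENNReal.ofReal_le_ofReal h2)
    rw [ofReal_integral_eq_lintegral_ofReal h1 (ae_of_all _ fun ω => by positivity)]
    refine lintegral_congr fun ω => ?_
    rw [ENNReal.ofReal_pow (norm_nonneg _), ofReal_norm, crossForm]
  have h4 := lintegral_rpow_inv_le (μ := μ)
    ((hε.aestronglyMeasurable_crossForm J p).enorm.pow_const 4) (p := 2) (by norm_num)
  have e : ∀ x : ℝ≥0∞, (x ^ 4) ^ (1 / 2 : ℝ) = x ^ 2 := fun x => by
    rw [← ENNReal.rpow_natCast, ← ENNReal.rpow_mul, ← ENNReal.rpow_natCast]; norm_num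
  simp only [e] at h4
  refine h4.trans ((ENNReal.rpow_le_rpow h3 (by norm_num)).trans (le_of_eq ?_))
  rw [ENNReal.ofReal_rpow_of_nonneg (by positivity) (by norm_num), ← Real.sqrt_eq_rpow]
  congr 1
  rw [show 16 * (J.card : ℝ) ^ 2 * (16 * ((1 : ℕ) : ℝ) ^ 2 * M ^ 2) = (16 * J.card * M) ^ 2 by
    push_cast; ring, Real.sqrt_sq (by positivity)]

theorem lintegral_crossDev_le (hε : IsNoise μ ε) (hψ : Summable fun m => ‖ψ m‖) (J : Finset ℤ)
    (k : ℕ) : ∫⁻ ω, crossDev ε ψ J k ω ∂μ ≤ ENNReal.ofReal ((∑' m, ‖ψ m‖) *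
      (4 * Real.sqrt (∫ ω, ‖ε 0 ω‖ ^ 4 ∂μ) * Real.sqrt J.card * Real.sqrt k)) := by
  set M := ∫ ω, ‖ε 0 ω‖ ^ 4 ∂μ with hM
  have hM0 : 0 ≤ M := integral_nonneg fun ω => by positivity
  have hm : ∀ m, AEMeasurable (fun ω => ∑ i ∈ Finset.range k, ‖crossForm ε J (i + m) ω‖ₑ ^ 2) μ :=
    fun m => Finset.aemeasurable_fun_sum _ fun i _ =>
      ((hε.aestronglyMeasurable_crossForm J (i + m)).enorm.pow_const 2)
  unfold crossDev
  rw [lintegral_tsum fun m => ((hm m).pow_const _).const_mul _]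
  have hb : ∀ m, ∫⁻ ω, (∑ i ∈ Finset.range k, ‖crossForm ε J (i + m) ω‖ₑ ^ 2) ^ (1 / 2 : ℝ) ∂μ ≤
      ENNReal.ofReal (4 * Real.sqrt M * Real.sqrt J.card * Real.sqrt k) := fun m => by
    refine (lintegral_rpow_inv_le (hm m) (by norm_num)).trans ?_
    rw [lintegral_finsetSum' _ fun i _ =>
      (hε.aestronglyMeasurable_crossForm J (i + m)).enorm.pow_const 2]
    refine (ENNReal.rpow_le_rpow (Finset.sum_le_card_nsmul _ _ _ fun i _ =>
      hε.lintegral_crossForm_le J (i + m)) (by norm_num)).trans (le_of_eq ?_)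
    rw [Finset.card_range, nsmul_eq_mul, ← ENNReal.ofReal_natCast,
      ← ENNReal.ofReal_mul (by positivity), ENNReal.ofReal_rpow_of_nonneg (by positivity)
      (by norm_num), ← Real.sqrt_eq_rpow]
    congr 1
    rw [← hM, show (k : ℝ) * (16 * J.card * M) = 4 ^ 2 * (M * (J.card * k)) by ring,
      Real.sqrt_mul (by positivity), Real.sqrt_sq (by norm_num), Real.sqrt_mul hM0,
      Real.sqrt_mul (by positivity)]
    ring
  calc _ ≤ ∑' m, ‖ψ m‖ₑ * ENNReal.ofReal (4 * Real.sqrt M * Real.sqrt J.card * Real.sqrt k) := by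
        refine ENNReal.tsum_le_tsum fun m => ?_
        rw [lintegral_const_mul'' _ ((hm m).pow_const _)]
        gcongr
        exact hb m
    _ = _ := by
        rw [ENNReal.tsum_mul_right, tsum_enorm_eq hψ,
          ← ENNReal.ofReal_mul (tsum_nonneg fun _ => norm_nonneg _)]

end IsNoise

/-- For each m, Cauchy–Schwarz over the k coordinates of the window; the sum over m is taken
outside. The expected size is then √k per term, where a coordinatewise operator bound would give k.
-/
theorem abs_sum_truncProc_mul_le (ε : ℤ → Ω → H) (ψ : ℕ → H →L[ℝ] H) (J : Finset ℤ) (k L : ℕ)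
    (ω : Ω) (hZ : crossDev ε ψ J k ω ≠ ∞) (v : ℕ → H) (u : H) :
    |∑ q ∈ J, (∑ i ∈ Finset.range k, ⟪truncProc ε ψ L (q - 1 - i) ω, v i⟫_ℝ) * ⟪ε q ω, u⟫_ℝ| ≤
      (crossDev ε ψ J k ω).toReal * Real.sqrt (∑ i ∈ Finset.range k, ‖v i‖ ^ 2) * ‖u‖ := by
  set V := Real.sqrt (∑ i ∈ Finset.range k, ‖v i‖ ^ 2) with hV
  have e1 : ∑ q ∈ J, (∑ i ∈ Finset.range k, ⟪truncProc ε ψ L (q - 1 - i) ω, v i⟫_ℝ) *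
      ⟪ε q ω, u⟫_ℝ = ∑ m ∈ Finset.range L, ∑ i ∈ Finset.range k,
        ⟪crossForm ε J (i + m) ω, ContinuousLinearMap.adjoint (ψ m) (v i) ⊗ₜ[ℝ] u⟫_ℝ := by
    simp only [crossForm, sum_inner, TensorProduct.inner_tmul, truncProc, Finset.sum_mul,
      ContinuousLinearMap.adjoint_inner_right]
    rw [Finset.sum_comm' (t' := Finset.range k) (s' := fun _ => J) (by simp)]
    rw [Finset.sum_comm' (s := Finset.range L) (t' := Finset.range k)
      (s' := fun _ => Finset.range L) (by simp)]
    refine Finset.sum_congr rfl fun i _ => ?_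
    rw [Finset.sum_comm' (t' := Finset.range L) (s' := fun _ => J) (by simp [and_comm])]
    refine Finset.sum_congr rfl fun m _ => Finset.sum_congr rfl fun q _ => ?_
    congr 4
    push_cast
    ring_nf
  set s : ℕ → ℝ := fun m => Real.sqrt (∑ i ∈ Finset.range k, ‖crossForm ε J (i + m) ω‖ ^ 2) with hs
  have e2 : ∀ m, ENNReal.ofReal (s m) =
      (∑ i ∈ Finset.range k, ‖crossForm ε J (i + m) ω‖ₑ ^ 2) ^ (1 / 2 : ℝ) := fun m => by
    rw [hs]
    simp only
    rw [Real.sqrt_eq_rpow, ← ENNReal.ofReal_rpow_of_nonneg (by positivity) (by norm_num),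
      ENNReal.ofReal_sum_of_nonneg fun _ _ => by positivity]
    simp only [ENNReal.ofReal_pow (norm_nonneg _), ofReal_norm]
  have h1 : ∑ m ∈ Finset.range L, ‖ψ m‖ * s m ≤ (crossDev ε ψ J k ω).toReal := by
    rw [← ENNReal.ofReal_le_iff_le_toReal hZ, ENNReal.ofReal_sum_of_nonneg fun _ _ =>
      mul_nonneg (norm_nonneg _) (Real.sqrt_nonneg _)]
    refine le_trans (le_of_eq (Finset.sum_congr rfl fun m _ => ?_)) (ENNReal.sum_le_tsum
      (Finset.range L))
    rw [ENNReal.ofReal_mul (norm_nonneg _), e2, ofReal_norm]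
  rw [e1]
  calc _ ≤ ∑ m ∈ Finset.range L, ‖ψ m‖ * s m * (V * ‖u‖) := by
        refine (Finset.abs_sum_le_sum_abs _ _).trans (Finset.sum_le_sum fun m _ => ?_)
        calc _ ≤ ∑ i ∈ Finset.range k, ‖ψ m‖ * ‖u‖ * (‖crossForm ε J (i + m) ω‖ * ‖v i‖) := by
              refine (Finset.abs_sum_le_sum_abs _ _).trans (Finset.sum_le_sum fun i _ => ?_)
              refine (abs_real_inner_le_norm (F := H ⊗[ℝ] H) _ _).trans ?_
              rw [TensorProduct.norm_tmul]
              have hA : ‖ContinuousLinearMap.adjoint (ψ m) (v i)‖ ≤ ‖ψ m‖ * ‖v i‖ := by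
                simpa using (ContinuousLinearMap.adjoint (ψ m)).le_opNorm (v i)
              calc _ ≤ ‖crossForm ε J (i + m) ω‖ * (‖ψ m‖ * ‖v i‖ * ‖u‖) := by gcongr
                _ = _ := by ring
          _ ≤ ‖ψ m‖ * ‖u‖ * (s m * V) := by
              rw [← Finset.mul_sum]
              refine mul_le_mul_of_nonneg_left ?_ (by positivity)
              exact Real.sum_mul_le_sqrt_mul_sqrt _ _ _
          _ = _ := by ring
    _ = (∑ m ∈ Finset.range L, ‖ψ m‖ * s m) * (V * ‖u‖) := by rw [Finset.sum_mul]
    _ ≤ (crossDev ε ψ J k ω).toReal * (V * ‖u‖) := by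
        refine mul_le_mul_of_nonneg_right h1 (by positivity)
    _ = _ := by ring

/-- The cross terms between windows of the process and the noise are bounded by `crossDev`. -/
theorem IsProc.abs_sum_mul_le (hX : IsProc μ X ε ψ) (J : Finset ℤ) (k : ℕ) :
    ∀ᵐ ω ∂μ, crossDev ε ψ J k ω ≠ ∞ → ∀ (v : ℕ → H) (u : H),
    |∑ q ∈ J, (∑ i ∈ Finset.range k, ⟪X (q - 1 - i) ω, v i⟫_ℝ) * ⟪ε q ω, u⟫_ℝ| ≤
      (crossDev ε ψ J k ω).toReal * Real.sqrt (∑ i ∈ Finset.range k, ‖v i‖ ^ 2) * ‖u‖ := by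
  filter_upwards [ae_all_iff.mpr hX.tendsto_truncProc] with ω hω hZ v u
  refine le_of_tendsto (x := atTop) (Tendsto.abs ?_) (Eventually.of_forall fun L =>
    abs_sum_truncProc_mul_le ε ψ J k L ω hZ v u)
  exact tendsto_finsetSum _ fun q _ => (tendsto_finsetSum _ fun i _ =>
    (hω _).inner tendsto_const_nhds).mul tendsto_const_nhds

/-- Minkowski's inequality in L², done by expanding the square. -/
theorem lintegral_tsum_mul_sq_le {c : ℕ → ℝ≥0∞} {f : ℕ → Ω → ℝ≥0∞}
    (hf : ∀ l, AEMeasurable (f l) μ) {S : ℝ≥0∞} (hS : ∀ l, ∫⁻ ω, f l ω ^ 2 ∂μ ≤ S) :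
    ∫⁻ ω, (∑' l, c l * f l ω) ^ 2 ∂μ ≤ (∑' l, c l) ^ 2 * S := by
  have h2 : ∀ a b : ℝ≥0∞, 2 * (a * b) ≤ a ^ 2 + b ^ 2 := fun a b => by
    rcases eq_or_ne a ∞ with rfl | ha
    · simp
    rcases eq_or_ne b ∞ with rfl | hb
    · simp
    lift a to NNReal using ha
    lift b to NNReal using hb
    have := two_mul_le_add_sq (a : ℝ) b
    rw [mul_assoc] at this
    exact_mod_cast this
  have hpair : ∀ l l', ∫⁻ ω, f l ω * f l' ω ∂μ ≤ S := fun l l' => by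
    have hmm : AEMeasurable (fun ω => f l ω * f l' ω) μ := (hf l).mul (hf l')
    have : 2 * ∫⁻ ω, f l ω * f l' ω ∂μ ≤ 2 * S := by
      rw [← lintegral_const_mul'' _ hmm]
      refine (lintegral_mono fun ω => h2 _ _).trans ?_
      rw [lintegral_add_left' ((hf l).pow_const 2), two_mul]
      exact add_le_add (hS l) (hS l')
    exact (ENNReal.mul_le_mul_iff_right (by norm_num) (by norm_num)).mp this
  have hm : ∀ l l', AEMeasurable (fun ω => c l * c l' * (f l ω * f l' ω)) μ := fun l l' =>
    ((hf l).mul (hf l')).const_mul _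
  have e : ∀ ω, (∑' l, c l * f l ω) ^ 2 = ∑' l, ∑' l', c l * c l' * (f l ω * f l' ω) := fun ω => by
    rw [pow_two, ← ENNReal.tsum_mul_right]
    refine tsum_congr fun m => ?_
    rw [← ENNReal.tsum_mul_left]
    exact tsum_congr fun m' => by ring
  simp only [e]
  rw [lintegral_tsum fun l => AEMeasurable.tsum fun l' => hm l l']
  calc _ ≤ ∑' l, ∑' l', c l * c l' * S := by
        refine ENNReal.tsum_le_tsum fun l => ?_
        rw [lintegral_tsum fun l' => hm l l']
        refine ENNReal.tsum_le_tsum fun l' => ?_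
        have hmm : AEMeasurable (fun ω => f l ω * f l' ω) μ := (hf l).mul (hf l')
        rw [lintegral_const_mul'' _ hmm]
        gcongr
        exact hpair _ _
    _ = _ := by
        simp only [ENNReal.tsum_mul_right, ENNReal.tsum_mul_left, pow_two]

/-- The sum over `q ∈ J` of the squares of `∑_ℓ c_ℓ ‖x_{q+1-ℓ}‖`. -/
noncomputable def residSum (c : ℕ → ℝ≥0∞) (x : ℤ → H) (J : Finset ℤ) : ℝ≥0∞ :=
  ∑ q ∈ J, (∑' l : ℕ, c l * ‖x (q + 1 - l)‖ₑ) ^ 2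

namespace IsProc

theorem aemeasurable_residSum (hX : IsProc μ X ε ψ) (c : ℕ → ℝ≥0∞) (J : Finset ℤ) :
    AEMeasurable (fun ω => residSum c (fun j => X j ω) J) μ :=
  Finset.aemeasurable_fun_sum _ fun _ _ => AEMeasurable.pow_const (AEMeasurable.tsum fun _ =>
    (hX.aestronglyMeasurable _).enorm.const_mul _) 2

theorem lintegral_residSum_le (hX : IsProc μ X ε ψ) (c : ℕ → ℝ≥0∞) (J : Finset ℤ) :
    ∫⁻ ω, residSum c (fun j => X j ω) J ∂μ ≤ J.card * ((∑' l, c l) ^ 2 *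
      ENNReal.ofReal ((∑' m, ‖ψ m‖) ^ 2 * ∫ ω, ‖ε 0 ω‖ ^ 2 ∂μ)) := by
  unfold residSum
  rw [lintegral_finsetSum' _ fun q _ => AEMeasurable.pow_const (AEMeasurable.tsum fun l =>
    (hX.aestronglyMeasurable _).enorm.const_mul _) 2, ← nsmul_eq_mul]
  exact Finset.sum_le_card_nsmul _ _ _ fun q _ =>
    lintegral_tsum_mul_sq_le (fun l => (hX.aestronglyMeasurable _).enorm)
      fun l => hX.lintegral_enorm_sq_le _

end IsProc

end Cross

/-! ### Least squares for windows of a path -/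

section Path

variable {H : Type*} [NormedAddCommGroup H] [InnerProductSpace ℝ H]

/-- The path `x` on `1, …, n`, extended by zero. -/
noncomputable def clip (x : ℤ → H) (n : ℕ) (j : ℤ) : H := if 1 ≤ j ∧ j ≤ n then x j else 0

theorem enorm_clip_le (x : ℤ → H) (n : ℕ) (j : ℤ) : ‖clip x n j‖ₑ ≤ ‖x j‖ₑ := by
  rw [clip]; split_ifs <;> simp

theorem clip_of_mem (x : ℤ → H) {n : ℕ} {j : ℤ} (h1 : 1 ≤ j) (h2 : j ≤ n) : clip x n j = x j :=
  if_pos ⟨h1, h2⟩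

/-- The operator `w ↦ ∑ π_ℓ w_ℓ` on `H^k`. -/
noncomputable def arOp (π : ℕ → H →L[ℝ] H) (k : ℕ) : HilbertPow H k →L[ℝ] H :=
  ∑ i : Fin k, π (i + 1) ∘L PiLp.proj 2 (fun _ : Fin k => H) i

theorem arOp_apply (π : ℕ → H →L[ℝ] H) (k : ℕ) (w : HilbertPow H k) :
    arOp π k w = ∑ i : Fin k, π (i + 1) (w i) := by
  simp [arOp]

/-- The sequence that extends an element of `H^k` by zero. -/
noncomputable def extend {k : ℕ} (v : HilbertPow H k) (i : ℕ) : H := if h : i < k then v ⟨i, h⟩ else 0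

theorem extend_coe {k : ℕ} (v : HilbertPow H k) (i : Fin k) : extend v i = v i := by
  simp [extend]

theorem sum_norm_extend {k : ℕ} (v : HilbertPow H k) :
    ∑ i ∈ Finset.range k, ‖extend v i‖ ^ 2 = ‖v‖ ^ 2 := by
  rw [PiLp.norm_sq_eq_of_L2, Finset.sum_range]
  simp only [extend_coe]

theorem inner_window (x : ℤ → H) (k : ℕ) (j : ℤ) (v : HilbertPow H k) :
    ⟪window x k j, v⟫_ℝ = ∑ i ∈ Finset.range k, ⟪x (j - i), extend v i⟫_ℝ := by
  rw [PiLp.inner_apply, Finset.sum_range]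
  simp only [extend_coe]
  rfl

theorem diagProj_apply (e : ℕ → H) (d : ℕ → ℕ) (k : ℕ) (v : HilbertPow H k) (i : Fin k) :
    diagProj e d k v i = projSpan e (d (k - i)) (v i) := rfl

theorem isOrthProj_diagProj (e : ℕ → H) (d : ℕ → ℕ) (k : ℕ) : IsOrthProj (diagProj e d k) := by
  refine ⟨fun v => ?_, fun u v => ?_⟩
  · ext i
    simp only [diagProj_apply, (isOrthProj_projSpan e _).idem]
  · simp only [PiLp.inner_apply, diagProj_apply, (isOrthProj_projSpan e _).symm]

variable [CompleteSpace H]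

/-- Every coordinate space is contained in the largest one because the dimensions increase. One
dimension, d_k, and one α therefore serve for the whole window. -/
theorem projSpan_extend {e : ℕ → H} (he : Orthonormal ℝ e) {d : ℕ → ℕ} (hd : Monotone d) {k : ℕ}
    {v : HilbertPow H k} (hv : diagProj e d k v = v) (i : ℕ) :
    projSpan e (d k) (extend v i) = extend v i := by
  rw [extend]
  split_ifs with h
  · have h1 : projSpan e (d (k - i)) (v ⟨i, h⟩) = v ⟨i, h⟩ := by
      rw [← diagProj_apply e d k v ⟨i, h⟩, hv]
    rw [← h1]
    exact projSpan_comp_projSpan he (hd (Nat.sub_le _ _)) _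
  · simp

/-- Sum of squares of projections of the path. -/
theorem sum_inner_clip_sq_le (x : ℤ → H) (n : ℕ) (J : Finset ℤ) (m : ℕ) (y : H) :
    ∑ j ∈ J, ⟪clip x n (j - m), y⟫_ℝ ^ 2 ≤ n * ⟪sampleCov x n 0 y, y⟫_ℝ := by
  have h1 : ∑ j ∈ J, ⟪clip x n (j - m), y⟫_ℝ ^ 2 ≤
      ∑ j ∈ Finset.Icc (1 : ℤ) n, ⟪x j, y⟫_ℝ ^ 2 := by
    have hsub : ∀ j ∈ J, ⟪clip x n (j - m), y⟫_ℝ ^ 2 =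
        if j - m ∈ Finset.Icc (1 : ℤ) n then ⟪x (j - m), y⟫_ℝ ^ 2 else 0 := fun j _ => by
      simp only [clip, Finset.mem_Icc]
      split_ifs <;> simp
    rw [Finset.sum_congr rfl hsub, ← Finset.sum_filter,
      ← Finset.sum_image (f := fun j => ⟪x j, y⟫_ℝ ^ 2) (g := fun j : ℤ => j - m)
        (fun a _ b _ h => by simpa using h)]
    refine Finset.sum_le_sum_of_subset_of_nonneg ?_ fun _ _ _ => by positivity
    intro j hj
    obtain ⟨i, hi, rfl⟩ := Finset.mem_image.mp hj
    exact (Finset.mem_filter.mp hi).2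
  refine h1.trans (le_of_eq ?_)
  rcases Nat.eq_zero_or_pos n with rfl | hn
  · simp
  have hn' : (n : ℝ) ≠ 0 := by positivity
  simp only [sampleCov, Nat.sub_zero, add_zero, smul_apply, sum_apply, tensor_apply,
    sum_inner, real_inner_smul_left]
  rw [← mul_assoc, mul_inv_cancel₀ hn', one_mul]
  symm
  refine Finset.sum_bij (fun j _ => (j : ℤ)) (fun j hj => ?_) (fun a _ b _ h => by simpa using h)
    (fun j hj => ?_) fun j _ => (pow_two _).symm
  · rw [Finset.mem_Icc] at hj ⊢; omega
  · rw [Finset.mem_Icc] at hj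
    exact ⟨j.toNat, by rw [Finset.mem_Icc]; omega, by omega⟩

/-- The components removed by the projections contribute little. -/
theorem sum_inner_arOp_sub_le {x : ℤ → H} {n : ℕ} {l : ℕ → ℝ} {e : HilbertBasis ℕ ℝ H}
    (he : IsEigenbasis (sampleCov x n 0) l e) (π : ℕ → H →L[ℝ] H) (d : ℕ → ℕ) (k : ℕ)
    (J : Finset ℤ) {Q T : ℝ} (hQ : ∑ i ∈ Finset.range k, ‖π (i + 1)‖ ≤ Q) (hQ0 : 0 ≤ Q)
    (hT : ∑ i ∈ Finset.range k, ‖π (i + 1)‖ * l (d (k - i)) ≤ T) (u : H) :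
    ∑ j ∈ J, ⟪arOp π k (window (clip x n) k j - diagProj e d k (window (clip x n) k j)), u⟫_ℝ ^ 2 ≤
      n * (Q * T) * ‖u‖ ^ 2 := by
  set r : ℤ → ℕ → ℝ := fun j i => ⟪clip x n (j - i), ContinuousLinearMap.adjoint (π (i + 1)) u -
    projSpan e (d (k - i)) (ContinuousLinearMap.adjoint (π (i + 1)) u)⟫_ℝ with hr
  have h1 : ∀ j, ⟪arOp π k (window (clip x n) k j - diagProj e d k (window (clip x n) k j)), u⟫_ℝ =
      ∑ i ∈ Finset.range k, r j i := fun j => by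
    rw [arOp_apply, sum_inner, Finset.sum_range]
    refine Finset.sum_congr rfl fun i _ => ?_
    rw [← ContinuousLinearMap.adjoint_inner_right, PiLp.sub_apply, diagProj_apply, inner_sub_left,
      (isOrthProj_projSpan e _).symm, ← inner_sub_right]
    rfl
  have hr0 : ∀ j i, ‖π (i + 1)‖ = 0 → r j i = 0 := fun j i h => by
    have : π (i + 1) = 0 := norm_eq_zero.mp h
    simp [hr, this]
  -- Cauchy–Schwarz with weights ‖π_{i+1}‖, so that the removed variances enter weighted by
  -- ‖π_{i+1}‖ and no factor k appears.
  have h2 : ∀ j, (∑ i ∈ Finset.range k, r j i) ^ 2 ≤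
      Q * ∑ i ∈ Finset.range k, r j i ^ 2 / ‖π (i + 1)‖ := fun j => by
    refine (Finset.sum_sq_le_sum_mul_sum_of_sq_le_mul (f := fun i => ‖π (i + 1)‖)
      (g := fun i => r j i ^ 2 / ‖π (i + 1)‖) _ (fun i _ => norm_nonneg _)
      (fun i _ => by positivity) fun i _ => ?_).trans
      (mul_le_mul_of_nonneg_right hQ (Finset.sum_nonneg fun i _ => by positivity))
    rcases eq_or_ne ‖π (i + 1)‖ 0 with h | h
    · simp [hr0 j i h]
    · rw [mul_div_cancel₀ _ h]
  -- The functional applied to the path lies in the complement of the leading sample eigenvectors,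
  -- where the sample covariance is at most the next sample eigenvalue.
  have h3 : ∀ i, ∑ j ∈ J, r j i ^ 2 ≤ n * (l (d (k - i)) * (‖π (i + 1)‖ * ‖u‖) ^ 2) := fun i => by
    set y := ContinuousLinearMap.adjoint (π (i + 1)) u -
      projSpan e (d (k - i)) (ContinuousLinearMap.adjoint (π (i + 1)) u) with hy
    refine (sum_inner_clip_sq_le x n J i y).trans ?_
    refine mul_le_mul_of_nonneg_left ?_ (Nat.cast_nonneg n)
    refine (he.inner_le_of_inner_eq_zero (d := d (k - i)) fun j hj =>
      inner_sub_projSpan e hj _).trans ?_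
    have hl : 0 ≤ l (d (k - i)) := he.nonneg (fun v => by
      have := sum_inner_clip_sq_le x n ∅ 0 v
      rcases Nat.eq_zero_or_pos n with h | h
      · subst h; simp [sampleCov]
      · simp only [Finset.sum_empty] at this
        exact nonneg_of_mul_nonneg_right this (by positivity)) _
    refine mul_le_mul_of_nonneg_left ?_ hl
    refine pow_le_pow_left₀ (norm_nonneg _) ?_ 2
    refine ((isOrthProj_projSpan e _).norm_sub_apply_le _).trans ?_
    simpa using (ContinuousLinearMap.adjoint (π (i + 1))).le_opNorm u
  calc _ ≤ ∑ j ∈ J, Q * ∑ i ∈ Finset.range k, r j i ^ 2 / ‖π (i + 1)‖ :=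
        Finset.sum_le_sum fun j _ => by rw [h1]; exact h2 j
    _ = Q * ∑ i ∈ Finset.range k, (∑ j ∈ J, r j i ^ 2) / ‖π (i + 1)‖ := by
        rw [← Finset.mul_sum, Finset.sum_comm]
        simp only [Finset.sum_div]
    _ ≤ Q * ∑ i ∈ Finset.range k, n * ‖u‖ ^ 2 * (‖π (i + 1)‖ * l (d (k - i))) := by
        refine mul_le_mul_of_nonneg_left (Finset.sum_le_sum fun i _ => ?_) hQ0
        rcases eq_or_ne ‖π (i + 1)‖ 0 with h | h
        · simp [h]
        · rw [div_le_iff₀ (lt_of_le_of_ne (norm_nonneg _) (Ne.symm h))]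
          refine (h3 i).trans (le_of_eq (by ring))
    _ ≤ Q * (n * ‖u‖ ^ 2 * T) := by
        rw [← Finset.mul_sum]
        gcongr
    _ = _ := by ring

/-- Coefficients of the tail of the autoregression. -/
noncomputable def tailCoef (π : ℕ → H →L[ℝ] H) (k l : ℕ) : ℝ≥0∞ := if k < l then ‖π l‖ₑ else 0

/-- Coefficients of the full autoregression. -/
noncomputable def fullCoef (π : ℕ → H →L[ℝ] H) (l : ℕ) : ℝ≥0∞ := if l = 0 then 1 else ‖π l‖ₑ

/-- For a complete window the autoregressive equation holds exactly, so subtracting its first k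
terms and the noise leaves only the tail. -/
theorem enorm_resid_le_tail {x ε : ℤ → H} {π : ℕ → H →L[ℝ] H} {k n : ℕ} {j : ℤ}
    (hj : j ∈ Finset.Ico (k : ℤ) n)
    (hx : HasSum (fun l : ℕ => π (l + 1) (x (j + 1 - (l + 1 : ℕ)))) (x (j + 1) - ε (j + 1))) :
    ‖clip x n (j + 1) - arOp π k (window (clip x n) k j) - ε (j + 1)‖ₑ ≤
      ∑' l : ℕ, tailCoef π k l * ‖x (j + 1 - l)‖ₑ := by
  rw [Finset.mem_Ico] at hj
  have h1 : arOp π k (window (clip x n) k j) =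
      ∑ i ∈ Finset.range k, π (i + 1) (x (j + 1 - (i + 1 : ℕ))) := by
    rw [arOp_apply, Finset.sum_range]
    refine Finset.sum_congr rfl fun i _ => ?_
    congr 1
    have : (window (clip x n) k j) i = clip x n (j - (i : ℕ)) := rfl
    rw [this, clip_of_mem x (by omega) (by omega)]
    congr 1
    push_cast; ring
  have h2 : HasSum (fun l : ℕ => π (l + k + 1) (x (j + 1 - (l + k + 1 : ℕ))))
      (clip x n (j + 1) - arOp π k (window (clip x n) k j) - ε (j + 1)) := by
    rw [hasSum_nat_add_iff (f := fun l : ℕ => π (l + 1) (x (j + 1 - (l + 1 : ℕ)))) k, ← h1,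
      clip_of_mem x (by omega) (by omega)]
    convert hx using 1
    abel
  rw [← h2.tsum_eq]
  refine enorm_tsum_le_tsum_enorm.trans ?_
  refine le_trans (ENNReal.tsum_le_tsum fun l => ?_) (ENNReal.tsum_comp_le_tsum_of_injective
    (f := fun l : ℕ => l + k + 1) (fun a b h => by simpa using h) _)
  rw [tailCoef, if_pos (by omega)]
  exact (π _).le_opENorm _

/-- At incomplete windows zero extension destroys the autoregressive equation, so everything is
counted as error. This is affordable because there are at most 2k such windows. -/
theorem enorm_resid_le_full (x : ℤ → H) (π : ℕ → H →L[ℝ] H) (k n : ℕ) (j : ℤ) :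
    ‖clip x n (j + 1) - arOp π k (window (clip x n) k j)‖ₑ ≤
      ∑' l : ℕ, fullCoef π l * ‖x (j + 1 - l)‖ₑ := by
  refine le_trans ?_ (ENNReal.sum_le_tsum (Finset.range (k + 1)))
  rw [Finset.sum_range_succ', add_comm (∑ i ∈ _, _)]
  refine (enorm_sub_le).trans (add_le_add ?_ ?_)
  · simpa [fullCoef] using enorm_clip_le x n (j + 1)
  · rw [arOp_apply, Finset.sum_range]
    refine (enorm_sum_le _ _).trans (Finset.sum_le_sum fun i _ => ?_)
    rw [fullCoef, if_neg (by omega)]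
    refine ((π _).le_opENorm _).trans (mul_le_mul_right ?_ _)
    have : (window (clip x n) k j) i = clip x n (j - (i : ℕ)) := rfl
    rw [this]
    refine (enorm_clip_le x n _).trans (le_of_eq ?_)
    congr 2
    push_cast; ring

/-- The regression operator of the zero-extended path over the times in `J`. -/
noncomputable def regOp (x : ℤ → H) (e : ℕ → H) (d : ℕ → ℕ) (n k : ℕ) (J : Finset ℤ) (b : ℝ) :
    HilbertPow H k →L[ℝ] H :=
  ((b • ∑ j ∈ J, tensor (window (clip x n) k j) (clip x n (j + 1))) ∘L diagProj e d k) ∘L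
    compInv (diagProj e d k)
      (b • ∑ j ∈ J, tensor (window (clip x n) k j) (window (clip x n) k j))

theorem sum_inner_sq_le_of_enorm_le {J : Finset ℤ} {f : ℤ → H} {g : ℤ → ℝ≥0∞} {R : ℝ}
    (hR0 : 0 ≤ R) (hf : ∀ j ∈ J, ‖f j‖ₑ ≤ g j) (hg : ∑ j ∈ J, g j ^ 2 ≤ ENNReal.ofReal R) (u : H) :
    ∑ j ∈ J, ⟪f j, u⟫_ℝ ^ 2 ≤ R * ‖u‖ ^ 2 := by
  have h1 : ∑ j ∈ J, ‖f j‖ ^ 2 ≤ R := by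
    rw [← ENNReal.ofReal_le_ofReal_iff hR0, ENNReal.ofReal_sum_of_nonneg fun _ _ => by positivity]
    refine le_trans (Finset.sum_le_sum fun j hj => ?_) hg
    rw [ENNReal.ofReal_pow (norm_nonneg _), ofReal_norm]
    exact pow_le_pow_left' (hf j hj) 2
  calc _ ≤ ∑ j ∈ J, ‖f j‖ ^ 2 * ‖u‖ ^ 2 := Finset.sum_le_sum fun j _ => by
        rw [← mul_pow, ← sq_abs]
        exact pow_le_pow_left₀ (abs_nonneg _) (abs_real_inner_le_norm _ _) 2
    _ = (∑ j ∈ J, ‖f j‖ ^ 2) * ‖u‖ ^ 2 := by rw [Finset.sum_mul]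
    _ ≤ _ := by gcongr

/-- Deterministic core, with J free between the complete windows and all windows of the
zero-extended path. The two extremes are the Yule–Walker regression and the Toeplitz system behind
the Innovations Algorithm. -/
theorem norm_regOp_sub_le {x ε : ℤ → H} {π : ℕ → H →L[ℝ] H} {n k : ℕ} {l : ℕ → ℝ}
    {e : HilbertBasis ℕ ℝ H} (he : IsEigenbasis (sampleCov x n 0) l e) {d : ℕ → ℕ}
    (hd : Monotone d) {J : Finset ℤ} (hJ1 : Finset.Ico (k : ℤ) n ⊆ J)
    (hJ2 : J ⊆ Finset.Ico (0 : ℤ) (n + k))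
    {a b Q T N r₁ r₂ : ℝ} (ha : 0 < a) (hb : 0 < b) (hbn : b * n ≤ 2)
    (hbk : 1 / 2 ≤ b * ((n : ℝ) - k)) (hN0 : 0 ≤ N) (hQ0 : 0 ≤ Q) (hr₁ : 0 ≤ r₁) (hr₂ : 0 ≤ r₂)
    (hQ : ∑ i ∈ Finset.range k, ‖π (i + 1)‖ ≤ Q) (hT0 : 0 ≤ T)
    (hT : ∑ i ∈ Finset.range k, ‖π (i + 1)‖ * l (d (k - i)) ≤ T)
    (hx : ∀ q : ℤ, HasSum (fun l : ℕ => π (l + 1) (x (q - (l + 1 : ℕ)))) (x q - ε q))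
    (hlow : ∀ v : ℕ → H, (∀ i, projSpan e (d k) (v i) = v i) →
      ((n : ℝ) - k) * a * ∑ i ∈ Finset.range k, ‖v i‖ ^ 2 ≤
        ∑ j ∈ Finset.Ico (k : ℤ) n, (∑ i ∈ Finset.range k, ⟪x (j - i), v i⟫_ℝ) ^ 2)
    (hN : ∀ (v : ℕ → H) (u : H), |∑ j ∈ Finset.Ico (k : ℤ) n,
      (∑ i ∈ Finset.range k, ⟪x (j - i), v i⟫_ℝ) * ⟪ε (j + 1), u⟫_ℝ| ≤
        N * Real.sqrt (∑ i ∈ Finset.range k, ‖v i‖ ^ 2) * ‖u‖)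
    (h₁ : residSum (tailCoef π k) x (Finset.Ico (k : ℤ) n) ≤ ENNReal.ofReal r₁)
    (h₂ : residSum (fullCoef π) x (Finset.Ico (0 : ℤ) (n + k) \ Finset.Ico (k : ℤ) n) ≤
      ENNReal.ofReal r₂) :
    ‖regOp x e d n k J b - arOp π k ∘L diagProj e d k‖ ≤
      Real.sqrt (2 * b * (r₁ + r₂) + 4 * (Q * T)) * (Real.sqrt (a / 2))⁻¹ + b * N * (a / 2)⁻¹ := by
  classical
  have hwin : ∀ j ∈ Finset.Ico (k : ℤ) n, ∀ v : HilbertPow H k,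
      ⟪window (clip x n) k j, v⟫_ℝ = ∑ i ∈ Finset.range k, ⟪x (j - i), extend v i⟫_ℝ := by
    intro j hj v
    rw [Finset.mem_Ico] at hj
    rw [inner_window]
    refine Finset.sum_congr rfl fun i hi => ?_
    rw [Finset.mem_range] at hi
    rw [clip_of_mem x (by omega) (by omega)]
  set w : ℤ → HilbertPow H k := fun j => window (clip x n) k j with hw
  set P := diagProj e d k with hP
  -- The noise part is switched off at incomplete windows, whose whole residual goes into r. The
  -- cross term then involves complete windows only.
  set s : ℤ → H := fun j => if j ∈ Finset.Ico (k : ℤ) n then ε (j + 1) else 0 with hs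
  set r : ℤ → H := fun j => clip x n (j + 1) - arOp π k (P (w j)) - s j with hr
  set ρ := fun j => clip x n (j + 1) - arOp π k (w j) - s j with hρ
  have hrρ : ∀ j, r j = ρ j + arOp π k (w j - P (w j)) := fun j => by
    simp only [hr, hρ, map_sub]; abel
  refine norm_leastSquares_sub_le J w (fun j => clip x n (j + 1)) r s (arOp π k)
    (isOrthProj_diagProj e d k) hb (half_pos ha) (Real.sqrt_nonneg _) (by positivity)
    (fun j _ => by simp only [hr]; abel) (fun v hv => ?_) (fun u => ?_) (fun v u => ?_)
  · have h1 := hlow (extend v) fun i => projSpan_extend e.orthonormal hd hv i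
    rw [sum_norm_extend] at h1
    have h2 : ∑ j ∈ Finset.Ico (k : ℤ) n, (∑ i ∈ Finset.range k, ⟪x (j - i), extend v i⟫_ℝ) ^ 2 ≤
        ∑ j ∈ J, ⟪w j, v⟫_ℝ ^ 2 := by
      rw [← Finset.sum_congr rfl fun j hj => congrArg (· ^ 2) (hwin j hj v)]
      exact Finset.sum_le_sum_of_subset_of_nonneg hJ1 fun _ _ _ => by positivity
    calc a / 2 * ‖v‖ ^ 2 = 1 / 2 * (a * ‖v‖ ^ 2) := by ring
      _ ≤ b * ((n : ℝ) - k) * (a * ‖v‖ ^ 2) := by gcongr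
      _ = b * (((n : ℝ) - k) * a * ‖v‖ ^ 2) := by ring
      _ ≤ _ := mul_le_mul_of_nonneg_left (h1.trans h2) hb.le
  · rw [Real.sq_sqrt (by positivity)]
    have hA := sum_inner_arOp_sub_le he π d k J hQ hQ0 hT u
    have hB : ∑ j ∈ J, ⟪ρ j, u⟫_ℝ ^ 2 ≤ (r₁ + r₂) * ‖u‖ ^ 2 := by
      have hsub : J ⊆ Finset.Ico (k : ℤ) n ∪
          (Finset.Ico (0 : ℤ) (n + k) \ Finset.Ico (k : ℤ) n) := fun j hj => by
        rw [Finset.mem_union, Finset.mem_sdiff]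
        by_cases h : j ∈ Finset.Ico (k : ℤ) n
        · exact Or.inl h
        · exact Or.inr ⟨hJ2 hj, h⟩
      refine (Finset.sum_le_sum_of_subset_of_nonneg hsub fun _ _ _ => by positivity).trans ?_
      rw [Finset.sum_union Finset.disjoint_sdiff, add_mul]
      refine add_le_add (sum_inner_sq_le_of_enorm_le hr₁ (fun j hj => ?_) h₁ u)
        (sum_inner_sq_le_of_enorm_le hr₂ (fun j hj => ?_) h₂ u)
      · simp only [hρ, hs, if_pos hj]
        exact enorm_resid_le_tail hj (hx (j + 1))
      · simp only [hρ, hs, if_neg (Finset.mem_sdiff.mp hj).2, sub_zero]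
        exact enorm_resid_le_full x π k n j
    calc b * ∑ j ∈ J, ⟪r j, u⟫_ℝ ^ 2
        ≤ b * ∑ j ∈ J, (2 * ⟪ρ j, u⟫_ℝ ^ 2 + 2 * ⟪arOp π k (w j - P (w j)), u⟫_ℝ ^ 2) := by
          refine mul_le_mul_of_nonneg_left (Finset.sum_le_sum fun j _ => ?_) hb.le
          rw [hrρ, inner_add_left]
          nlinarith [sq_nonneg (⟪ρ j, u⟫_ℝ - ⟪arOp π k (w j - P (w j)), u⟫_ℝ)]
      _ = 2 * b * ∑ j ∈ J, ⟪ρ j, u⟫_ℝ ^ 2 +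
          2 * b * ∑ j ∈ J, ⟪arOp π k (w j - P (w j)), u⟫_ℝ ^ 2 := by
          rw [Finset.sum_add_distrib, ← Finset.mul_sum, ← Finset.mul_sum]; ring
      _ ≤ 2 * b * ((r₁ + r₂) * ‖u‖ ^ 2) + 2 * b * (n * (Q * T) * ‖u‖ ^ 2) := by gcongr
      _ = 2 * b * (r₁ + r₂) * ‖u‖ ^ 2 + 2 * (b * n) * (Q * T * ‖u‖ ^ 2) := by ring
      _ ≤ 2 * b * (r₁ + r₂) * ‖u‖ ^ 2 + 2 * 2 * (Q * T * ‖u‖ ^ 2) := by gcongr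
      _ = _ := by ring
  · have h1 : ∑ j ∈ J, ⟪w j, v⟫_ℝ * ⟪s j, u⟫_ℝ = ∑ j ∈ Finset.Ico (k : ℤ) n,
        (∑ i ∈ Finset.range k, ⟪x (j - i), extend v i⟫_ℝ) * ⟪ε (j + 1), u⟫_ℝ := by
      symm
      refine Finset.sum_subset_zero_on_sdiff hJ1 (fun j hj => ?_) fun j hj => ?_
      · simp only [hs, if_neg (Finset.mem_sdiff.mp hj).2, inner_zero_left, mul_zero]
      · rw [hwin j hj]
        simp only [hs, if_pos hj]
    have h2 := hN (extend v) u
    rw [sum_norm_extend, Real.sqrt_sq (norm_nonneg _)] at h2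
    rw [h1, abs_mul, abs_of_pos hb]
    calc _ ≤ b * (N * ‖v‖ * ‖u‖) := mul_le_mul_of_nonneg_left h2 hb.le
      _ = _ := by ring

end Path

/-! ### Events of probability tending to one -/

section Whp

variable {Ω : Type*} [MeasurableSpace Ω] {μ : Measure Ω}

/-- `p n` holds with (outer) probability tending to one. -/
def Whp (μ : Measure Ω) (p : ℕ → Ω → Prop) : Prop :=
  Tendsto (fun n => μ {ω | ¬ p n ω}) atTop (𝓝 0)

theorem Whp.mono_ae {p q : ℕ → Ω → Prop} (hp : Whp μ p)
    (h : ∀ᶠ n in atTop, ∀ᵐ ω ∂μ, p n ω → q n ω) : Whp μ q := by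
  refine tendsto_of_tendsto_of_tendsto_of_le_of_le' tendsto_const_nhds hp
    (Eventually.of_forall fun _ => bot_le) ?_
  filter_upwards [h] with n hn
  refine measure_mono_ae ?_
  filter_upwards [hn] with ω hω hq hp
  exact hq (hω hp)

theorem Whp.mono {p q : ℕ → Ω → Prop} (hp : Whp μ p)
    (h : ∀ᶠ n in atTop, ∀ ω, p n ω → q n ω) : Whp μ q :=
  hp.mono_ae (h.mono fun _ hn => ae_of_all _ hn)

theorem Whp.of_ae {p : ℕ → Ω → Prop} (h : ∀ᶠ n in atTop, ∀ᵐ ω ∂μ, p n ω) : Whp μ p := by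
  refine tendsto_const_nhds.congr' ?_
  filter_upwards [h] with n hn
  exact (ae_iff.mp hn).symm

theorem Whp.and {p q : ℕ → Ω → Prop} (hp : Whp μ p) (hq : Whp μ q) :
    Whp μ fun n ω => p n ω ∧ q n ω := by
  have h := hp.add hq
  rw [add_zero] at h
  refine tendsto_of_tendsto_of_tendsto_of_le_of_le tendsto_const_nhds h (fun _ => bot_le)
    fun n => ?_
  refine (measure_mono fun ω hω => ?_).trans (measure_union_le _ _)
  simp only [Set.mem_ofPred_eq, Set.mem_union] at hω ⊢
  tauto

/-- Markov's inequality. -/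
theorem Whp.of_lintegral {Z : ℕ → Ω → ℝ≥0∞} (hZ : ∀ n, AEMeasurable (Z n) μ) {B c : ℕ → ℝ}
    (hB : ∀ᶠ n in atTop, ∫⁻ ω, Z n ω ∂μ ≤ ENNReal.ofReal (B n)) (hc : ∀ᶠ n in atTop, 0 < c n)
    (h : Tendsto (fun n => B n / c n) atTop (𝓝 0)) :
    Whp μ fun n ω => Z n ω ≤ ENNReal.ofReal (c n) := by
  have h0 : Tendsto (fun n => ENNReal.ofReal (B n / c n)) atTop (𝓝 0) := by
    simpa using ENNReal.tendsto_ofReal h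
  refine tendsto_of_tendsto_of_tendsto_of_le_of_le' tendsto_const_nhds h0
    (Eventually.of_forall fun _ => bot_le) ?_
  filter_upwards [hB, hc] with n hBn hcn
  have hc0 : ENNReal.ofReal (c n) ≠ 0 := by simpa using hcn
  calc μ {ω | ¬ Z n ω ≤ ENNReal.ofReal (c n)} ≤ μ {ω | ENNReal.ofReal (c n) ≤ Z n ω} :=
        measure_mono fun ω hω => (not_le.mp hω).le
    _ ≤ (∫⁻ ω, Z n ω ∂μ) / ENNReal.ofReal (c n) :=
        meas_ge_le_lintegral_div (hZ n) hc0 ENNReal.ofReal_ne_top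
    _ ≤ ENNReal.ofReal (B n) / ENNReal.ofReal (c n) := by gcongr
    _ = _ := (ENNReal.ofReal_div_of_pos hcn).symm

theorem tendstoInMeasure_of_whp {f : ℕ → Ω → ℝ} (h0 : ∀ n ω, 0 ≤ f n ω)
    (h : ∀ δ > 0, Whp μ fun n ω => f n ω ≤ δ) : TendstoInMeasure μ f atTop fun _ => 0 := by
  rw [tendstoInMeasure_iff_dist]
  intro δ hδ
  refine tendsto_of_tendsto_of_tendsto_of_le_of_le tendsto_const_nhds (h (δ / 2) (half_pos hδ))
    (fun _ => bot_le) fun n => measure_mono fun ω hω => ?_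
  simp only [Set.mem_ofPred_eq, Real.dist_eq, sub_zero, abs_of_nonneg (h0 n ω)] at hω ⊢
  linarith

end Whp

/-! ### Lower bounds for the empirical covariance form -/

section Lower

variable {Ω H : Type*} [MeasurableSpace Ω] {μ : Measure Ω} [IsProbabilityMeasure μ]
  [NormedAddCommGroup H] [InnerProductSpace ℝ H] [CompleteSpace H]
  [MeasurableSpace H] [BorelSpace H] [SecondCountableTopology H]
  {X ε : ℤ → Ω → H} {ψ : ℕ → H →L[ℝ] H}

/-- Polarization at u and at the multiple of T u with the norm of u, where the parallelogram law is
sharp. -/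
theorem opNorm_le_of_abs_inner_self_le {T : H →L[ℝ] H} (hT : ∀ u v, ⟪T u, v⟫_ℝ = ⟪u, T v⟫_ℝ)
    {c : ℝ} (hc : 0 ≤ c) (h : ∀ v, |⟪T v, v⟫_ℝ| ≤ c * ‖v‖ ^ 2) : ‖T‖ ≤ c := by
  refine ContinuousLinearMap.opNorm_le_bound _ hc fun u => ?_
  rcases eq_or_ne (T u) 0 with h0 | h0
  · rw [h0, norm_zero]; positivity
  rcases eq_or_ne u 0 with hu | hu
  · rw [hu, map_zero, norm_zero]; positivity
  have hTu : 0 < ‖T u‖ := norm_pos_iff.mpr h0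
  have hu' : 0 < ‖u‖ := norm_pos_iff.mpr hu
  set v : H := (‖u‖ / ‖T u‖) • T u with hv
  have hvn : ‖v‖ = ‖u‖ := by
    rw [hv, norm_smul, Real.norm_of_nonneg (by positivity), div_mul_cancel₀ _ hTu.ne']
  have h1 : ⟪T u, v⟫_ℝ = ‖u‖ * ‖T u‖ := by
    rw [hv, real_inner_smul_right, real_inner_self_eq_norm_sq]
    field_simp
  have h2 : ⟪T (u + v), u + v⟫_ℝ - ⟪T (u - v), u - v⟫_ℝ = 4 * ⟪T u, v⟫_ℝ := by
    have : ⟪T v, u⟫_ℝ = ⟪T u, v⟫_ℝ := by rw [hT, real_inner_comm]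
    simp only [map_add, map_sub, inner_add_left, inner_add_right, inner_sub_left, inner_sub_right,
      this]
    ring
  have h3 := (abs_le.mp (h (u + v))).2
  have h4 := (abs_le.mp (h (u - v))).1
  have h5 := parallelogram_law_with_norm ℝ u v
  rw [hvn] at h5
  have : ‖u‖ * ‖T u‖ ≤ c * ‖u‖ * ‖u‖ := by nlinarith
  nlinarith

/-- With windows of length one, the Toeplitz deviation bound controls the sample covariance operator
too. -/
theorem inner_sampleCov_zero (x : ℤ → H) (n : ℕ) (v : H) :
    n * ⟪sampleCov x n 0 v, v⟫_ℝ =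
      toeplitzForm (Finset.Ico 1 (1 + (n : ℤ))) 1 (fun s s' => opForm (tensor (x s) (x s')))
        fun _ => v := by
  rcases Nat.eq_zero_or_pos n with rfl | hn
  · simp [toeplitzForm]
  have hn' : (n : ℝ) ≠ 0 := by positivity
  simp only [sampleCov, Nat.sub_zero, add_zero, smul_apply, sum_apply, tensor_apply,
    sum_inner, real_inner_smul_left, toeplitzForm, Finset.sum_range_one, opForm_apply, Nat.cast_zero]
  rw [← mul_assoc, mul_inv_cancel₀ hn', one_mul]
  simp only [Finset.sum_ite_eq]
  rw [Finset.sum_congr rfl fun s hs => if_pos hs]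
  refine Finset.sum_bij (fun j _ => (j : ℤ)) (fun j hj => ?_) (fun a _ b _ h => by simpa using h)
    (fun j hj => ?_) fun j _ => rfl
  · rw [Finset.mem_Icc] at hj; rw [Finset.mem_Ico]; omega
  · rw [Finset.mem_Ico] at hj
    exact ⟨j.toNat, by rw [Finset.mem_Icc]; omega, by omega⟩

theorem IsProc.norm_sampleCov_sub_le (hX : IsProc μ X ε ψ) (e : HilbertBasis ℕ ℝ H) {n : ℕ}
    (hn : 0 < n) : ∀ᵐ ω ∂μ, toepDev μ ε ψ e (Finset.Ico 1 (1 + (n : ℤ))) 1 ω ≠ ∞ →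
      ‖sampleCov (fun j => X j ω) n 0 - lagCov μ X 0‖ ≤
        2 * (toepDev μ ε ψ e (Finset.Ico 1 (1 + (n : ℤ))) 1 ω).toReal / n := by
  filter_upwards [hX.abs_toeplitzForm_sub_le e (Finset.Ico 1 (1 + (n : ℤ))) 1] with ω h hZ
  have hn' : (0 : ℝ) < n := by exact_mod_cast hn
  refine opNorm_le_of_abs_inner_self_le (fun u v => ?_) (by positivity) fun v => ?_
  · simp only [_root_.sub_apply, inner_sub_left, inner_sub_right]
    congr 1
    · simp only [sampleCov, smul_apply, sum_apply, tensor_apply, sum_inner, inner_sum,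
        real_inner_smul_left, real_inner_smul_right, add_zero]
      congr 1
      refine Finset.sum_congr rfl fun j _ => ?_
      rw [real_inner_comm u]
      ring
    · have := hX.inner_lagCov_neg 0 u v
      rwa [neg_zero] at this
  · have h1 := h hZ fun _ => v
    rw [← inner_sampleCov_zero] at h1
    have h2 : toeplitzForm (Finset.Ico 1 (1 + (n : ℤ))) 1
        (fun s s' => opForm (lagCov μ X (s' - s))) (fun _ => v) = n * ⟪lagCov μ X 0 v, v⟫_ℝ := by
      simp only [toeplitzForm, Finset.sum_range_one, Nat.cast_zero, add_zero, Finset.sum_ite_eq,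
        opForm_apply]
      rw [Finset.sum_congr rfl fun s hs => if_pos hs]
      simp
    rw [h2, ← mul_sub, abs_mul, abs_of_pos hn', Finset.sum_range_one] at h1
    rw [_root_.sub_apply, inner_sub_left]
    rw [div_mul_eq_mul_div, le_div_iff₀ hn', mul_comm]
    exact h1

/-- The covariance form is coercive on the sample eigenspaces. -/
theorem IsProc.le_covForm (hX : IsProc μ X ε ψ) {C : H →L[ℝ] H} {lam lamHat : ℕ → ℝ}
    {ν νHat : HilbertBasis ℕ ℝ H} (hν : IsEigenbasis (lagCov μ X 0) lam ν)
    (hlam : ∀ i, 0 ≤ lam i) (hνHat : IsEigenbasis C lamHat νHat) {d k : ℕ} {a θ : ℝ}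
    (hα : 0 < alpha μ X ν (d + 1)) (ha : a = alpha μ X ν (d + 1))
    (hθ : ‖C - lagCov μ X 0‖ ≤ θ) (hθa : θ ≤ a)
    (hθ2 : (Real.pi * a + ∑' h, ‖lagCov μ X h‖) * θ ^ 2 ≤ a ^ 3)
    (hcase : lam (d + 1) ≤ a ∨ ∀ h ≠ 0, lagCov μ X h = 0)
    {v : ℕ → H} (hv : ∀ i, projSpan νHat (d + 1) (v i) = v i) :
    2 * a * ∑ i ∈ Finset.range k, ‖v i‖ ^ 2 ≤ covForm (lagCov μ X) k v := by
  have hpi := Real.pi_gt_three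
  have ha0 : 0 < a := ha ▸ hα
  have hla := hX.two_pi_mul_alpha_le hν d hα
  rw [← ha] at hla
  have hθ0 : 0 ≤ θ := (norm_nonneg _).trans hθ
  have hweyl := hνHat.le_add_norm_sub hν d
  rw [norm_sub_rev] at hweyl
  have hm : 2 * Real.pi * a - θ ≤ lamHat d := by linarith
  set V := ∑ i ∈ Finset.range k, ‖v i‖ ^ 2 with hV
  rcases hcase with h1 | h1
  -- By Weyl, the last retained sample eigenvalue is at least 2πa - θ ≥ (2π - 1)a, and the next
  -- population eigenvalue is at most a. The Davis–Kahan gap is thus at least a, without any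
  -- separation inside the population spectrum.
  · have hgap : a ≤ lamHat d - lam (d + 1) := by nlinarith
    set p : ℕ → H := fun i => projSpan ν (d + 1) (v i) with hp
    have hτ : ∀ i, ‖v i - p i‖ ^ 2 ≤ (θ / a) ^ 2 * ‖v i‖ ^ 2 := fun i => by
      have h2 := hν.norm_sub_projSpan_le hνHat hlam (by linarith) (hv i)
      have h3 : a * ‖v i - p i‖ ≤ θ * ‖v i‖ :=
        (mul_le_mul_of_nonneg_right hgap (norm_nonneg _)).trans
          (h2.trans (mul_le_mul_of_nonneg_right hθ (norm_nonneg _)))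
      rw [← mul_pow]
      refine pow_le_pow_left₀ (norm_nonneg _) ?_ 2
      rw [div_mul_eq_mul_div, le_div_iff₀ ha0]
      linarith
    have hpy : ∀ i, ‖p i‖ ^ 2 = ‖v i‖ ^ 2 - ‖v i - p i‖ ^ 2 := fun i => by
      have := (isOrthProj_projSpan ν (d + 1)).norm_sq (v i)
      linarith
    have h4 := hX.two_pi_mul_alpha_le_covForm ν (d + 1) hα k p fun i =>
      (isOrthProj_projSpan ν (d + 1)).idem _
    have h5 := (abs_le.mp (abs_covForm_le hX.summable_norm_lagCov k fun i => v i - p i)).2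
    have h6 := hX.covForm_add_ge k p fun i => v i - p i
    simp only [add_sub_cancel] at h6
    set W := ∑ i ∈ Finset.range k, ‖v i - p i‖ ^ 2 with hW
    have hWV : W ≤ (θ / a) ^ 2 * V := by
      rw [hW, hV, Finset.mul_sum]
      exact Finset.sum_le_sum fun i _ => hτ i
    have hPV : ∑ i ∈ Finset.range k, ‖p i‖ ^ 2 = V - W := by
      rw [hV, hW, ← Finset.sum_sub_distrib]
      exact Finset.sum_congr rfl fun i _ => hpy i
    rw [hPV, ← ha] at h4
    have hG : 0 ≤ ∑' h, ‖lagCov μ X h‖ := tsum_nonneg fun _ => norm_nonneg _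
    have hV0 : 0 ≤ V := Finset.sum_nonneg fun _ _ => by positivity
    -- The part of v outside the population eigenspace costs at most aV. Half of the population
    -- bound, πaV, minus this loss still exceeds 2aV since π > 3.
    have h7 : (Real.pi * a + ∑' h, ‖lagCov μ X h‖) * W ≤ a * V := by
      calc _ ≤ (Real.pi * a + ∑' h, ‖lagCov μ X h‖) * ((θ / a) ^ 2 * V) := by gcongr
        _ = (Real.pi * a + ∑' h, ‖lagCov μ X h‖) * θ ^ 2 / a ^ 2 * V := by ring
        _ ≤ a ^ 3 / a ^ 2 * V := by gcongr
        _ = a * V := by field_simp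
    have h8 : 0 ≤ (Real.pi - 3) * (a * V) := mul_nonneg (by linarith) (by positivity)
    nlinarith
  -- White noise: only lag 0 remains, and the sample covariance bounds each summand below directly,
  -- up to θ.
  · have h2 : covForm (lagCov μ X) k v = ∑ i ∈ Finset.range k, ⟪lagCov μ X 0 (v i), v i⟫_ℝ := by
      refine Finset.sum_congr rfl fun i hi => ?_
      rw [Finset.sum_eq_single_of_mem i hi fun i' _ hne => by
        rw [h1 _ (by omega)]; simp]
      simp
    rw [h2, hV, Finset.mul_sum]
    refine Finset.sum_le_sum fun i _ => ?_
    have h3 : lamHat d * ‖v i‖ ^ 2 ≤ ⟪C (v i), v i⟫_ℝ :=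
      hνHat.le_inner_of_inner_eq_zero fun j hj => inner_eq_zero_of_projSpan_eq νHat hj (hv i)
    have h4 : ⟪C (v i), v i⟫_ℝ - ⟪lagCov μ X 0 (v i), v i⟫_ℝ ≤ θ * ‖v i‖ ^ 2 := by
      rw [← inner_sub_left, ← _root_.sub_apply]
      refine (real_inner_le_norm _ _).trans ?_
      have := (C - lagCov μ X 0).le_opNorm (v i)
      calc _ ≤ (θ * ‖v i‖) * ‖v i‖ := by gcongr; exact this.trans (by gcongr)
        _ = _ := by ring
    have h5 : 4 * a ≤ lamHat d - θ + a := by nlinarith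
    have h6 := mul_le_mul_of_nonneg_right h5 (sq_nonneg ‖v i‖)
    have h7 : 0 ≤ a * ‖v i‖ ^ 2 := by positivity
    linarith

/-- The empirical quadratic form over full windows is bounded below. -/
theorem IsProc.le_sum_window_sq (hX : IsProc μ X ε ψ) (e : HilbertBasis ℕ ℝ H) {n k : ℕ}
    (hk : 1 ≤ k) (hn : k < n) : ∀ᵐ ω ∂μ, ∀ a Z : ℝ,
    toepDev μ ε ψ e (Finset.Ico 1 (1 + (n - 1 : ℕ))) k ω ≤ ENNReal.ofReal Z →
    toepDev μ ε ψ e (Finset.Ico 1 (1 + (k - 1 : ℕ))) k ω ≤ ENNReal.ofReal Z →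
    toepDev μ ε ψ e (Finset.Ico ((n - k + 1 : ℕ) : ℤ) ((n - k + 1 : ℕ) + (k - 1 : ℕ))) k ω ≤
      ENNReal.ofReal Z → 0 ≤ Z →
    4 * k * (∑' h, ‖lagCov μ X h‖) + 6 * Z ≤ ((n : ℝ) - k) * a → ∀ v : ℕ → H,
    2 * a * ∑ i ∈ Finset.range k, ‖v i‖ ^ 2 ≤ covForm (lagCov μ X) k v →
    ((n : ℝ) - k) * a * ∑ i ∈ Finset.range k, ‖v i‖ ^ 2 ≤
      ∑ j ∈ Finset.Ico (k : ℤ) n, (∑ i ∈ Finset.range k, ⟪X (j - i) ω, v i⟫_ℝ) ^ 2 := by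
  filter_upwards [hX.abs_toeplitzForm_sub_le e (Finset.Ico 1 (1 + (n - 1 : ℕ))) k,
    hX.abs_toeplitzForm_sub_le e (Finset.Ico 1 (1 + (k - 1 : ℕ))) k,
    hX.abs_toeplitzForm_sub_le e
      (Finset.Ico ((n - k + 1 : ℕ) : ℤ) ((n - k + 1 : ℕ) + (k - 1 : ℕ))) k]
    with ω h1 h2 h3 a Z hZ1 hZ2 hZ3 hZ0 hsmall v hv
  have hfin : ∀ {z : ℝ≥0∞}, z ≤ ENNReal.ofReal Z → z ≠ ∞ ∧ z.toReal ≤ Z := fun {z} hz =>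
    ⟨ne_top_of_le_ne_top ENNReal.ofReal_ne_top hz, ENNReal.toReal_le_of_le_ofReal hZ0 hz⟩
  set V := ∑ i ∈ Finset.range k, ‖v i‖ ^ 2 with hV
  have hV0 : 0 ≤ V := Finset.sum_nonneg fun _ _ => by positivity
  have b1 := (abs_le.mp (h1 (hfin hZ1).1 v)).1
  have b2 := (abs_le.mp (h2 (hfin hZ2).1 v)).2
  have b3 := (abs_le.mp (h3 (hfin hZ3).1 v)).2
  have c1 := mul_le_mul_of_nonneg_right (hfin hZ1).2 hV0
  have c2 := mul_le_mul_of_nonneg_right (hfin hZ2).2 hV0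
  have c3 := mul_le_mul_of_nonneg_right (hfin hZ3).2 hV0
  have hs := hX.summable_norm_lagCov
  have m1 := (abs_le.mp (abs_toeplitzForm_sub_covForm_le hs 1 (n - 1) k v)).1
  have m2 := (abs_le.mp (abs_toeplitzForm_sub_covForm_le hs 1 (k - 1) k v)).2
  have m3 := (abs_le.mp (abs_toeplitzForm_sub_covForm_le hs ((n - k + 1 : ℕ) : ℤ) (k - 1) k v)).2
  have hG := (abs_le.mp (abs_covForm_le hs k v)).2
  have hmain := toeplitzForm_le_sum (fun j => X j ω) hk hn v
  have e1 : (((n - 1 : ℕ) : ℝ)) = n - 1 := by rw [Nat.cast_sub (by omega)]; simp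
  have e2 : (((k - 1 : ℕ) : ℝ)) = k - 1 := by rw [Nat.cast_sub hk]; simp
  rw [e1] at m1
  rw [e2] at m2 m3
  rw [← hV] at m1 m2 m3 hG b1 b2 b3
  set G := ∑' h, ‖lagCov μ X h‖ with hGdef
  set cf := covForm (lagCov μ X) k v with hcf
  have hk' : (1 : ℝ) ≤ k := by exact_mod_cast hk
  have hn' : (k : ℝ) < n := by exact_mod_cast hn
  -- Bookkeeping for the constants: the long form carries n - 1 copies of the covariance form and
  -- the two short ones remove 2(k - 1), leaving (n - k) - (k - 1). Three edge errors kGV, this loss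
  -- of at most kGV, and three deviations 2ZV add up to 4kG + 6Z.
  have h5 : ((k : ℝ) - 1) * cf ≤ k * (G * V) := by
    have hGV : 0 ≤ G * V := mul_nonneg (tsum_nonneg fun _ => norm_nonneg _) hV0
    calc ((k : ℝ) - 1) * cf ≤ (k - 1) * (G * V) := mul_le_mul_of_nonneg_left hG (by linarith)
      _ ≤ k * (G * V) := mul_le_mul_of_nonneg_right (by linarith) hGV
  have h6 : ((n : ℝ) - k) * (2 * a * V) ≤ ((n : ℝ) - k) * cf :=
    mul_le_mul_of_nonneg_left hv (by linarith)
  have h7 := mul_le_mul_of_nonneg_right hsmall hV0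
  linarith

end Lower

/-! ### Rates -/

section Rates

variable {Ω H : Type*} [MeasurableSpace Ω] {μ : Measure Ω} [IsProbabilityMeasure μ]
  [NormedAddCommGroup H] [InnerProductSpace ℝ H] [CompleteSpace H]
  [MeasurableSpace H] [BorelSpace H] [SecondCountableTopology H]
  {X ε : ℤ → Ω → H} {ψ π : ℕ → H →L[ℝ] H} {lam : ℕ → ℝ} {ν : HilbertBasis ℕ ℝ H} {d : ℕ → ℕ}
  {κ : ℕ → ℕ}

/-- An invertible linear process with the eigenstructure of its covariance operator and the
dimensions of the projections. -/
structure Setting (μ : Measure Ω) (X ε : ℤ → Ω → H) (ψ π : ℕ → H →L[ℝ] H) (lam : ℕ → ℝ)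
    (ν : HilbertBasis ℕ ℝ H) (d : ℕ → ℕ) : Prop where
  proc : IsProc μ X ε ψ
  inv : IsInvertible μ X ε π
  eig : IsEigenbasis (lagCov μ X 0) lam ν
  lam_pos : ∀ i, 0 < lam i
  d_pos : ∀ i, 0 < d i
  d_mono : Monotone d
  alpha_pos : ∀ i, 0 < alpha μ X ν (d i)

/-- The rate conditions for a sequence of orders. -/
structure Rates (μ : Measure Ω) (X : ℤ → Ω → H) (π : ℕ → H →L[ℝ] H) (lam : ℕ → ℝ)
    (ν : HilbertBasis ℕ ℝ H) (d κ : ℕ → ℕ) : Prop where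
  tendsto : Tendsto κ atTop atTop
  lt : ∀ᶠ n in atTop, κ n < n
  ratio : Tendsto (fun n : ℕ => Real.sqrt (κ n) * (Real.sqrt ((n : ℝ) - κ n))⁻¹ *
      (alpha μ X ν (d (κ n)) ^ 2)⁻¹) atTop (𝓝 0)
  power : Tendsto (fun n : ℕ => (κ n : ℝ) ^ (3 / 2 : ℝ) *
      (alpha μ X ν (d (κ n)) ^ 2)⁻¹ * (n : ℝ)⁻¹) atTop (𝓝 0)
  trunc : Tendsto (fun n : ℕ => truncRate (alpha μ X ν) π lam d (κ n)) atTop (𝓝 0)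

namespace Setting

theorem alpha_le (S : Setting μ X ε ψ π lam ν d) (i : ℕ) : alpha μ X ν (d i) ≤ lam 0 := by
  obtain ⟨m, hm⟩ := Nat.exists_eq_succ_of_ne_zero (S.d_pos i).ne'
  have h0 := S.alpha_pos i
  rw [hm] at h0 ⊢
  have h1 := S.proc.two_pi_mul_alpha_le S.eig m h0
  have h2 := S.eig.1 (Nat.zero_le m)
  nlinarith [Real.pi_gt_three]

/-- Partial traces are bounded by E ‖X_0‖², by Bessel's inequality. -/
theorem summable_lam (S : Setting μ X ε ψ π lam ν d) : Summable lam := by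
  refine summable_of_sum_le (c := ∫ ω, ‖X 0 ω‖ ^ 2 ∂μ) (fun i => (S.lam_pos i).le) fun s => ?_
  have h1 : ∀ i, lam i = ∫ ω, ⟪ν i, X 0 ω⟫_ℝ ^ 2 ∂μ := fun i => by
    have h2 := S.proc.inner_lagCov_zero 0 (ν i) (ν i)
    rw [S.eig.2 i, real_inner_smul_left, real_inner_self_eq_norm_sq, ν.orthonormal.1 i] at h2
    rw [one_pow, mul_one] at h2
    rw [h2]
    simp only [pow_two, real_inner_comm (ν i)]
  have hi : ∀ i, Integrable (fun ω => ⟪ν i, X 0 ω⟫_ℝ ^ 2) μ := fun i =>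
    ((S.proc.memLp_two 0).const_inner (ν i)).integrable_sq
  simp only [h1]
  rw [← integral_finsetSum _ fun i _ => hi i]
  refine integral_mono (integrable_finsetSum _ fun i _ => hi i)
    ((S.proc.memLp_two 0).integrable_norm_pow (by norm_num)) fun ω => ?_
  have := ν.orthonormal.sum_inner_products_le (X 0 ω) (s := s)
  simpa using this

theorem lam_le_tsum (S : Setting μ X ε ψ π lam ν d) (m : ℕ) : lam m ≤ ∑' i : ℕ, lam (m + i) := by
  have h : Summable fun i => lam (m + i) := by
    have := (summable_nat_add_iff m).mpr S.summable_lam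
    simpa only [add_comm] using this
  simpa using h.le_tsum 0 fun i _ => (S.lam_pos _).le

theorem tail_le (S : Setting μ X ε ψ π lam ν d) {k : ℕ} (hk : 1 ≤ k) :
    ∑' ℓ : ℕ, ‖π (k + 1 + ℓ)‖ ≤ alpha μ X ν (d k) * truncRate (alpha μ X ν) π lam d k := by
  have ha := S.alpha_pos k
  have hk1 : 1 ≤ Real.sqrt k := by
    rw [Real.one_le_sqrt]; exact_mod_cast hk
  have h2 : 0 ≤ ∑ ℓ ∈ Finset.Icc 1 k, ‖π ℓ‖ * ∑' i : ℕ, lam (d (k + 1 - ℓ) + i) :=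
    Finset.sum_nonneg fun ℓ _ => mul_nonneg (norm_nonneg _) (tsum_nonneg fun i => (S.lam_pos _).le)
  have h1 : 0 ≤ ∑' ℓ : ℕ, ‖π (k + 1 + ℓ)‖ := tsum_nonneg fun _ => norm_nonneg _
  rw [truncRate, ← mul_assoc, mul_left_comm, mul_inv_cancel₀ ha.ne', mul_one]
  nlinarith

/-- With ℓ = i + 1, `lam (d (k - i))` is the first term of the eigenvalue tail in R(k). A single
discarded eigenvalue per coordinate is enough for the weak mean square bound, and the factor √k ≥ 1
is dropped. -/
theorem sum_lam_le (S : Setting μ X ε ψ π lam ν d) {k : ℕ} (hk : 1 ≤ k) :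
    ∑ i ∈ Finset.range k, ‖π (i + 1)‖ * lam (d (k - i)) ≤
      alpha μ X ν (d k) * truncRate (alpha μ X ν) π lam d k := by
  have ha := S.alpha_pos k
  have hk1 : 1 ≤ Real.sqrt k := by
    rw [Real.one_le_sqrt]; exact_mod_cast hk
  have h1 : 0 ≤ ∑' ℓ : ℕ, ‖π (k + 1 + ℓ)‖ := tsum_nonneg fun _ => norm_nonneg _
  have h2 : ∑ i ∈ Finset.range k, ‖π (i + 1)‖ * lam (d (k - i)) ≤
      ∑ ℓ ∈ Finset.Icc 1 k, ‖π ℓ‖ * ∑' i : ℕ, lam (d (k + 1 - ℓ) + i) := by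
    rw [Finset.range_eq_Ico, Finset.sum_Ico_add' (fun ℓ => ‖π ℓ‖ * lam (d (k + 1 - ℓ))) 0 k 1 |>.symm
      |> fun h => (Finset.sum_congr rfl fun i _ => by
        rw [Nat.add_sub_add_right] : ∑ i ∈ Finset.Ico 0 k, ‖π (i + 1)‖ * lam (d (k - i)) =
          ∑ i ∈ Finset.Ico 0 k, ‖π (i + 1)‖ * lam (d (k + 1 - (i + 1)))).trans h.symm]
    refine le_trans (le_of_eq ?_) (Finset.sum_le_sum fun ℓ _ =>
      mul_le_mul_of_nonneg_left (S.lam_le_tsum _) (norm_nonneg _))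
    refine Finset.sum_congr ?_ fun _ _ => rfl
    ext i; simp only [Finset.mem_Ico, Finset.mem_Icc]; omega
  have h3 : 0 ≤ ∑ i ∈ Finset.range k, ‖π (i + 1)‖ * lam (d (k - i)) :=
    Finset.sum_nonneg fun ℓ _ => mul_nonneg (norm_nonneg _) (S.lam_pos _).le
  rw [truncRate, ← mul_assoc, mul_left_comm, mul_inv_cancel₀ ha.ne', mul_one]
  nlinarith

/-- If the autoregression is trivial, the process is white noise. -/
theorem lagCov_eq_zero (S : Setting μ X ε ψ π lam ν d) (h0 : ∀ ℓ, π (ℓ + 1) = 0) (h : ℤ)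
    (hh : h ≠ 0) : lagCov μ X h = 0 := by
  have hae : ∀ j, X j =ᵐ[μ] ε j := fun j => by
    filter_upwards [S.inv.series j] with ω hω
    simp only [h0, zero_apply] at hω
    exact sub_eq_zero.mp (hω.unique hasSum_zero)
  ext u
  refine ext_inner_right ℝ fun v => ?_
  rw [S.proc.inner_lagCov_zero]
  have h1 := S.proc.noise.integral_inner_mul_inner 0 h u v
  rw [if_neg hh.symm] at h1
  simp only [zero_apply, inner_zero_left]
  rw [← h1]
  refine integral_congr_ae ?_
  filter_upwards [hae 0, hae h] with ω e1 e2
  rw [e1, e2]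

/-- One nonzero autoregressive coefficient suffices: ‖π_{ℓ+1}‖ λ at index d_k is at most ‖π_{ℓ+1}‖ λ
at index d_{k-ℓ}, a term of a sum bounded by α R(k), and R(k) → 0. This supplies the spectral gap
for Davis–Kahan. -/
theorem eventually_lam_le (S : Setting μ X ε ψ π lam ν d) (R : Rates μ X π lam ν d κ) {ℓ : ℕ}
    (hℓ : π (ℓ + 1) ≠ 0) {c : ℝ} (hc : 0 < c) :
    ∀ᶠ n in atTop, lam (d (κ n)) ≤ c * alpha μ X ν (d (κ n)) := by
  have hp : 0 < ‖π (ℓ + 1)‖ := norm_pos_iff.mpr hℓ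
  filter_upwards [R.trunc.eventually_le_const (mul_pos hc hp),
    R.tendsto.eventually_ge_atTop (ℓ + 1)] with n h1 h2
  have ha := S.alpha_pos (κ n)
  have h3 := S.sum_lam_le (k := κ n) (by omega)
  have h4 : ‖π (ℓ + 1)‖ * lam (d (κ n - ℓ)) ≤
      ∑ i ∈ Finset.range (κ n), ‖π (i + 1)‖ * lam (d (κ n - i)) :=
    Finset.single_le_sum (f := fun i => ‖π (i + 1)‖ * lam (d (κ n - i)))
      (fun i _ => mul_nonneg (norm_nonneg _) (S.lam_pos _).le) (Finset.mem_range.mpr h2)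
  have h5 : lam (d (κ n)) ≤ lam (d (κ n - ℓ)) := S.eig.1 (S.d_mono (Nat.sub_le _ _))
  have h6 : ‖π (ℓ + 1)‖ * lam (d (κ n)) ≤ ‖π (ℓ + 1)‖ * (c * alpha μ X ν (d (κ n))) :=
    calc _ ≤ ‖π (ℓ + 1)‖ * lam (d (κ n - ℓ)) := by gcongr
      _ ≤ _ := h4.trans h3
      _ ≤ alpha μ X ν (d (κ n)) * (c * ‖π (ℓ + 1)‖) := by gcongr
      _ = _ := by ring
  exact le_of_mul_le_mul_left h6 hp

theorem eventually_case (S : Setting μ X ε ψ π lam ν d) (R : Rates μ X π lam ν d κ) :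
    ∀ᶠ n in atTop, lam (d (κ n)) ≤ alpha μ X ν (d (κ n)) ∨ ∀ h ≠ 0, lagCov μ X h = 0 := by
  by_cases h0 : ∀ ℓ, π (ℓ + 1) = 0
  · exact Eventually.of_forall fun n => Or.inr (S.lagCov_eq_zero h0)
  · push Not at h0
    obtain ⟨ℓ, hℓ⟩ := h0
    filter_upwards [S.eventually_lam_le R hℓ one_pos] with n hn
    exact Or.inl (by rwa [one_mul] at hn)

end Setting

end Rates

-- Consequences of the rates, and paths with small deviations

section Good

variable {Ω H : Type*} [MeasurableSpace Ω] {μ : Measure Ω} [IsProbabilityMeasure μ]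
  [NormedAddCommGroup H] [InnerProductSpace ℝ H] [CompleteSpace H]
  [MeasurableSpace H] [BorelSpace H] [SecondCountableTopology H]
  {X ε : ℤ → Ω → H} {ψ π : ℕ → H →L[ℝ] H} {lam : ℕ → ℝ} {ν : HilbertBasis ℕ ℝ H} {d : ℕ → ℕ}
  {κ : ℕ → ℕ}

theorem tendsto_zero_of_le {f g : ℕ → ℝ} (hg : Tendsto g atTop (𝓝 0))
    (h0 : ∀ᶠ n in atTop, 0 ≤ f n) (h : ∀ᶠ n in atTop, f n ≤ g n) : Tendsto f atTop (𝓝 0) :=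
  tendsto_of_tendsto_of_tendsto_of_le_of_le' tendsto_const_nhds hg h0 h

theorem sub_cast_pos {k n : ℕ} (h : k < n) : (0 : ℝ) < n - k :=
  sub_pos.mpr (Nat.cast_lt.mpr h)

namespace Rates

/-- The square of `Rates.ratio` times α³, with α bounded by the largest eigenvalue. Boundary effects
have this order. -/
theorem tendsto_ratio (S : Setting μ X ε ψ π lam ν d) (R : Rates μ X π lam ν d κ) :
    Tendsto (fun n : ℕ => (κ n : ℝ) / (((n : ℝ) - κ n) * alpha μ X ν (d (κ n)))) atTop (𝓝 0) := by
  have h1 := (R.ratio.pow 2).mul_const (lam 0 ^ 3)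
  rw [zero_pow (by norm_num), zero_mul] at h1
  refine tendsto_zero_of_le h1 ?_ ?_
  · filter_upwards [R.lt] with n hn
    have := sub_cast_pos hn
    have := S.alpha_pos (κ n)
    positivity
  · filter_upwards [R.lt] with n hn
    have hp := sub_cast_pos hn
    have ha := S.alpha_pos (κ n)
    have hA := S.alpha_le (κ n)
    rw [mul_pow, mul_pow, inv_pow, Real.sq_sqrt (Nat.cast_nonneg _), Real.sq_sqrt hp.le]
    generalize alpha μ X ν (d (κ n)) = a at *
    calc _ = (κ n : ℝ) * ((n : ℝ) - κ n)⁻¹ * (a ^ 2)⁻¹ ^ 2 * a ^ 3 := by field_simp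
      _ ≤ _ := by gcongr

theorem eventually_le_two_mul (S : Setting μ X ε ψ π lam ν d) (R : Rates μ X π lam ν d κ) :
    ∀ᶠ n : ℕ in atTop, (n : ℝ) ≤ 2 * ((n : ℝ) - κ n) := by
  have hl := S.lam_pos 0
  filter_upwards [(R.tendsto_ratio S).eventually_le_const (inv_pos.mpr hl), R.lt] with n h hn
  have hp := sub_cast_pos hn
  have ha := S.alpha_pos (κ n)
  have hA := S.alpha_le (κ n)
  rw [div_le_iff₀ (by positivity), inv_mul_eq_div, le_div_iff₀ hl] at h
  have : (κ n : ℝ) * lam 0 ≤ (n - κ n) * lam 0 := h.trans (by gcongr)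
  have := le_of_mul_le_mul_right this hl
  linarith

/-- The square root of `Rates.power`, up to replacing n by 2(n - k). It says that the Toeplitz
deviation √n k^{3/4} is negligible against (n - k)α. -/
theorem tendsto_power (S : Setting μ X ε ψ π lam ν d) (R : Rates μ X π lam ν d κ) :
    Tendsto (fun n : ℕ => Real.sqrt n * (κ n : ℝ) ^ (3 / 4 : ℝ) /
      (((n : ℝ) - κ n) * alpha μ X ν (d (κ n)))) atTop (𝓝 0) := by
  have h1 := (R.power.sqrt).mul_const 2
  rw [Real.sqrt_zero, zero_mul] at h1
  refine tendsto_zero_of_le h1 ?_ ?_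
  · filter_upwards [R.lt] with n hn
    have := sub_cast_pos hn
    have := S.alpha_pos (κ n)
    positivity
  · filter_upwards [R.lt, R.eventually_le_two_mul S] with n hn h2
    have hp := sub_cast_pos hn
    have hn0 : (0 : ℝ) < n := by have := Nat.cast_nonneg (α := ℝ) (κ n); linarith
    have ha := S.alpha_pos (κ n)
    generalize alpha μ X ν (d (κ n)) = a at *
    have e1 : Real.sqrt ((κ n : ℝ) ^ (3 / 2 : ℝ)) = (κ n : ℝ) ^ (3 / 4 : ℝ) := by
      rw [Real.sqrt_eq_rpow, ← Real.rpow_mul (Nat.cast_nonneg _)]; norm_num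
    rw [Real.sqrt_mul (by positivity), Real.sqrt_mul (by positivity), e1, Real.sqrt_inv,
      Real.sqrt_sq ha.le, Real.sqrt_inv, div_le_iff₀ (by positivity)]
    have e2 : Real.sqrt n = n * (Real.sqrt n)⁻¹ := by
      rw [← div_eq_mul_inv, Real.div_sqrt]
    calc Real.sqrt n * (κ n : ℝ) ^ (3 / 4 : ℝ)
        = (n * (Real.sqrt n)⁻¹) * (κ n : ℝ) ^ (3 / 4 : ℝ) := by rw [← e2]
      _ ≤ (2 * ((n : ℝ) - κ n) * (Real.sqrt n)⁻¹) * (κ n : ℝ) ^ (3 / 4 : ℝ) := by gcongr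
      _ = _ := by field_simp

/-- Dominated by `Rates.ratio`, since k ≥ 1 and n - k ≤ n. It makes the covariance error of order
n^{-1/2} negligible against α². -/
theorem tendsto_cov (S : Setting μ X ε ψ π lam ν d) (R : Rates μ X π lam ν d κ) :
    Tendsto (fun n : ℕ => Real.sqrt n / (n * alpha μ X ν (d (κ n)) ^ 2)) atTop (𝓝 0) := by
  refine tendsto_zero_of_le R.ratio ?_ ?_
  · filter_upwards with n
    have := S.alpha_pos (κ n)
    positivity
  · filter_upwards [R.lt, R.tendsto.eventually_ge_atTop 1] with n hn hk
    have hp := sub_cast_pos hn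
    have hn0 : (0 : ℝ) < n := by have := Nat.cast_nonneg (α := ℝ) (κ n); linarith
    have hk1 : 1 ≤ Real.sqrt (κ n) := by
      rw [Real.one_le_sqrt]; exact_mod_cast hk
    have ha := S.alpha_pos (κ n)
    generalize alpha μ X ν (d (κ n)) = a at *
    rw [div_mul_eq_div_div, Real.sqrt_div_self, div_eq_mul_inv]
    refine mul_le_mul_of_nonneg_right ?_ (by positivity)
    calc (Real.sqrt n)⁻¹ ≤ (Real.sqrt (n - κ n))⁻¹ := by
          gcongr
          linarith [Nat.cast_nonneg (α := ℝ) (κ n)]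
      _ ≤ _ := le_mul_of_one_le_left (by positivity) hk1

theorem tendsto_cross (S : Setting μ X ε ψ π lam ν d) (R : Rates μ X π lam ν d κ) :
    Tendsto (fun n : ℕ => Real.sqrt ((n : ℝ) - κ n) * Real.sqrt (κ n) /
      (((n : ℝ) - κ n) * alpha μ X ν (d (κ n)))) atTop (𝓝 0) := by
  have h1 := R.ratio.mul_const (lam 0)
  rw [zero_mul] at h1
  refine tendsto_zero_of_le h1 ?_ ?_
  · filter_upwards [R.lt] with n hn
    have := sub_cast_pos hn
    have := S.alpha_pos (κ n)
    positivity
  · filter_upwards [R.lt] with n hn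
    have hp := sub_cast_pos hn
    have ha := S.alpha_pos (κ n)
    have hA := S.alpha_le (κ n)
    generalize alpha μ X ν (d (κ n)) = a at *
    calc _ = Real.sqrt (κ n) * (Real.sqrt ((n : ℝ) - κ n) / ((n : ℝ) - κ n)) * a⁻¹ := by field_simp
      _ = Real.sqrt (κ n) * (Real.sqrt ((n : ℝ) - κ n))⁻¹ * (a ^ 2)⁻¹ * a := by
          rw [Real.sqrt_div_self]; field_simp
      _ ≤ _ := by gcongr

theorem tendsto_tail (S : Setting μ X ε ψ π lam ν d) (R : Rates μ X π lam ν d κ) :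
    Tendsto (fun n : ℕ => (∑' ℓ : ℕ, ‖π (κ n + 1 + ℓ)‖) ^ 2 / alpha μ X ν (d (κ n)))
      atTop (𝓝 0) := by
  have h1 := (R.trunc.pow 2).const_mul (lam 0)
  rw [zero_pow (by norm_num), mul_zero] at h1
  refine tendsto_zero_of_le h1 ?_ ?_
  · filter_upwards with n
    have := S.alpha_pos (κ n)
    positivity
  · filter_upwards [R.tendsto.eventually_ge_atTop 1] with n hk
    have h2 := S.tail_le hk
    have ha := S.alpha_pos (κ n)
    have hA := S.alpha_le (κ n)
    have h3 : 0 ≤ ∑' ℓ : ℕ, ‖π (κ n + 1 + ℓ)‖ := tsum_nonneg fun _ => norm_nonneg _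
    generalize ∑' ℓ : ℕ, ‖π (κ n + 1 + ℓ)‖ = t at *
    generalize truncRate (alpha μ X ν) π lam d (κ n) = r at *
    generalize alpha μ X ν (d (κ n)) = a at *
    rw [div_le_iff₀ ha]
    calc t ^ 2 ≤ (a * r) ^ 2 := by gcongr
      _ = a * r ^ 2 * a := by ring
      _ ≤ _ := by gcongr

end Rates

/-- The deviations of the path from its population behaviour are small. -/
structure Good (μ : Measure Ω) (X : ℤ → Ω → H) (π : ℕ → H →L[ℝ] H) (ν : HilbertBasis ℕ ℝ H)
    (d : ℕ → ℕ) (n k : ℕ) (δ : ℝ) (x y : ℤ → H) (e : ℕ → H) : Prop where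
  cov : ‖sampleCov x n 0 - lagCov μ X 0‖ ≤ δ * alpha μ X ν (d k) ^ 2
  low : ∀ v : ℕ → H, (∀ i, projSpan e (d k) (v i) = v i) →
      ((n : ℝ) - k) * alpha μ X ν (d k) * ∑ i ∈ Finset.range k, ‖v i‖ ^ 2 ≤
        ∑ j ∈ Finset.Ico (k : ℤ) n, (∑ i ∈ Finset.range k, ⟪x (j - i), v i⟫_ℝ) ^ 2
  cross : ∀ (v : ℕ → H) (u : H), |∑ j ∈ Finset.Ico (k : ℤ) n,
      (∑ i ∈ Finset.range k, ⟪x (j - i), v i⟫_ℝ) * ⟪y (j + 1), u⟫_ℝ| ≤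
        δ * (((n : ℝ) - k) * alpha μ X ν (d k)) *
          Real.sqrt (∑ i ∈ Finset.range k, ‖v i‖ ^ 2) * ‖u‖
  tail : residSum (tailCoef π k) x (Finset.Ico (k : ℤ) n) ≤
    ENNReal.ofReal (δ * (((n : ℝ) - k) * alpha μ X ν (d k)))
  full : residSum (fullCoef π) x (Finset.Ico (0 : ℤ) (n + k) \ Finset.Ico (k : ℤ) n) ≤
      ENNReal.ofReal (δ * (((n : ℝ) - k) * alpha μ X ν (d k)))
  inv : ∀ q : ℤ, HasSum (fun l : ℕ => π (l + 1) (x (q - (l + 1 : ℕ)))) (x q - y q)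

theorem tsum_tailCoef {π : ℕ → H →L[ℝ] H} (hπ : Summable fun ℓ => ‖π (ℓ + 1)‖) (k : ℕ) :
    ∑' l, tailCoef π k l = ENNReal.ofReal (∑' ℓ : ℕ, ‖π (k + 1 + ℓ)‖) := by
  rw [← Summable.sum_add_tsum_nat_add' (k := k + 1) ENNReal.summable,
    Finset.sum_eq_zero fun l hl => by
      rw [Finset.mem_range] at hl; rw [tailCoef, if_neg (by omega)], zero_add]
  have hs : Summable fun ℓ => ‖π (k + 1 + ℓ)‖ := by
    have := (summable_nat_add_iff k).mpr hπ
    refine this.congr fun ℓ => ?_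
    rw [show ℓ + k + 1 = k + 1 + ℓ by ring]
  rw [ENNReal.ofReal_tsum_of_nonneg (fun _ => norm_nonneg _) hs]
  refine tsum_congr fun l => ?_
  rw [tailCoef, if_pos (by omega), ofReal_norm, add_comm]

theorem tsum_fullCoef {π : ℕ → H →L[ℝ] H} (hπ : Summable fun ℓ => ‖π (ℓ + 1)‖) :
    ∑' l, fullCoef π l = ENNReal.ofReal (1 + ∑' ℓ : ℕ, ‖π (ℓ + 1)‖) := by
  rw [← Summable.sum_add_tsum_nat_add' (k := 1) ENNReal.summable, Finset.sum_range_one,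
    ENNReal.ofReal_add zero_le_one (tsum_nonneg fun _ => norm_nonneg _),
    ENNReal.ofReal_tsum_of_nonneg (fun _ => norm_nonneg _) hπ]
  simp [fullCoef]

variable {lamHat : ℕ → Ω → ℕ → ℝ} {νHat : ℕ → Ω → HilbertBasis ℕ ℝ H}

/-- The Toeplitz deviation with window length one has mean O(√n), so the error of the sample
covariance is O(n^{-1/2}), small against α² by `Rates.tendsto_cov`. -/
theorem Setting.whp_cov (S : Setting μ X ε ψ π lam ν d) (R : Rates μ X π lam ν d κ) {δ : ℝ}
    (hδ : 0 < δ) : Whp μ fun n ω => ‖sampleCov (fun j => X j ω) n 0 - lagCov μ X 0‖ ≤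
      δ * alpha μ X ν (d (κ n)) ^ 2 := by
  set K := 21 * (∑' m, ‖ψ m‖) ^ 2 * Real.sqrt (∫ ω, ‖ε 0 ω‖ ^ 4 ∂μ) with hK
  have h1 : Whp μ fun n ω => toepDev μ ε ψ ν (Finset.Ico 1 (1 + (n : ℤ))) 1 ω ≤
      ENNReal.ofReal (δ / 2 * (n * alpha μ X ν (d (κ n)) ^ 2)) := by
    refine Whp.of_lintegral (fun n => S.proc.noise.aemeasurable_toepDev ψ ν _ 1)
      (B := fun n => K * Real.sqrt n) (Eventually.of_forall fun n => ?_) ?_ ?_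
    · refine (S.proc.noise.lintegral_toepDev_le S.proc.summable ν _ le_rfl).trans (le_of_eq ?_)
      rw [hK]
      simp
    · filter_upwards [eventually_gt_atTop 0] with n hn
      have := S.alpha_pos (κ n)
      positivity
    · have := (R.tendsto_cov S).const_mul (K / (δ / 2))
      rw [mul_zero] at this
      refine this.congr fun n => ?_
      rw [div_mul_div_comm]
  refine h1.mono_ae ?_
  filter_upwards [eventually_gt_atTop 0] with n hn
  filter_upwards [S.proc.norm_sampleCov_sub_le ν hn] with ω hω hZ
  have hn' : (0 : ℝ) < n := by exact_mod_cast hn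
  have ha := S.alpha_pos (κ n)
  have h2 := ENNReal.toReal_le_of_le_ofReal (by positivity) hZ
  refine (hω (ne_top_of_le_ne_top ENNReal.ofReal_ne_top hZ)).trans ?_
  rw [div_le_iff₀ hn']
  linarith

theorem Setting.whp_toepDev (S : Setting μ X ε ψ π lam ν d) (R : Rates μ X π lam ν d κ) {δ : ℝ}
    (hδ : 0 < δ) (I : ℕ → Finset ℤ) (hI : ∀ᶠ n in atTop, (I n).card ≤ n) :
    Whp μ fun n ω => toepDev μ ε ψ ν (I n) (κ n) ω ≤
      ENNReal.ofReal (δ * (((n : ℝ) - κ n) * alpha μ X ν (d (κ n)))) := by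
  set K := 21 * (∑' m, ‖ψ m‖) ^ 2 * Real.sqrt (∫ ω, ‖ε 0 ω‖ ^ 4 ∂μ) with hK
  refine Whp.of_lintegral (fun n => S.proc.noise.aemeasurable_toepDev ψ ν _ _)
    (B := fun n => K * (Real.sqrt n * (κ n : ℝ) ^ (3 / 4 : ℝ))) ?_ ?_ ?_
  · filter_upwards [R.tendsto.eventually_ge_atTop 1, hI] with n hk hc
    refine (S.proc.noise.lintegral_toepDev_le S.proc.summable ν _ hk).trans
      (ENNReal.ofReal_le_ofReal ?_)
    rw [← hK, mul_assoc]
    have hc' : ((I n).card : ℝ) ≤ n := by exact_mod_cast hc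
    gcongr
  · filter_upwards [R.lt] with n hn
    have hp := sub_cast_pos hn
    have := S.alpha_pos (κ n)
    positivity
  · have := (R.tendsto_power S).const_mul (K / δ)
    rw [mul_zero] at this
    refine this.congr fun n => ?_
    rw [div_mul_div_comm]

/-- The covariance error puts the sample eigenspaces within reach of `le_covForm`, and the Toeplitz
deviations over the long interval and the two short end intervals then pass the bound to the data.
-/
theorem Setting.whp_low (S : Setting μ X ε ψ π lam ν d) (R : Rates μ X π lam ν d κ)
    (hνHat : ∀ n ω, IsEigenbasis (sampleCov (fun j => X j ω) n 0) (lamHat n ω) (νHat n ω)) :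
    Whp μ fun n ω => ∀ v : ℕ → H, (∀ i, projSpan (νHat n ω) (d (κ n)) (v i) = v i) →
      ((n : ℝ) - κ n) * alpha μ X ν (d (κ n)) * ∑ i ∈ Finset.range (κ n), ‖v i‖ ^ 2 ≤
        ∑ j ∈ Finset.Ico (κ n : ℤ) n,
          (∑ i ∈ Finset.range (κ n), ⟪X (j - i) ω, v i⟫_ℝ) ^ 2 := by
  set G := ∑' h, ‖lagCov μ X h‖ with hG
  have hG0 : 0 ≤ G := tsum_nonneg fun _ => norm_nonneg _
  have hA := S.lam_pos 0
  -- These inequalities at α = λ_1 imply, for every α ≤ λ_1, the two conditions θ ≤ α and (πα + G)θ²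
  -- ≤ α³ with θ = δα². The reciprocal of a number dominating both products is a witness.
  obtain ⟨δ, hδ, hδ1, hδ2⟩ : ∃ δ : ℝ, 0 < δ ∧ δ * lam 0 ≤ 1 ∧
      (Real.pi * lam 0 + G) * (δ ^ 2 * lam 0) ≤ 1 := by
    have hpos : 0 < (Real.pi * lam 0 + G) * lam 0 + lam 0 + 1 := by positivity
    refine ⟨((Real.pi * lam 0 + G) * lam 0 + lam 0 + 1)⁻¹, by positivity, ?_, ?_⟩
    · rw [inv_mul_le_iff₀ hpos]
      have : 0 ≤ (Real.pi * lam 0 + G) * lam 0 := by positivity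
      linarith
    · set t := (Real.pi * lam 0 + G) * lam 0 + lam 0 + 1 with ht
      have h1 : 1 ≤ t := by
        have : 0 ≤ (Real.pi * lam 0 + G) * lam 0 := by positivity
        linarith
      rw [show (Real.pi * lam 0 + G) * (t⁻¹ ^ 2 * lam 0) =
        ((Real.pi * lam 0 + G) * lam 0) / t ^ 2 by field_simp, div_le_one (by positivity)]
      nlinarith
  have w0 := S.whp_cov R hδ
  -- With Z = (n - k)α/12 the deviations 6Z take half of the allowance (n - k)α; the edge term 4kG
  -- takes the other half.
  have w1 := S.whp_toepDev R (δ := 1 / 12) (by norm_num)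
    (fun n => Finset.Ico 1 (1 + (n - 1 : ℕ))) (Eventually.of_forall fun n => by simp)
  have w2 := S.whp_toepDev R (δ := 1 / 12) (by norm_num)
    (fun n => Finset.Ico 1 (1 + (κ n - 1 : ℕ))) (by
      filter_upwards [R.lt] with n hn; simp; omega)
  have w3 := S.whp_toepDev R (δ := 1 / 12) (by norm_num)
    (fun n => Finset.Ico ((n - κ n + 1 : ℕ) : ℤ) ((n - κ n + 1 : ℕ) + (κ n - 1 : ℕ))) (by
      filter_upwards [R.lt] with n hn; simp; omega)
  refine (w0.and (w1.and (w2.and w3))).mono_ae ?_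
  have hGr := (R.tendsto_ratio S).const_mul (4 * G)
  rw [mul_zero] at hGr
  filter_upwards [R.lt, R.tendsto.eventually_ge_atTop 1, S.eventually_case R,
    hGr.eventually_le_const (show (0 : ℝ) < 1 / 2 by norm_num)] with n hn hk hcase hGn
  filter_upwards [S.proc.le_sum_window_sq ν hk hn] with ω hω ⟨h0, h1, h2, h3⟩ v hv
  have hp := sub_cast_pos hn
  have ha := S.alpha_pos (κ n)
  have haA := S.alpha_le (κ n)
  set a := alpha μ X ν (d (κ n)) with hadef
  refine hω a (1 / 12 * (((n : ℝ) - κ n) * a)) h1 h2 h3 (by positivity) ?_ v ?_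
  · rw [← mul_div_assoc, div_le_iff₀ (by positivity)] at hGn
    linarith
  · obtain ⟨m, hm⟩ := Nat.exists_eq_succ_of_ne_zero (S.d_pos (κ n)).ne'
    rw [Nat.succ_eq_add_one] at hm
    refine S.proc.le_covForm S.eig (fun i => (S.lam_pos i).le) (hνHat n ω) (d := m)
      (hm ▸ S.alpha_pos (κ n)) (by rw [hadef, hm]) h0 ?_ ?_ (hm ▸ hcase) (fun i => hm ▸ hv i)
    · have h4 : δ * a ≤ 1 := (mul_le_mul_of_nonneg_left haA hδ.le).trans hδ1
      calc δ * a ^ 2 = (δ * a) * a := by ring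
        _ ≤ 1 * a := by gcongr
        _ = a := one_mul a
    · have h5 : (Real.pi * a + G) * (δ ^ 2 * a) ≤ 1 := le_trans (by gcongr) hδ2
      calc (Real.pi * a + G) * (δ * a ^ 2) ^ 2 = (Real.pi * a + G) * (δ ^ 2 * a) * a ^ 3 := by ring
        _ ≤ 1 * a ^ 3 := by gcongr
        _ = _ := one_mul _

theorem Setting.whp_cross (S : Setting μ X ε ψ π lam ν d) (R : Rates μ X π lam ν d κ) {δ : ℝ}
    (hδ : 0 < δ) : Whp μ fun n ω => ∀ (v : ℕ → H) (u : H), |∑ j ∈ Finset.Ico (κ n : ℤ) n,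
      (∑ i ∈ Finset.range (κ n), ⟪X (j - i) ω, v i⟫_ℝ) * ⟪ε (j + 1) ω, u⟫_ℝ| ≤
        δ * (((n : ℝ) - κ n) * alpha μ X ν (d (κ n))) *
          Real.sqrt (∑ i ∈ Finset.range (κ n), ‖v i‖ ^ 2) * ‖u‖ := by
  set K := (∑' m, ‖ψ m‖) * (4 * Real.sqrt (∫ ω, ‖ε 0 ω‖ ^ 4 ∂μ)) with hK
  have h1 : Whp μ fun n ω => crossDev ε ψ (Finset.Ico ((κ n : ℤ) + 1) (n + 1)) (κ n) ω ≤
      ENNReal.ofReal (δ * (((n : ℝ) - κ n) * alpha μ X ν (d (κ n)))) := by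
    refine Whp.of_lintegral (fun n => S.proc.noise.aemeasurable_crossDev _ _)
      (B := fun n => K * (Real.sqrt ((n : ℝ) - κ n) * Real.sqrt (κ n))) ?_ ?_ ?_
    · filter_upwards [R.lt] with n hn
      refine (S.proc.noise.lintegral_crossDev_le S.proc.summable _ _).trans (le_of_eq ?_)
      have : ((Finset.Ico ((κ n : ℤ) + 1) (n + 1)).card : ℝ) = n - κ n := by
        rw [Int.card_Ico, ← Nat.cast_sub hn.le]
        congr 1
        omega
      rw [this, hK]
      congr 1; ring
    · filter_upwards [R.lt] with n hn
      have hp := sub_cast_pos hn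
      have := S.alpha_pos (κ n)
      positivity
    · have := (R.tendsto_cross S).const_mul (K / δ)
      rw [mul_zero] at this
      refine this.congr fun n => ?_
      rw [div_mul_div_comm]
  refine h1.mono_ae ?_
  filter_upwards [R.lt] with n hn
  filter_upwards [S.proc.abs_sum_mul_le (Finset.Ico ((κ n : ℤ) + 1) (n + 1)) (κ n)]
    with ω hω hZ v u
  have hp := sub_cast_pos hn
  have ha := S.alpha_pos (κ n)
  have h2 := ENNReal.toReal_le_of_le_ofReal (by positivity) hZ
  have h3 := hω (ne_top_of_le_ne_top ENNReal.ofReal_ne_top hZ) v u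
  rw [← Finset.sum_Ico_add'] at h3
  simp only [add_sub_cancel_right] at h3
  refine h3.trans ?_
  gcongr

/-- Markov with the L² bound for the process: the relevant size is the number of windows times the
squared sum of the coefficients. It is applied to the tail over complete windows and to the full
coefficients over at most 2k incomplete ones. -/
theorem Setting.whp_residSum (S : Setting μ X ε ψ π lam ν d) (R : Rates μ X π lam ν d κ) {δ : ℝ}
    (hδ : 0 < δ) (c : ℕ → ℕ → ℝ≥0∞) (J : ℕ → Finset ℤ) (s m : ℕ → ℝ) (hs0 : ∀ n, 0 ≤ s n)
    (hs : ∀ n, ∑' l, c n l = ENNReal.ofReal (s n)) (hm : ∀ᶠ n in atTop, ((J n).card : ℝ) ≤ m n)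
    (h : Tendsto (fun n : ℕ => m n * s n ^ 2 / (((n : ℝ) - κ n) * alpha μ X ν (d (κ n))))
      atTop (𝓝 0)) :
    Whp μ fun n ω => residSum (c n) (fun j => X j ω) (J n) ≤
      ENNReal.ofReal (δ * (((n : ℝ) - κ n) * alpha μ X ν (d (κ n)))) := by
  set K := (∑' m, ‖ψ m‖) ^ 2 * ∫ ω, ‖ε 0 ω‖ ^ 2 ∂μ with hK
  have hK0 : 0 ≤ K := mul_nonneg (sq_nonneg _) (integral_nonneg fun _ => by positivity)
  refine Whp.of_lintegral (fun n => S.proc.aemeasurable_residSum _ _)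
    (B := fun n => K * (m n * s n ^ 2)) ?_ ?_ ?_
  · filter_upwards [hm] with n hmn
    refine (S.proc.lintegral_residSum_le _ _).trans ?_
    have := hs0 n
    rw [hs, ← ENNReal.ofReal_pow (hs0 n), ← ENNReal.ofReal_mul (by positivity),
      ← ENNReal.ofReal_natCast, ← ENNReal.ofReal_mul (by positivity)]
    refine ENNReal.ofReal_le_ofReal ?_
    rw [← hK]
    calc ((J n).card : ℝ) * (s n ^ 2 * K) ≤ m n * (s n ^ 2 * K) := by gcongr
      _ = _ := by ring
  · filter_upwards [R.lt] with n hn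
    have hp := sub_cast_pos hn
    have := S.alpha_pos (κ n)
    positivity
  · have := h.const_mul (K / δ)
    rw [mul_zero] at this
    refine this.congr fun n => ?_
    rw [div_mul_div_comm]

theorem Setting.whp_good (S : Setting μ X ε ψ π lam ν d) (R : Rates μ X π lam ν d κ)
    (hνHat : ∀ n ω, IsEigenbasis (sampleCov (fun j => X j ω) n 0) (lamHat n ω) (νHat n ω)) {δ : ℝ}
    (hδ : 0 < δ) : Whp μ fun n ω =>
      Good μ X π ν d n (κ n) δ (fun j => X j ω) (fun j => ε j ω) (νHat n ω) := by
  have hQ0 : 0 ≤ ∑' ℓ : ℕ, ‖π (ℓ + 1)‖ := tsum_nonneg fun _ => norm_nonneg _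
  have w1 := S.whp_residSum R hδ (fun n => tailCoef π (κ n)) (fun n => Finset.Ico (κ n : ℤ) n)
    (fun n => ∑' ℓ : ℕ, ‖π (κ n + 1 + ℓ)‖) (fun n => (n : ℝ) - κ n)
    (fun n => tsum_nonneg fun _ => norm_nonneg _) (fun n => tsum_tailCoef S.inv.summable _)
    (by
      filter_upwards [R.lt] with n hn
      have : ((n : ℤ) - κ n).toNat = n - κ n := by omega
      rw [Int.card_Ico, this, Nat.cast_sub hn.le])
    (by
      refine (R.tendsto_tail S).congr' ?_
      filter_upwards [R.lt] with n hn
      have hp := sub_cast_pos hn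
      rw [mul_div_mul_left _ _ hp.ne'])
  have w2 := S.whp_residSum R hδ (fun _ => fullCoef π)
    (fun n => Finset.Ico (0 : ℤ) (n + κ n) \ Finset.Ico (κ n : ℤ) n)
    (fun n => 1 + ∑' ℓ : ℕ, ‖π (ℓ + 1)‖) (fun n => 2 * κ n)
    (fun n => by positivity) (fun n => tsum_fullCoef S.inv.summable)
    (by
      filter_upwards [R.lt] with n hn
      rw [Finset.card_sdiff_of_subset (Finset.Ico_subset_Ico (by omega) (by omega)), Int.card_Ico,
        Int.card_Ico]
      exact_mod_cast (by omega : ((n : ℤ) + κ n - 0).toNat - ((n : ℤ) - κ n).toNat ≤ 2 * κ n))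
    (by
      have := (R.tendsto_ratio S).const_mul (2 * (1 + ∑' ℓ : ℕ, ‖π (ℓ + 1)‖) ^ 2)
      rw [mul_zero] at this
      refine this.congr fun n => ?_
      ring)
  refine ((S.whp_cov R hδ).and ((S.whp_low R hνHat).and ((S.whp_cross R hδ).and
    (w1.and w2)))).mono_ae (Eventually.of_forall fun n => ?_)
  filter_upwards [ae_all_iff.mpr S.inv.series] with ω hω ⟨h1, h2, h3, h4, h5⟩
  exact ⟨h1, h2, h3, h4, h5, hω⟩

end Good

/-! ### Algebra of the Innovations Algorithm -/

section Innovations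

variable {H : Type*} [NormedAddCommGroup H] [InnerProductSpace ℝ H] [CompleteSpace H]
  {C P : ℕ → H →L[ℝ] H}

theorem IsOrthProj.star_eq {P : H →L[ℝ] H} (hP : IsOrthProj P) : star P = P := by
  rw [ContinuousLinearMap.star_eq_adjoint]
  symm
  rw [ContinuousLinearMap.eq_adjoint_iff]
  exact hP.symm

theorem compInv_mul_self {P : H →L[ℝ] H} (hP : IsOrthProj P) (T : H →L[ℝ] H) :
    compInv P T * P = compInv P T := by
  rw [compInv, mul_assoc, hP.mul_self]

/-- The entries of the projected block Toeplitz matrix of covariances. -/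
noncomputable def toepOp (C P : ℕ → H →L[ℝ] H) (a b : ℕ) : H →L[ℝ] H :=
  if b ≤ a then P (a + 1) * C (a - b) * P (b + 1) else P (a + 1) * star (C (b - a)) * P (b + 1)

/-- The lower triangular factor with the innovations coefficients. -/
noncomputable def innovL (C P : ℕ → H →L[ℝ] H) (a b : ℕ) : H →L[ℝ] H :=
  if b < a then innovRev C P a b else if b = a then P (a + 1) else 0

theorem innovL_of_lt {a b : ℕ} (h : b < a) : innovL C P a b = innovRev C P a b := if_pos h

theorem innovL_self (a : ℕ) : innovL C P a a = P (a + 1) := by simp [innovL]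

theorem innovL_of_gt {a b : ℕ} (h : a < b) : innovL C P a b = 0 := by
  rw [innovL, if_neg (by omega), if_neg (by omega)]

theorem innovVar_eq (k : ℕ) : innovVar C P k = P (k + 1) * C 0 * P (k + 1) -
    ∑ j ∈ Finset.range k, innovL C P k j * innovVar C P j * star (innovL C P k j) := by
  rw [innovVar, Finset.sum_range]
  congr 1
  refine Finset.sum_congr rfl fun j _ => ?_
  rw [innovL_of_lt j.2, ContinuousLinearMap.star_eq_adjoint]

theorem innovL_eq {a b : ℕ} (h : b < a) : innovL C P a b = (P (a + 1) * C (a - b) * P (b + 1) -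
    ∑ j ∈ Finset.range b, innovL C P a j * innovVar C P j * star (innovL C P b j)) *
      compInv (P (b + 1)) (innovVar C P b) := by
  rw [innovL_of_lt h, innovRev, dif_pos h, Finset.sum_range]
  congr 2
  refine Finset.sum_congr rfl fun j _ => ?_
  rw [innovL_of_lt j.2, innovL_of_lt (j.2.trans h), ContinuousLinearMap.star_eq_adjoint]

theorem proj_mul_innovL (hP : ∀ i, IsOrthProj (P i)) (a b : ℕ) :
    P (a + 1) * innovL C P a b = innovL C P a b := by
  induction b using Nat.strong_induction_on with
  | _ b ih =>
    rcases lt_trichotomy b a with h | h | h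
    · rw [innovL_eq h, ← mul_assoc, mul_sub, Finset.mul_sum]
      congr 2
      · rw [← mul_assoc, ← mul_assoc, (hP _).mul_self]
      · refine Finset.sum_congr rfl fun j hj => ?_
        rw [← mul_assoc, ← mul_assoc, ih j (Finset.mem_range.mp hj)]
    · subst h; rw [innovL_self, (hP _).mul_self]
    · rw [innovL_of_gt h, mul_zero]

theorem innovL_mul_proj (hP : ∀ i, IsOrthProj (P i)) (a b : ℕ) :
    innovL C P a b * P (b + 1) = innovL C P a b := by
  rcases lt_trichotomy b a with h | h | h
  · rw [innovL_eq h, mul_assoc, compInv_mul_self (hP _)]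
  · subst h; rw [innovL_self, (hP _).mul_self]
  · rw [innovL_of_gt h, zero_mul]

theorem star_innovL_mul_proj (hP : ∀ i, IsOrthProj (P i)) (a b : ℕ) :
    star (innovL C P a b) * P (a + 1) = star (innovL C P a b) := by
  conv_lhs => rw [← (hP (a + 1)).star_eq, ← star_mul, proj_mul_innovL hP]

theorem proj_mul_star_innovL (hP : ∀ i, IsOrthProj (P i)) (a b : ℕ) :
    P (b + 1) * star (innovL C P a b) = star (innovL C P a b) := by
  conv_lhs => rw [← (hP (b + 1)).star_eq, ← star_mul, innovL_mul_proj hP]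

theorem star_innovVar (hP : ∀ i, IsOrthProj (P i)) (hC : star (C 0) = C 0) (k : ℕ) :
    star (innovVar C P k) = innovVar C P k := by
  induction k using Nat.strong_induction_on with
  | _ k ih =>
    rw [innovVar_eq, star_sub, star_sum]
    congr 1
    · rw [star_mul, star_mul, (hP _).star_eq, hC, mul_assoc]
    · refine Finset.sum_congr rfl fun j hj => ?_
      rw [star_mul, star_mul, star_star, ih j (Finset.mem_range.mp hj), mul_assoc]

theorem proj_mul_innovVar (hP : ∀ i, IsOrthProj (P i)) (k : ℕ) :
    P (k + 1) * innovVar C P k = innovVar C P k := by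
  rw [innovVar_eq, mul_sub, Finset.mul_sum]
  congr 1
  · rw [← mul_assoc, ← mul_assoc, (hP _).mul_self]
  · refine Finset.sum_congr rfl fun j _ => ?_
    rw [← mul_assoc, ← mul_assoc, proj_mul_innovL hP]

theorem innovVar_mul_proj (hP : ∀ i, IsOrthProj (P i)) (k : ℕ) :
    innovVar C P k * P (k + 1) = innovVar C P k := by
  rw [innovVar_eq, sub_mul, Finset.sum_mul]
  congr 1
  · rw [mul_assoc, (hP _).mul_self]
  · refine Finset.sum_congr rfl fun j _ => ?_
    rw [mul_assoc, star_innovL_mul_proj hP]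

/-- Coercivity of the innovation variance on the range of its projection. -/
def InnovPos (C P : ℕ → H →L[ℝ] H) (b : ℕ) : Prop :=
  ∃ c > 0, ∀ v, P (b + 1) v = v → c * ‖v‖ ^ 2 ≤ ⟪innovVar C P b v, v⟫_ℝ

/-- Once V_b is invertible on the range of its projection, multiplying by it undoes the inverse in
the recursion. What remains is one entry of the factorization L V L*. -/
theorem innovL_mul_innovVar (hP : ∀ i, IsOrthProj (P i)) {a b : ℕ} (h : b < a)
    (hb : InnovPos C P b) : innovL C P a b * innovVar C P b = P (a + 1) * C (a - b) * P (b + 1) -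
      ∑ j ∈ Finset.range b, innovL C P a j * innovVar C P j * star (innovL C P b j) := by
  obtain ⟨c, hc, hv⟩ := hb
  obtain ⟨-, -, h3, -⟩ := comp_mul_compInv (hP (b + 1)) hc hv
  rw [proj_mul_innovVar hP, innovVar_mul_proj hP] at h3
  rw [innovL_eq h, mul_assoc, h3, sub_mul, Finset.sum_mul]
  congr 1
  · rw [mul_assoc, (hP _).mul_self]
  · refine Finset.sum_congr rfl fun j _ => ?_
    rw [mul_assoc, star_innovL_mul_proj hP]

/-- The Innovations Algorithm is a block factorization G = L V L* with projections on the diagonal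
of L. Below the diagonal this is the recursion for θ, on the diagonal the recursion for V. -/
theorem toepOp_eq_sum_of_le (hP : ∀ i, IsOrthProj (P i)) {a b : ℕ} (h : b ≤ a)
    (hb : b < a → InnovPos C P b) : toepOp C P a b = ∑ j ∈ Finset.range (b + 1),
      innovL C P a j * innovVar C P j * star (innovL C P b j) := by
  rw [toepOp, if_pos h, Finset.sum_range_succ, innovL_self, (hP _).star_eq]
  rcases h.lt_or_eq with h' | h'
  · rw [innovL_mul_innovVar hP h' (hb h'), sub_mul, mul_assoc _ (P (b + 1)), (hP _).mul_self,
      Finset.sum_mul]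
    have : ∀ j ∈ Finset.range b, innovL C P a j * innovVar C P j * star (innovL C P b j) *
        P (b + 1) = innovL C P a j * innovVar C P j * star (innovL C P b j) := fun j _ => by
      rw [mul_assoc _ _ (P (b + 1)), star_innovL_mul_proj hP]
    rw [Finset.sum_congr rfl this]
    abel
  · subst h'
    rw [innovL_self, proj_mul_innovVar hP, innovVar_mul_proj hP, innovVar_eq b, Nat.sub_self]
    abel

theorem star_toepOp (hP : ∀ i, IsOrthProj (P i)) (hC : star (C 0) = C 0) (a b : ℕ) :
    star (toepOp C P a b) = toepOp C P b a := by
  rw [toepOp, toepOp]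
  rcases lt_trichotomy b a with h | h | h
  · rw [if_pos h.le, if_neg (by omega), star_mul, star_mul, (hP _).star_eq, (hP _).star_eq,
      mul_assoc]
  · subst h
    rw [if_pos le_rfl, star_mul, star_mul, (hP _).star_eq, Nat.sub_self, hC, mul_assoc]
  · rw [if_neg (by omega), if_pos h.le, star_mul, star_mul, (hP _).star_eq, (hP _).star_eq,
      star_star, mul_assoc]

theorem toepOp_eq_sum (hP : ∀ i, IsOrthProj (P i)) (hC : star (C 0) = C 0) {a b N : ℕ}
    (hN : ∀ j, j < a → j ≤ b → InnovPos C P j) (hN' : ∀ j, j < b → j ≤ a → InnovPos C P j)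
    (hmin : min a b < N) : toepOp C P a b = ∑ j ∈ Finset.range N,
      innovL C P a j * innovVar C P j * star (innovL C P b j) := by
  rcases le_total b a with h | h
  · rw [toepOp_eq_sum_of_le hP h fun h' => hN b h' le_rfl]
    refine Finset.sum_subset (Finset.range_subset_range.mpr (by omega)) fun j _ hj => ?_
    rw [Finset.mem_range] at hj
    rw [innovL_of_gt (a := b) (by omega), star_zero, mul_zero]
  · rw [← star_toepOp hP hC, toepOp_eq_sum_of_le hP h fun h' => hN' a h' le_rfl, star_sum]
    refine (Finset.sum_congr rfl fun j _ => ?_).trans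
      (Finset.sum_subset (Finset.range_subset_range.mpr (by omega)) fun j _ hj => ?_)
    · rw [star_mul, star_mul, star_star, star_innovVar hP hC, mul_assoc]
    · rw [Finset.mem_range] at hj
      rw [innovL_of_gt (a := a) (by omega), zero_mul, zero_mul]

/-- Solution of the triangular system that decorrelates the last component. -/
theorem exists_decorrelate (hP : ∀ i, IsOrthProj (P i)) (b : ℕ) {u : H} (hu : P (b + 1) u = u)
    (t : ℕ) (ht : t ≤ b) : ∃ z : ℕ → H, z b = u ∧ (∀ a, P (a + 1) (z a) = z a) ∧
      (∀ a, b < a → z a = 0) ∧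
      ∀ j, b - t ≤ j → j < b → ∑ a ∈ Finset.range (b + 1), star (innovL C P a j) (z a) = 0 := by
  induction t with
  | zero =>
    refine ⟨fun a => if a = b then u else 0, by simp, fun a => ?_, fun a ha => ?_, fun j h1 h2 => ?_⟩
    · by_cases h : a = b
      · subst h; simpa using hu
      · simp [h]
    · simp [ha.ne']
    · omega
  | succ t ih =>
    obtain ⟨z, h1, h2, h3, h4⟩ := ih (by omega)
    set i := b - (t + 1) with hi
    -- Back substitution: L* is upper triangular with projections on its diagonal, so the i-th
    -- equation determines the i-th component from the later ones.
    set y : H := -∑ a ∈ Finset.Ico (i + 1) (b + 1), star (innovL C P a i) (z a) with hy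
    refine ⟨Function.update z i y, ?_, fun a => ?_, fun a ha => ?_, fun j hj1 hj2 => ?_⟩
    · rw [Function.update_of_ne (by omega), h1]
    · rcases eq_or_ne a i with rfl | h
      · rw [Function.update_self, hy, map_neg, map_sum]
        congr 1
        refine Finset.sum_congr rfl fun a _ => ?_
        exact DFunLike.congr_fun (proj_mul_star_innovL hP a _) (z a)
      · rw [Function.update_of_ne h, h2]
    · rw [Function.update_of_ne (by omega), h3 a ha]
    · rcases eq_or_ne j i with rfl | h
      · rw [Finset.range_eq_Ico, ← Finset.sum_Ico_consecutive _ (Nat.zero_le (i + 1))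
          (show i + 1 ≤ b + 1 by omega), Finset.sum_Ico_succ_top (Nat.zero_le i),
          Function.update_self, innovL_self, (hP _).star_eq]
        rw [Finset.sum_eq_zero fun a ha => by
          rw [Finset.mem_Ico] at ha
          rw [innovL_of_gt (by omega), star_zero, zero_apply]]
        have hup : ∀ a ∈ Finset.Ico (i + 1) (b + 1), star (innovL C P a i)
            (Function.update z i y a) = star (innovL C P a i) (z a) := fun a ha => by
          rw [Finset.mem_Ico] at ha
          rw [Function.update_of_ne (by omega)]
        rw [Finset.sum_congr rfl hup]
        have : P (i + 1) y = y := by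
          rw [hy, map_neg, map_sum]
          congr 1
          refine Finset.sum_congr rfl fun a _ => ?_
          exact DFunLike.congr_fun (proj_mul_star_innovL hP a _) (z a)
        rw [this, hy]
        simp
      · rw [← h4 j (by omega) hj2]
        refine Finset.sum_congr rfl fun a _ => ?_
        rcases eq_or_ne a i with rfl | h'
        · rw [innovL_of_gt (by omega), star_zero, zero_apply, zero_apply]
        · rw [Function.update_of_ne h']

/-- Choose z with L* z supported at b with value u. Then ⟨G z, z⟩ = ⟨V_b u, u⟩, while ‖z‖ ≥ ‖u‖
because z_b = u. The factorization of G up to b needs positivity of earlier V_j only, hence strong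
induction. -/
theorem innovPos_of_coercive (hP : ∀ i, IsOrthProj (P i)) (hC : star (C 0) = C 0) {N : ℕ} {c : ℝ}
    (hc : 0 < c) (hT : ∀ z : ℕ → H, (∀ a, P (a + 1) (z a) = z a) →
      c * ∑ a ∈ Finset.range N, ‖z a‖ ^ 2 ≤
        ∑ a ∈ Finset.range N, ∑ b ∈ Finset.range N, ⟪toepOp C P a b (z b), z a⟫_ℝ)
    (b : ℕ) (hb : b < N) : InnovPos C P b := by
  induction b using Nat.strong_induction_on with
  | _ b ih =>
    refine ⟨c, hc, fun u hu => ?_⟩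
    obtain ⟨z, h1, h2, h3, h4⟩ := exists_decorrelate (C := C) hP b hu b le_rfl
    have h5 := hT z h2
    have hsub : Finset.range (b + 1) ⊆ Finset.range N := Finset.range_subset_range.mpr hb
    have hz : ∀ a ∈ Finset.range N, a ∉ Finset.range (b + 1) → z a = 0 := fun a _ ha =>
      h3 a (by rw [Finset.mem_range] at ha; omega)
    have h6 : ∑ a ∈ Finset.range N, ∑ b ∈ Finset.range N, ⟪toepOp C P a b (z b), z a⟫_ℝ =
        ∑ a ∈ Finset.range (b + 1), ∑ a' ∈ Finset.range (b + 1), ⟪toepOp C P a a' (z a'), z a⟫_ℝ := by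
      symm
      refine Finset.sum_subset_zero_on_sdiff hsub (fun a ha => ?_) fun a _ => ?_
      · rw [Finset.mem_sdiff] at ha
        simp [hz a ha.1 ha.2]
      · exact Finset.sum_subset hsub fun a' h h' => by simp [hz a' h h']
    have h7 : ∑ a ∈ Finset.range (b + 1), ∑ a' ∈ Finset.range (b + 1),
        ⟪toepOp C P a a' (z a'), z a⟫_ℝ = ∑ j ∈ Finset.range (b + 1),
          ⟪innovVar C P j (∑ a ∈ Finset.range (b + 1), star (innovL C P a j) (z a)),
            ∑ a ∈ Finset.range (b + 1), star (innovL C P a j) (z a)⟫_ℝ := by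
      simp only [map_sum, sum_inner, inner_sum]
      rw [Finset.sum_comm (s := Finset.range (b + 1)) (t := Finset.range (b + 1))
        (f := fun j a => ∑ i ∈ Finset.range (b + 1), ⟪innovVar C P j (star (innovL C P i j) (z i)),
          star (innovL C P a j) (z a)⟫_ℝ)]
      refine Finset.sum_congr rfl fun a ha => ?_
      rw [Finset.sum_comm (s := Finset.range (b + 1)) (t := Finset.range (b + 1))
        (f := fun j i => ⟪innovVar C P j (star (innovL C P i j) (z i)),
          star (innovL C P a j) (z a)⟫_ℝ)]
      refine Finset.sum_congr rfl fun a' ha' => ?_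
      rw [Finset.mem_range] at ha ha'
      rw [toepOp_eq_sum hP hC (N := b + 1) (fun j hj _ => ih j (by omega) (by omega))
        (fun j hj _ => ih j (by omega) (by omega)) (by omega), sum_apply, sum_inner]
      refine Finset.sum_congr rfl fun j _ => ?_
      rw [mul_assoc]
      simp only [ContinuousLinearMap.star_eq_adjoint, ContinuousLinearMap.adjoint_inner_right]
      rfl
    have h8 : ∑ j ∈ Finset.range (b + 1),
          ⟪innovVar C P j (∑ a ∈ Finset.range (b + 1), star (innovL C P a j) (z a)),
            ∑ a ∈ Finset.range (b + 1), star (innovL C P a j) (z a)⟫_ℝ = ⟪innovVar C P b u, u⟫_ℝ := by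
      rw [Finset.sum_range_succ, Finset.sum_eq_zero fun j hj => by
        rw [Finset.mem_range] at hj
        rw [h4 j (by omega) hj]; simp, zero_add]
      have : ∑ a ∈ Finset.range (b + 1), star (innovL C P a b) (z a) = u := by
        rw [Finset.sum_range_succ, Finset.sum_eq_zero fun a ha => by
          rw [Finset.mem_range] at ha
          rw [innovL_of_gt ha, star_zero, zero_apply], zero_add, innovL_self, (hP _).star_eq, h1,
          hu]
      rw [this]
    rw [h6, h7, h8] at h5
    refine le_trans ?_ h5
    refine mul_le_mul_of_nonneg_left ?_ hc.le
    have := Finset.single_le_sum (f := fun a => ‖z a‖ ^ 2) (s := Finset.range N)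
      (fun _ _ => by positivity) (Finset.mem_range.mpr hb)
    simpa [h1] using this

/-- The innovations coefficients are obtained recursively from the linear predictors. -/
theorem innovL_eq_sum (hP : ∀ i, IsOrthProj (P i)) (hC : star (C 0) = C 0) {k : ℕ}
    (hpos : ∀ b < k, InnovPos C P b) {B : ℕ → H →L[ℝ] H}
    (hB : ∀ b < k, ∑ a ∈ Finset.range k, B a * toepOp C P a b = toepOp C P k b) (j : ℕ)
    (hj : j < k) : innovL C P k j = ∑ a ∈ Finset.range k, B a * innovL C P a j := by
  -- The row M satisfies M V L* = 0. Triangularity of L* and invertibility of the V_j on their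
  -- ranges kill its entries one after the other.
  set M : ℕ → H →L[ℝ] H := fun j => innovL C P k j - ∑ a ∈ Finset.range k, B a * innovL C P a j
    with hM
  suffices h : M j = 0 from sub_eq_zero.mp h
  have hMP : ∀ j, M j * P (j + 1) = M j := fun j => by
    simp only [hM, sub_mul, Finset.sum_mul, mul_assoc, innovL_mul_proj hP]
  have hsum : ∀ b < k, ∑ i ∈ Finset.range k, M i * innovVar C P i * star (innovL C P b i) = 0 := by
    intro b hb
    have h1 := hB b hb
    rw [toepOp_eq_sum hP hC (a := k) (b := b) (N := k) (fun j h _ => hpos j h)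
      (fun j h _ => hpos j (by omega)) (by omega)] at h1
    have h2 : ∑ a ∈ Finset.range k, B a * toepOp C P a b = ∑ i ∈ Finset.range k,
        (∑ a ∈ Finset.range k, B a * innovL C P a i) * innovVar C P i *
          star (innovL C P b i) := by
      simp only [Finset.sum_mul]
      rw [Finset.sum_comm]
      refine Finset.sum_congr rfl fun a ha => ?_
      rw [Finset.mem_range] at ha
      rw [toepOp_eq_sum hP hC (N := k) (fun j h _ => hpos j (by omega))
        (fun j h _ => hpos j (by omega)) (by omega), Finset.mul_sum]
      simp only [mul_assoc]
    rw [h2] at h1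
    simp only [hM, sub_mul, Finset.sum_sub_distrib]
    rw [h1, sub_self]
  induction j using Nat.strong_induction_on with
  | _ j ih =>
    have h1 := hsum j hj
    rw [Finset.sum_eq_single_of_mem j (Finset.mem_range.mpr hj) fun i hi hne => by
      rcases lt_or_gt_of_ne hne with h | h
      · rw [ih i h (h.trans hj), zero_mul, zero_mul]
      · rw [innovL_of_gt h, star_zero, mul_zero], innovL_self, (hP _).star_eq, mul_assoc,
      innovVar_mul_proj hP] at h1
    obtain ⟨c, hc, hv⟩ := hpos j hj
    obtain ⟨-, h3, -, -⟩ := comp_mul_compInv (hP (j + 1)) hc hv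
    rw [proj_mul_innovVar hP, innovVar_mul_proj hP] at h3
    rw [← hMP, ← h3, ← mul_assoc, h1, zero_mul]

end Innovations

/-! ### Consistency of the projections -/

section Close

variable {H : Type*} [NormedAddCommGroup H] [InnerProductSpace ℝ H] [CompleteSpace H]
  {ν : HilbertBasis ℕ ℝ H} {lam : ℕ → ℝ} {P T : H →L[ℝ] H} {τ δ : ℝ}

/-- The orthogonal projection `P` almost fixes the leading elements of `ν`. -/
structure Close (ν : ℕ → H) (lam : ℕ → ℝ) (P : H →L[ℝ] H) (τ : ℝ) : Prop where
  proj : IsOrthProj P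
  le : ∀ j, ‖ν j - P (ν j)‖ ≤ τ / lam j

theorem inner_sampleCov_nonneg (x : ℤ → H) (n : ℕ) (v : H) : 0 ≤ ⟪sampleCov x n 0 v, v⟫_ℝ := by
  have := sum_inner_clip_sq_le x n ∅ 0 v
  rcases Nat.eq_zero_or_pos n with h | h
  · subst h; simp [sampleCov]
  · simp only [Finset.sum_empty] at this
    exact nonneg_of_mul_nonneg_right this (by positivity)

/-- For y = (1 - P)ν_j, apply 1 - P to C ν_j = λ_j ν_j: λ_j y = A y + (1 - P)(C - A)ν_j, and A is at
most m_D on the complement of its D leading eigenvectors. No gap enters; the price is the factor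
1/λ_j, harmless for fixed j. -/
theorem IsEigenbasis.close {C A : H →L[ℝ] H} {m : ℕ → ℝ} {f : HilbertBasis ℕ ℝ H}
    (hC : IsEigenbasis C lam ν) (hA : IsEigenbasis A m f) (hlam : ∀ i, 0 < lam i)
    (hm : ∀ i, 0 ≤ m i) (D : ℕ) (hτ : lam D + 2 * ‖A - C‖ ≤ τ) :
    Close ν lam (projSpan f D) τ := by
  refine ⟨isOrthProj_projSpan f D, fun j => ?_⟩
  have hP := isOrthProj_projSpan (f : ℕ → H) D
  rw [le_div_iff₀ (hlam j)]
  set y := ν j - projSpan f D (ν j) with hy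
  have h1 : lam j • y = A y + ((C - A) (ν j) - projSpan f D ((C - A) (ν j))) := by
    simp only [hy, map_sub, _root_.sub_apply, hC.2, hA.commute, map_smul, smul_sub]
    abel
  have hν : ‖ν j‖ = 1 := ν.orthonormal.1 j
  have h2 : ‖A y‖ ≤ m D * ‖y‖ :=
    hA.norm_apply_le_of_inner_eq_zero hm fun i hi => inner_sub_projSpan f hi _
  have h3 : ‖(C - A) (ν j) - projSpan f D ((C - A) (ν j))‖ ≤ ‖A - C‖ := by
    refine (hP.norm_sub_apply_le _).trans (((C - A).le_opNorm _).trans ?_)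
    rw [hν, mul_one, norm_sub_rev]
  have h4 : ‖y‖ ≤ 1 := hν ▸ hP.norm_sub_apply_le (ν j)
  have h5 := hC.le_add_norm_sub hA D
  calc ‖y‖ * lam j = ‖lam j • y‖ := by
        rw [norm_smul, Real.norm_of_nonneg (hlam j).le, mul_comm]
    _ ≤ m D * ‖y‖ + ‖A - C‖ := by rw [h1]; exact (norm_add_le _ _).trans (add_le_add h2 h3)
    _ ≤ m D * 1 + ‖A - C‖ := by gcongr; exact hm D
    _ ≤ τ := by linarith

theorem Close.mono (h : Close ν lam P τ) (hlam : ∀ i, 0 < lam i) {τ' : ℝ} (hτ : τ ≤ τ') :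
    Close ν lam P τ' :=
  ⟨h.proj, fun j => (h.le j).trans (div_le_div_of_nonneg_right hτ (hlam j).le)⟩

/-- Approximate x by a finite combination of the ν_j; the remainder is not enlarged by 1 - P. So
`Close` with small τ is a quantitative form of strong convergence. -/
theorem exists_close_apply (ν : HilbertBasis ℕ ℝ H) (hlam : ∀ i, 0 < lam i) (x : H) (hδ : 0 < δ) :
    ∃ τ > 0, ∀ P, Close ν lam P τ → ‖x - P x‖ ≤ δ := by
  obtain ⟨s, hs⟩ := ((ν.hasSum_repr x).eventually
    (Metric.ball_mem_nhds x (half_pos hδ))).exists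
  set y := ∑ i ∈ s, ν.repr x i • ν i with hy
  set K := ∑ i ∈ s, |ν.repr x i| / lam i with hK
  have hK0 : 0 ≤ K := Finset.sum_nonneg fun i _ => div_nonneg (abs_nonneg _) (hlam i).le
  refine ⟨δ / 2 / (K + 1), by positivity, fun P hP => ?_⟩
  have h1 : ‖(x - y) - P (x - y)‖ ≤ δ / 2 := by
    refine (hP.proj.norm_sub_apply_le _).trans ?_
    rw [← dist_eq_norm, dist_comm]
    exact (Metric.mem_ball.mp hs).le
  have h2 : ‖y - P y‖ ≤ δ / 2 := by
    have : y - P y = ∑ i ∈ s, ν.repr x i • (ν i - P (ν i)) := by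
      simp only [hy, map_sum, map_smul, smul_sub, Finset.sum_sub_distrib]
    rw [this]
    calc _ ≤ ∑ i ∈ s, |ν.repr x i| * (δ / 2 / (K + 1) / lam i) := by
          refine (norm_sum_le _ _).trans (Finset.sum_le_sum fun i _ => ?_)
          rw [norm_smul, Real.norm_eq_abs]
          exact mul_le_mul_of_nonneg_left (hP.le i) (abs_nonneg _)
      _ = K * (δ / 2 / (K + 1)) := by
          rw [hK, Finset.sum_mul]
          exact Finset.sum_congr rfl fun i _ => by ring
      _ ≤ (K + 1) * (δ / 2 / (K + 1)) := by gcongr; linarith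
      _ = _ := by field_simp
  calc ‖x - P x‖ = ‖((x - y) - P (x - y)) + (y - P y)‖ := by rw [map_sub]; congr 1; abel
    _ ≤ _ := (norm_add_le _ _).trans (by linarith)

theorem exists_close_finset (ν : HilbertBasis ℕ ℝ H) (hlam : ∀ i, 0 < lam i) {ι : Type*}
    (s : Finset ι) (x : ι → H) (hδ : 0 < δ) :
    ∃ τ > 0, ∀ P, Close ν lam P τ → ∀ i ∈ s, ‖x i - P (x i)‖ ≤ δ := by
  classical
  induction s using Finset.induction_on with
  | empty => exact ⟨1, one_pos, fun P _ i hi => by simp at hi⟩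
  | insert i s _ ih =>
    obtain ⟨τ₁, h₁, H₁⟩ := ih
    obtain ⟨τ₂, h₂, H₂⟩ := exists_close_apply ν hlam (x i) hδ
    refine ⟨min τ₁ τ₂, lt_min h₁ h₂, fun P hP j hj => ?_⟩
    rcases Finset.mem_insert.mp hj with rfl | hj
    · exact H₂ P (hP.mono hlam (min_le_right _ _))
    · exact H₁ P (hP.mono hlam (min_le_left _ _)) j hj

/-- Hilbert–Schmidt operators are limits of operators of finite rank. -/
theorem IsHilbertSchmidt.exists_finite (hT : IsHilbertSchmidt T) (hδ : 0 < δ) :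
    ∃ (b : ℕ → H) (s : Finset ℕ), (∀ i, ‖b i‖ = 1) ∧
      ‖T - ∑ i ∈ s, tensor (b i) (T (b i))‖ ≤ δ := by
  obtain ⟨b, hb⟩ := hT
  obtain ⟨s, hs⟩ := ((hb.hasSum).eventually
    (Metric.ball_mem_nhds _ (show 0 < δ ^ 2 by positivity))).exists
  refine ⟨b, s, b.orthonormal.1, ContinuousLinearMap.opNorm_le_bound _ hδ.le fun x => ?_⟩
  set R := T - ∑ i ∈ s, tensor (b i) (T (b i)) with hR
  have htail : ∀ t : Finset ℕ, ∑ i ∈ t \ s, ‖T (b i)‖ ^ 2 ≤ δ ^ 2 := fun t => by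
    have h1 := hb.sum_le_tsum (s ∪ t \ s) fun _ _ => by positivity
    rw [Finset.sum_union Finset.disjoint_sdiff] at h1
    have h2 := Metric.mem_ball.mp hs
    rw [Real.dist_eq, abs_sub_lt_iff] at h2
    linarith [h2.2]
  have hRb : ∀ i, R (b i) = if i ∈ s then 0 else T (b i) := fun i => by
    simp only [hR, _root_.sub_apply, sum_apply, tensor_apply,
      orthonormal_iff_ite.mp b.orthonormal, ite_smul, one_smul, zero_smul, Finset.sum_ite_eq']
    split_ifs <;> simp
  have h1 : HasSum (fun i => ⟪b i, x⟫_ℝ • R (b i)) (R x) := by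
    have := (b.hasSum_repr x).mapL R
    simpa [HilbertBasis.repr_apply_apply] using this
  refine le_of_tendsto h1.norm (Eventually.of_forall fun t => ?_)
  have h2 : ∑ i ∈ t, ⟪b i, x⟫_ℝ • R (b i) = ∑ i ∈ t \ s, ⟪b i, x⟫_ℝ • T (b i) := by
    symm
    refine Finset.sum_subset_zero_on_sdiff Finset.sdiff_subset (fun i hi => ?_) fun i hi => ?_
    · have : i ∈ s := by
        by_contra h; exact (Finset.mem_sdiff.mp hi).2 (Finset.mem_sdiff.mpr
          ⟨(Finset.mem_sdiff.mp hi).1, h⟩)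
      rw [hRb, if_pos this, smul_zero]
    · rw [hRb, if_neg (Finset.mem_sdiff.mp hi).2]
  rw [h2]
  refine (norm_sum_le _ _).trans ?_
  have h3 := Finset.sum_mul_sq_le_sq_mul_sq (t \ s) (fun i => ‖T (b i)‖) (fun i => |⟪b i, x⟫_ℝ|)
  have h4 : ∑ i ∈ t \ s, |⟪b i, x⟫_ℝ| ^ 2 ≤ ‖x‖ ^ 2 := by
    have := b.orthonormal.sum_inner_products_le x (s := t \ s)
    simpa using this
  have h5 : ∑ i ∈ t \ s, ‖⟪b i, x⟫_ℝ • T (b i)‖ = ∑ i ∈ t \ s, ‖T (b i)‖ * |⟪b i, x⟫_ℝ| :=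
    Finset.sum_congr rfl fun i _ => by rw [norm_smul, Real.norm_eq_abs, mul_comm]
  rw [h5]
  refine (abs_le_of_sq_le_sq' (h3.trans ?_) (by positivity)).2
  rw [mul_pow]
  exact mul_le_mul (htail t) h4 (Finset.sum_nonneg fun _ _ => by positivity) (by positivity)

/-- Reduction to finite rank: there both compositions depend only on how P acts on finitely many
vectors, the b_i for T P and the T b_i for P T. -/
theorem IsHilbertSchmidt.exists_close (hT : IsHilbertSchmidt T) (ν : HilbertBasis ℕ ℝ H)
    (hlam : ∀ i, 0 < lam i) (hδ : 0 < δ) :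
    ∃ τ > 0, ∀ P, Close ν lam P τ → ‖T - P * T‖ ≤ δ ∧ ‖T - T * P‖ ≤ δ := by
  obtain ⟨b, s, hb, hR⟩ := hT.exists_finite (half_pos hδ)
  set R := T - ∑ i ∈ s, tensor (b i) (T (b i)) with hRdef
  set K := ∑ i ∈ s, ‖T (b i)‖ with hK
  have hK0 : 0 ≤ K := Finset.sum_nonneg fun _ _ => norm_nonneg _
  set c : ℝ := (s.card : ℝ) with hc
  have hc0 : 0 ≤ c := Nat.cast_nonneg _
  obtain ⟨τ₁, h₁, H₁⟩ := exists_close_finset ν hlam s b (δ := δ / 2 / (K + 1)) (by positivity)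
  obtain ⟨τ₂, h₂, H₂⟩ := exists_close_finset ν hlam s (fun i => T (b i))
    (δ := δ / 2 / (c + 1)) (by positivity)
  refine ⟨min τ₁ τ₂, lt_min h₁ h₂, fun P hP => ⟨?_, ?_⟩⟩
  · have e1 : T - P * T = (1 - P) * R + ∑ i ∈ s, tensor (b i) (T (b i) - P (T (b i))) := by
      ext x
      simp only [hRdef, _root_.sub_apply, _root_.add_apply, sum_apply, tensor_apply, smul_sub,
        Finset.sum_sub_distrib, mul_apply_eq_comp, map_sub, map_sum, map_smul,
        one_apply_eq_self]
      abel
    rw [e1]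
    refine (norm_add_le _ _).trans ?_
    have e2 : ‖(1 - P) * R‖ ≤ δ / 2 := (norm_mul_le _ _).trans
      ((mul_le_mul hP.proj.norm_one_sub_le hR (norm_nonneg _) zero_le_one).trans (one_mul _).le)
    have e3 : ‖∑ i ∈ s, tensor (b i) (T (b i) - P (T (b i)))‖ ≤ c * (δ / 2 / (c + 1)) := by
      refine (norm_sum_le _ _).trans ((Finset.sum_le_sum fun i hi => ?_).trans
        (by rw [Finset.sum_const, nsmul_eq_mul]))
      rw [norm_tensor, hb, one_mul]
      exact H₂ P (hP.mono hlam (min_le_right _ _)) i hi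
    have e4 : c * (δ / 2 / (c + 1)) ≤ δ / 2 := by
      rw [← mul_div_assoc, div_le_iff₀ (by positivity)]; nlinarith
    linarith
  · have e1 : T - T * P = R * (1 - P) + ∑ i ∈ s, tensor (b i - P (b i)) (T (b i)) := by
      ext x
      simp only [hRdef, _root_.sub_apply, _root_.add_apply, sum_apply, tensor_apply,
        mul_apply_eq_comp, map_sub, one_apply_eq_self, inner_sub_left,
        hP.proj.symm, sub_smul, Finset.sum_sub_distrib]
      abel
    rw [e1]
    refine (norm_add_le _ _).trans ?_
    have e2 : ‖R * (1 - P)‖ ≤ δ / 2 := (norm_mul_le _ _).trans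
      ((mul_le_mul hR hP.proj.norm_one_sub_le (norm_nonneg _) (by positivity)).trans
        (mul_one _).le)
    have e3 : ‖∑ i ∈ s, tensor (b i - P (b i)) (T (b i))‖ ≤ (δ / 2 / (K + 1)) * K := by
      rw [hK, Finset.mul_sum]
      refine (norm_sum_le _ _).trans (Finset.sum_le_sum fun i hi => ?_)
      rw [norm_tensor]
      exact mul_le_mul_of_nonneg_right (H₁ P (hP.mono hlam (min_le_left _ _)) i hi) (norm_nonneg _)
    have e4 : (δ / 2 / (K + 1)) * K ≤ δ / 2 := by
      rw [div_mul_eq_mul_div, div_le_iff₀ (by positivity)]; nlinarith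
    linarith

end Close

/-! ### Consistency of the regression operators -/

section Coordinates

variable {H : Type*} [NormedAddCommGroup H] [InnerProductSpace ℝ H]
  {π : ℕ → H →L[ℝ] H} {d : ℕ → ℕ}

theorem coordEmb_apply (k i : ℕ) (y : H) (r : Fin k) :
    coordEmb H k i y r = if (r : ℕ) + 1 = i then y else 0 := by
  have : coordEmb H k i y r = (if (r : ℕ) + 1 = i then ContinuousLinearMap.id ℝ H else 0) y := rfl
  rw [this]
  split_ifs <;> rfl

theorem norm_coordEmb_le (k i : ℕ) : ‖coordEmb H k i‖ ≤ 1 := by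
  refine ContinuousLinearMap.opNorm_le_bound _ zero_le_one fun y => ?_
  rw [one_mul, ← abs_of_nonneg (norm_nonneg y)]
  refine abs_le_of_sq_le_sq' ?_ (abs_nonneg _) |>.2
  rw [PiLp.norm_sq_eq_of_L2, sq_abs]
  simp only [coordEmb_apply]
  by_cases h : ∃ r : Fin k, (r : ℕ) + 1 = i
  · obtain ⟨r, hr⟩ := h
    rw [Finset.sum_eq_single r (fun q _ hq => by
      rw [if_neg (fun h => hq (Fin.ext (by omega)))]; simp) (by simp), if_pos hr]
  · push Not at h
    rw [Finset.sum_eq_zero fun r _ => by rw [if_neg (h r)]; simp]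
    positivity

theorem arOp_diagProj_coordEmb (e : ℕ → H) {k i : ℕ} (hi : 1 ≤ i) (hik : i ≤ k) :
    (arOp π k ∘L diagProj e d k) ∘L coordEmb H k i = π i * projSpan e (d (k + 1 - i)) := by
  ext y
  simp only [ContinuousLinearMap.comp_apply, arOp_apply, diagProj_apply, coordEmb_apply,
    mul_apply_eq_comp]
  rw [Finset.sum_eq_single (⟨i - 1, by omega⟩ : Fin k)]
  · simp only
    rw [if_pos (by omega), Nat.sub_add_cancel hi, show k - (i - 1) = k + 1 - i by omega]
  · intro r _ hr
    rw [if_neg (fun h => hr (Fin.ext (by simp; omega))), map_zero, map_zero]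
  · simp

theorem sum_Ico_natCast {M : Type*} [AddCommMonoid M] (a b : ℕ) (f : ℤ → M) :
    ∑ j ∈ Finset.Ico a b, f j = ∑ j ∈ Finset.Ico (a : ℤ) b, f j := by
  refine Finset.sum_bij (fun j _ => (j : ℤ)) (fun j hj => ?_) (fun a _ b _ h => by simpa using h)
    (fun j hj => ?_) fun j _ => rfl
  · rw [Finset.mem_Ico] at hj ⊢; omega
  · rw [Finset.mem_Ico] at hj
    exact ⟨j.toNat, by rw [Finset.mem_Ico]; omega, by omega⟩

/-- For k ≤ j < n the window and its successor lie inside 1, …, n, so extension by zero is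
invisible. -/
theorem yuleWalker_eq (x : ℤ → H) (e : ℕ → H) (n k : ℕ) :
    yuleWalker x e d n k = regOp x e d n k (Finset.Ico (k : ℤ) n) ((n : ℝ) - k)⁻¹ := by
  have hw : ∀ j ∈ Finset.Ico (k : ℤ) n, window (clip x n) k j = window x k j := fun j hj => by
    rw [Finset.mem_Ico] at hj
    ext i
    exact clip_of_mem x (by omega) (by omega)
  rw [yuleWalker, regOp, gammaHat, gammaHatOne]
  congr 3
  · rw [← sum_Ico_natCast k n fun j => tensor (window (clip x n) k j) (clip x n (j + 1))]
    refine Finset.sum_congr rfl fun j hj => ?_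
    rw [Finset.mem_Ico] at hj
    rw [hw j (by rw [Finset.mem_Ico]; omega), clip_of_mem x (by omega) (by omega)]
  · rw [← sum_Ico_natCast k n fun j => tensor (window (clip x n) k j) (window (clip x n) k j)]
    refine Finset.sum_congr rfl fun j hj => ?_
    rw [Finset.mem_Ico] at hj
    rw [hw j (by rw [Finset.mem_Ico]; omega)]

theorem tendsto_dim {d κ : ℕ → ℕ} (hd : Tendsto d atTop atTop) (hκ : Tendsto κ atTop atTop) (i : ℕ) :
    Tendsto (fun n => d (κ n + 1 - i)) atTop atTop :=
  hd.comp (tendsto_atTop.mpr fun b =>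
    (hκ.eventually_ge_atTop (b + i)).mono fun n hn => by omega)

end Coordinates

-- Convergence in probability of the regression coefficients

section Regression

variable {Ω H : Type*} [MeasurableSpace Ω] {μ : Measure Ω} [IsProbabilityMeasure μ]
  [NormedAddCommGroup H] [InnerProductSpace ℝ H] [CompleteSpace H]
  [MeasurableSpace H] [BorelSpace H] [SecondCountableTopology H]
  {X ε : ℤ → Ω → H} {ψ π : ℕ → H →L[ℝ] H} {lam : ℕ → ℝ} {ν : HilbertBasis ℕ ℝ H} {d : ℕ → ℕ}
  {κ : ℕ → ℕ} {lamHat : ℕ → Ω → ℕ → ℝ} {νHat : ℕ → Ω → HilbertBasis ℕ ℝ H}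

/-- Every squared error is of order δα after normalization, so division by the coercivity constant
α/2 leaves a quantity that vanishes with δ. -/
theorem Setting.norm_regOp_sub_le (S : Setting μ X ε ψ π lam ν d) {n k : ℕ} {δ : ℝ} (hδ : 0 < δ)
    {x y : ℤ → H} {l : ℕ → ℝ} {e : HilbertBasis ℕ ℝ H} (G : Good μ X π ν d n k δ x y e)
    (he : IsEigenbasis (sampleCov x n 0) l e) (hk : 1 ≤ k) (hkn : k < n)
    (hR : truncRate (alpha μ X ν) π lam d k ≤ δ) {J : Finset ℤ}
    (hJ1 : Finset.Ico (k : ℤ) n ⊆ J) (hJ2 : J ⊆ Finset.Ico (0 : ℤ) (n + k)) {b : ℝ} (hb : 0 < b)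
    (hbn : b * n ≤ 2) (hbk : 1 / 2 ≤ b * ((n : ℝ) - k)) :
    ‖regOp x e d n k J b - arOp π k ∘L diagProj e d k‖ ≤
      Real.sqrt (2 * (8 + 4 * (∑' ℓ, ‖π (ℓ + 1)‖) * (1 + (∑' ℓ, ‖π (ℓ + 1)‖) * lam 0)) * δ) +
        4 * δ := by
  set Q := ∑' ℓ, ‖π (ℓ + 1)‖ with hQdef
  have hQ0 : 0 ≤ Q := tsum_nonneg fun _ => norm_nonneg _
  have hA := S.alpha_le k
  have ha := S.alpha_pos k
  have hl0 := S.lam_pos 0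
  have hsl := S.sum_lam_le hk
  set a := alpha μ X ν (d k) with hadef
  have hm : (0 : ℝ) < (n : ℝ) - k := sub_pos.mpr (by exact_mod_cast hkn)
  have hbm : b * ((n : ℝ) - k) ≤ 2 := le_trans (mul_le_mul_of_nonneg_left (by simp) hb.le) hbn
  have hQ : ∑ i ∈ Finset.range k, ‖π (i + 1)‖ ≤ Q :=
    S.inv.summable.sum_le_tsum _ fun _ _ => norm_nonneg _
  -- Weyl replaces sample eigenvalues by population ones at a cost δα², which is of the required
  -- order δα because α ≤ λ_1.
  have hT : ∑ i ∈ Finset.range k, ‖π (i + 1)‖ * l (d (k - i)) ≤ a * δ * (1 + Q * lam 0) := by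
    calc _ ≤ ∑ i ∈ Finset.range k, ‖π (i + 1)‖ * (lam (d (k - i)) + δ * a ^ 2) :=
          Finset.sum_le_sum fun i _ => mul_le_mul_of_nonneg_left
            ((S.eig.le_add_norm_sub he _).trans (add_le_add_right G.cov _)) (norm_nonneg _)
      _ = ∑ i ∈ Finset.range k, ‖π (i + 1)‖ * lam (d (k - i)) +
          (∑ i ∈ Finset.range k, ‖π (i + 1)‖) * (δ * a ^ 2) := by
          simp only [mul_add, Finset.sum_add_distrib, Finset.sum_mul]
      _ ≤ a * δ + Q * (δ * (a * lam 0)) := by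
          refine add_le_add (hsl.trans (by gcongr)) ?_
          rw [pow_two]
          gcongr
      _ = _ := by ring
  have key := FTS.norm_regOp_sub_le he S.d_mono hJ1 hJ2 (a := a) ha hb hbn hbk
    (N := δ * (((n : ℝ) - k) * a)) (by positivity) hQ0 (r₁ := δ * (((n : ℝ) - k) * a))
    (r₂ := δ * (((n : ℝ) - k) * a)) (by positivity) (by positivity) hQ (by positivity) hT G.inv
    G.low G.cross G.tail G.full
  refine key.trans (add_le_add ?_ ?_)
  · rw [← div_eq_mul_inv, ← Real.sqrt_div (by positivity)]
    refine Real.sqrt_le_sqrt ?_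
    rw [div_le_iff₀ (by positivity)]
    calc 2 * b * (δ * (((n : ℝ) - k) * a) + δ * (((n : ℝ) - k) * a)) +
          4 * (Q * (a * δ * (1 + Q * lam 0)))
        = 4 * (b * ((n : ℝ) - k)) * (δ * a) + 4 * (Q * (a * δ * (1 + Q * lam 0))) := by ring
      _ ≤ 4 * 2 * (δ * a) + 4 * (Q * (a * δ * (1 + Q * lam 0))) := by gcongr
      _ = _ := by ring
  · have : b * (δ * (((n : ℝ) - k) * a)) * (a / 2)⁻¹ = 2 * δ * (b * ((n : ℝ) - k)) := by
      field_simp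
    rw [this]
    nlinarith

theorem exists_modulus (K : ℝ) {δ : ℝ} (hδ : 0 < δ) :
    ∃ η > 0, Real.sqrt (K * η) + 4 * η ≤ δ := by
  have h : Tendsto (fun η : ℝ => Real.sqrt (K * η) + 4 * η) (𝓝[>] 0) (𝓝 0) := by
    have : Continuous fun η : ℝ => Real.sqrt (K * η) + 4 * η := by fun_prop
    have h2 := (this.tendsto 0).mono_left (nhdsWithin_le_nhds (s := Set.Ioi 0))
    simpa using h2
  obtain ⟨η, h1, h2⟩ := ((h.eventually_le_const hδ).and self_mem_nhdsWithin).exists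
  exact ⟨η, h2, h1⟩

theorem Setting.whp_regOp (S : Setting μ X ε ψ π lam ν d) (R : Rates μ X π lam ν d κ)
    (hνHat : ∀ n ω, IsEigenbasis (sampleCov (fun j => X j ω) n 0) (lamHat n ω) (νHat n ω)) {δ : ℝ}
    (hδ : 0 < δ) : Whp μ fun n ω => ∀ (J : Finset ℤ) (b : ℝ), Finset.Ico (κ n : ℤ) n ⊆ J →
      J ⊆ Finset.Ico (0 : ℤ) (n + κ n) → 0 < b → b * n ≤ 2 → 1 / 2 ≤ b * ((n : ℝ) - κ n) →
      ‖regOp (fun j => X j ω) (νHat n ω) d n (κ n) J b -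
        arOp π (κ n) ∘L diagProj (νHat n ω) d (κ n)‖ ≤ δ := by
  obtain ⟨η, hη, h⟩ := exists_modulus (2 * (8 + 4 * (∑' ℓ, ‖π (ℓ + 1)‖) *
    (1 + (∑' ℓ, ‖π (ℓ + 1)‖) * lam 0))) hδ
  refine (S.whp_good R hνHat hη).mono ?_
  filter_upwards [R.lt, R.tendsto.eventually_ge_atTop 1, R.trunc.eventually_le_const hη]
    with n h1 h2 h3 ω G J b hJ1 hJ2 hb hbn hbk
  exact (S.norm_regOp_sub_le hη G (hνHat n ω) h2 h1 h3 hJ1 hJ2 hb hbn hbk).trans h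

theorem Setting.whp_close (S : Setting μ X ε ψ π lam ν d) (R : Rates μ X π lam ν d κ)
    (hνHat : ∀ n ω, IsEigenbasis (sampleCov (fun j => X j ω) n 0) (lamHat n ω) (νHat n ω))
    {D : ℕ → ℕ} (hD : Tendsto D atTop atTop) {τ : ℝ} (hτ : 0 < τ) :
    Whp μ fun n ω => Close ν lam (projSpan (νHat n ω) (D n)) τ := by
  have hl := S.lam_pos 0
  have hδ : 0 < τ / 4 / lam 0 ^ 2 := by positivity
  refine (S.whp_cov R hδ).mono ?_
  have h0 := (S.summable_lam.tendsto_atTop_zero.comp hD).eventually_le_const (half_pos hτ)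
  filter_upwards [h0] with n hn ω hω
  refine S.eig.close (hνHat n ω) S.lam_pos
    ((hνHat n ω).nonneg (inner_sampleCov_nonneg _ _)) (D n) ?_
  have h1 : τ / 4 / lam 0 ^ 2 * alpha μ X ν (d (κ n)) ^ 2 ≤ τ / 4 := by
    have := S.alpha_pos (κ n)
    have h2 := S.alpha_le (κ n)
    calc _ ≤ τ / 4 / lam 0 ^ 2 * lam 0 ^ 2 := by gcongr
      _ = _ := by field_simp
  have hn' : lam (D n) ≤ τ / 2 := hn
  linarith

/-- Stated around π_i P with P the sample projection: the passage from P to the identity is purely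
qualitative and is left to the pointwise and Hilbert–Schmidt statements. -/
theorem Setting.whp_betaHat (S : Setting μ X ε ψ π lam ν d) (R : Rates μ X π lam ν d κ)
    (hνHat : ∀ n ω, IsEigenbasis (sampleCov (fun j => X j ω) n 0) (lamHat n ω) (νHat n ω)) {i : ℕ}
    (hi : 1 ≤ i) {δ : ℝ} (hδ : 0 < δ) : Whp μ fun n ω =>
      ‖betaHat (fun j => X j ω) (νHat n ω) d n (κ n) i -
        π i * projSpan (νHat n ω) (d (κ n + 1 - i))‖ ≤ δ := by
  refine (S.whp_regOp R hνHat hδ).mono ?_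
  filter_upwards [R.lt, R.tendsto.eventually_ge_atTop i, R.eventually_le_two_mul S]
    with n h1 h2 h3 ω h
  have hm : (0 : ℝ) < (n : ℝ) - κ n := sub_pos.mpr (by exact_mod_cast h1)
  have h4 := h (Finset.Ico (κ n : ℤ) n) ((n : ℝ) - κ n)⁻¹ subset_rfl
    (Finset.Ico_subset_Ico (by omega) (by omega)) (by positivity)
    (by rw [inv_mul_le_iff₀ hm]; linarith) (by rw [inv_mul_cancel₀ hm.ne']; norm_num)
  rw [betaHat, yuleWalker_eq, ← arOp_diagProj_coordEmb _ hi h2, ← ContinuousLinearMap.sub_comp]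
  refine (ContinuousLinearMap.opNorm_comp_le _ _).trans ?_
  calc _ ≤ δ * 1 := mul_le_mul h4 (norm_coordEmb_le _ _) (ContinuousLinearMap.opNorm_nonneg _) hδ.le
    _ = δ := mul_one δ

theorem Setting.tendsto_betaHat_apply (S : Setting μ X ε ψ π lam ν d)
    (R : Rates μ X π lam ν d κ) (hd : Tendsto d atTop atTop)
    (hνHat : ∀ n ω, IsEigenbasis (sampleCov (fun j => X j ω) n 0) (lamHat n ω) (νHat n ω)) {i : ℕ}
    (hi : 1 ≤ i) (x : H) : TendstoInMeasure μ (fun n ω =>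
      ‖(betaHat (fun j => X j ω) (νHat n ω) d n (κ n) i - π i) x‖) atTop fun _ => 0 := by
  refine tendstoInMeasure_of_whp (fun _ _ => norm_nonneg _) fun δ hδ => ?_
  obtain ⟨τ, hτ, hc⟩ := exists_close_apply ν S.lam_pos x
    (δ := δ / 2 / (‖π i‖ + 1)) (by positivity)
  refine ((S.whp_betaHat R hνHat hi (δ := δ / 2 / (‖x‖ + 1)) (by positivity)).and
    (S.whp_close R hνHat (tendsto_dim hd R.tendsto i) hτ)).mono
      (Eventually.of_forall fun n ω h => ?_)
  set B := betaHat (fun j => X j ω) (νHat n ω) d n (κ n) i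
  set P := projSpan (νHat n ω) (d (κ n + 1 - i))
  have e1 : (B - π i) x = (B - π i * P) x - π i (x - P x) := by
    simp only [_root_.sub_apply, mul_apply_eq_comp, map_sub]; abel
  rw [e1]
  have e2 : ‖(B - π i * P) x‖ ≤ δ / 2 / (‖x‖ + 1) * (‖x‖ + 1) :=
    ((B - π i * P).le_opNorm x).trans (by gcongr; exacts [h.1, by linarith])
  have e3 : ‖π i (x - P x)‖ ≤ (‖π i‖ + 1) * (δ / 2 / (‖π i‖ + 1)) :=
    ((π i).le_opNorm _).trans (by gcongr; exacts [by linarith, hc P h.2])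
  rw [div_mul_cancel₀ _ (by positivity)] at e2
  rw [mul_div_cancel₀ _ (by positivity)] at e3
  linarith [norm_sub_le ((B - π i * P) x) (π i (x - P x))]

theorem Setting.tendsto_betaHat (S : Setting μ X ε ψ π lam ν d)
    (R : Rates μ X π lam ν d κ) (hd : Tendsto d atTop atTop)
    (hνHat : ∀ n ω, IsEigenbasis (sampleCov (fun j => X j ω) n 0) (lamHat n ω) (νHat n ω)) {i : ℕ}
    (hi : 1 ≤ i) (hπ : IsHilbertSchmidt (π i)) : TendstoInMeasure μ (fun n ω =>
      ‖betaHat (fun j => X j ω) (νHat n ω) d n (κ n) i - π i‖) atTop fun _ => 0 := by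
  refine tendstoInMeasure_of_whp (fun _ _ => norm_nonneg _) fun δ hδ => ?_
  obtain ⟨τ, hτ, hc⟩ := hπ.exists_close ν S.lam_pos (half_pos hδ)
  refine ((S.whp_betaHat R hνHat hi (half_pos hδ)).and
    (S.whp_close R hνHat (tendsto_dim hd R.tendsto i) hτ)).mono
      (Eventually.of_forall fun n ω h => ?_)
  have h1 := norm_sub_le_norm_sub_add_norm_sub (betaHat (fun j => X j ω) (νHat n ω) d n (κ n) i)
    (π i * projSpan (νHat n ω) (d (κ n + 1 - i))) (π i)
  have h2 := (hc _ h.2).2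
  rw [norm_sub_rev] at h2
  linarith [h.1]

end Regression

/-! ### The Toeplitz form of the Yule–Walker equations -/

section Toeplitz

variable {H : Type*} [NormedAddCommGroup H] [InnerProductSpace ℝ H] [CompleteSpace H]
  {x : ℤ → H} {e : HilbertBasis ℕ ℝ H} {l : ℕ → ℝ} {d : ℕ → ℕ} {n k : ℕ}

theorem star_tensor (u v : H) : star (tensor u v) = tensor v u := by
  rw [ContinuousLinearMap.star_eq_adjoint]
  symm
  rw [ContinuousLinearMap.eq_adjoint_iff]
  intro a b
  simp only [tensor_apply, real_inner_smul_left, real_inner_smul_right]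
  rw [real_inner_comm v a]
  ring

theorem star_sampleCov_zero (x : ℤ → H) (n : ℕ) : star (sampleCov x n 0) = sampleCov x n 0 := by
  rw [sampleCov, star_smul, star_sum]
  simp only [star_tensor, add_zero, star_trivial]

/-- Sample covariance operators as sums over the zero-extended path. -/
theorem sum_tensor_clip (x : ℤ → H) (n h : ℕ) {i : ℕ} (hi : i < k) :
    (n : ℝ)⁻¹ • ∑ j ∈ Finset.Ico (0 : ℤ) (n + k),
      tensor (clip x n (j - i)) (clip x n (j - i + h)) = sampleCov x n h := by
  rw [sampleCov]
  congr 1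
  have h0 : ∀ j ∉ Finset.Icc (1 + i : ℤ) (n - h + i),
      tensor (clip x n (j - i)) (clip x n (j - i + h)) = 0 := fun j hj => by
    rw [Finset.mem_Icc] at hj
    by_cases h1 : 1 ≤ j - i ∧ j - i ≤ n
    · have h2 : clip x n (j - i + h) = 0 := by rw [clip, if_neg (by omega)]
      rw [h2, tensor, map_zero, zero_apply]
    · rw [clip, if_neg h1]; simp [tensor]
  rw [← Finset.sum_subset (s₁ := Finset.Icc (1 + i : ℤ) (n - h + i)) (fun j hj => by
    rw [Finset.mem_Icc] at hj; rw [Finset.mem_Ico]; omega) fun j _ hj => h0 j hj]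
  symm
  refine Finset.sum_bij (fun j _ => (j : ℤ) + i) (fun j hj => ?_)
    (fun a _ b _ h => by simpa using h) (fun j hj => ?_) fun j hj => ?_
  · rw [Finset.mem_Icc] at hj ⊢; omega
  · rw [Finset.mem_Icc] at hj
    exact ⟨(j - i).toNat, by rw [Finset.mem_Icc]; omega, by omega⟩
  · rw [Finset.mem_Icc] at hj
    rw [add_sub_cancel_right, clip_of_mem x (by omega) (by omega),
      clip_of_mem x (by omega) (by omega)]
    push_cast; rfl

/-- The entries of the block Toeplitz matrix of `C`. -/
noncomputable def lagOp (C : ℕ → H →L[ℝ] H) (r i : ℕ) : H →L[ℝ] H :=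
  if r ≤ i then C (i - r) else star (C (r - i))

/-- Windows run backwards in time while the algorithm counts forwards, so coordinate r of a window
corresponds to row k - 1 - r, and the projection of index k - r is the right one for both. -/
theorem toepOp_reflect (C P : ℕ → H →L[ℝ] H) {r i : ℕ} (hr : r < k) (hi : i < k) :
    toepOp C P (k - 1 - r) (k - 1 - i) = P (k - r) * lagOp C r i * P (k - i) := by
  rw [toepOp, lagOp, show k - 1 - r + 1 = k - r by omega, show k - 1 - i + 1 = k - i by omega]
  by_cases h : r ≤ i
  · rw [if_pos h, if_pos (by omega), show k - 1 - r - (k - 1 - i) = i - r by omega]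
  · rw [if_neg h, if_neg (by omega), show k - 1 - i - (k - 1 - r) = r - i by omega]

theorem sum_tensor_lag (x : ℤ → H) (n : ℕ) {r i : ℕ} (hr : r < k) (hi : i < k) :
    (n : ℝ)⁻¹ • ∑ j ∈ Finset.Ico (0 : ℤ) (n + k),
      tensor (clip x n (j - i)) (clip x n (j - r)) = lagOp (sampleCov x n) r i := by
  rw [lagOp]
  split_ifs with h
  · rw [← sum_tensor_clip x n (i - r) hi]
    congr 1
    refine Finset.sum_congr rfl fun j _ => ?_
    congr 2
    omega
  · rw [← sum_tensor_clip x n (r - i) hr, star_smul, star_sum, star_trivial]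
    congr 1
    refine Finset.sum_congr rfl fun j _ => ?_
    rw [star_tensor]
    congr 2
    omega

theorem hilbertPow_sum_apply {ι : Type*} (s : Finset ι) (f : ι → HilbertPow H k) (r : Fin k) :
    (∑ i ∈ s, f i) r = ∑ i ∈ s, f i r :=
  map_sum (PiLp.proj 2 (𝕜 := ℝ) (fun _ : Fin k => H) r) f s

/-- The block Toeplitz operator of sample covariances. -/
noncomputable def gram (x : ℤ → H) (n k : ℕ) : HilbertPow H k →L[ℝ] HilbertPow H k :=
  (n : ℝ)⁻¹ • ∑ j ∈ Finset.Ico (0 : ℤ) (n + k),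
    tensor (window (clip x n) k j) (window (clip x n) k j)

theorem inner_coordEmb (w : HilbertPow H k) (i : Fin k) (z : H) :
    ⟪w, coordEmb H k (i + 1) z⟫_ℝ = ⟪w i, z⟫_ℝ := by
  rw [PiLp.inner_apply, Finset.sum_eq_single i]
  · rw [coordEmb_apply, if_pos rfl]
  · intro r _ hr
    rw [coordEmb_apply, if_neg (fun h => hr (Fin.ext (by omega))), inner_zero_right]
  · simp

theorem sum_coordEmb (v : HilbertPow H k) : ∑ i : Fin k, coordEmb H k (i + 1) (v i) = v := by
  ext r
  rw [hilbertPow_sum_apply, Finset.sum_eq_single r]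
  · rw [coordEmb_apply, if_pos rfl]
  · intro i _ hi
    rw [coordEmb_apply, if_neg (fun h => hi (Fin.ext (by omega)))]
  · simp

/-- Because the sum runs over all windows of the zero-extended path, each block of the Gram operator
is exactly the sample covariance with divisor n, as used by the algorithm. -/
theorem gram_coordEmb (x : ℤ → H) (n : ℕ) (i r : Fin k) (z : H) :
    gram x n k (coordEmb H k (i + 1) z) r = lagOp (sampleCov x n) r i z := by
  rw [← sum_tensor_lag x n r.2 i.2]
  simp only [gram, smul_apply, sum_apply, tensor_apply, inner_coordEmb, PiLp.smul_apply,
    hilbertPow_sum_apply]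
  rfl

theorem diagProj_coordEmb (e : ℕ → H) (i : Fin k) (z : H) :
    diagProj e d k (coordEmb H k (i + 1) z) =
      coordEmb H k (i + 1) (projSpan e (d (k - i)) z) := by
  ext r
  rw [diagProj_apply, coordEmb_apply, coordEmb_apply]
  split_ifs with h
  · rw [show (r : ℕ) = i by omega]
  · rw [map_zero]

/-- The `i`-th coefficient of the regression over the full Toeplitz design. -/
noncomputable def regCoef (x : ℤ → H) (e : ℕ → H) (d : ℕ → ℕ) (n k i : ℕ) : H →L[ℝ] H :=
  regOp x e d n k (Finset.Ico (0 : ℤ) (n + k)) (n : ℝ)⁻¹ ∘L coordEmb H k i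

variable {c : ℝ}

/-- The projected Toeplitz system in terms of the algorithm's matrix entries. -/
theorem sum_regCoef_mul_toepOp (hc : 0 < c)
    (hG : ∀ v, diagProj e d k v = v → c * ‖v‖ ^ 2 ≤ ⟪gram x n k v, v⟫_ℝ) {b : ℕ} (hb : b < k) :
    ∑ a ∈ Finset.range k, projSpan e (d (k + 1)) * regCoef x e d n k (k - a) *
      toepOp (sampleCov x n) (fun r => projSpan e (d r)) a b =
      toepOp (sampleCov x n) (fun r => projSpan e (d r)) k b := by
  set D := diagProj e d k with hD
  set A := regOp x e d n k (Finset.Ico (0 : ℤ) (n + k)) (n : ℝ)⁻¹ with hA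
  obtain ⟨-, -, h3, -⟩ := comp_mul_compInv (isOrthProj_diagProj e d k) hc hG
  set i : Fin k := ⟨k - 1 - b, by omega⟩ with hi
  have hib : k - 1 - (i : ℕ) = b := by simp only [hi]; omega
  have hib' : k - (i : ℕ) = b + 1 := by simp only [hi]; omega
  have key : ∀ y, A (D (gram x n k (D (coordEmb H k (i + 1) y)))) =
      sampleCov x n (k - b) (projSpan e (d (b + 1)) y) := fun y => by
    -- The regression solves its normal equations exactly on the range of the projection. Tested
    -- against one coordinate, the right-hand side is a sample cross-covariance, which is an entry
    -- of row k.
    have e1 : compInv D (gram x n k) (D (gram x n k (D (coordEmb H k (i + 1) y)))) =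
        D (coordEmb H k (i + 1) y) := DFunLike.congr_fun h3 _
    have e2 : A (D (gram x n k (D (coordEmb H k (i + 1) y)))) =
        ((n : ℝ)⁻¹ • ∑ j ∈ Finset.Ico (0 : ℤ) (n + k), tensor (window (clip x n) k j)
          (clip x n (j + 1))) (D (compInv D (gram x n k)
            (D (gram x n k (D (coordEmb H k (i + 1) y)))))) := rfl
    rw [e2, e1, hD, (isOrthProj_diagProj e d k).idem, diagProj_coordEmb, hib',
      ← sum_tensor_clip x n (k - b) i.2]
    simp only [smul_apply, sum_apply, tensor_apply, inner_coordEmb]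
    congr 1
    refine Finset.sum_congr rfl fun j _ => ?_
    congr 2
    simp only [hi]; omega
  rw [← Finset.sum_range_reflect]
  ext y
  have e3 : toepOp (sampleCov x n) (fun r => projSpan e (d r)) k b y =
      projSpan e (d (k + 1)) (sampleCov x n (k - b) (projSpan e (d (b + 1)) y)) := by
    rw [toepOp, if_pos hb.le]; rfl
  rw [e3, ← key, ← sum_coordEmb (D (gram x n k (D (coordEmb H k (i + 1) y)))), map_sum, map_sum,
    sum_apply, Finset.sum_range]
  refine Finset.sum_congr rfl fun r _ => ?_
  have e4 := toepOp_reflect (sampleCov x n) (fun r => projSpan e (d r)) r.2 i.2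
  rw [hib, hib'] at e4
  rw [e4, show k - (k - 1 - (r : ℕ)) = r + 1 by omega, hD, diagProj_apply, diagProj_coordEmb,
    gram_coordEmb, hib']
  rfl

theorem sum_inner_toepOp (x : ℤ → H) (e : HilbertBasis ℕ ℝ H) (d : ℕ → ℕ) (n k : ℕ) {z : ℕ → H}
    (hz : ∀ a, projSpan e (d (a + 1)) (z a) = z a) :
    ∑ a ∈ Finset.range k, ∑ b ∈ Finset.range k,
      ⟪toepOp (sampleCov x n) (fun r => projSpan e (d r)) a b (z b), z a⟫_ℝ =
    ⟪gram x n k (WithLp.toLp 2 fun r : Fin k => z (k - 1 - r)),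
      WithLp.toLp 2 fun r : Fin k => z (k - 1 - r)⟫_ℝ := by
  set v : HilbertPow H k := WithLp.toLp 2 fun r : Fin k => z (k - 1 - r) with hv
  have hvr : ∀ r, v r = z (k - 1 - r) := fun r => rfl
  rw [PiLp.inner_apply, ← Finset.sum_range_reflect, Finset.sum_range]
  refine Finset.sum_congr rfl fun r _ => ?_
  rw [← Finset.sum_range_reflect, Finset.sum_range]
  have h1 : gram x n k v r = ∑ i : Fin k, lagOp (sampleCov x n) r i (v i) := by
    conv_lhs => rw [← sum_coordEmb v, map_sum, hilbertPow_sum_apply]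
    exact Finset.sum_congr rfl fun i _ => gram_coordEmb x n i r (v i)
  rw [h1, sum_inner]
  refine Finset.sum_congr rfl fun i _ => ?_
  rw [toepOp_reflect _ _ r.2 i.2, hvr, hvr]
  have h2 : ∀ r : Fin k, projSpan e (d (k - r)) (z (k - 1 - r)) = z (k - 1 - r) := fun r => by
    have := hz (k - 1 - r)
    rwa [show k - 1 - (r : ℕ) + 1 = k - r by omega] at this
  rw [mul_apply_eq_comp, mul_apply_eq_comp, h2, (isOrthProj_projSpan e _).symm, h2]

theorem innovPos_sampleCov (hc : 0 < c)
    (hG : ∀ v, diagProj e d k v = v → c * ‖v‖ ^ 2 ≤ ⟪gram x n k v, v⟫_ℝ) {b : ℕ} (hb : b < k) :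
    InnovPos (sampleCov x n) (fun r => projSpan e (d r)) b := by
  refine innovPos_of_coercive (fun i => isOrthProj_projSpan e _) (star_sampleCov_zero x n) (N := k)
    hc (fun z hz => ?_) b hb
  rw [sum_inner_toepOp x e d n k hz]
  refine le_trans (le_of_eq ?_) (hG _ ?_)
  · rw [PiLp.norm_sq_eq_of_L2, ← Finset.sum_range_reflect, Finset.sum_range]
  · ext r
    rw [diagProj_apply]
    have := hz (k - 1 - r)
    rwa [show k - 1 - (r : ℕ) + 1 = k - r by omega] at this

/-- The innovations coefficients in terms of regression operators. -/
theorem innovL_eq_sum_regCoef (hc : 0 < c)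
    (hG : ∀ v, diagProj e d k v = v → c * ‖v‖ ^ 2 ≤ ⟪gram x n k v, v⟫_ℝ) {m : ℕ} (hm : 1 ≤ m)
    (hmk : m ≤ k) : innovL (sampleCov x n) (fun r => projSpan e (d r)) k (k - m) =
      ∑ i ∈ Finset.Icc 1 m, projSpan e (d (k + 1)) * regCoef x e d n k i *
          innovL (sampleCov x n) (fun r => projSpan e (d r)) (k - i) (k - m) := by
  rw [innovL_eq_sum (fun i => isOrthProj_projSpan e _) (star_sampleCov_zero x n)
    (fun b hb => innovPos_sampleCov hc hG hb) (fun b hb => sum_regCoef_mul_toepOp hc hG hb) (k - m)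
    (by omega)]
  symm
  refine Finset.sum_bij_ne_zero (fun i _ _ => k - i) (fun i hi _ => ?_) (fun i hi _ j hj _ h => ?_)
    (fun a ha hne => ?_) fun i hi _ => ?_
  · rw [Finset.mem_Icc] at hi; rw [Finset.mem_range]; omega
  · rw [Finset.mem_Icc] at hi hj; omega
  · rw [Finset.mem_range] at ha
    -- Rows above the column k - m vanish by triangularity. The sum thus has m terms however large k
    -- is, and only finitely many regression coefficients are involved.
    have h1 : k - m ≤ a := by
      by_contra h
      rw [innovL_of_gt (by omega), mul_zero] at hne
      exact hne rfl
    refine ⟨k - a, by rw [Finset.mem_Icc]; omega, ?_, by omega⟩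
    rwa [show k - (k - a) = a by omega]
  · rw [Finset.mem_Icc] at hi
    rw [show k - (k - i) = i by omega]

/-- The Gram form adds the squares of the incomplete windows to those of the complete ones, so the
lower bound for the latter carries over. -/
theorem le_inner_gram {a : ℝ} (hd : Monotone d)
    (hlow : ∀ v : ℕ → H, (∀ i, projSpan e (d k) (v i) = v i) →
      ((n : ℝ) - k) * a * ∑ i ∈ Finset.range k, ‖v i‖ ^ 2 ≤
        ∑ j ∈ Finset.Ico (k : ℤ) n, (∑ i ∈ Finset.range k, ⟪x (j - i), v i⟫_ℝ) ^ 2)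
    {v : HilbertPow H k} (hv : diagProj e d k v = v) :
    (n : ℝ)⁻¹ * (((n : ℝ) - k) * a) * ‖v‖ ^ 2 ≤ ⟪gram x n k v, v⟫_ℝ := by
  have hG : ⟪gram x n k v, v⟫_ℝ =
      (n : ℝ)⁻¹ * ∑ j ∈ Finset.Ico (0 : ℤ) (n + k), ⟪window (clip x n) k j, v⟫_ℝ ^ 2 := by
    simp only [gram, smul_apply, sum_apply, tensor_apply, sum_inner, real_inner_smul_left, pow_two]
  have h1 := hlow (extend v) fun i => projSpan_extend e.orthonormal hd hv i
  rw [sum_norm_extend] at h1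
  rw [hG, mul_assoc]
  refine mul_le_mul_of_nonneg_left (h1.trans ?_) (by positivity)
  refine le_trans (le_of_eq ?_) (Finset.sum_le_sum_of_subset_of_nonneg
    (Finset.Ico_subset_Ico (by omega) (by omega) : Finset.Ico (k : ℤ) n ⊆ _)
      fun _ _ _ => by positivity)
  refine Finset.sum_congr rfl fun j hj => ?_
  rw [Finset.mem_Ico] at hj
  rw [inner_window]
  congr 1
  refine Finset.sum_congr rfl fun i hi => ?_
  rw [Finset.mem_range] at hi
  rw [clip_of_mem x (by omega) (by omega)]

end Toeplitz

/-! ### Consistency of the innovations coefficients -/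

section Small

variable {Ω : Type*} [MeasurableSpace Ω] {μ : Measure Ω} {f g : ℕ → Ω → ℝ}

/-- `f n` converges to zero from above in (outer) probability. -/
def Small (μ : Measure Ω) (f : ℕ → Ω → ℝ) : Prop := ∀ δ > 0, Whp μ fun n ω => f n ω ≤ δ

theorem Small.mono_whp (hf : Small μ f) {p : ℕ → Ω → Prop} (hp : Whp μ p)
    (h : ∀ᶠ n in atTop, ∀ ω, p n ω → g n ω ≤ f n ω) : Small μ g := fun δ hδ =>
  ((hf δ hδ).and hp).mono (h.mono fun _ hn ω hω => (hn ω hω.2).trans hω.1)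

theorem Small.mono (hf : Small μ f) (h : ∀ᶠ n in atTop, ∀ ω, g n ω ≤ f n ω) : Small μ g :=
  fun δ hδ => (hf δ hδ).mono (h.mono fun _ hn ω hω => (hn ω).trans hω)

theorem Small.add (hf : Small μ f) (hg : Small μ g) : Small μ fun n ω => f n ω + g n ω :=
  fun δ hδ => ((hf _ (half_pos hδ)).and (hg _ (half_pos hδ))).mono
    (Eventually.of_forall fun n ω h => by linarith [h.1, h.2])

theorem Small.const_mul (hf : Small μ f) {c : ℝ} (hc : 0 ≤ c) : Small μ fun n ω => c * f n ω :=
  fun δ hδ => (hf (δ / (c + 1)) (by positivity)).mono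
    (Eventually.of_forall fun n ω h => by
      calc c * f n ω ≤ c * (δ / (c + 1)) := mul_le_mul_of_nonneg_left h hc
        _ ≤ (c + 1) * (δ / (c + 1)) := by gcongr; linarith
        _ = δ := by field_simp)

theorem Small.mul (hf : Small μ f) (hg : Small μ g) (hg0 : ∀ n ω, 0 ≤ g n ω) :
    Small μ fun n ω => f n ω * g n ω := fun δ hδ =>
  ((hf 1 one_pos).and (hg δ hδ)).mono (Eventually.of_forall fun n ω h => by
    calc f n ω * g n ω ≤ 1 * g n ω := mul_le_mul_of_nonneg_right h.1 (hg0 n ω)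
      _ ≤ δ := by linarith [h.2])

theorem Small.sum {ι : Type*} (s : Finset ι) {f : ι → ℕ → Ω → ℝ} (hf : ∀ i ∈ s, Small μ (f i)) :
    Small μ fun n ω => ∑ i ∈ s, f i n ω := by
  classical
  induction s using Finset.induction_on with
  | empty => exact fun δ hδ => Whp.of_ae (Eventually.of_forall fun _ => ae_of_all _ fun _ => by
      simpa using hδ.le)
  | insert i s hi ih =>
    simp only [Finset.sum_insert hi]
    exact (hf i (Finset.mem_insert_self _ _)).add (ih fun j hj => hf j (Finset.mem_insert_of_mem hj))

end Small

-- Perturbation of products with projections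

section Perturbation

variable {H : Type*} [NormedAddCommGroup H] [InnerProductSpace ℝ H] [CompleteSpace H]

/-- A telescoping in which each error is small in the only sense available: A - p P' in norm, t - y
as a vector, and the projections applied to the fixed vectors y and p y. -/
theorem norm_comp_apply_sub_le {P : H →L[ℝ] H} (hP : IsOrthProj P) (P' A p : H →L[ℝ] H) (t y : H) :
    ‖P (A t) - p y‖ ≤ ‖A - p * P'‖ * ‖t - y‖ + ‖p * P'‖ * ‖t - y‖ + ‖y‖ * ‖A - p * P'‖ +
      ‖p‖ * ‖y - P' y‖ + ‖p y - P (p y)‖ := by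
  have e1 : P (A t) - p y = P ((A - p * P') (t - y)) + P ((p * P') (t - y)) + P ((A - p * P') y) -
      P (p (y - P' y)) - (p y - P (p y)) := by
    simp only [_root_.sub_apply, map_sub, mul_apply_eq_comp]; abel
  have h1 := (hP.norm_apply_le _).trans ((A - p * P').le_opNorm (t - y))
  have h2 := (hP.norm_apply_le _).trans ((p * P').le_opNorm (t - y))
  have h3 := (hP.norm_apply_le _).trans ((A - p * P').le_opNorm y)
  have h4 := (hP.norm_apply_le _).trans (p.le_opNorm (y - P' y))
  rw [e1, mul_comm ‖y‖]
  refine (norm_sub_le _ _).trans (add_le_add ((norm_sub_le _ _).trans (add_le_add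
    ((norm_add_le _ _).trans (add_le_add ((norm_add_le _ _).trans (add_le_add h1 h2)) h3)) h4))
      le_rfl)

/-- The same telescoping in operator norm. The projections now act on fixed operators, which is
where the Hilbert–Schmidt assumption will enter. -/
theorem norm_comp_sub_le {P : H →L[ℝ] H} (hP : IsOrthProj P) (P' A p T Y : H →L[ℝ] H) :
    ‖P * A * T - p * Y‖ ≤ ‖A - p * P'‖ * ‖T - Y‖ + ‖p * P'‖ * ‖T - Y‖ + ‖Y‖ * ‖A - p * P'‖ +
      ‖p‖ * ‖Y - P' * Y‖ + ‖Y‖ * ‖p - P * p‖ := by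
  have e1 : P * A * T - p * Y = P * ((A - p * P') * (T - Y)) + P * ((p * P') * (T - Y)) +
      P * ((A - p * P') * Y) - P * (p * (Y - P' * Y)) - (p - P * p) * Y := by
    noncomm_ring
  have hb : ∀ U : H →L[ℝ] H, ‖P * U‖ ≤ ‖U‖ := fun U => (norm_mul_le _ _).trans
    ((mul_le_mul_of_nonneg_right hP.norm_le (norm_nonneg _)).trans (one_mul _).le)
  rw [e1, mul_comm ‖Y‖, mul_comm ‖Y‖]
  refine (norm_sub_le _ _).trans (add_le_add ((norm_sub_le _ _).trans (add_le_add
    ((norm_add_le _ _).trans (add_le_add ((norm_add_le _ _).trans (add_le_add ?_ ?_)) ?_)) ?_))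
      (norm_mul_le _ _)) <;>
  exact (hb _).trans (norm_mul_le _ _)

end Perturbation

-- Induction on the lag of the innovations coefficients

section Theta

variable {Ω H : Type*} [MeasurableSpace Ω] {μ : Measure Ω} [IsProbabilityMeasure μ]
  [NormedAddCommGroup H] [InnerProductSpace ℝ H] [CompleteSpace H]
  [MeasurableSpace H] [BorelSpace H] [SecondCountableTopology H]
  {X ε : ℤ → Ω → H} {ψ π : ℕ → H →L[ℝ] H} {lam : ℕ → ℝ} {ν : HilbertBasis ℕ ℝ H} {d : ℕ → ℕ}
  {κ : ℕ → ℕ} {lamHat : ℕ → Ω → ℕ → ℝ} {νHat : ℕ → Ω → HilbertBasis ℕ ℝ H}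

/-- α decreases with the dimension, so a smaller order makes α⁻¹ smaller and the conditions `ratio`
and `power` are inherited. The truncation rate is not monotone in the order and has to be supplied.
-/
theorem Rates.sub (S : Setting μ X ε ψ π lam ν d) (R : Rates μ X π lam ν d κ) (s : ℕ)
    (h : Tendsto (fun n : ℕ => truncRate (alpha μ X ν) π lam d (κ n - s)) atTop (𝓝 0)) :
    Rates μ X π lam ν d fun n => κ n - s := by
  have ha : ∀ n, (alpha μ X ν (d (κ n - s)) ^ 2)⁻¹ ≤ (alpha μ X ν (d (κ n)) ^ 2)⁻¹ := fun n => by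
    have h1 := S.proc.alpha_antitone ν (S.d_mono (Nat.sub_le (κ n) s)) (S.alpha_pos _)
      (S.alpha_pos _)
    have h2 := S.alpha_pos (κ n)
    gcongr
  have hk : ∀ n, ((κ n - s : ℕ) : ℝ) ≤ κ n := fun n => by exact_mod_cast Nat.sub_le _ _
  refine ⟨tendsto_atTop.mpr fun b => (R.tendsto.eventually_ge_atTop (b + s)).mono fun n hn => by
    omega, R.lt.mono fun n hn => by omega, tendsto_zero_of_le R.ratio ?_ ?_,
    tendsto_zero_of_le R.power ?_ ?_, h⟩
  · exact Eventually.of_forall fun n => by positivity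
  · filter_upwards [R.lt] with n hn
    have hm : (0 : ℝ) < (n : ℝ) - κ n := sub_pos.mpr (by exact_mod_cast hn)
    have h1 : (Real.sqrt ((n : ℝ) - (κ n - s : ℕ)))⁻¹ ≤ (Real.sqrt ((n : ℝ) - κ n))⁻¹ := by
      have := hk n
      have := Real.sqrt_pos.mpr hm
      gcongr
    exact mul_le_mul (mul_le_mul (Real.sqrt_le_sqrt (hk n)) h1 (by positivity) (by positivity))
      (ha n) (by positivity) (by positivity)
  · exact Eventually.of_forall fun n => by positivity
  · refine Eventually.of_forall fun n => ?_
    have h1 : ((κ n - s : ℕ) : ℝ) ^ (3 / 2 : ℝ) ≤ (κ n : ℝ) ^ (3 / 2 : ℝ) :=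
      Real.rpow_le_rpow (by positivity) (hk n) (by norm_num)
    exact mul_le_mul_of_nonneg_right (mul_le_mul h1 (ha n) (by positivity) (by positivity))
      (by positivity)

namespace Setting

/-- The case of all windows, J = [0, n + k) with weight 1/n. The requirement on the weight holds
because k is eventually at most n/2. -/
theorem small_regCoef (S : Setting μ X ε ψ π lam ν d) (R : Rates μ X π lam ν d κ)
    (hνHat : ∀ n ω, IsEigenbasis (sampleCov (fun j => X j ω) n 0) (lamHat n ω) (νHat n ω)) {i : ℕ}
    (hi : 1 ≤ i) : Small μ fun n ω => ‖regCoef (fun j => X j ω) (νHat n ω) d n (κ n) i -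
        π i * projSpan (νHat n ω) (d (κ n + 1 - i))‖ := by
  intro δ hδ
  refine (S.whp_regOp R hνHat hδ).mono ?_
  filter_upwards [R.lt, R.tendsto.eventually_ge_atTop i, R.eventually_le_two_mul S]
    with n h1 h2 h3 ω h
  have hn : (0 : ℝ) < n := by exact_mod_cast (Nat.zero_le _).trans_lt h1
  have h4 := h (Finset.Ico (0 : ℤ) (n + κ n)) (n : ℝ)⁻¹
    (Finset.Ico_subset_Ico (by omega) (by omega)) subset_rfl (by positivity)
    (by rw [inv_mul_cancel₀ hn.ne']; norm_num) (by rw [le_inv_mul_iff₀ hn]; linarith)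
  rw [regCoef, ← arOp_diagProj_coordEmb _ hi h2, ← ContinuousLinearMap.sub_comp]
  refine (ContinuousLinearMap.opNorm_comp_le _ _).trans ?_
  calc _ ≤ δ * 1 := mul_le_mul h4 (norm_coordEmb_le _ _) (ContinuousLinearMap.opNorm_nonneg _) hδ.le
    _ = δ := mul_one δ

theorem whp_innovL_eq (S : Setting μ X ε ψ π lam ν d) (R : Rates μ X π lam ν d κ)
    (hνHat : ∀ n ω, IsEigenbasis (sampleCov (fun j => X j ω) n 0) (lamHat n ω) (νHat n ω)) {m : ℕ}
    (hm : 1 ≤ m) : Whp μ fun n ω =>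
      innovL (sampleCov (fun j => X j ω) n) (fun r => projSpan (νHat n ω) (d r)) (κ n) (κ n - m) =
        ∑ i ∈ Finset.Icc 1 m, projSpan (νHat n ω) (d (κ n + 1)) *
          regCoef (fun j => X j ω) (νHat n ω) d n (κ n) i *
          innovL (sampleCov (fun j => X j ω) n) (fun r => projSpan (νHat n ω) (d r))
            (κ n - i) (κ n - m) := by
  refine (S.whp_low R hνHat).mono ?_
  filter_upwards [R.lt, R.tendsto.eventually_ge_atTop m] with n h1 h2 ω h
  have hn : (0 : ℝ) < n := by exact_mod_cast (Nat.zero_le _).trans_lt h1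
  have hmm : (0 : ℝ) < (n : ℝ) - κ n := sub_pos.mpr (by exact_mod_cast h1)
  have ha := S.alpha_pos (κ n)
  have hc : 0 < (n : ℝ)⁻¹ * (((n : ℝ) - κ n) * alpha μ X ν (d (κ n))) := by positivity
  have h4 : ∀ v, diagProj (νHat n ω) d (κ n) v = v → _ := fun v hv =>
    le_inner_gram (x := fun j => X j ω) (a := alpha μ X ν (d (κ n))) S.d_mono h hv
  exact innovL_eq_sum_regCoef (x := fun j => X j ω) (e := νHat n ω) hc h4 hm h2

theorem small_sub_proj_apply (S : Setting μ X ε ψ π lam ν d) (R : Rates μ X π lam ν d κ)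
    (hνHat : ∀ n ω, IsEigenbasis (sampleCov (fun j => X j ω) n 0) (lamHat n ω) (νHat n ω))
    {D : ℕ → ℕ} (hD : Tendsto D atTop atTop) (x : H) :
    Small μ fun n ω => ‖x - projSpan (νHat n ω) (D n) x‖ := fun δ hδ => by
  obtain ⟨τ, hτ, hc⟩ := exists_close_apply ν S.lam_pos x hδ
  exact (S.whp_close R hνHat hD hτ).mono (Eventually.of_forall fun n ω h => hc _ h)

theorem small_sub_proj_mul (S : Setting μ X ε ψ π lam ν d) (R : Rates μ X π lam ν d κ)
    (hνHat : ∀ n ω, IsEigenbasis (sampleCov (fun j => X j ω) n 0) (lamHat n ω) (νHat n ω))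
    {D : ℕ → ℕ} (hD : Tendsto D atTop atTop) {T : H →L[ℝ] H} (hT : IsHilbertSchmidt T) :
    (Small μ fun n ω => ‖T - projSpan (νHat n ω) (D n) * T‖) ∧
      Small μ fun n ω => ‖T - T * projSpan (νHat n ω) (D n)‖ := by
  constructor <;> intro δ hδ <;> obtain ⟨τ, hτ, hc⟩ := hT.exists_close ν S.lam_pos hδ
  · exact (S.whp_close R hνHat hD hτ).mono (Eventually.of_forall fun n ω h => (hc _ h).1)
  · exact (S.whp_close R hνHat hD hτ).mono (Eventually.of_forall fun n ω h => (hc _ h).2)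

theorem small_mul_proj (p : H →L[ℝ] H) {D : ℕ → ℕ}
    {f : ℕ → Ω → ℝ} (hf : Small μ f) (hf0 : ∀ n ω, 0 ≤ f n ω) :
    Small μ fun n ω => ‖p * projSpan (νHat n ω) (D n)‖ * f n ω :=
  (hf.const_mul (norm_nonneg p)).mono (Eventually.of_forall fun n ω =>
    mul_le_mul_of_nonneg_right ((norm_mul_le _ _).trans (mul_le_of_le_one_right (norm_nonneg _)
      (isOrthProj_projSpan _ _).norm_le)) (hf0 n ω))

/-- θ_{k,m} is a finite sum of P β_{k,i} θ_{k-i,m-i}, matching ψ_m = Σ π_i ψ_{m-i}. The order drops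
along with the lag, so the induction on m is uniform over all shifts s of the order. At m = 0 the
coefficient is a projection, which tends strongly to ψ_0 = 1. -/
theorem small_innovL_apply (S : Setting μ X ε ψ π lam ν d) (hd : Tendsto d atTop atTop)
    (R : ∀ s, Rates μ X π lam ν d fun n => κ n - s)
    (hνHat : ∀ n ω, IsEigenbasis (sampleCov (fun j => X j ω) n 0) (lamHat n ω) (νHat n ω))
    (h0 : ψ 0 = 1) (hψ : ∀ m, 1 ≤ m → ψ m = ∑ i ∈ Finset.Icc 1 m, π i * ψ (m - i)) (x : H)
    (m s : ℕ) : Small μ fun n ω => ‖(innovL (sampleCov (fun j => X j ω) n)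
      (fun r => projSpan (νHat n ω) (d r)) (κ n - s) (κ n - s - m) - ψ m) x‖ := by
  induction m using Nat.strong_induction_on generalizing s with
  | _ m ih =>
    rcases Nat.eq_zero_or_pos m with rfl | hm
    · have h1 := S.small_sub_proj_apply (R s) hνHat (tendsto_dim hd (R s).tendsto 0) x
      refine h1.mono (Eventually.of_forall fun n ω => ?_)
      rw [Nat.sub_zero, innovL_self, h0, _root_.sub_apply, one_apply_eq_self, norm_sub_rev]
      rfl
    have hterm : ∀ i ∈ Finset.Icc 1 m, Small μ fun n ω =>
        ‖projSpan (νHat n ω) (d (κ n - s + 1)) (regCoef (fun j => X j ω) (νHat n ω) d n (κ n - s) i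
          (innovL (sampleCov (fun j => X j ω) n) (fun r => projSpan (νHat n ω) (d r))
            (κ n - s - i) (κ n - s - m) x)) - π i (ψ (m - i) x)‖ := by
      intro i hi
      rw [Finset.mem_Icc] at hi
      have hA := S.small_regCoef (R s) hνHat hi.1
      have hI : Small μ fun n ω => ‖innovL (sampleCov (fun j => X j ω) n)
          (fun r => projSpan (νHat n ω) (d r)) (κ n - s - i) (κ n - s - m) x - ψ (m - i) x‖ := by
        refine (ih (m - i) (by omega) (s + i)).mono (Eventually.of_forall fun n ω => le_of_eq ?_)
        rw [_root_.sub_apply, Nat.sub_sub, show κ n - (s + i) - (m - i) = κ n - s - m by omega]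
      have hP' := S.small_sub_proj_apply (R s) hνHat (tendsto_dim hd (R s).tendsto i) (ψ (m - i) x)
      have hP := S.small_sub_proj_apply (R s) hνHat (tendsto_dim hd (R s).tendsto 0)
        (π i (ψ (m - i) x))
      refine (((((hA.mul hI fun _ _ => norm_nonneg _).add
        (small_mul_proj (νHat := νHat) (π i) (D := fun n => d (κ n - s + 1 - i)) hI
          fun _ _ => norm_nonneg _)).add
        (hA.const_mul (norm_nonneg (ψ (m - i) x)))).add (hP'.const_mul (norm_nonneg (π i)))).add
        hP).mono (Eventually.of_forall fun n ω => ?_)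
      exact norm_comp_apply_sub_le (isOrthProj_projSpan _ _) _ _ _ _ _
    refine (Small.sum _ hterm).mono_whp (S.whp_innovL_eq (R s) hνHat hm)
      (Eventually.of_forall fun n ω h => ?_)
    rw [h, hψ m hm, _root_.sub_apply, sum_apply, sum_apply, ← Finset.sum_sub_distrib]
    exact norm_sum_le _ _

/-- The induction has to start at m = 1: at m = 0 the coefficient is a projection of finite rank,
which does not tend to the identity in norm. -/
theorem small_innovL (S : Setting μ X ε ψ π lam ν d) (hd : Tendsto d atTop atTop)
    (R : ∀ s, Rates μ X π lam ν d fun n => κ n - s)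
    (hνHat : ∀ n ω, IsEigenbasis (sampleCov (fun j => X j ω) n 0) (lamHat n ω) (νHat n ω))
    (h0 : ψ 0 = 1) (hψ : ∀ m, 1 ≤ m → ψ m = ∑ i ∈ Finset.Icc 1 m, π i * ψ (m - i))
    (hHS : ∀ m, 1 ≤ m → IsHilbertSchmidt (ψ m) ∧ IsHilbertSchmidt (π m))
    (m : ℕ) (hm : 1 ≤ m) (s : ℕ) : Small μ fun n ω => ‖innovL (sampleCov (fun j => X j ω) n)
      (fun r => projSpan (νHat n ω) (d r)) (κ n - s) (κ n - s - m) - ψ m‖ := by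
  induction m using Nat.strong_induction_on generalizing s with
  | _ m ih =>
    have hterm : ∀ i ∈ Finset.Icc 1 m, Small μ fun n ω =>
        ‖projSpan (νHat n ω) (d (κ n - s + 1)) * regCoef (fun j => X j ω) (νHat n ω) d n (κ n - s) i
          * innovL (sampleCov (fun j => X j ω) n) (fun r => projSpan (νHat n ω) (d r))
            (κ n - s - i) (κ n - s - m) - π i * ψ (m - i)‖ := by
      intro i hi
      rw [Finset.mem_Icc] at hi
      have hA := S.small_regCoef (R s) hνHat hi.1
      have hP := (S.small_sub_proj_mul (R s) hνHat (tendsto_dim hd (R s).tendsto 0)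
        (hHS i hi.1).2).1
      -- The term i = m contains the zeroth coefficient P'. It is compared with π_i directly, since
      -- P and P' multiply the Hilbert–Schmidt operator π_i, next to which they are close to 1 in
      -- norm.
      rcases hi.2.eq_or_lt with rfl | him
      · have hP' := (S.small_sub_proj_mul (R s) hνHat (tendsto_dim hd (R s).tendsto i)
          (hHS i hi.1).2).2
        refine ((hA.add hP').add hP).mono ?_
        filter_upwards [(R s).tendsto.eventually_ge_atTop i] with n hn ω
        rw [Nat.sub_self, h0, mul_one, innovL_self,
          show κ n - s - i + 1 = κ n - s + 1 - i by omega, Nat.sub_zero]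
        have hPp := isOrthProj_projSpan (νHat n ω) (d (κ n - s + 1))
        have hPp' := isOrthProj_projSpan (νHat n ω) (d (κ n - s + 1 - i))
        set P := projSpan (νHat n ω) (d (κ n - s + 1))
        set P' := projSpan (νHat n ω) (d (κ n - s + 1 - i))
        set A := regCoef (fun j => X j ω) (νHat n ω) d n (κ n - s) i
        have e1 : P * A * P' - π i = P * ((A - π i * P') * P') - P * (π i - π i * P') -
            (π i - P * π i) := by
          have : (A - π i * P') * P' = A * P' - π i * P' := by
            rw [sub_mul, mul_assoc, hPp'.mul_self]
          rw [this]; noncomm_ring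
        have hb : ∀ U : H →L[ℝ] H, ‖P * U‖ ≤ ‖U‖ := fun U => (norm_mul_le _ _).trans
          ((mul_le_mul_of_nonneg_right hPp.norm_le (norm_nonneg _)).trans (one_mul _).le)
        have hb' : ‖(A - π i * P') * P'‖ ≤ ‖A - π i * P'‖ := (norm_mul_le _ _).trans
          (mul_le_of_le_one_right (norm_nonneg _) hPp'.norm_le)
        rw [e1]
        exact (norm_sub_le _ _).trans (add_le_add ((norm_sub_le _ _).trans
          (add_le_add ((hb _).trans hb') (hb _))) le_rfl)
      have hI : Small μ fun n ω => ‖innovL (sampleCov (fun j => X j ω) n)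
          (fun r => projSpan (νHat n ω) (d r)) (κ n - s - i) (κ n - s - m) - ψ (m - i)‖ := by
        refine (ih (m - i) (by omega) (by omega) (s + i)).mono
          (Eventually.of_forall fun n ω => le_of_eq ?_)
        rw [Nat.sub_sub, show κ n - (s + i) - (m - i) = κ n - s - m by omega]
      have hP' := (S.small_sub_proj_mul (R s) hνHat (tendsto_dim hd (R s).tendsto i)
        (hHS (m - i) (by omega)).1).1
      refine (((((hA.mul hI fun _ _ => norm_nonneg _).add
        (small_mul_proj (νHat := νHat) (π i) (D := fun n => d (κ n - s + 1 - i)) hI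
          fun _ _ => norm_nonneg _)).add
        (hA.const_mul (norm_nonneg (ψ (m - i))))).add (hP'.const_mul (norm_nonneg (π i)))).add
        (hP.const_mul (norm_nonneg (ψ (m - i))))).mono (Eventually.of_forall fun n ω => ?_)
      exact norm_comp_sub_le (isOrthProj_projSpan _ _) _ _ _ _ _
    refine (Small.sum _ hterm).mono_whp (S.whp_innovL_eq (R s) hνHat hm)
      (Eventually.of_forall fun n ω h => ?_)
    rw [h, hψ m hm, ← Finset.sum_sub_distrib]
    exact norm_sum_le _ _

end Setting

end Theta

/-! ### Linear functionals of the process in `L²` -/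

section Functional

variable {Ω H : Type*} [MeasurableSpace Ω] {μ : Measure Ω} [IsProbabilityMeasure μ]
  [NormedAddCommGroup H] [InnerProductSpace ℝ H]

theorem inner_toLp {f g : Ω → ℝ} (hf : MemLp f 2 μ) (hg : MemLp g 2 μ) :
    ⟪hf.toLp f, hg.toLp g⟫_ℝ = ∫ ω, f ω * g ω ∂μ := by
  rw [L2.inner_def]
  refine integral_congr_ae ?_
  filter_upwards [hf.coeFn_toLp, hg.coeFn_toLp] with ω h1 h2
  rw [h1, h2, real_inner_eq_re_inner, RCLike.inner_apply]
  simp [mul_comm]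

/-- The functional `u ↦ ⟨Y, u⟩` with values in `L²`. -/
noncomputable def functional {Y : Ω → H} (hY : MemLp Y 2 μ) : H →ₗ[ℝ] Lp ℝ 2 μ where
  toFun u := (hY.inner_const u).toLp
  map_add' u v := by
    rw [← MemLp.toLp_add]
    exact MemLp.toLp_congr _ _ (ae_of_all _ fun ω => inner_add_right _ _ _)
  map_smul' c u := by
    rw [RingHom.id_apply, ← MemLp.toLp_const_smul]
    exact MemLp.toLp_congr _ _ (ae_of_all _ fun ω => real_inner_smul_right _ _ _)

theorem inner_functional {Y Z : Ω → H} (hY : MemLp Y 2 μ) (hZ : MemLp Z 2 μ) (u v : H) :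
    ⟪functional hY u, functional hZ v⟫_ℝ = ∫ ω, ⟪Y ω, u⟫_ℝ * ⟪Z ω, v⟫_ℝ ∂μ :=
  inner_toLp (hY.inner_const u) (hZ.inner_const v)

theorem norm_functional_le {Y : Ω → H} (hY : MemLp Y 2 μ) {B : ℝ} (hB : 0 ≤ B)
    (h : eLpNorm Y 2 μ ≤ ENNReal.ofReal B) (u : H) : ‖functional hY u‖ ≤ ‖u‖ * B := by
  have h1 : ‖functional hY u‖ = (eLpNorm (fun ω => ⟪Y ω, u⟫_ℝ) 2 μ).toReal :=
    Lp.norm_toLp _ (hY.inner_const u)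
  rw [h1]
  refine ENNReal.toReal_le_of_le_ofReal (by positivity) ?_
  rw [ENNReal.ofReal_mul (norm_nonneg _)]
  refine (eLpNorm_le_mul_eLpNorm_of_ae_le_mul (c := ‖u‖) (g := Y)
    (ae_of_all _ fun ω => ?_) 2).trans (mul_le_mul_right h _)
  rw [mul_comm]
  exact norm_inner_le_norm _ _

variable [CompleteSpace H]

/-- Almost surely convergent series with absolutely summable coefficients converge in `L²`. -/
theorem hasSum_functional {T : ℕ → H →L[ℝ] H} (hT : Summable fun ℓ => ‖T ℓ‖) {Y : ℕ → Ω → H}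
    {Z : Ω → H} (hY : ∀ ℓ, MemLp (Y ℓ) 2 μ) (hZ : MemLp Z 2 μ) {B : ℝ} (hB : 0 ≤ B)
    (h : ∀ ℓ, eLpNorm (Y ℓ) 2 μ ≤ ENNReal.ofReal B)
    (hs : ∀ᵐ ω ∂μ, HasSum (fun ℓ => T ℓ (Y ℓ ω)) (Z ω)) (u : H) :
    HasSum (fun ℓ => functional (hY ℓ) (ContinuousLinearMap.adjoint (T ℓ) u)) (functional hZ u) := by
  set F := fun ℓ => functional (hY ℓ) (ContinuousLinearMap.adjoint (T ℓ) u) with hF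
  have hsum : Summable fun ℓ => ‖F ℓ‖ := by
    refine Summable.of_nonneg_of_le (fun _ => norm_nonneg _) (fun ℓ => ?_)
      (hT.mul_right (‖u‖ * B))
    refine (norm_functional_le (hY ℓ) hB (h ℓ) _).trans ?_
    rw [← mul_assoc]
    refine mul_le_mul_of_nonneg_right ?_ hB
    simpa using (ContinuousLinearMap.adjoint (T ℓ)).le_opNorm u
  have hne : ∑' ℓ, ‖F ℓ‖ₑ ≠ ∞ := by
    simp only [← ofReal_norm]
    rw [← ENNReal.ofReal_tsum_of_nonneg (fun _ => norm_nonneg _) hsum]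
    exact ENNReal.ofReal_ne_top
  have h1 := Lp.hasSum_coeFn_tsum hne
  have h2 : ∀ᵐ ω ∂μ, ∀ ℓ, F ℓ ω = ⟪T ℓ (Y ℓ ω), u⟫_ℝ := by
    rw [ae_all_iff]
    intro ℓ
    filter_upwards [((hY ℓ).inner_const (𝕜 := ℝ)
      (ContinuousLinearMap.adjoint (T ℓ) u)).coeFn_toLp] with ω hω
    exact hω.trans (ContinuousLinearMap.adjoint_inner_right _ _ _)
  -- The norms are summable, so the L² series also converges almost everywhere. Its limit must then
  -- be the given almost sure sum.
  have h3 : ∑' ℓ, F ℓ = functional hZ u := by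
    refine Lp.ext ?_
    filter_upwards [h1, h2, hs, (hZ.inner_const (𝕜 := ℝ) u).coeFn_toLp] with ω e1 e2 e3 e4
    refine Eq.trans ?_ e4.symm
    refine e1.unique ?_
    simp only [e2]
    have := e3.mapL (innerSL ℝ u)
    simpa [real_inner_comm] using this
  rw [← h3]
  exact hsum.of_norm.hasSum

end Functional

-- Centring and measurability of the innovations

section Innovation

variable {Ω H : Type*} [MeasurableSpace Ω] {μ : Measure Ω} [IsProbabilityMeasure μ]
  [NormedAddCommGroup H] [InnerProductSpace ℝ H] [CompleteSpace H]
  [MeasurableSpace H] [BorelSpace H] [SecondCountableTopology H]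
  {X ε : ℤ → Ω → H} {ψ π : ℕ → H →L[ℝ] H} {lam : ℕ → ℝ} {ν : HilbertBasis ℕ ℝ H} {d : ℕ → ℕ}
  {κ : ℕ → ℕ}

theorem IsProc.exists_eLpNorm_le (hX : IsProc μ X ε ψ) :
    ∃ B : ℝ, 0 ≤ B ∧ ∀ j, eLpNorm (X j) 2 μ ≤ ENNReal.ofReal B := by
  set M := (∑' m, ‖ψ m‖) ^ 2 * ∫ ω, ‖ε 0 ω‖ ^ 2 ∂μ with hM
  have hM0 : 0 ≤ M := mul_nonneg (sq_nonneg _) (integral_nonneg fun ω => by positivity)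
  refine ⟨M ^ (1 / 2 : ℝ), by positivity, fun j => ?_⟩
  rw [eLpNorm_eq_lintegral_rpow_enorm_toReal (by norm_num) (by norm_num),
    ← ENNReal.ofReal_rpow_of_nonneg hM0 (by norm_num)]
  have := hX.lintegral_enorm_sq_le j
  simp only [ENNReal.toReal_ofNat, ENNReal.rpow_ofNat]
  exact ENNReal.rpow_le_rpow this (by norm_num)

theorem IsNoise.eLpNorm_le (hε : IsNoise μ ε) :
    ∃ B : ℝ, 0 ≤ B ∧ ∀ j, eLpNorm (ε j) 2 μ ≤ ENNReal.ofReal B :=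
  ⟨(eLpNorm (ε 0) 2 μ).toReal, ENNReal.toReal_nonneg, fun j => by
    rw [ENNReal.ofReal_toReal (hε.memLp_two 0).2.ne]
    exact ((hε.ident j).eLpNorm_eq 2).le⟩

/-- The innovations of an invertible linear process are centered, and they can be taken to be
measurable. -/
theorem IsLinearProcess.exists_isProc (hX : IsLinearProcess μ X ε ψ) (hinv : IsInvertible μ X ε π) :
    ∃ ε', IsProc μ X ε' ψ ∧ IsInvertible μ X ε' π := by
  set η : ℤ → Ω → H := fun j => (hX.ident j).aemeasurable_fst.mk (ε j) with hη
  have hae : ∀ j, ε j =ᵐ[μ] η j := fun j => (hX.ident j).aemeasurable_fst.ae_eq_mk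
  have hmeas : ∀ j, Measurable (η j) := fun j => (hX.ident j).aemeasurable_fst.measurable_mk
  have hindep : iIndepFun η μ := hX.indep.congr hae
  have hident : ∀ j, IdentDistrib (η j) (η 0) μ μ := fun j =>
    ((IdentDistrib.of_ae_eq (hmeas j).aemeasurable (hae j).symm).trans (hX.ident j)).trans
      (IdentDistrib.of_ae_eq (hX.ident 0).aemeasurable_fst (hae 0))
  have hmem : MemLp (η 0) 4 μ := hX.moment.ae_eq (hae 0)
  have hall : ∀ᵐ ω ∂μ, ∀ j, ε j ω = η j ω := ae_all_iff.mpr hae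
  have hser : ∀ j, ∀ᵐ ω ∂μ, HasSum (fun ℓ : ℕ => ψ ℓ (η (j - ℓ) ω)) (X j ω) := fun j => by
    filter_upwards [hX.series j, hall] with ω h1 h2
    simpa only [h2] using h1
  have hinv' : IsInvertible μ X η π := ⟨hinv.summable, fun j => by
    filter_upwards [hinv.series j, hae j] with ω h1 h2
    rwa [← h2]⟩
  -- The L² theory was developed for centred noise. Subtracting the mean m from the noise and c = Σ
  -- ψ_ℓ m from the process makes it available, and X - c in L² gives X in L² with uniform bounds.
  set m := ∫ ω, η 0 ω ∂μ with hm
  set c := ∑' ℓ, ψ ℓ m with hc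
  have hη1 : ∀ j, Integrable (η j) μ := fun j =>
    (((hident j).memLp_iff).mpr hmem).integrable (by norm_num)
  have hnoise : IsNoise μ fun j ω => η j ω - m :=
    ⟨fun j => (hmeas j).sub_const m, hindep.comp (fun _ x => x - m) fun _ => measurable_sub_const m,
      fun j => (hident j).comp (measurable_sub_const m), hmem.sub (memLp_const m), by
        rw [integral_sub (hη1 0) (integrable_const m)]; simp [hm]⟩
  have hproc : IsProc μ (fun j ω => X j ω - c) (fun j ω => η j ω - m) ψ :=
    ⟨hnoise, hX.summable, fun j => by
      filter_upwards [hser j] with ω h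
      simp only [map_sub]
      refine h.sub (Summable.hasSum (Summable.of_norm_bounded (hX.summable.mul_right ‖m‖) fun ℓ => ?_))
      exact (ψ ℓ).le_opNorm m⟩
  have hXm : ∀ j, MemLp (X j) 2 μ := fun j => by
    have := (hproc.memLp_two j).add (memLp_const c)
    refine this.ae_eq (ae_of_all _ fun ω => ?_)
    simp
  obtain ⟨B, hB, hBX⟩ := hproc.exists_eLpNorm_le
  have hη2 : MemLp (η 0) 2 μ := hmem.mono_exponent (by norm_num)
  have hXb : ∀ j, eLpNorm (X j) 2 μ ≤ ENNReal.ofReal (B + ‖c‖) := fun j => by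
    have h1 : X j = (fun ω => X j ω - c) + fun _ => c := by ext ω; simp
    rw [h1, ENNReal.ofReal_add hB (norm_nonneg _)]
    refine (eLpNorm_add_le (hproc.aestronglyMeasurable j) aestronglyMeasurable_const
      (by norm_num)).trans (add_le_add (hBX j) ?_)
    rw [eLpNorm_const _ (by norm_num) (IsProbabilityMeasure.ne_zero μ)]
    simp
  -- Expectations in the inverted series, taken as an inner product with 1 in L²: all terms vanish
  -- because X is centred, and the sum has mean -m.
  have hm0 : m = 0 := by
    refine ext_inner_right ℝ fun u => ?_
    have h1 := hasSum_functional hinv.summable (fun ℓ => hXm (0 - (ℓ + 1 : ℕ))) ((hXm 0).sub hη2)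
      (by positivity) (fun ℓ => hXb _) (hinv'.series 0) u
    have hone : MemLp (fun _ : Ω => (1 : ℝ)) 2 μ := memLp_const 1
    have h2 := h1.mapL (innerSL ℝ (hone.toLp _))
    have h3 : ∀ {Y : Ω → H} (hY : MemLp Y 2 μ) (v : H),
        innerSL ℝ (hone.toLp _) (functional hY v) = ⟪∫ ω, Y ω ∂μ, v⟫_ℝ := fun {Y} hY v => by
      rw [innerSL_apply_apply]
      refine (inner_toLp hone (hY.inner_const v)).trans ?_
      simp only [one_mul]
      rw [real_inner_comm, ← integral_inner (hY.integrable (by norm_num))]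
      simp only [real_inner_comm]
    simp only [h3, hX.mean, inner_zero_left] at h2
    have h4 := h2.unique hasSum_zero
    have h5 : ∫ ω, (X 0 - η 0) ω ∂μ = -m := by
      simp only [Pi.sub_apply]
      rw [integral_sub ((hXm 0).integrable (by norm_num)) (hη1 0), hX.mean, zero_sub]
    rw [h5, inner_neg_left, neg_eq_zero] at h4
    rw [h4, inner_zero_left]
  refine ⟨η, ⟨?_, hX.summable, hser⟩, hinv'⟩
  simpa only [hm0, sub_zero] using hnoise

end Innovation

/-! ### The causal coefficients in terms of the autoregressive ones -/

section Causal

variable {Ω H : Type*} [MeasurableSpace Ω] {μ : Measure Ω} [IsProbabilityMeasure μ]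
  [NormedAddCommGroup H] [InnerProductSpace ℝ H] [CompleteSpace H]
  [MeasurableSpace H] [BorelSpace H] [SecondCountableTopology H]
  {X ε : ℤ → Ω → H} {ψ π : ℕ → H →L[ℝ] H} {lam : ℕ → ℝ} {ν : HilbertBasis ℕ ℝ H} {d : ℕ → ℕ}
  {κ : ℕ → ℕ}

theorem functional_sub {Y Z : Ω → H} (hY : MemLp Y 2 μ) (hZ : MemLp Z 2 μ) (u : H) :
    functional (hY.sub hZ) u = functional hY u - functional hZ u := by
  refine Eq.trans ?_ (MemLp.toLp_sub (hY.inner_const u) (hZ.inner_const u))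
  exact MemLp.toLp_congr ((hY.sub hZ).inner_const u) ((hY.inner_const u).sub (hZ.inner_const u))
    (ae_of_all _ fun ω => inner_sub_left _ _ _)

theorem IsNoise.inner_functional_functional (hε : IsNoise μ ε) (p q : ℤ) (u v : H) :
    ⟪functional (hε.memLp_two p) u, functional (hε.memLp_two q) v⟫_ℝ =
      if p = q then ⟪noiseCov μ ε u, v⟫_ℝ else 0 := by
  rw [inner_functional, hε.integral_inner_mul_inner]

theorem IsNoise.symm_noiseCov (hε : IsNoise μ ε) (u v : H) :
    ⟪noiseCov μ ε u, v⟫_ℝ = ⟪u, noiseCov μ ε v⟫_ℝ := by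
  have h1 := hε.inner_functional_functional 0 0 u v
  have h2 := hε.inner_functional_functional 0 0 v u
  rw [if_pos rfl] at h1 h2
  exact h1.symm.trans ((real_inner_comm _ _).trans (h2.trans (real_inner_comm _ _)))

namespace IsProc

/-- In the causal series of X_j only the term with ℓ = j - p is correlated with ε_p. -/
theorem inner_noise_functional (hX : IsProc μ X ε ψ) (p j : ℤ) (u v : H) :
    ⟪functional (hX.noise.memLp_two p) u, functional (hX.memLp_two j) v⟫_ℝ =
      if p ≤ j then ⟪ψ (j - p).toNat (noiseCov μ ε u), v⟫_ℝ else 0 := by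
  obtain ⟨B, hB, h⟩ := hX.noise.eLpNorm_le
  have h1 := (hasSum_functional hX.summable (fun ℓ => hX.noise.memLp_two (j - ℓ))
    (hX.memLp_two j) hB (fun ℓ => h _) (hX.series j) v).mapL
      (innerSL ℝ (functional (hX.noise.memLp_two p) u))
  simp only [innerSL_apply_apply, hX.noise.inner_functional_functional,
    ContinuousLinearMap.adjoint_inner_right] at h1
  refine h1.unique ?_
  split_ifs with hpj
  · have h2 := hasSum_single (j - p).toNat (f := fun ℓ : ℕ =>
      if p = j - ℓ then ⟪ψ ℓ (noiseCov μ ε u), v⟫_ℝ else 0) fun ℓ hℓ => if_neg (by omega)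
    rwa [if_pos (by omega)] at h2
  · convert hasSum_zero using 2 with ℓ
    exact if_neg (by omega)

theorem norm_functional_sq (hX : IsProc μ X ε ψ) (k : ℕ) (v : ℕ → H) :
    ‖∑ i ∈ Finset.range k, functional (hX.memLp_two (-i)) (v i)‖ ^ 2 =
      covForm (lagCov μ X) k v := by
  rw [← real_inner_self_eq_norm_sq, sum_inner, covForm]
  refine Finset.sum_congr rfl fun i _ => ?_
  rw [inner_sum]
  refine Finset.sum_congr rfl fun i' _ => ?_
  rw [inner_functional, ← hX.inner_lagCov]
  congr 3
  ring

theorem hasSum_autoregression (hX : IsProc μ X ε ψ) (hinv : IsInvertible μ X ε π) (j : ℤ) (v : H) :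
    HasSum (fun ℓ : ℕ => functional (hX.memLp_two (j - (ℓ + 1 : ℕ)))
      (ContinuousLinearMap.adjoint (π (ℓ + 1)) v))
      (functional (hX.memLp_two j) v - functional (hX.noise.memLp_two j) v) := by
  obtain ⟨B, hB, h⟩ := hX.exists_eLpNorm_le
  rw [← functional_sub]
  exact hasSum_functional hinv.summable (fun ℓ => hX.memLp_two _)
    ((hX.memLp_two j).sub (hX.noise.memLp_two j)) hB (fun ℓ => h _) (hinv.series j) v

/-- Correlate the autoregressive equation at time 0 with ε_{-m}. The correlation of X_0 with ε_{-m}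
is ψ_m times the noise covariance, and terms with ℓ ≥ m precede ε_{-m} and drop out. -/
theorem mul_noiseCov_eq (hX : IsProc μ X ε ψ) (hinv : IsInvertible μ X ε π) (m : ℕ) :
    ψ m * noiseCov μ ε - (if m = 0 then noiseCov μ ε else 0) =
      ∑ ℓ ∈ Finset.range m, π (ℓ + 1) * ψ (m - (ℓ + 1)) * noiseCov μ ε := by
  ext u
  refine ext_inner_right ℝ fun v => ?_
  have h1 := (hX.hasSum_autoregression hinv 0 v).mapL
    (innerSL ℝ (functional (hX.noise.memLp_two (-m)) u))
  simp only [innerSL_apply_apply, inner_sub_right, hX.noise.inner_functional_functional,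
    hX.inner_noise_functional, ContinuousLinearMap.adjoint_inner_right] at h1
  have h2 := h1.unique (hasSum_sum_of_ne_finset_zero (s := Finset.range m) fun ℓ hℓ => by
    rw [Finset.mem_range] at hℓ
    exact if_neg (by omega))
  rw [if_pos (by omega), show ((0 : ℤ) - -(m : ℤ)).toNat = m by omega] at h2
  rw [sum_apply, sum_inner, _root_.sub_apply, inner_sub_left, mul_apply_eq_comp]
  have h3 : ⟪(if m = 0 then noiseCov μ ε else 0) u, v⟫_ℝ =
      if -(m : ℤ) = 0 then ⟪noiseCov μ ε u, v⟫_ℝ else 0 := by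
    by_cases h : m = 0
    · simp [h]
    · rw [if_neg h, if_neg (by omega), zero_apply, inner_zero_left]
  rw [h3, h2]
  refine Finset.sum_congr rfl fun ℓ hℓ => ?_
  rw [Finset.mem_range] at hℓ
  rw [if_pos (by omega), show ((0 : ℤ) - ((ℓ + 1 : ℕ) : ℤ) - -(m : ℤ)).toNat = m - (ℓ + 1) by omega]
  rfl

end IsProc

namespace Setting

theorem norm_functional_le (S : Setting μ X ε ψ π lam ν d) (j : ℤ) {D : ℕ} {u : H}
    (hu : ∀ i < D, ⟪ν i, u⟫_ℝ = 0) :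
    ‖functional (S.proc.memLp_two j) u‖ ≤ Real.sqrt (lam D) * ‖u‖ := by
  refine abs_le_of_sq_le_sq' ?_ (by positivity) |>.2
  rw [mul_pow, Real.sq_sqrt (S.lam_pos D).le, ← real_inner_self_eq_norm_sq, inner_functional,
    ← S.proc.inner_lagCov, sub_self]
  exact S.eig.inner_le_of_inner_eq_zero hu

/-- A direction that the noise does not charge is almost invisible at every order. -/
theorem norm_projSpan_le (S : Setting μ X ε ψ π lam ν d) {v : H} (hv : noiseCov μ ε v = 0)
    {k : ℕ} (hk : 1 ≤ k) {c : ℝ} (hc : 0 < c) (h1 : lam (d k) ≤ c ^ 2 * alpha μ X ν (d k))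
    (h2 : truncRate (alpha μ X ν) π lam d k ≤ c) :
    ‖projSpan ν (d k) v‖ ≤ c * (lam 0 + 1 + ∑' ℓ, ‖π (ℓ + 1)‖) * ‖v‖ := by
  have ha := S.alpha_pos k
  have hA := S.alpha_le k
  have hl0 := S.lam_pos 0
  have htail := S.tail_le hk
  set Q := ∑' ℓ, ‖π (ℓ + 1)‖ with hQdef
  have hQ0 : 0 ≤ Q := tsum_nonneg fun _ => norm_nonneg _
  have hlow := S.proc.two_pi_mul_alpha_le_covForm ν (d k) ha (k + 1)
  set a := alpha μ X ν (d k) with hadef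
  set P := projSpan ν (d k) with hP
  have hPp : IsOrthProj P := isOrthProj_projSpan ν (d k)
  -- The coefficients of ⟨ε_0, v⟩ in terms of X_0, X_{-1}, …: by hypothesis this combination is zero
  -- in L².
  set q : ℕ → H := fun i => if i = 0 then v else -ContinuousLinearMap.adjoint (π i) v with hq
  set ξ := fun i : ℕ => functional (S.proc.memLp_two (-(i : ℤ))) with hξ
  have hη : functional (S.proc.noise.memLp_two 0) v = 0 := by
    have := S.proc.noise.inner_functional_functional 0 0 v v
    rw [if_pos rfl, hv, inner_zero_left] at this
    exact inner_self_eq_zero.mp this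
  have hqn : ∀ ℓ, ‖q (ℓ + 1)‖ ≤ ‖π (ℓ + 1)‖ * ‖v‖ := fun ℓ => by
    simp only [hq, Nat.succ_ne_zero, if_false, norm_neg]
    simpa using (ContinuousLinearMap.adjoint (π (ℓ + 1))).le_opNorm v
  have hsum : HasSum (fun i => ξ i (q i)) 0 := by
    rw [← hasSum_nat_add_iff' 1, Finset.sum_range_one, zero_sub]
    have h3 := (S.proc.hasSum_autoregression S.inv 0 v).neg
    rw [hη, sub_zero] at h3
    convert h3 using 1
    · funext ℓ
      simp only [hq, hξ, Nat.succ_ne_zero, if_false, map_neg]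
    · simp only [hq, hξ, if_true]
  have hs1 : HasSum (fun ℓ => ξ (ℓ + (k + 1)) (q (ℓ + (k + 1))))
      (-∑ i ∈ Finset.range (k + 1), ξ i (q i)) := by
    have := (hasSum_nat_add_iff' (k + 1)).mpr hsum
    rwa [zero_sub] at this
  have hπs : Summable fun ℓ => ‖π (k + 1 + ℓ)‖ := by
    have := (summable_nat_add_iff k).mpr S.inv.summable
    refine this.congr fun ℓ => ?_
    congr 2; ring
  -- The partial sum equals minus the tail beyond k, which the truncation rate makes O(ca).
  have hnt : ‖∑ i ∈ Finset.range (k + 1), ξ i (q i)‖ ≤ Real.sqrt (lam 0) * ‖v‖ * (a * c) := by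
    rw [← norm_neg]
    have h3 : HasSum (fun ℓ => Real.sqrt (lam 0) * ‖v‖ * ‖π (k + 1 + ℓ)‖)
        (Real.sqrt (lam 0) * ‖v‖ * ∑' ℓ, ‖π (k + 1 + ℓ)‖) := hπs.hasSum.mul_left _
    refine (hs1.norm_le_of_bounded h3 fun ℓ => ?_).trans ?_
    · refine (S.norm_functional_le _ (D := 0) (by simp)).trans ?_
      have := hqn (ℓ + k)
      rw [show k + 1 + ℓ = ℓ + k + 1 by ring, mul_assoc]
      refine mul_le_mul_of_nonneg_left (this.trans (mul_comm _ _).le) (by positivity)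
    · exact mul_le_mul_of_nonneg_left (htail.trans (by gcongr)) (by positivity)
  -- Replacing q_i by its projection discards directions of variance at most `lam (d k)`, which is
  -- at most c²a.
  have hns : ‖∑ i ∈ Finset.range (k + 1), ξ i (q i - P (q i))‖ ≤
      Real.sqrt (lam (d k)) * ((1 + Q) * ‖v‖) := by
    have h3 : ∑ i ∈ Finset.range (k + 1), ‖q i‖ ≤ (1 + Q) * ‖v‖ := by
      rw [Finset.sum_range_succ']
      have h4 : ∑ i ∈ Finset.range k, ‖q (i + 1)‖ ≤ Q * ‖v‖ := by
        refine (Finset.sum_le_sum fun i _ => hqn i).trans ?_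
        rw [← Finset.sum_mul]
        exact mul_le_mul_of_nonneg_right
          (S.inv.summable.sum_le_tsum _ fun _ _ => norm_nonneg _) (norm_nonneg _)
      have h5 : ‖q 0‖ = ‖v‖ := by simp [hq]
      rw [h5]; linarith
    refine (norm_sum_le _ _).trans (le_trans ?_ (mul_le_mul_of_nonneg_left h3 (Real.sqrt_nonneg _)))
    rw [Finset.mul_sum]
    refine Finset.sum_le_sum fun i _ => (S.norm_functional_le _ (D := d k) fun i hi =>
      inner_sub_projSpan ν hi _).trans ?_
    exact mul_le_mul_of_nonneg_left (hPp.norm_sub_apply_le _) (Real.sqrt_nonneg _)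
  have hPq : ‖∑ i ∈ Finset.range (k + 1), ξ i (P (q i))‖ ≤
      Real.sqrt a * (c * (lam 0 + 1 + Q) * ‖v‖) := by
    have e1 : ∑ i ∈ Finset.range (k + 1), ξ i (P (q i)) = ∑ i ∈ Finset.range (k + 1), ξ i (q i) -
        ∑ i ∈ Finset.range (k + 1), ξ i (q i - P (q i)) := by
      rw [← Finset.sum_sub_distrib]
      exact Finset.sum_congr rfl fun i _ => by rw [map_sub]; abel
    rw [e1]
    refine (norm_sub_le _ _).trans ((add_le_add hnt hns).trans ?_)
    have e2 : Real.sqrt (lam (d k)) ≤ c * Real.sqrt a := by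
      rw [← Real.sqrt_sq hc.le, ← Real.sqrt_mul (sq_nonneg c)]
      exact Real.sqrt_le_sqrt h1
    have e3 : Real.sqrt (lam 0) * a ≤ lam 0 * Real.sqrt a := by
      have h3 : Real.sqrt a ≤ Real.sqrt (lam 0) := Real.sqrt_le_sqrt hA
      calc Real.sqrt (lam 0) * a = Real.sqrt (lam 0) * (Real.sqrt a * Real.sqrt a) := by
            rw [Real.mul_self_sqrt ha.le]
        _ ≤ Real.sqrt (lam 0) * (Real.sqrt (lam 0) * Real.sqrt a) := by gcongr
        _ = _ := by rw [← mul_assoc, Real.mul_self_sqrt hl0.le]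
    calc Real.sqrt (lam 0) * ‖v‖ * (a * c) + Real.sqrt (lam (d k)) * ((1 + Q) * ‖v‖)
        = (Real.sqrt (lam 0) * a) * (c * ‖v‖) + Real.sqrt (lam (d k)) * ((1 + Q) * ‖v‖) := by ring
      _ ≤ (lam 0 * Real.sqrt a) * (c * ‖v‖) + c * Real.sqrt a * ((1 + Q) * ‖v‖) := by gcongr
      _ = _ := by ring
  have h3 := hlow (fun i => P (q i)) fun i => hPp.idem _
  rw [← S.proc.norm_functional_sq] at h3
  -- Coordinate 0 of q is v, so the coercive lower bound on the projected relation bounds ‖P v‖ in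
  -- particular, and the factor a cancels.
  have h4 : ‖P v‖ ^ 2 ≤ ∑ i ∈ Finset.range (k + 1), ‖P (q i)‖ ^ 2 := by
    have := Finset.single_le_sum (f := fun i => ‖P (q i)‖ ^ 2) (s := Finset.range (k + 1))
      (fun _ _ => by positivity) (Finset.mem_range.mpr (Nat.succ_pos k))
    simpa [hq] using this
  have h5 := pow_le_pow_left₀ (norm_nonneg _) hPq 2
  rw [mul_pow, Real.sq_sqrt ha.le] at h5
  have h6 : a * ‖P v‖ ^ 2 ≤ a * (c * (lam 0 + 1 + Q) * ‖v‖) ^ 2 :=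
    calc a * ‖P v‖ ^ 2 ≤ a * ∑ i ∈ Finset.range (k + 1), ‖P (q i)‖ ^ 2 := by gcongr
      _ ≤ 2 * Real.pi * a * ∑ i ∈ Finset.range (k + 1), ‖P (q i)‖ ^ 2 := by
          refine mul_le_mul_of_nonneg_right ?_ (Finset.sum_nonneg fun _ _ => by positivity)
          nlinarith [Real.pi_gt_three]
      _ ≤ _ := h3.trans h5
  exact (abs_le_of_sq_le_sq' (le_of_mul_le_mul_left h6 ha) (by positivity)).2

/-- Along the given orders `norm_projSpan_le` makes the projections of v arbitrarily small, while
they also converge to v. If all π_ℓ vanish, X equals the noise and injectivity is positivity of the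
eigenvalues of C_X. -/
theorem noiseCov_injective (S : Setting μ X ε ψ π lam ν d) (R : Rates μ X π lam ν d κ)
    (hd : Tendsto d atTop atTop) {v : H} (hv : noiseCov μ ε v = 0) : v = 0 := by
  by_contra hne
  have hv0 : 0 < ‖v‖ := norm_pos_iff.mpr hne
  by_cases h0 : ∀ ℓ, π (ℓ + 1) = 0
  · have h2 := S.proc.hasSum_autoregression S.inv 0 v
    have hη : functional (S.proc.noise.memLp_two 0) v = 0 := by
      have := S.proc.noise.inner_functional_functional 0 0 v v
      rw [if_pos rfl, hv, inner_zero_left] at this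
      exact inner_self_eq_zero.mp this
    simp only [h0, map_zero, zero_apply, hη, sub_zero] at h2
    have h3 : functional (S.proc.memLp_two 0) v = 0 := h2.unique hasSum_zero
    have h4 : ⟪lagCov μ X 0 v, v⟫_ℝ = 0 := by
      have := S.proc.inner_lagCov 0 0 v v
      rw [sub_self] at this
      rw [this, ← inner_functional (S.proc.memLp_two 0) (S.proc.memLp_two 0), h3, inner_zero_left]
    have h5 := S.eig.hasSum_inner v
    rw [h4] at h5
    have h6 := (hasSum_zero_iff_of_nonneg fun i =>
      mul_nonneg (S.lam_pos i).le (sq_nonneg _)).mp h5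
    have h7 : ∀ i, ⟪ν i, v⟫_ℝ ^ 2 = 0 := fun i =>
      (mul_eq_zero.mp (congrFun h6 i)).resolve_left (S.lam_pos i).ne'
    have h8 := hasSum_inner_sq ν v
    simp only [h7] at h8
    have h9 := h8.unique hasSum_zero
    exact hne (norm_eq_zero.mp (pow_eq_zero_iff (by norm_num) |>.mp h9))
  · push Not at h0
    obtain ⟨ℓ, hℓ⟩ := h0
    set K := lam 0 + 1 + ∑' ℓ, ‖π (ℓ + 1)‖ with hK
    have hl0 := S.lam_pos 0
    have hQ0 : 0 ≤ ∑' ℓ, ‖π (ℓ + 1)‖ := tsum_nonneg fun _ => norm_nonneg _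
    have hK0 : 0 < K := by positivity
    obtain ⟨τ, hτ, hcl⟩ := exists_close_apply ν S.lam_pos v (half_pos hv0)
    have hτ' := (S.summable_lam.tendsto_atTop_zero.comp
      (hd.comp R.tendsto)).eventually_le_const hτ
    have hc : 0 < 1 / (4 * K) := by positivity
    obtain ⟨n, h1, h2, h3, h4⟩ := ((S.eventually_lam_le R hℓ (pow_pos hc 2)).and
      ((R.trunc.eventually_le_const hc).and
        (hτ'.and (R.tendsto.eventually_ge_atTop 1)))).exists
    have h5 := S.norm_projSpan_le hv h4 hc h1 h2
    have h6 := hcl _ (S.eig.close S.eig S.lam_pos (fun i => (S.lam_pos i).le) (d (κ n))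
      (by rw [sub_self, norm_zero, mul_zero, add_zero]; exact h3))
    have h7 : 1 / (4 * K) * (lam 0 + 1 + ∑' ℓ, ‖π (ℓ + 1)‖) * ‖v‖ = ‖v‖ / 4 := by
      rw [← hK]; field_simp
    rw [h7] at h5
    have h8 := norm_sub_norm_le v (projSpan ν (d (κ n)) v)
    linarith

/-- Cancels the noise covariance on the right in `mul_noiseCov_eq`: it is symmetric and injective,
so T composed with it can vanish only if T* = 0. -/
theorem psi_eq (S : Setting μ X ε ψ π lam ν d) (R : Rates μ X π lam ν d κ)
    (hd : Tendsto d atTop atTop) :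
    ψ 0 = 1 ∧ ∀ m, 1 ≤ m → ψ m = ∑ i ∈ Finset.Icc 1 m, π i * ψ (m - i) := by
  have hinj : ∀ T : H →L[ℝ] H, T * noiseCov μ ε = 0 → T = 0 := fun T hT => by
    have h1 : ∀ u, noiseCov μ ε (ContinuousLinearMap.adjoint T u) = 0 := fun u => by
      refine ext_inner_right ℝ fun w => ?_
      rw [S.proc.noise.symm_noiseCov, ContinuousLinearMap.adjoint_inner_left, inner_zero_left]
      have : T (noiseCov μ ε w) = 0 := DFunLike.congr_fun hT w
      rw [this, inner_zero_right]
    have h2 : ContinuousLinearMap.adjoint T = 0 := by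
      ext u; exact S.noiseCov_injective R hd (h1 u)
    rw [← ContinuousLinearMap.adjoint_adjoint T, h2, map_zero]
  constructor
  · have h := S.proc.mul_noiseCov_eq S.inv 0
    rw [if_pos rfl, Finset.range_zero, Finset.sum_empty] at h
    refine sub_eq_zero.mp (hinj _ ?_)
    rw [sub_mul, one_mul, h]
  · intro m hm
    have h := S.proc.mul_noiseCov_eq S.inv m
    rw [if_neg (by omega), sub_zero, ← Finset.sum_mul] at h
    have h2 := sub_eq_zero.mp (hinj (ψ m - ∑ ℓ ∈ Finset.range m, π (ℓ + 1) * ψ (m - (ℓ + 1)))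
      (by rw [sub_mul, h, sub_self]))
    rw [h2, Finset.range_eq_Ico, Finset.sum_Ico_add' (fun i => π i * ψ (m - i)) 0 m 1]
    rfl

end Setting

end Causal

/-! ### Consistency -/

section Consistency

variable {Ω H : Type*} [MeasurableSpace Ω] {μ : Measure Ω} [IsProbabilityMeasure μ]
  [NormedAddCommGroup H] [InnerProductSpace ℝ H] [CompleteSpace H]

theorem secondCountableTopology_of_hilbertBasis (ν : HilbertBasis ℕ ℝ H) :
    SecondCountableTopology H := by
  have h1 : TopologicalSpace.IsSeparable (Set.univ : Set H) := by
    have h2 := ((Set.countable_range ν).isSeparable.span (R := ℝ)).closure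
    rwa [← Submodule.topologicalClosure_coe, ν.dense_span, Submodule.top_coe] at h2
  have := TopologicalSpace.isSeparable_univ_iff.mp h1
  exact UniformSpace.secondCountable_of_separable H

/-- The first summand of the gap sum is a fixed positive number, so the gap factor is bounded below
and can be divided out. -/
theorem rates_power {lam : ℕ → ℝ} (hlam : StrictAnti lam) {d k : ℕ → ℕ} (hd_pos : ∀ i, 0 < d i)
    {f : ℕ → ℝ} (hf : ∀ n, 0 ≤ f n)
    (h : Tendsto (fun n : ℕ => f n *
      Real.sqrt (∑ ℓ ∈ Finset.range (d (k n)), (gap lam ℓ ^ 2)⁻¹)) atTop (𝓝 0)) :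
    Tendsto f atTop (𝓝 0) := by
  have hg : 0 < gap lam 0 := by
    rw [gap, if_pos rfl]; exact sub_pos.mpr (hlam zero_lt_one)
  have h1 := h.const_mul (gap lam 0)
  rw [mul_zero] at h1
  refine tendsto_zero_of_le h1 (Eventually.of_forall hf) (Eventually.of_forall fun n => ?_)
  have h2 : (gap lam 0 ^ 2)⁻¹ ≤ ∑ ℓ ∈ Finset.range (d (k n)), (gap lam ℓ ^ 2)⁻¹ :=
    Finset.single_le_sum (f := fun ℓ => (gap lam ℓ ^ 2)⁻¹) (fun ℓ _ => by positivity)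
      (Finset.mem_range.mpr (hd_pos _))
  have h3 := Real.sqrt_le_sqrt h2
  rw [Real.sqrt_inv, Real.sqrt_sq hg.le] at h3
  calc f n = gap lam 0 * (f n * (gap lam 0)⁻¹) := by field_simp
    _ ≤ _ := by
      have := hf n
      gcongr

theorem thetaHat_eq (x : ℤ → H) (e : ℕ → H) (d : ℕ → ℕ) (n : ℕ) {k i : ℕ} (hi : 1 ≤ i)
    (hk : 1 ≤ k) : thetaHat x e d n k i =
      innovL (sampleCov x n) (fun r => projSpan e (d r)) k (k - i) := by
  rw [thetaHat, innovL_of_lt (by omega)]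

variable [MeasurableSpace H] [BorelSpace H] [SecondCountableTopology H]
  {X ε : ℤ → Ω → H} {ψ π : ℕ → H →L[ℝ] H} {lam : ℕ → ℝ} {ν : HilbertBasis ℕ ℝ H} {d : ℕ → ℕ}
  {κ : ℕ → ℕ} {lamHat : ℕ → Ω → ℕ → ℝ} {νHat : ℕ → Ω → HilbertBasis ℕ ℝ H}

theorem Setting.tendsto_thetaHat_apply (S : Setting μ X ε ψ π lam ν d)
    (R : Rates μ X π lam ν d κ) (hd : Tendsto d atTop atTop)
    (hνHat : ∀ n ω, IsEigenbasis (sampleCov (fun j => X j ω) n 0) (lamHat n ω) (νHat n ω))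
    (h : ∀ s : ℕ, Tendsto (fun n : ℕ => truncRate (alpha μ X ν) π lam d (κ n - s)) atTop (𝓝 0))
    {i : ℕ} (hi : 1 ≤ i) (x : H) : TendstoInMeasure μ (fun n ω =>
      ‖(thetaHat (fun j => X j ω) (νHat n ω) d n (κ n) i - ψ i) x‖) atTop fun _ => 0 := by
  obtain ⟨h0, hψ⟩ := S.psi_eq R hd
  refine tendstoInMeasure_of_whp (fun _ _ => norm_nonneg _)
    ((S.small_innovL_apply hd (fun s => R.sub S s (h s)) hνHat h0 hψ x i 0).mono ?_)
  filter_upwards [R.tendsto.eventually_ge_atTop 1] with n hn ω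
  rw [thetaHat_eq _ _ _ _ hi hn]
  rfl

theorem Setting.tendsto_thetaHat (S : Setting μ X ε ψ π lam ν d)
    (R : Rates μ X π lam ν d κ) (hd : Tendsto d atTop atTop)
    (hνHat : ∀ n ω, IsEigenbasis (sampleCov (fun j => X j ω) n 0) (lamHat n ω) (νHat n ω))
    (h : ∀ s : ℕ, Tendsto (fun n : ℕ => truncRate (alpha μ X ν) π lam d (κ n - s)) atTop (𝓝 0))
    (hHS : ∀ m, 1 ≤ m → IsHilbertSchmidt (ψ m) ∧ IsHilbertSchmidt (π m))
    {i : ℕ} (hi : 1 ≤ i) : TendstoInMeasure μ (fun n ω =>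
      ‖thetaHat (fun j => X j ω) (νHat n ω) d n (κ n) i - ψ i‖) atTop fun _ => 0 := by
  obtain ⟨h0, hψ⟩ := S.psi_eq R hd
  refine tendstoInMeasure_of_whp (fun _ _ => norm_nonneg _)
    ((S.small_innovL hd (fun s => R.sub S s (h s)) hνHat h0 hψ hHS i hi 0).mono ?_)
  filter_upwards [R.tendsto.eventually_ge_atTop 1] with n hn ω
  rw [thetaHat_eq _ _ _ _ hi hn]
  rfl

end Consistency

end FTS

theorem theorem3p3 {Ω H : Type*} [MeasurableSpace Ω] (μ : Measure Ω) [IsProbabilityMeasure μ]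
    [NormedAddCommGroup H] [InnerProductSpace ℝ H] [CompleteSpace H]
    [MeasurableSpace H] [BorelSpace H]
    -- the process, its causal and its invertible representation
    (X ε : ℤ → Ω → H) (ψ π : ℕ → H →L[ℝ] H)
    (hX : FTS.IsLinearProcess μ X ε ψ) (hinv : FTS.IsInvertible μ X ε π)
    -- eigenvalues (positive, no ties) and eigenfunctions of the covariance operator
    (lam : ℕ → ℝ) (ν : HilbertBasis ℕ ℝ H)
    (hν : FTS.IsEigenbasis (FTS.lagCov μ X 0) lam ν)
    (hlam_pos : ∀ i, 0 < lam i) (hlam : StrictAnti lam)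
    -- sample eigenvalues and eigenfunctions of the sample covariance operator
    (lamHat : ℕ → Ω → ℕ → ℝ) (νHat : ℕ → Ω → HilbertBasis ℕ ℝ H)
    (hνHat : ∀ n ω,
      FTS.IsEigenbasis (FTS.sampleCov (fun j => X j ω) n 0) (lamHat n ω) (νHat n ω))
    -- projection dimensions `d 1 ≤ d 2 ≤ …` and orders `k n`
    (d : ℕ → ℕ) (hd_pos : ∀ i, 0 < d i) (hd_mono : Monotone d) (hd : Tendsto d atTop atTop)
    (k : ℕ → ℕ) (hk : Tendsto k atTop atTop) (hkn : ∀ᶠ n in atTop, k n < n)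
    (hα : ∀ i, 0 < FTS.alpha μ X ν (d i))
    -- assumption (ii)
    (h2 : Tendsto (fun n : ℕ => Real.sqrt (k n) * (Real.sqrt ((n : ℝ) - k n))⁻¹ *
      (FTS.alpha μ X ν (d (k n)) ^ 2)⁻¹) atTop (𝓝 0))
    -- assumption (iii)
    (h3 : Tendsto (fun n : ℕ => FTS.truncRate (FTS.alpha μ X ν) π lam d (k n)) atTop (𝓝 0))
    -- assumption (iv)
    (h4 : Tendsto (fun n : ℕ => (k n : ℝ) ^ (3 / 2 : ℝ) *
      (FTS.alpha μ X ν (d (k n)) ^ 2)⁻¹ * (n : ℝ)⁻¹ *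
      Real.sqrt (∑ ℓ ∈ Finset.range (d (k n)), (FTS.gap lam ℓ ^ 2)⁻¹)) atTop (𝓝 0)) :
    -- (i), pointwise and uniform
    ((∀ i, 1 ≤ i → ∀ x : H, TendstoInMeasure μ
        (fun n ω => ‖(FTS.betaHat (fun j => X j ω) (νHat n ω) d n (k n) i - π i) x‖)
        atTop (fun _ => 0)) ∧
      ((∀ ℓ, 1 ≤ ℓ → FTS.IsHilbertSchmidt (ψ ℓ) ∧ FTS.IsHilbertSchmidt (π ℓ)) →
        ∀ i, 1 ≤ i → TendstoInMeasure μ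
          (fun n ω => ‖FTS.betaHat (fun j => X j ω) (νHat n ω) d n (k n) i - π i‖)
          atTop (fun _ => 0))) ∧
    -- (ii), pointwise and uniform, where (iii) is understood along `k n - s` for every fixed `s`
    ((∀ s : ℕ, Tendsto (fun n : ℕ => FTS.truncRate (FTS.alpha μ X ν) π lam d (k n - s))
        atTop (𝓝 0)) →
      (∀ i, 1 ≤ i → ∀ x : H, TendstoInMeasure μ
        (fun n ω => ‖(FTS.thetaHat (fun j => X j ω) (νHat n ω) d n (k n) i - ψ i) x‖)
        atTop (fun _ => 0)) ∧
      ((∀ ℓ, 1 ≤ ℓ → FTS.IsHilbertSchmidt (ψ ℓ) ∧ FTS.IsHilbertSchmidt (π ℓ)) →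
        ∀ i, 1 ≤ i → TendstoInMeasure μ
          (fun n ω => ‖FTS.thetaHat (fun j => X j ω) (νHat n ω) d n (k n) i - ψ i‖)
          atTop (fun _ => 0))) := by
  have hsc : SecondCountableTopology H := FTS.secondCountableTopology_of_hilbertBasis ν
  obtain ⟨ε', hproc, hinv'⟩ := hX.exists_isProc hinv
  have S : FTS.Setting μ X ε' ψ π lam ν d :=
    ⟨hproc, hinv', hν, hlam_pos, hd_pos, hd_mono, hα⟩
  have R : FTS.Rates μ X π lam ν d k :=
    ⟨hk, hkn, h2, FTS.rates_power hlam hd_pos (fun n => by positivity) h4, h3⟩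
  exact ⟨⟨fun i hi x => S.tendsto_betaHat_apply R hd hνHat hi x,
    fun hHS i hi => S.tendsto_betaHat R hd hνHat hi (hHS i hi).2⟩,
    fun h => ⟨fun i hi x => S.tendsto_thetaHat_apply R hd hνHat h hi x,
      fun hHS i hi => S.tendsto_thetaHat R hd hνHat h hHS hi⟩⟩
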